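/- **Model.** Fix $\alpha>2$, $\beta\ge 1$, $\varepsilon>0$, noise $\mathcal N>0$ and a transmission power $P>0$. A network consists of $n\ge 1$ stations at distinct points of the Euclidean plane, with distinct labels in $\{1,\dots,N\}$, where $n\le N\le p(n)$ for a fixed polynomial $p$. Time is divided into synchronous rounds. If exactly the stations in $\mathcal T$ transmit in a round, then $u$ receives the message of $v$ iff $v\in\mathcal T$, $u\notin\mathcal T$, $P\,\mathrm{dist}(v,u)^{-\alpha}\ge(1+\varepsilon)\beta\mathcal N$ and $$\frac{P\,\mathrm{dist}(v,u)^{-\alpha}}{\mathcal N+\sum_{w\in\mathcal T\setminus\{v\}}P\,\mathrm{dist}(w,u)^{-\alpha}}\ge\beta .$$ There is no other feedback and no global clock. Two stations are neighbours if each receives the message of the other when the latter transmits alone; the graph of neighbours is assumed to be connected. Initially a station knows only $n$, $N$, its own label, the labels of its neighbours and its own rumours (no coordinates). There are $k$ distinct rumours in total, each held initially by exactly one station; a station may hold several or none. Wake-up is non-spontaneous: a station without initial rumours sleeps, and does not transmit, until it first receives a message. *Multi-broadcast* is accomplished when every station holds (initially or by having received it in a message) every rumour. **Selective families.** A family $F$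 of subsets of $[N]$ is an $(N,c)$-SSF if for every non-empty $Z\subseteq[N]$ with $|Z|\le c$ and every $z\in Z$ some $S\in F$ has $S\cap Z=\{z\}$; it is an $(N,x,y)$-selector if for every $A\subseteq[N]$ with $|A|=x$ at least $y$ elements $a\in A$ satisfy $S\cap A=\{a\}$ for some $S\in F$. To execute $F=(S_0,S_1,\dots)$ means to transmit in round $i$ iff one's label lies in $S_i$. **BTD\_Construct** (one token, whose id is the label of its root). Every node $v$ keeps a list $L_v$ of unmarked neighbours, initially all its neighbours except the root. When a node $w$ gets the token for the first time, it becomes visited, the sender becomes its parent (unless $w$ is the root), and $w$ sends a message "check $z$" for each $z$ left on $L_w$, one after another. The node $z$ becomes marked and replies in the next round, whereby it becomes a child of $w$. Unvisited nodes that hear "check $z$", and all nodes that hear a reply of $z$ to another node, remove $z$ from their lists. Having finished checking, and later whenever it gets the token back, $w$ passes the token to its next child not yet served or, if there is none, to its parent; the root then finishes. **Smallest\_Token.** Each node that intends to send a message (which is associated with a token and has a destination) executes the SSF with that message. Then each destination that received messages addressed to it executes the SSF with the smallest token id among them. A destination accepts the message with the smallest token addressed to it, and thereby becomes the holder of that token,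 only if it has heard no smaller token; all other nodes are no longer holders. **BTD\_Traversals.** (1) The nodes with rumours execute successively $(N,x_i,y_i)$-selectors, $x_i=\lceil(2/3)^in\rceil$, $y_i=\lceil(2/3)^in/2\rceil$, $i=1,\dots,\lceil\log_{3/2}n\rceil$; a participant that hears a smaller label becomes idle. (2) Each surviving node issues a token and starts BTD\_Construct, every round of which is simulated by one execution of Smallest\_Token. A node skips messages with tokens larger than the smallest token it has heard of, and on hearing of a smaller token abandons its current traversal and joins that of the smaller token. (3) A root whose traversal is complete starts an Eulerian walk along its tree that counts the nodes, and then a second one that carries this number and a counter of moves, so that all nodes know when the second walk ends; the algorithm terminates then. **BTD\_MB.** (1) An Eulerian walk along the tree is made; a leaf visited by it freezes it while sending its rumours, one per round, to its parent, which stores them. A second walk with the number of nodes and a counter synchronizes the nodes. (2) Every internal (non-leaf) node has a stack of rumours, initially its own ones and those received from its leaves. At the beginning of each of a succession of runs of the SSF it removes the top rumour, if any, and executes the SSF with it; a new rumour, when received, is put on top of the stack. **Theorem.** There are constants $c$ and $C$, depending only on $\alpha,\beta,\varepsilon,\mathcal N,P$ and $p$, such that for all $n\ge1$ and $N$ with $n\le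 N\le p(n)$ there are $(N,x_i,y_i)$-selectors of lengths at most $C\,(2/3)^in\log(n+1)$, $1\le i\le\lceil\log_{3/2}n\rceil$, and an $(N,c)$-SSF of length at most $C\log(n+1)$ with which the following holds. In every connected network of $n$ stations as above, for every $k$ and every initial distribution of $k$ rumours, the execution of the deterministic protocol BTD\_Traversals followed by BTD\_MB sends only messages that contain at most one rumour and at most $C\log(n+1)$ control bits, and accomplishes multi-broadcast within $C\,(n+k)\log n$ rounds. -/

import Mathlib

/-! ## The SINR model in the plane -/

namespace Sinr

/-- Parameters of the SINR model: path loss `α`, threshold `β`, signal sensitivity `ε`,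
ambient noise and the (uniform) transmission power. -/
structure Model where
  α : ℝ
  β : ℝ
  ε : ℝ
  noise : ℝ
  power : ℝ
  two_lt_α : 2 < α
  one_le_β : 1 ≤ β
  ε_pos : 0 < ε
  noise_pos : 0 < noise
  power_pos : 0 < power

/-- Stations at distinct points of the Euclidean plane, with distinct labels in `{1, …, N}`. -/
structure Network (V : Type*) (N : ℕ) where
  pos : V → EuclideanSpace ℝ (Fin 2)
  pos_injective : Function.Injective pos
  label : V → ℕ
  label_injective : Function.Injective label
  label_mem : ∀ v, label v ∈ Finset.Icc 1 N

variable {V : Type*} {N : ℕ}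

/-- Power with which the signal of `v` arrives at `u`. -/
noncomputable def signal (M : Model) (net : Network V N) (v u : V) : ℝ :=
  M.power * dist (net.pos v) (net.pos u) ^ (-M.α)

open Classical in
/-- The signal to interference and noise ratio, `T` being the set of transmitting stations. -/
noncomputable def sinr (M : Model) (net : Network V N) (v u : V) (T : Finset V) : ℝ :=
  signal M net v u / (M.noise + ∑ w ∈ T.erase v, signal M net w u)

/-- `u` successfully receives the message of `v` when exactly the stations in `T` transmit. -/
def Receives (M : Model) (net : Network V N) (T : Finset V) (v u : V) : Prop :=
  v ∈ T ∧ u ∉ T ∧ (1 + M.ε) * M.β * M.noise ≤ signal M net v u ∧ M.β ≤ sinr M net v u T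

/-- In each round a station receives the message of at most one station. -/
theorem Receives.unique {M : Model} {net : Network V N} {T : Finset V} {v v' u : V}
    (h : Receives M net T v u) (h' : Receives M net T v' u) : v = v' := by
  classical
  by_contra hne
  have key : ∀ a b : V, b ∈ T → a ≠ b → Receives M net T a u →
      signal M net b u < signal M net a u := by
    intro a b hb hab ha
    have hnn : ∀ w, 0 ≤ signal M net w u := fun w =>
      mul_nonneg M.power_pos.le (Real.rpow_nonneg dist_nonneg _)
    have hmem : b ∈ T.erase a := Finset.mem_erase.2 ⟨fun e => hab e.symm, hb⟩
    have hle : signal M net b u ≤ ∑ w ∈ T.erase a, signal M net w u :=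
      Finset.single_le_sum (f := fun w => signal M net w u) (fun w _ => hnn w) hmem
    have hpos : 0 < M.noise + ∑ w ∈ T.erase a, signal M net w u :=
      add_pos_of_pos_of_nonneg M.noise_pos (Finset.sum_nonneg fun w _ => hnn w)
    have h1 : (1 : ℝ) ≤ sinr M net a u T := M.one_le_β.trans ha.2.2.2
    unfold sinr at h1
    have h2 := (one_le_div hpos).1 (by convert h1)
    have := M.noise_pos
    linarith
  have h1 := key v v' h'.1 hne h
  have h2 := key v' v h.1 (fun e => hne e.symm) h'
  exact lt_asymm h1 h2

/-- The communication graph: `u` receives the message of `v` when only `v` transmits. -/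
def commGraph (M : Model) (net : Network V N) : SimpleGraph V where
  Adj v u := Receives M net {v} v u
  symm := ⟨by
    classical
    intro v u h
    obtain ⟨_, h2, h3, h4⟩ := h
    have hs : signal M net u v = signal M net v u := by simp [signal, dist_comm]
    refine ⟨by simp, ?_, by rw [hs]; exact h3, ?_⟩
    · simpa [eq_comm] using h2
    · simpa [sinr, hs] using h4⟩
  loopless := ⟨fun v h => h.2.1 h.1⟩

/-! ## Deterministic distributed protocols -/

/-- A unit-size message: control information and at most one rumour. -/
structure Msg (Ctl R : Type*) where
  ctl : Ctl
  rumor : Option R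

/-- What a station knows initially: `n`, `N`, its own label and the labels of its neighbours. -/
structure Knowledge where
  n : ℕ
  N : ℕ
  id : ℕ
  nbrs : Finset ℕ

/-- A deterministic protocol for stations without global clock and without carrier sensing. Sources
start in state `start`; any other station sleeps until it first receives a message, which puts it
into state `wake`. In each round an awake station transmits `send s`, if this is a message, and
updates its state on the basis of the message received in this round, if any. The control part of
a message is a bit string, given by the injective encoding `encode`. -/
structure Protocol (R : Type*) where
  State : Type*
  Ctl : Type
  encode : Ctl → List Bool
  encode_injective : Function.Injective encode
  start : Knowledge → List R → State
  wake : Knowledge → Msg Ctl R → State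
  send : State → Option (Msg Ctl R)
  recv : State → Option (Msg Ctl R) → State

section Execution

variable [Fintype V] {R : Type*}

open Classical in
/-- The initial knowledge of station `v`. -/
noncomputable def knowledge (M : Model) (net : Network V N) (v : V) : Knowledge where
  n := Fintype.card V
  N := N
  id := net.label v
  nbrs := (Finset.univ.filter fun u => (commGraph M net).Adj u v).image net.label

/-- The message transmitted by `v`, the current states being `s` (`none` is for sleeping). -/
def transmitted (P : Protocol R) (s : V → Option P.State) (v : V) : Option (Msg P.Ctl R) :=
  (s v).bind P.send

open Classical in
/-- The message received by `u` in a round that starts with states `s`. -/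
noncomputable def received (M : Model) (net : Network V N) (P : Protocol R)
    (s : V → Option P.State) (u : V) : Option (Msg P.Ctl R) :=
  let T : Finset V := Finset.univ.filter fun v => transmitted P s v ≠ none
  if h : ∃ v, Receives M net T v u then transmitted P s h.choose else none

/-- The states after `t` rounds. The station `v` initially holds the rumours `hold v`. -/
noncomputable def states (M : Model) (net : Network V N) (P : Protocol R) (hold : V → List R) :
    ℕ → V → Option P.State
  | 0 => fun v =>
    match hold v with
    | [] => none
    | r :: l => some (P.start (knowledge M net v) (r :: l))
  | t + 1 => fun v =>
    match states M net P hold t v, received M net P (states M net P hold t) v with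
    | none, none => none
    | none, some m => some (P.wake (knowledge M net v) m)
    | some s, m => some (P.recv s m)

/-- After `t` rounds, station `v` holds the rumour `r`. -/
def Knows (M : Model) (net : Network V N) (P : Protocol R) (hold : V → List R)
    (t : ℕ) (v : V) (r : R) : Prop :=
  r ∈ hold v ∨ ∃ t' < t, ∃ m, received M net P (states M net P hold t') v = some m ∧
    m.rumor = some r

end Execution

/-! ## Selective families -/

/-- `F` is an `(N, x)`-SSF (strongly selective family). -/
def IsSSF (N x : ℕ) (F : List (Finset ℕ)) : Prop :=
  (∀ S ∈ F, S ⊆ Finset.Icc 1 N) ∧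
  ∀ Z ⊆ Finset.Icc 1 N, Z.Nonempty → Z.card ≤ x → ∀ z ∈ Z, ∃ S ∈ F, S ∩ Z = {z}

/-- `F` is an `(N, x, y)`-selector. -/
def IsSelector (N x y : ℕ) (F : List (Finset ℕ)) : Prop :=
  (∀ S ∈ F, S ⊆ Finset.Icc 1 N) ∧
  ∀ A ⊆ Finset.Icc 1 N, A.card = x →
    ∃ B ⊆ A, y ≤ B.card ∧ ∀ b ∈ B, ∃ S ∈ F, S ∩ A = {b}

/-- The families of sets used by the algorithm, known to all stations. -/
structure Families where
  sel : List (List (Finset ℕ))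
  ssf : List (Finset ℕ)

/-- For `i = 1, …, ⌈log_{3/2} n⌉`, the `i`-th member of `sel` is an
`(N, (2/3)^i n, (2/3)^i n / 2)`-selector (numbers rounded up) of length `O((2/3)^i n log n)`, and
`ssf` is an `(N, c)`-SSF of length `O(log n)`; all with the constant `C`. -/
structure Families.Valid (F : Families) (n N c : ℕ) (C : ℝ) : Prop where
  sel_length : F.sel.length = ⌈Real.logb (3 / 2) n⌉₊
  sel_selector : ∀ (i : ℕ) (h : i < F.sel.length),
    IsSelector N ⌈(2 / 3 : ℝ) ^ (i + 1) * n⌉₊ ⌈(2 / 3 : ℝ) ^ (i + 1) * n / 2⌉₊ F.sel[i]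
  sel_short : ∀ (i : ℕ) (h : i < F.sel.length),
    (F.sel[i].length : ℝ) ≤ C * ((2 / 3 : ℝ) ^ (i + 1) * n) * Real.log (n + 1)
  ssf_ssf : IsSSF N c F.ssf
  ssf_short : (F.ssf.length : ℝ) ≤ C * Real.log (n + 1)

/-- Does the station `id` transmit in round `q` of the schedule `F`? -/
def fires (F : List (Finset ℕ)) (q id : ℕ) : Bool :=
  decide (id ∈ F.getD q ∅)

/-! ## Messages of the algorithm -/

inductive Kind
  | token
  | check
  | reply

/-- A message `⟨kind, tok, src, dst⟩` of `BTD_Construct`, associated with the token `tok`. -/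
structure Pass where
  kind : Kind
  tok : ℕ
  src : ℕ
  dst : ℕ

/-- Control parts of messages. In the part of the execution in which some stations may still be
asleep (the first three kinds), the sender's clock is attached.
* `elim`: transmission in the elimination of contending neighbours;
* `pass`: first part of `Smallest_Token`;
* `claim`: second part of `Smallest_Token`, repeating a token id;
* `walk`: move of an Eulerian walk from `src` to `dst`, carrying a number of nodes and the number
  of earlier moves; `sync` tells the second (synchronizing) walk of a pair from the first one;
* `hand`: a rumour of a leaf for its parent `dst`;
* `spread`: a rumour sent by an internal node. -/
inductive Ctl
  | elim (clock src : ℕ)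
  | pass (clock : ℕ) (m : Pass)
  | claim (clock tok : ℕ)
  | walk (sync : Bool) (src dst num step : ℕ)
  | hand (dst : ℕ)
  | spread

def Kind.code : Kind → ℕ
  | .token => 0
  | .check => 1
  | .reply => 2

def Ctl.fields : Ctl → List ℕ
  | .elim c v => [0, c, v]
  | .pass c m => [1, c, m.kind.code, m.tok, m.src, m.dst]
  | .claim c τ => [2, c, τ]
  | .walk b v w n s => [3, b.toNat, v, w, n, s]
  | .hand w => [4, w]
  | .spread => [5]

/-- Self-delimiting binary encoding of a natural number. -/
def encodeNat (x : ℕ) : List Bool :=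
  (Nat.bits x).flatMap (fun b => [true, b]) ++ [false]

def Ctl.encode (c : Ctl) : List Bool :=
  c.fields.flatMap encodeNat

theorem flatMap_bits_inj : ∀ (a b l l' : List Bool),
    a.flatMap (fun b => [true, b]) ++ [false] ++ l =
      b.flatMap (fun b => [true, b]) ++ [false] ++ l' → a = b ∧ l = l'
  | [], [], l, l', h => by simpa using h
  | [], _ :: _, l, l', h => by simp at h
  | _ :: _, [], l, l', h => by simp at h
  | x :: a, y :: b, l, l', h => by
    simp only [List.flatMap_cons, List.cons_append, List.nil_append, List.cons.injEq,
      true_and] at h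
    obtain ⟨h1, h2⟩ := flatMap_bits_inj a b l l' h.2
    exact ⟨by rw [h.1, h1], h2⟩

theorem Nat_bits_injective : Function.Injective Nat.bits := by
  intro a
  induction a using Nat.binaryRec' with
  | zero =>
    intro b h
    induction b using Nat.binaryRec' with
    | zero => rfl
    | bit x m hm _ => rw [Nat.bits_append_bit m x hm] at h; simp at h
  | bit x m hm ih =>
    intro b h
    rw [Nat.bits_append_bit m x hm] at h
    induction b using Nat.binaryRec' with
    | zero => simp at h
    | bit y k hk _ =>
      rw [Nat.bits_append_bit k y hk] at h
      simp only [List.cons.injEq] at h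
      rw [h.1, ih h.2]

theorem encodeNat_append_inj {x y : ℕ} {l l' : List Bool}
    (h : encodeNat x ++ l = encodeNat y ++ l') : x = y ∧ l = l' := by
  obtain ⟨h1, h2⟩ := flatMap_bits_inj _ _ _ _ h
  exact ⟨Nat_bits_injective h1, h2⟩

theorem flatMap_encodeNat_injective :
    Function.Injective fun l : List ℕ => l.flatMap encodeNat := by
  intro l
  induction l with
  | nil =>
    intro l' h
    cases l' with
    | nil => rfl
    | cons y l' => simp [encodeNat] at h
  | cons x l ih =>
    intro l' h
    cases l' with
    | nil => simp [encodeNat] at h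
    | cons y l' =>
      simp only [List.flatMap_cons] at h
      obtain ⟨h1, h2⟩ := encodeNat_append_inj h
      rw [h1, ih h2]

theorem Ctl.encode_injective : Function.Injective Ctl.encode := by
  intro a b h
  have h' : a.fields = b.fields := flatMap_encodeNat_injective h
  rcases a with _ | ⟨_, ⟨k, _, _, _⟩⟩ | _ | ⟨s, _, _, _, _⟩ | _ | _ <;>
    rcases b with _ | ⟨_, ⟨k', _, _, _⟩⟩ | _ | ⟨s', _, _, _, _⟩ | _ | _ <;>
    simp_all [Ctl.fields]
  · cases k <;> cases k' <;> simp_all [Kind.code]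
  · cases s <;> cases s' <;> simp_all

/-! ## Pairs of Eulerian walks

Both algorithms use a pair of Eulerian walks along the tree, started by the root: a first walk and
then a second walk, which carries the number of nodes and a counter of moves, so that every node
can compute when the second walk ends. One move takes one round. -/

/-- The token of a walk. -/
structure Walk where
  sync : Bool
  num : ℕ
  step : ℕ

/-- Local data of a node: the walk token, if the node has it; the children that the current walk
has still to visit; the number of rounds until the second walk ends and the number of nodes, once
they are known. -/
structure Tour where
  token : Option Walk
  pending : List ℕ
  timer : Option ℕ
  size : ℕ

namespace Tour

def idle : Tour := ⟨none, [], none, 0⟩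

/-- The root starts the first walk. -/
def start (children : List ℕ) (num : ℕ) : Tour := ⟨some ⟨false, num, 0⟩, children, none, 0⟩

/-- When the first walk has come back to the root, the root starts the second one. The second walk
is over when it has come back to the root. -/
def turn (parent : Option ℕ) (children : List ℕ) (T : Tour) : Tour :=
  match T.token, T.pending, parent with
  | some w, [], none =>
    if w.sync then ⟨none, [], some 0, w.num⟩ else ⟨some ⟨true, w.num, 0⟩, children, none, w.num⟩
  | _, _, _ => T

/-- The next move: to the next child or, if there is none, to the parent. -/
def send (id : ℕ) (parent : Option ℕ) (T : Tour) : Option Ctl :=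
  match T.token with
  | none => none
  | some w =>
    (T.pending.head?.or parent).map fun z => Ctl.walk w.sync id z w.num w.step

/-- Update after the move. -/
def depart (parent : Option ℕ) (T : Tour) : Tour :=
  if (T.pending.head?.or parent).isSome && T.token.isSome then
    { T with token := none, pending := T.pending.tail }
  else T

/-- One round passes. -/
def tick (T : Tour) : Tour := { T with timer := T.timer.map (· - 1) }

/-- The walk token arrives from `src`; this is the first visit of the walk iff `src` is the parent.
If `counting`, the first walk counts the nodes. A walk on `num` nodes has `2 * num - 2` moves. -/
def arrive (parent : Option ℕ) (children : List ℕ) (counting sync : Bool)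
    (src num step : ℕ) (T : Tour) : Tour :=
  let first : Bool := decide (parent = some src)
  { token := some ⟨sync, if counting && !sync && first then num + 1 else num, step + 1⟩
    pending := if first then children else T.pending
    timer := if sync then some (2 * num - 2 - (step + 1)) else T.timer
    size := if sync then num else T.size }

end Tour

/-! ## Algorithm BTD_Traversals -/

namespace Trav

/-- Local record of the execution of `BTD_Construct` for one token: status and sub-status, parent,
list of neighbours not known to be marked, children that have not been given the token yet, and all
children. -/
structure Btd where
  tok : ℕ
  visited : Bool
  marked : Bool
  parent : Option ℕ
  unmarked : List ℕ
  queue : List ℕ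
  children : List ℕ

/-- `out` is the message of `BTD_Construct` that the node intends to send (it holds the token);
`inbox` and `claims` are what it has heard in the two parts of the current `Smallest_Token`. -/
structure State where
  id : ℕ
  nbrs : List ℕ
  clock : ℕ
  active : Bool
  btd : Option Btd
  out : Option Pass
  inbox : List Pass
  claims : List ℕ
  tour : Tour

namespace State

def parent (s : State) : Option ℕ := s.btd.bind Btd.parent

def children (s : State) : List ℕ := (s.btd.map Btd.children).getD []

/-- Initial record for the token `τ`. The token id is the label of the root. -/
def fresh (s : State) (τ : ℕ) : Btd :=
  ⟨τ, false, false, none, s.nbrs.erase τ, [], []⟩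

/-- The holder of the token goes on: first it checks the neighbours that are left on its list of
unmarked neighbours, then it passes the token to its children, then back to its parent. The root
finally starts the Eulerian walks. -/
def advance (s : State) (b : Btd) : State :=
  match b.unmarked, b.queue, b.parent with
  | z :: l, _, _ =>
    { s with btd := some { b with unmarked := l }, out := some ⟨.check, b.tok, s.id, z⟩ }
  | [], z :: l, _ =>
    { s with btd := some { b with queue := l }, out := some ⟨.token, b.tok, s.id, z⟩ }
  | [], [], some p => { s with btd := some b, out := some ⟨.token, b.tok, s.id, p⟩ }
  | [], [], none => { s with btd := some b, out := none, tour := Tour.start b.children 1 }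

/-- Reaction of `BTD_Construct` to the message `m`, which belongs to the traversal of record `b`. -/
def handle (s : State) (b : Btd) (m : Pass) : State :=
  if m.dst = s.id then
    match m.kind with
    | .token =>
      if b.visited then s.advance b
      else s.advance { b with visited := true, parent := some m.src }
    | .check =>
      { s with btd := some { b with marked := true }, out := some ⟨.reply, b.tok, s.id, m.src⟩ }
    | .reply =>
      s.advance { b with queue := b.queue ++ [m.src], children := b.children ++ [m.src] }
  else
    match m.kind with
    | .token => s
    | .check =>
      if b.visited then s else { s with btd := some { b with unmarked := b.unmarked.erase m.dst } }
    | .reply => { s with btd := some { b with unmarked := b.unmarked.erase m.src } }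

/-- The end of an execution of `Smallest_Token`. Let `τ` be the smallest token id known. If it is
new, the node abandons its record and joins the traversal of `τ`. Messages with larger tokens
are skipped; the message with token `τ`, if any, is handled. In particular, a destination accepts
the smallest token addressed to it only if it has heard no smaller one. -/
def settle (s : State) : State :=
  match ((s.btd.map Btd.tok).toList ++ s.inbox.map Pass.tok ++ s.claims).min? with
  | none => { s with out := none, inbox := [], claims := [] }
  | some τ =>
    let b := match s.btd with
      | some b => if b.tok = τ then b else s.fresh τ
      | none => s.fresh τ
    let s' := { s with btd := some b, out := none, inbox := [], claims := [] }
    match s.inbox.find? (fun m => decide (m.tok = τ)) with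
    | none => s'
    | some m => s'.handle b m

/-- At the end of the elimination, each surviving node issues a token with its own label. -/
def issue (F : Families) (s : State) : State :=
  if s.clock = F.sel.flatten.length ∧ s.active = true then
    s.advance { s.fresh s.id with visited := true }
  else s

/-- Updates at the beginning of a round. -/
def prepare (F : Families) (s : State) : State :=
  let s := s.issue F
  { s with tour := s.tour.turn s.parent s.children }

/-- Position in the current execution of `Smallest_Token`. -/
def position (F : Families) (s : State) : ℕ :=
  (s.clock - F.sel.flatten.length) % (2 * F.ssf.length)

/-- The transmission in the current round, for a prepared state. -/
def emit (F : Families) (s : State) : Option Ctl :=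
  match s.tour.send s.id s.parent with
  | some c => some c
  | none =>
    if s.clock < F.sel.flatten.length then
      if s.active && fires F.sel.flatten s.clock s.id then some (.elim s.clock s.id) else none
    else
      let q := s.position F
      if q < F.ssf.length then
        match s.out with
        | some m => if fires F.ssf q s.id then some (.pass s.clock m) else none
        | none => none
      else
        match ((s.inbox.filter fun m => decide (m.dst = s.id)).map Pass.tok).min? with
        | some τ => if fires F.ssf (q - F.ssf.length) s.id then some (.claim s.clock τ) else none
        | none => none

/-- The message received in the current round is recorded. -/
def absorb (s : State) : Ctl → State
  | .elim _ v => if v < s.id then { s with active := false } else s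
  | .pass _ m => { s with inbox := s.inbox ++ [m] }
  | .claim _ τ => { s with claims := s.claims ++ [τ] }
  | .walk sync src dst num step =>
    if dst = s.id then
      { s with tour := s.tour.arrive s.parent s.children true sync src num step }
    else s
  | _ => s

def send (F : Families) (s : State) : Option Ctl := (s.prepare F).emit F

def recv (F : Families) (s : State) (c : Option Ctl) : State :=
  let s := s.prepare F
  let s := { s with tour := (s.tour.depart s.parent).tick }
  let s := match c with
    | some c => s.absorb c
    | none => s
  let s :=
    if F.sel.flatten.length ≤ s.clock ∧ s.position F + 1 = 2 * F.ssf.length then s.settle else s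
  { s with clock := s.clock + 1 }

end State

/-- Initial state of a node whose clock shows `clock`; the sources are `active`. -/
def init (K : Knowledge) (clock : ℕ) (active : Bool) : State :=
  ⟨K.id, K.nbrs.sort (· ≤ ·), clock, active, none, none, [], [], Tour.idle⟩

/-- A sleeping node takes the clock reading from the first message that it receives. -/
def clockOf : Ctl → ℕ
  | .elim c _ => c
  | .pass c _ => c
  | .claim c _ => c
  | _ => 0

end Trav

/-! ## Algorithm BTD_MB -/

namespace Mb

/-- `pour` are the rumours that the node, if it is a leaf, has still to send to its parent; `stack`
the rumours to be forwarded and `seen` all rumours that ever were on the stack; `round` is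
the number of rounds since the beginning of the second stage, and `cur` the rumour executed in the
current run of the SSF. -/
structure State (R : Type*) where
  id : ℕ
  parent : Option ℕ
  children : List ℕ
  tour : Tour
  pour : List R
  stack : List R
  seen : List R
  round : Option ℕ
  cur : Option R

/-- Initial state. Here `n` is the number of nodes computed by `BTD_Traversals`, and `own` are the
rumours that the node holds initially. -/
def init {R : Type*} (id : ℕ) (parent : Option ℕ) (children : List ℕ) (n : ℕ) (own : List R) :
    State R where
  id := id
  parent := parent
  children := children
  tour := if parent = none then Tour.start children n else Tour.idle
  pour := own
  stack := own
  seen := own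
  round := none
  cur := none

namespace State

variable {R : Type*}

/-- Updates at the beginning of a round. At the beginning of each run of the SSF in the second
stage, the top rumour is taken from the stack. -/
def prepare (F : Families) (s : State R) : State R :=
  match s.round with
  | none => { s with tour := s.tour.turn s.parent s.children }
  | some q =>
    if q % F.ssf.length = 0 then { s with cur := s.stack.head?, stack := s.stack.tail } else s

/-- A leaf visited by the first walk freezes the token as long as it has a rumour for its parent;
this is the message in which it sends the next one. -/
def frozen (s : State R) : Option (Msg Ctl R) :=
  match s.tour.token, s.children, s.parent, s.pour with
  | some w, [], some p, r :: _ => if w.sync then none else some ⟨.hand p, some r⟩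
  | _, _, _, _ => none

/-- The transmission in the current round, for a prepared state. In the second stage, only internal
nodes transmit. -/
def emit (F : Families) (s : State R) : Option (Msg Ctl R) :=
  match s.round with
  | none => s.frozen.or ((s.tour.send s.id s.parent).map fun c => ⟨c, none⟩)
  | some q =>
    match s.children, s.cur with
    | _ :: _, some r =>
      if fires F.ssf (q % F.ssf.length) s.id then some ⟨.spread, some r⟩ else none
    | _, _ => none

/-- A new rumour is put at the top of the stack. -/
def push [DecidableEq R] (s : State R) (r : R) : State R :=
  if r ∈ s.seen then s else { s with stack := r :: s.stack, seen := r :: s.seen }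

def absorb [DecidableEq R] (s : State R) (m : Msg Ctl R) : State R :=
  match m.ctl, m.rumor with
  | .walk sync src dst num step, _ =>
    if dst = s.id then
      { s with tour := s.tour.arrive s.parent s.children false sync src num step }
    else s
  | .hand dst, some r => if dst = s.id then s.push r else s
  | .spread, some r => s.push r
  | _, _ => s

def send (F : Families) (s : State R) : Option (Msg Ctl R) := (s.prepare F).emit F

def recv [DecidableEq R] (F : Families) (s : State R) (m : Option (Msg Ctl R)) : State R :=
  let s := s.prepare F
  let s :=
    match s.frozen with
    | some _ => { s with pour := s.pour.tail }
    | none => { s with tour := (s.tour.depart s.parent).tick }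
  let s := match m with
    | some m => s.absorb m
    | none => s
  match s.round with
  | some q => { s with round := some (q + 1) }
  | none => if s.tour.timer = some 0 then { s with round := some 0 } else s

end State

end Mb

/-! ## BTD_Traversals followed by BTD_MB -/

inductive NodeState (R : Type*)
  | traversing (s : Trav.State) (own : List R)
  | broadcasting (s : Mb.State R)

/-- When `BTD_Traversals` terminates at a node, the node starts `BTD_MB` with the results. -/
def proceed {R : Type*} (s : Trav.State) (own : List R) : NodeState R :=
  if s.tour.timer = some 0 then
    .broadcasting (Mb.init s.id s.parent s.children s.tour.size own)
  else .traversing s own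

/-- Algorithm `BTD_Traversals` followed by `BTD_MB`. -/
def btdProtocol (R : Type*) [DecidableEq R] (F : Families) : Protocol R where
  State := NodeState R
  Ctl := Ctl
  encode := Ctl.encode
  encode_injective := Ctl.encode_injective
  start K own := .traversing (Trav.init K 0 true) own
  wake K m := proceed ((Trav.init K (Trav.clockOf m.ctl) false).recv F (some m.ctl)) []
  send
    | .traversing s _ => (s.send F).map fun c => ⟨c, none⟩
    | .broadcasting s => s.send F
  recv
    | .traversing s own, m => proceed (s.recv F (m.map Msg.ctl)) own
    | .broadcasting s, m => .broadcasting (s.recv F m)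

end Sinr

/-! The plane is cut into square cells whose side is half the transmission range. Stations of one
cell are pairwise neighbours, and neighbours lie in cells at a bounded offset. Since `α > 2`, the
signals from all cells outside a finite set of offsets add up to as little as desired, provided that
each cell contains boundedly many transmitters (`exists_isNear`, `sum_gain_le`), and the slack `ε`
absorbs this far interference (`receives_of_far`). Hence, if a set has at most `δ` stations in each
cell, an SSF with parameter independent of `n`, of length `O(log n)`, brings a message of each of
them to all its neighbours (`IsSSF.spreads`). Much of the proof consists in showing that whenever
the SSF is executed, the transmitters are sparse in this sense.

Elimination. The families may be chosen, and they are built from hash functions. A function from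
labels to a range of size `O(x)` has more than `x / 8` collisions on a given set of `O(x)` labels
only with probability exponentially small in `x`; so `O(log n)` functions suffice for all such sets
(`exists_isHashing`). The resulting schedules are selectors, and they also withstand interference:
one phase reduces the number of participants in a cell from `2 * x` to `2 * (x / 8) + 1`
(`elim_phase`). The sizes fall geometrically, the total length is `O(n log n)`, and at most two
survivors per cell remain (`sparse_survivors`).

Traversals. All survivors start traversals at the same time. The invariant `Contest` compares every
token that is still held with the traversal that its root would carry out if it were alone. A token
addressed to a node that knows a smaller one dies; the smallest token is never disturbed
(`Contest.step`). A rival cannot become complete, because it would have to visit the smallest root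
(`Contest.started`). Two nodes of one cell that accept different tokens would hear each other's
claims, so there is at most one holder per cell after each execution of `Smallest_Token`
(`Contest.sparse`). An undisturbed traversal sends at most `4 * n` messages (`exists_traversal`),
which gives `O(n log n)` rounds.

The tree. Each cell contains a bounded number of internal nodes (`Search.innerCount_le`). When a
node of a cell is visited, the whole cell becomes marked. From then on, a node of this cell with
children has a child in a neighbouring cell that was not completely marked, and the visit of this
child marks that cell completely. This can happen once for each neighbouring cell only. So the
internal nodes form a sparse, connected, dominating set.

Broadcast. The walks have a single transmitter in each round and present no interference; leaves
hand over their rumours at a cost of `k` rounds in total. Afterwards, the top rumours of all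
internal nodes reach all neighbours in each run of the SSF, and the rumours are pipelined whatever
the order of the stacks: if a node has sent neither `r` nor many rumours, it must have lagged behind
its predecessor by at most one run (`Flood.sent_of_adj`). So `n + k + 1` runs of length `O(log n)`
suffice (`Flood.complete`).

Message size. All fields of messages are labels, clocks of the first part or counters of a walk,
hence polynomial in `n`, and take `O(log n)` bits. -/

namespace Sinr

/-! ## Geometry of the SINR model -/

section Geometry

variable {V : Type*} {N : ℕ} (M : Model) (net : Network V N)

/-- The smallest power with which a message can be received. -/
noncomputable def Model.sens : ℝ := (1 + M.ε) * M.β * M.noise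

theorem Model.sens_pos : 0 < M.sens :=
  mul_pos (mul_pos (by linarith [M.ε_pos]) (by linarith [M.one_le_β])) M.noise_pos

/-- Half of the transmission range. -/
noncomputable def Model.cell : ℝ := (M.power / M.sens) ^ (M.α)⁻¹ / 2

theorem Model.cell_pos : 0 < M.cell :=
  half_pos (Real.rpow_pos_of_pos (div_pos M.power_pos M.sens_pos) _)

theorem signal_nonneg (v u : V) : 0 ≤ signal M net v u :=
  mul_nonneg M.power_pos.le (Real.rpow_nonneg dist_nonneg _)

theorem sens_le_signal_iff {v u : V} (h : v ≠ u) :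
    M.sens ≤ signal M net v u ↔ dist (net.pos v) (net.pos u) ≤ 2 * M.cell := by
  have hd : 0 < dist (net.pos v) (net.pos u) := dist_pos.2 fun e => h (net.pos_injective e)
  have hα : 0 < M.α := by linarith [M.two_lt_α]
  have e : 2 * M.cell = (M.power / M.sens) ^ (M.α)⁻¹ := by unfold Model.cell; ring
  rw [e, Real.le_rpow_inv_iff_of_pos hd.le (div_pos M.power_pos M.sens_pos).le hα, signal,
    Real.rpow_neg hd.le, le_div_iff₀ M.sens_pos, ← div_eq_mul_inv,
    le_div_iff₀ (Real.rpow_pos_of_pos hd _), mul_comm]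

/-- Without other transmitters the sensitivity condition already implies the SINR condition, since
`(1 + ε) β` times the noise exceeds `β` times the noise. So the communication graph is the disc
graph of radius `2 * M.cell`. -/
theorem adj_iff {v u : V} :
    (commGraph M net).Adj v u ↔ v ≠ u ∧ dist (net.pos v) (net.pos u) ≤ 2 * M.cell := by
  constructor
  · intro h
    have hne : v ≠ u := (commGraph M net).ne_of_adj h
    exact ⟨hne, (sens_le_signal_iff M net hne).1 h.2.2.1⟩
  · rintro ⟨hne, hd⟩
    have hs := (sens_le_signal_iff M net hne).2 hd
    refine ⟨by simp, by simpa using hne.symm, hs, ?_⟩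
    simp only [sinr, Finset.erase_singleton, Finset.sum_empty, add_zero]
    rw [le_div_iff₀ M.noise_pos]
    refine le_trans ?_ hs
    have : 0 ≤ M.ε * (M.β * M.noise) :=
      mul_nonneg M.ε_pos.le (mul_nonneg (by linarith [M.one_le_β]) M.noise_pos.le)
    unfold Model.sens
    nlinarith

/-- The grid cell of a station. -/
noncomputable def box (v : V) : Fin 2 → ℤ := fun i => ⌊net.pos v i / M.cell⌋

/-- Offsets of the cells of neighbours. -/
noncomputable def nb : Finset (Fin 2 → ℤ) := Fintype.piFinset fun _ => Finset.Icc (-3) 3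

theorem mem_nb {o : Fin 2 → ℤ} : o ∈ nb ↔ ∀ i, |o i| ≤ 3 := by
  simp [nb, Fintype.mem_piFinset, abs_le]

theorem zero_mem_nb : (0 : Fin 2 → ℤ) ∈ nb := mem_nb.2 fun i => by simp

theorem abs_coord_le_dist (v u : V) (i : Fin 2) :
    |net.pos v i - net.pos u i| ≤ dist (net.pos v) (net.pos u) := by
  rw [dist_eq_norm]
  simpa using PiLp.norm_apply_le (net.pos v - net.pos u) i

/-- The factor `2` in place of the square root of `2` costs nothing, because the side of a cell is
half the range. -/
theorem dist_le_of_coord {v u : V} {a : ℝ} (ha : 0 ≤ a)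
    (h : ∀ i, |net.pos v i - net.pos u i| ≤ a) : dist (net.pos v) (net.pos u) ≤ 2 * a := by
  rw [EuclideanSpace.dist_eq, Fin.sum_univ_two]
  refine Real.sqrt_le_iff.2 ⟨by positivity, ?_⟩
  have h0 := h 0
  have h1 := h 1
  rw [Real.dist_eq, Real.dist_eq]
  nlinarith [abs_nonneg (net.pos v 0 - net.pos u 0), abs_nonneg (net.pos v 1 - net.pos u 1)]

theorem abs_box_sub_lt (v u : V) (i : Fin 2) :
    (|box M net v i - box M net u i| : ℝ) < dist (net.pos v) (net.pos u) / M.cell + 1 := by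
  have hc := M.cell_pos
  have h1 := abs_coord_le_dist net v u i
  have h2 : |net.pos v i / M.cell - net.pos u i / M.cell| ≤
      dist (net.pos v) (net.pos u) / M.cell := by
    rw [← sub_div, abs_div, abs_of_pos hc]
    exact div_le_div_of_nonneg_right h1 hc.le
  have a1 := Int.floor_le (net.pos v i / M.cell)
  have a2 := Int.lt_floor_add_one (net.pos v i / M.cell)
  have b1 := Int.floor_le (net.pos u i / M.cell)
  have b2 := Int.lt_floor_add_one (net.pos u i / M.cell)
  rw [abs_le] at h2
  unfold box
  rw [abs_lt]
  constructor <;> linarith [h2.1, h2.2]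

/-- Cells are cliques. The elimination, the contest of tokens and the bound on internal nodes all
rest on this. -/
theorem adj_of_box_eq {v u : V} (hne : v ≠ u) (h : box M net v = box M net u) :
    (commGraph M net).Adj v u := by
  refine (adj_iff M net).2 ⟨hne, dist_le_of_coord net M.cell_pos.le fun i => ?_⟩
  have h' := Int.abs_sub_lt_one_of_floor_eq_floor (congrFun h i)
  rw [← sub_div, abs_div, abs_of_pos M.cell_pos, div_lt_one M.cell_pos] at h'
  exact h'.le

theorem box_sub_mem_nb {v u : V} (h : (commGraph M net).Adj v u) :
    box M net v - box M net u ∈ nb := by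
  refine mem_nb.2 fun i => ?_
  have h1 := abs_box_sub_lt M net v u i
  have h2 : dist (net.pos v) (net.pos u) / M.cell ≤ 2 :=
    (div_le_iff₀ M.cell_pos).2 ((adj_iff M net).1 h).2
  have h3 : (|box M net v i - box M net u i| : ℝ) < 3 := by linarith
  have h4 : |box M net v i - box M net u i| < 3 := by exact_mod_cast h3
  simpa using h4.le

/-- A bound on the power of the signals between cells at offset `o`. -/
noncomputable def gain (o : Fin 2 → ℤ) : ℝ :=
  M.power * (M.cell / 2) ^ (-M.α) * ‖o‖ ^ (-M.α)

theorem gain_nonneg (o : Fin 2 → ℤ) : 0 ≤ gain M o :=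
  mul_nonneg (mul_nonneg M.power_pos.le (Real.rpow_nonneg (half_pos M.cell_pos).le _))
    (Real.rpow_nonneg (norm_nonneg _) _)

/-- The series of `‖o‖ ^ (-α)` over the plane lattice converges because `α > 2`; this is where the
path loss exponent enters. -/
theorem summable_gain : Summable (gain M) :=
  (EisensteinSeries.summable_one_div_norm_rpow M.two_lt_α).mul_left _

/-- Outside `nb` the distance exceeds two cell sides, so the rounding error of one cell side at most
doubles the ratio of offset to distance. This explains `M.cell / 2` in `gain`. -/
theorem signal_le_gain {w u : V} (h : box M net w - box M net u ∉ nb) :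
    signal M net w u ≤ gain M (box M net w - box M net u) := by
  set o := box M net w - box M net u with ho
  have hc := M.cell_pos
  rw [mem_nb] at h
  push Not at h
  obtain ⟨i, hi⟩ := h
  have hi' : (3 : ℝ) < |((box M net w i : ℝ) - box M net u i)| := by
    have : (3 : ℤ) < |box M net w i - box M net u i| := hi
    exact_mod_cast this
  have h1 := abs_box_sub_lt M net w u i
  have hno : ‖o‖ ≤ dist (net.pos w) (net.pos u) / (M.cell / 2) := by
    refine (pi_norm_le_iff_of_nonneg (by positivity)).2 fun j => ?_
    have h2 := abs_box_sub_lt M net w u j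
    rw [Int.norm_eq_abs, ho]
    simp only [Pi.sub_apply]
    push_cast
    have : dist (net.pos w) (net.pos u) / (M.cell / 2) =
        2 * (dist (net.pos w) (net.pos u) / M.cell) := by field_simp
    linarith
  have hpos : 0 < ‖o‖ := by
    refine norm_pos_iff.2 fun e => ?_
    rw [e] at hi
    simp at hi
  unfold signal gain
  rw [mul_assoc, ← Real.mul_rpow (by positivity) hpos.le]
  refine mul_le_mul_of_nonneg_left ?_ M.power_pos.le
  refine Real.rpow_le_rpow_of_nonpos (by positivity) ?_ (by linarith [M.two_lt_α])
  rw [le_div_iff₀ (by positivity)] at hno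
  linarith

/-- `near` is a finite set of offsets, outside of which the total gain is at most `η`. -/
structure IsNear (near : Finset (Fin 2 → ℤ)) (η : ℝ) : Prop where
  nb_subset : nb ⊆ near
  tail_le : ∀ t : Finset (Fin 2 → ℤ), Disjoint t near → ∑ o ∈ t, gain M o ≤ η

theorem exists_isNear {η : ℝ} (hη : 0 < η) : ∃ near, IsNear M near η := by
  obtain ⟨s, hs⟩ := (summable_iff_vanishing_norm.1 (summable_gain M)) η hη
  refine ⟨s ∪ nb, Finset.subset_union_right, fun t ht => ?_⟩
  have := hs t (ht.mono_right Finset.subset_union_left)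
  exact (le_abs_self _).trans (by simpa using this.le)

open Classical in
/-- Total gain from far cells if no cell contains more than `x` of the stations. -/
theorem sum_gain_le {near : Finset (Fin 2 → ℤ)} {η : ℝ} (hn : IsNear M near η) (W : Finset V)
    (x : ℝ) (hx : 0 ≤ x) (hW : ∀ b, ((W.filter fun v => box M net v = b).card : ℝ) ≤ x)
    (b : Fin 2 → ℤ) (hfar : ∀ w ∈ W, box M net w - b ∉ near) :
    ∑ w ∈ W, gain M (box M net w - b) ≤ x * η := by
  -- Stations are grouped by their offset from `b`. A group lies in a single cell and has at most
  -- `x` members, so the sum is at most `x` times a tail of the series of gains.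
  rw [← Finset.sum_fiberwise_of_maps_to (t := W.image fun w => box M net w - b)
    (g := fun w => box M net w - b) (fun w hw => Finset.mem_image_of_mem _ hw)]
  calc _ ≤ ∑ o ∈ W.image (fun w => box M net w - b), x * gain M o := by
        refine Finset.sum_le_sum fun o _ => ?_
        rw [Finset.sum_congr rfl (g := fun _ => gain M o)
          (fun w hw => by rw [(Finset.mem_filter.1 hw).2]), Finset.sum_const, nsmul_eq_mul]
        refine mul_le_mul_of_nonneg_right ?_ (gain_nonneg M o)
        refine le_trans ?_ (hW (o + b))
        exact_mod_cast Finset.card_le_card fun w hw => by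
          simp only [Finset.mem_filter] at hw ⊢
          exact ⟨hw.1, by rw [← hw.2]; simp⟩
    _ = x * ∑ o ∈ W.image (fun w => box M net w - b), gain M o := by rw [Finset.mul_sum]
    _ ≤ x * η := by
        refine mul_le_mul_of_nonneg_left (hn.tail_le _ ?_) hx
        rw [Finset.disjoint_left]
        intro o ho
        obtain ⟨w, hw, rfl⟩ := Finset.mem_image.1 ho
        exact hfar w hw

-- The received power is at least `(1 + ε) β` times the noise, so far interference of up to `ε`
-- times the noise is harmless if no other transmitter is near.
open Classical in
theorem receives_of_far {near : Finset (Fin 2 → ℤ)} (hnb : nb ⊆ near) {T : Finset V} {v u : V}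
    (hv : v ∈ T) (hu : u ∉ T) (h : (commGraph M net).Adj v u)
    (hfar : ∀ w ∈ T, w ≠ v → box M net w - box M net u ∉ near)
    (hsum : ∑ w ∈ T.erase v, gain M (box M net w - box M net u) ≤ M.ε * M.noise) :
    Receives M net T v u := by
  have hs : M.sens ≤ signal M net v u := h.2.2.1
  refine ⟨hv, hu, hs, ?_⟩
  have h1 : ∑ w ∈ T.erase v, signal M net w u ≤ M.ε * M.noise := by
    refine le_trans (Finset.sum_le_sum fun w hw => ?_) hsum
    have hw' := Finset.mem_erase.1 hw
    exact signal_le_gain M net fun h => hfar w hw'.2 hw'.1 (hnb h)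
  have h2 : 0 ≤ ∑ w ∈ T.erase v, signal M net w u :=
    Finset.sum_nonneg fun w _ => signal_nonneg M net w u
  unfold sinr
  rw [le_div_iff₀ (by linarith [M.noise_pos])]
  refine le_trans ?_ hs
  unfold Model.sens
  have : M.β * (M.noise + ∑ w ∈ T.erase v, signal M net w u) ≤
      M.β * (M.noise + M.ε * M.noise) :=
    mul_le_mul_of_nonneg_left (by linarith) (by linarith [M.one_le_β])
  linarith

theorem Receives.adj {T : Finset V} {v u : V} (h : Receives M net T v u) :
    (commGraph M net).Adj v u := by
  have hne : v ≠ u := fun e => h.2.1 (e ▸ h.1)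
  exact (adj_iff M net).2 ⟨hne, (sens_le_signal_iff M net hne).1 h.2.2.1⟩

theorem fires_iff {S : List (Finset ℕ)} {q i : ℕ} (hq : q < S.length) :
    fires S q i = true ↔ i ∈ S[q] := by
  simp [fires, List.getD_eq_getElem?_getD, hq]

end Geometry

/-! ## Hearing -/

section Hear

variable {V : Type*} {N : ℕ} (M : Model) (net : Network V N) [Fintype V] {μ ν : Type*}

open Classical in
/-- The stations that transmit, if `e` gives their transmissions. -/
noncomputable def senders (e : V → Option μ) : Finset V :=
  Finset.univ.filter fun v => e v ≠ none

theorem mem_senders {e : V → Option μ} {v : V} : v ∈ senders e ↔ e v ≠ none := by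
  simp [senders]

open Classical in
/-- What `u` receives if the stations transmit `e`. -/
noncomputable def hear (e : V → Option μ) (u : V) : Option μ :=
  if h : ∃ v, Receives M net (senders e) v u then e h.choose else none

theorem received_eq_hear {R : Type*} (P : Protocol R) (s : V → Option P.State) (u : V) :
    received M net P s u = hear M net (transmitted P s) u := rfl

theorem hear_of_receives {e : V → Option μ} {v u : V} (h : Receives M net (senders e) v u) :
    hear M net e u = e v := by
  have h' : ∃ v, Receives M net (senders e) v u := ⟨v, h⟩
  rw [hear, dif_pos h', h'.choose_spec.unique h]

theorem exists_of_hear {e : V → Option μ} {u : V} {m : μ} (h : hear M net e u = some m) :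
    ∃ v, Receives M net (senders e) v u ∧ e v = some m := by
  unfold hear at h
  split_ifs at h with h'
  exact ⟨_, h'.choose_spec, h⟩

theorem adj_of_hear {e : V → Option μ} {u : V} {m : μ} (h : hear M net e u = some m) :
    ∃ v, (commGraph M net).Adj v u ∧ e v = some m := by
  obtain ⟨v, h1, h2⟩ := exists_of_hear M net h
  exact ⟨v, h1.adj, h2⟩

theorem senders_map (f : μ → ν) (e : V → Option μ) :
    senders (fun v => (e v).map f) = senders e := by
  ext v; simp [mem_senders]

theorem hear_map (f : μ → ν) (e : V → Option μ) (u : V) :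
    hear M net (fun v => (e v).map f) u = (hear M net e u).map f := by
  unfold hear
  rw [senders_map]
  split_ifs <;> rfl

theorem hear_single {e : V → Option μ} {h : V} (hh : ∀ v, v ≠ h → e v = none) {u : V}
    (hu : (commGraph M net).Adj h u) : hear M net e u = e h := by
  by_cases h0 : e h = none
  · cases hm : hear M net e u with
    | none => exact h0.symm
    | some m =>
      obtain ⟨v, -, hv⟩ := adj_of_hear M net hm
      by_cases hvh : v = h
      · rw [hvh, h0] at hv; cases hv
      · rw [hh v hvh] at hv; cases hv
  · refine hear_of_receives M net ?_
    have : senders e = {h} := by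
      ext v
      rw [mem_senders, Finset.mem_singleton]
      exact ⟨fun hv => by_contra fun hne => hv (hh v hne), fun e' => e' ▸ h0⟩
    rw [this]
    exact hu

theorem hear_single_eq_none {e : V → Option μ} {h : V} (hh : ∀ v, v ≠ h → e v = none) {u : V}
    (hu : ¬(commGraph M net).Adj h u) : hear M net e u = none := by
  cases hm : hear M net e u with
  | none => rfl
  | some m =>
    obtain ⟨v, hv, hv'⟩ := adj_of_hear M net hm
    by_cases hvh : v = h
    · exact absurd (hvh ▸ hv) hu
    · rw [hh v hvh] at hv'; cases hv'

open Classical in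
/-- No cell contains more than `δ` stations of `X`. -/
def Sparse (X : Finset V) (δ : ℕ) : Prop :=
  ∀ b, (X.filter fun v => box M net v = b).card ≤ δ

open Classical in
/-- During an execution of the SSF by the stations of a sparse set, each of them is heard by each of
its neighbours. -/
theorem exists_hear {near : Finset (Fin 2 → ℤ)} {δ c : ℕ} {F : List (Finset ℕ)}
    (hF : IsSSF N c F) (hn : IsNear M near (M.ε * M.noise / (δ + 1))) (hc : δ * near.card ≤ c)
    {X : Finset V} (hX : Sparse M net X δ) (e : ℕ → V → Option μ)
    (he : ∀ q < F.length, ∀ v, e q v ≠ none ↔ v ∈ X ∧ fires F q (net.label v) = true)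
    {v u : V} (hv : v ∈ X) (hvu : (commGraph M net).Adj v u) :
    ∃ q < F.length, e q v ≠ none ∧ hear M net (e q) u = e q v := by
  -- `Z` consists of the stations of `X` near the receiver. There are at most `δ * near.card` of
  -- them, so the SSF has a set that isolates `v` in `Z`; the other transmitters of that round are
  -- far from `u`.
  set Z : Finset V := X.filter fun w => box M net w - box M net u ∈ near with hZ
  have hvZ : v ∈ Z := Finset.mem_filter.2 ⟨hv, hn.nb_subset (box_sub_mem_nb M net hvu)⟩
  have hZc : Z.card ≤ c := by
    refine le_trans ?_ hc
    calc Z.card ≤ ∑ o ∈ near, (Z.filter fun w => box M net w - box M net u = o).card :=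
          (Finset.card_eq_sum_card_fiberwise fun w hw => (Finset.mem_filter.1 hw).2).le
      _ ≤ ∑ o ∈ near, δ := by
          refine Finset.sum_le_sum fun o _ => le_trans (Finset.card_le_card ?_)
            (hX (o + box M net u))
          intro w hw
          simp only [hZ, Finset.mem_filter] at hw ⊢
          exact ⟨hw.1.1, by rw [← hw.2]; simp⟩
      _ = δ * near.card := by simp [mul_comm]
  obtain ⟨S, hS, hSZ⟩ := hF.2 (Z.image net.label)
    (fun i hi => by obtain ⟨w, -, rfl⟩ := Finset.mem_image.1 hi; exact net.label_mem w)
    ⟨_, Finset.mem_image_of_mem _ hvZ⟩ (Finset.card_image_le.trans hZc) _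
    (Finset.mem_image_of_mem _ hvZ)
  obtain ⟨q, hq, rfl⟩ := List.getElem_of_mem hS
  have key : ∀ w ∈ Z, net.label w ∈ F[q] → w = v := by
    intro w hw hwq
    have : net.label w ∈ F[q] ∩ Z.image net.label :=
      Finset.mem_inter.2 ⟨hwq, Finset.mem_image_of_mem _ hw⟩
    rw [hSZ, Finset.mem_singleton] at this
    exact net.label_injective this
  have hvq : net.label v ∈ F[q] := by
    have : net.label v ∈ F[q] ∩ Z.image net.label := by rw [hSZ]; simp
    exact (Finset.mem_inter.1 this).1
  have hsend : ∀ w, w ∈ senders (e q) ↔ w ∈ X ∧ net.label w ∈ F[q] := by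
    intro w
    rw [mem_senders, he q hq, fires_iff hq]
  have hvs : v ∈ senders (e q) := (hsend v).2 ⟨hv, hvq⟩
  refine ⟨q, hq, mem_senders.1 hvs, hear_of_receives M net ?_⟩
  refine receives_of_far M net hn.nb_subset hvs ?_ hvu ?_ ?_
  · intro hu
    have hu' := (hsend u).1 hu
    have := key u (Finset.mem_filter.2 ⟨hu'.1, by simpa using hn.nb_subset zero_mem_nb⟩) hu'.2
    exact (commGraph M net).ne_of_adj hvu this.symm
  · intro w hw hwv hwn
    have hw' := (hsend w).1 hw
    exact hwv (key w (Finset.mem_filter.2 ⟨hw'.1, hwn⟩) hw'.2)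
  · refine le_trans (sum_gain_le M net hn _ δ (by positivity) (fun b => ?_) _ ?_) ?_
    · refine le_trans ?_ (Nat.cast_le.2 (hX b))
      refine Nat.cast_le.2 (Finset.card_le_card ?_)
      intro w hw
      simp only [Finset.mem_filter, Finset.mem_erase] at hw ⊢
      exact ⟨((hsend w).1 hw.1.2).1, hw.2⟩
    · intro w hw hwn
      have hw' := (hsend w).1 (Finset.mem_of_mem_erase hw)
      exact Finset.ne_of_mem_erase hw (key w (Finset.mem_filter.2 ⟨hw'.1, hwn⟩) hw'.2)
    -- The far interference is at most `δ / (δ + 1)` times the tolerated amount. The denominator `δ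
    -- + 1` only serves to avoid division by zero.
    · have : 0 ≤ M.ε * M.noise := (mul_pos M.ε_pos M.noise_pos).le
      rw [mul_div_assoc', div_le_iff₀ (by positivity)]
      nlinarith

end Hear

end Sinr

namespace Sinr

/-! ## Selective families from hash functions -/

section Hash

/-- The number of repetitions among the values of `h` on `Z`. -/
def rep {α : Type*} {k : ℕ} (h : α → Fin k) (Z : Finset α) : ℕ := Z.card - (Z.image h).card

theorem rep_insert {α : Type*} [DecidableEq α] {k : ℕ} (h : α → Fin k) {Z : Finset α} {z : α}
    (hz : z ∉ Z) : rep h (insert z Z) = rep h Z + if h z ∈ Z.image h then 1 else 0 := by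
  have := Finset.card_image_le (s := Z) (f := h)
  unfold rep
  rw [Finset.card_insert_of_notMem hz, Finset.image_insert]
  split_ifs with h1
  · rw [Finset.insert_eq_of_mem h1]; omega
  · rw [Finset.card_insert_of_notMem h1]; omega

/-- Choosing a random function and then choosing its value at `z` anew gives again a random
function. Exchanging the old and the new value is an involution of the pairs. -/
theorem sum_update {α : Type*} [Fintype α] [DecidableEq α] {k : ℕ} (z : α)
    (f : (α → Fin k) → ℕ) :
    ∑ h : α → Fin k, ∑ y : Fin k, f (Function.update h z y) = k * ∑ h, f h := by
  let σ : (α → Fin k) × Fin k → (α → Fin k) × Fin k := fun p => (Function.update p.1 z p.2, p.1 z)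
  have hσ : Function.Involutive σ := fun p => by simp [σ]
  have := Equiv.sum_comp hσ.toPerm fun p : (α → Fin k) × Fin k => f p.1
  rw [Fintype.sum_prod_type, Fintype.sum_prod_type] at this
  simp only [Function.Involutive.coe_toPerm, σ] at this
  rw [this]
  simp [Finset.mul_sum]

/-- An exponential moment bound. When an element is added to `Z`, its random value hits one of at
most `s` earlier values out of `s * q`, that is with probability at most `1 / q`, and then
contributes a factor `q`; otherwise the factor is `1`. So each element contributes an expected
factor of at most `2`. -/
theorem sum_pow_rep_le {α : Type*} [Fintype α] [DecidableEq α] {s q : ℕ} (hs : 0 < s) (hq : 0 < q)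
    (Z : Finset α) (hZ : Z.card ≤ s) :
    ∑ h : α → Fin (s * q), q ^ rep h Z ≤ 2 ^ Z.card * (s * q) ^ Fintype.card α := by
  induction Z using Finset.induction_on with
  | empty => simp [rep]
  | insert z Z hz ih =>
    rw [Finset.card_insert_of_notMem hz] at hZ
    have ih := ih (by omega)
    have hk : 0 < s * q := Nat.mul_pos hs hq
    refine Nat.le_of_mul_le_mul_left (c := s * q) ?_ hk
    rw [← sum_update z]
    have hpt : ∀ h : α → Fin (s * q), ∑ y : Fin (s * q),
        q ^ rep (Function.update h z y) (insert z Z) ≤ q ^ rep h Z * (2 * (s * q)) := by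
      intro h
      have him : ∀ y, Z.image (Function.update h z y) = Z.image h := fun y =>
        Finset.image_congr fun w hw => by
          rw [Function.update_of_ne]
          rintro rfl
          exact hz hw
      have hr : ∀ y, rep (Function.update h z y) Z = rep h Z := fun y => by
        unfold rep; rw [him]
      calc ∑ y : Fin (s * q), q ^ rep (Function.update h z y) (insert z Z)
          ≤ ∑ y : Fin (s * q), q ^ rep h Z * (1 + if y ∈ Z.image h then q else 0) := by
            refine Finset.sum_le_sum fun y _ => ?_
            rw [rep_insert _ hz, hr, him, Function.update_self]
            split_ifs
            · rw [pow_succ]; exact Nat.mul_le_mul_left _ (by omega)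
            · simp
        _ = q ^ rep h Z * (s * q + (Z.image h).card * q) := by
            rw [← Finset.mul_sum, Finset.sum_add_distrib, ← Finset.sum_filter]
            simp only [Finset.sum_const, Finset.card_univ, Fintype.card_fin, smul_eq_mul, mul_one,
              Finset.filter_univ_mem]
        _ ≤ q ^ rep h Z * (2 * (s * q)) := by
            refine Nat.mul_le_mul_left _ ?_
            have : (Z.image h).card ≤ s := Finset.card_image_le.trans (by omega)
            nlinarith
    calc _ ≤ ∑ h : α → Fin (s * q), q ^ rep h Z * (2 * (s * q)) :=
          Finset.sum_le_sum fun h _ => hpt h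
      _ = (s * q) * (2 * ∑ h : α → Fin (s * q), q ^ rep h Z) := by
          rw [← Finset.sum_mul]; ring
      _ ≤ _ := by
          refine Nat.mul_le_mul_left _ ?_
          rw [Finset.card_insert_of_notMem hz, pow_succ]
          nlinarith

/-- Markov's inequality for the exponential moment. -/
theorem card_le_rep_mul {α : Type*} [Fintype α] [DecidableEq α] {s q : ℕ} (hs : 0 < s)
    (hq : 0 < q) (Z : Finset α) (hZ : Z.card ≤ s) (a : ℕ) :
    (Finset.univ.filter fun h : α → Fin (s * q) => a ≤ rep h Z).card * q ^ a ≤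
      2 ^ s * (s * q) ^ Fintype.card α := by
  calc _ = ∑ h ∈ Finset.univ.filter fun h : α → Fin (s * q) => a ≤ rep h Z, q ^ a := by simp
    _ ≤ ∑ h ∈ Finset.univ.filter fun h : α → Fin (s * q) => a ≤ rep h Z, q ^ rep h Z :=
        Finset.sum_le_sum fun h hh => Nat.pow_le_pow_right hq (Finset.mem_filter.1 hh).2
    _ ≤ ∑ h : α → Fin (s * q), q ^ rep h Z :=
        Finset.sum_le_sum_of_subset (Finset.filter_subset _ _)
    _ ≤ 2 ^ Z.card * (s * q) ^ Fintype.card α := sum_pow_rep_le hs hq Z hZ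
    _ ≤ _ := Nat.mul_le_mul_right _ (Nat.pow_le_pow_right (by norm_num) hZ)

/-- The fibres of `h` on `D` have at least two elements, so `D` loses at least half of its size
under `h`, and this loss is part of the loss of `Z`. -/
theorem card_collision_le {α : Type*} [DecidableEq α] {k : ℕ} (h : α → Fin k) {D Z : Finset α}
    (hDZ : D ⊆ Z) (hD : ∀ v ∈ D, ∃ w ∈ D, w ≠ v ∧ h w = h v) : D.card ≤ 2 * rep h Z := by
  have h1 : 2 * (D.image h).card ≤ D.card := by
    refine Finset.mul_card_image_le_card D 2 fun y hy => ?_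
    obtain ⟨v, hv, rfl⟩ := Finset.mem_image.1 hy
    obtain ⟨w, hw, hwv, he⟩ := hD v hv
    have : ({v, w} : Finset α) ⊆ D.filter fun x => h x = h v := by
      intro x hx
      rw [Finset.mem_insert, Finset.mem_singleton] at hx
      rcases hx with rfl | rfl
      · exact Finset.mem_filter.2 ⟨hv, rfl⟩
      · exact Finset.mem_filter.2 ⟨hw, he⟩
    simpa [Finset.card_pair hwv.symm] using Finset.card_le_card this
  have h2 : (Z.image h).card ≤ (Z \ D).card + (D.image h).card := by
    have : Z.image h ⊆ (Z \ D).image h ∪ D.image h := by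
      rw [← Finset.image_union, Finset.sdiff_union_of_subset hDZ]
    exact (Finset.card_le_card this).trans ((Finset.card_union_le _ _).trans
      (Nat.add_le_add_right Finset.card_image_le _))
  have h3 : (Z \ D).card + D.card = Z.card :=
    Finset.card_sdiff_add_card_eq_card hDZ
  unfold rep
  omega

/-- If every element of `K` is bad for a fraction of at most `1 / B` of all `ω` then some short list
contains a good `ω` for each of them. -/
theorem exists_list_cover {κ Ω : Type*} [Fintype Ω] [Nonempty Ω] (bad : κ → Ω → Prop)
    [∀ k, DecidablePred (bad k)] (B : ℕ) (m : ℕ) :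
    ∀ K : Finset κ, (∀ k ∈ K, (Finset.univ.filter (bad k)).card * B ≤ Fintype.card Ω) →
      K.card < B ^ m → ∃ l : List Ω, l.length = m ∧ ∀ k ∈ K, ∃ ω ∈ l, ¬bad k ω := by
  induction m with
  | zero =>
    intro K _ hK
    have : K = ∅ := Finset.card_eq_zero.1 (by simpa using hK)
    exact ⟨[], rfl, by simp [this]⟩
  | succ m ih =>
    intro K hbad hK
    -- Greedy choice: by averaging, some `ω` is bad for at most a fraction `1 / B` of `K`, and the
    -- induction goes on with these elements. After `m` choices fewer than one element is left.
    have : ∃ ω, (K.filter fun k => bad k ω).card * B ≤ K.card := by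
      by_contra! hcon
      have h1 : ∑ ω : Ω, K.card < ∑ ω : Ω, (K.filter fun k => bad k ω).card * B :=
        Finset.sum_lt_sum_of_nonempty Finset.univ_nonempty fun ω _ => hcon ω
      have h2 : ∑ ω : Ω, (K.filter fun k => bad k ω).card * B =
          ∑ k ∈ K, (Finset.univ.filter (bad k)).card * B := by
        rw [← Finset.sum_mul, ← Finset.sum_mul]
        simp only [Finset.card_filter]
        rw [Finset.sum_comm]
      have h3 : ∑ k ∈ K, (Finset.univ.filter (bad k)).card * B ≤ ∑ _k ∈ K, Fintype.card Ω :=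
        Finset.sum_le_sum hbad
      simp only [Finset.sum_const, smul_eq_mul, Finset.card_univ] at h1 h3
      rw [h2, mul_comm] at h1
      omega
    obtain ⟨ω, hω⟩ := this
    have hpos : 0 < B := by
      rcases Nat.eq_zero_or_pos B with rfl | h
      · simp at hK
      · exact h
    obtain ⟨l, hl, hl'⟩ := ih (K.filter fun k => bad k ω)
      (fun k hk => hbad k (Finset.mem_of_mem_filter k hk)) (by
        refine lt_of_mul_lt_mul_right (a := B) ?_ (Nat.zero_le _)
        rw [← pow_succ]
        omega)
    refine ⟨ω :: l, by simp [hl], fun k hk => ?_⟩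
    by_cases hb : bad k ω
    · obtain ⟨ω', h1, h2⟩ := hl' k (Finset.mem_filter.2 ⟨hk, hb⟩)
      exact ⟨ω', List.mem_cons_of_mem _ h1, h2⟩
    · exact ⟨ω, List.mem_cons_self, hb⟩

/-- The sum of the binomial coefficients is compared termwise with the expansion of `(n + 1) ^ s`.
-/
theorem card_small_finsets_le (n s : ℕ) :
    (Finset.univ.filter fun Z : Finset (Fin n) => Z.card ≤ s).card ≤ (n + 1) ^ s := by
  have hsub : (Finset.univ.filter fun Z : Finset (Fin n) => Z.card ≤ s) ⊆
      (Finset.range (s + 1)).biUnion fun i => Finset.powersetCard i Finset.univ := by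
    intro Z hZ
    simp only [Finset.mem_biUnion, Finset.mem_powersetCard, Finset.mem_range]
    exact ⟨Z.card, by have := (Finset.mem_filter.1 hZ).2; omega, Finset.subset_univ _, rfl⟩
  refine (Finset.card_le_card hsub).trans (Finset.card_biUnion_le.trans ?_)
  rw [add_pow]
  refine Finset.sum_le_sum fun i hi => ?_
  rw [Finset.card_powersetCard, Finset.card_univ, Fintype.card_fin, one_pow, mul_one]
  refine (Nat.choose_le_pow n i).trans (Nat.le_mul_of_pos_right _ (Nat.choose_pos ?_))
  have := Finset.mem_range.1 hi
  omega

/-- The elements of `Z` that share their hash value with another element of `Z`. -/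
def collisions (h : ℕ → ℕ) (Z : Finset ℕ) : Finset ℕ :=
  Z.filter fun v => ∃ w ∈ Z, w ≠ v ∧ h w = h v

/-- By `hB`, more than `a` repetitions on a given set occur for at most a fraction `1 / B` of all
functions; by `hm`, the cover of length `m` reaches all sets of at most `s` labels. Labels up to `N`
live in `Fin (N + 1)`, hence the base `N + 2`. -/
theorem exists_hashes (N s q a B m : ℕ) (hs : 0 < s) (hq : 0 < q)
    (hB : 2 ^ s * B ≤ q ^ (a + 1)) (hm : (N + 2) ^ s < B ^ m) :
    ∃ l : List (ℕ → ℕ), l.length = m ∧ (∀ h ∈ l, ∀ v, h v < s * q) ∧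
      ∀ Z ⊆ Finset.Icc 1 N, Z.card ≤ s → ∃ h ∈ l, (collisions h Z).card ≤ 2 * a := by
  have hsq : 0 < s * q := Nat.mul_pos hs hq
  have : Nonempty (Fin (N + 1) → Fin (s * q)) := ⟨fun _ => ⟨0, hsq⟩⟩
  obtain ⟨l, hl, hl'⟩ := exists_list_cover
    (fun (Z : Finset (Fin (N + 1))) (h : Fin (N + 1) → Fin (s * q)) => a + 1 ≤ rep h Z) B m
    (Finset.univ.filter fun Z : Finset (Fin (N + 1)) => Z.card ≤ s) (by
      intro Z hZ
      have h1 := card_le_rep_mul hs hq Z (Finset.mem_filter.1 hZ).2 (a + 1)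
      have h2 : 0 < 2 ^ s := by positivity
      refine Nat.le_of_mul_le_mul_left (c := 2 ^ s) ?_ h2
      have : Fintype.card (Fin (N + 1) → Fin (s * q)) = (s * q) ^ Fintype.card (Fin (N + 1)) := by
        simp
      rw [this]
      refine le_trans ?_ h1
      rw [mul_left_comm]
      exact Nat.mul_le_mul_left _ hB)
    ((card_small_finsets_le _ _).trans_lt hm)
  let ext : (Fin (N + 1) → Fin (s * q)) → ℕ → ℕ := fun h v =>
    if hv : v < N + 1 then (h ⟨v, hv⟩ : ℕ) else 0
  refine ⟨l.map ext, by simp [hl], ?_, ?_⟩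
  · intro h hh v
    obtain ⟨h, -, rfl⟩ := List.mem_map.1 hh
    simp only [ext]
    split_ifs
    · exact (h _).2
    · exact hsq
  · intro Z hZ hZs
    have hlt : ∀ v ∈ Z, v < N + 1 := fun v hv => by
      have := Finset.mem_Icc.1 (hZ hv); omega
    have hmem : ∀ v : Fin (N + 1), v ∈ Z.attachFin hlt ↔ (v : ℕ) ∈ Z := fun v =>
      Finset.mem_attachFin hlt
    have hcard : (Z.attachFin hlt).card ≤ s := by rwa [Finset.card_attachFin]
    generalize Z.attachFin hlt = Z' at hmem hcard
    obtain ⟨h, hh, hr⟩ := hl' Z' (Finset.mem_filter.2 ⟨Finset.mem_univ _, hcard⟩)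
    refine ⟨ext h, List.mem_map_of_mem hh, ?_⟩
    have h2 : 2 * rep h Z' ≤ 2 * a := by omega
    have hlt' : ∀ v ∈ collisions (ext h) Z, v < N + 1 := fun v hv =>
      hlt v (Finset.mem_filter.1 hv).1
    refine le_trans (le_of_eq (Finset.card_attachFin _ hlt').symm)
      ((card_collision_le h (fun v hv => ?_) fun v hv => ?_).trans h2)
    · exact (hmem v).2 (Finset.mem_filter.1 ((Finset.mem_attachFin hlt').1 hv)).1
    · obtain ⟨hvZ, w, hw, hne, he⟩ := Finset.mem_filter.1 ((Finset.mem_attachFin hlt').1 hv)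
      have hw' := hlt w hw
      refine ⟨⟨w, hw'⟩, (Finset.mem_attachFin hlt').2
        (Finset.mem_filter.2 ⟨hw, v, hvZ, hne.symm, he.symm⟩),
        fun e => hne (congrArg Fin.val e), ?_⟩
      simp only [ext, v.2, hw', dif_pos] at he
      exact Fin.ext he

/-- The schedule given by a list of hash functions with values below `k`. -/
def hashSets (N k : ℕ) (l : List (ℕ → ℕ)) : List (Finset ℕ) :=
  l.flatMap fun h => (List.range k).map fun y => (Finset.Icc 1 N).filter fun v => h v = y

theorem hashSets_length (N k : ℕ) (l : List (ℕ → ℕ)) : (hashSets N k l).length = l.length * k := by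
  simp [hashSets, List.length_flatMap]

theorem mem_hashSets {N k : ℕ} {l : List (ℕ → ℕ)} {S : Finset ℕ} :
    S ∈ hashSets N k l ↔
      ∃ h ∈ l, ∃ y < k, S = (Finset.Icc 1 N).filter fun v => h v = y := by
  simp only [hashSets, List.mem_flatMap, List.mem_map, List.mem_range]
  constructor
  · rintro ⟨h, hh, y, hy, rfl⟩; exact ⟨h, hh, y, hy, rfl⟩
  · rintro ⟨h, hh, y, hy, rfl⟩; exact ⟨h, hh, y, hy, rfl⟩

theorem hashSets_isolates {N k : ℕ} {l : List (ℕ → ℕ)} (hk : ∀ h ∈ l, ∀ v, h v < k)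
    {Z : Finset ℕ} (hZ : Z ⊆ Finset.Icc 1 N) {h : ℕ → ℕ} (hh : h ∈ l) {z : ℕ} (hz : z ∈ Z)
    (hz' : z ∉ collisions h Z) : ∃ S ∈ hashSets N k l, S ∩ Z = {z} := by
  refine ⟨_, mem_hashSets.2 ⟨h, hh, h z, hk h hh z, rfl⟩, ?_⟩
  ext w
  simp only [Finset.mem_inter, Finset.mem_filter, Finset.mem_singleton]
  constructor
  · rintro ⟨⟨-, he⟩, hw⟩
    by_contra hne
    exact hz' (Finset.mem_filter.2 ⟨hz, w, hw, hne, he⟩)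
  · rintro rfl
    exact ⟨⟨hZ hz, rfl⟩, hz⟩

theorem hashSets_subset {N k : ℕ} {l : List (ℕ → ℕ)} : ∀ S ∈ hashSets N k l, S ⊆ Finset.Icc 1 N := by
  intro S hS
  obtain ⟨h, -, y, -, rfl⟩ := mem_hashSets.1 hS
  exact Finset.filter_subset _ _

/-- The case `a = 0`, in which some function of the list is injective on the given set. The range
has constant size, so the length is of the order of `log N`. -/
theorem exists_ssf (N c : ℕ) (hc : 0 < c) : ∃ F, IsSSF N c F ∧
    F.length = c * (Nat.log 2 (N + 2) + 1) * (c * 2 ^ (c + 1)) := by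
  obtain ⟨l, hl, hk, hZ⟩ := exists_hashes N c (2 ^ (c + 1)) 0 2 (c * (Nat.log 2 (N + 2) + 1)) hc
    (by positivity) (by rw [zero_add, pow_one, pow_succ]) (by
      rw [mul_comm, pow_mul]
      exact Nat.pow_lt_pow_left (Nat.lt_pow_succ_log_self (by norm_num) _) hc.ne')
  refine ⟨hashSets N _ l, ⟨hashSets_subset, ?_⟩, by rw [hashSets_length, hl]⟩
  intro Z hZN _ hZc z hz
  obtain ⟨h, hh, h0⟩ := hZ Z hZN hZc
  have : collisions h Z = ∅ := Finset.card_eq_zero.1 (by omega)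
  exact hashSets_isolates hk hZN hh hz (by simp [this])

/-- A list of hash functions such that on every set of at most `D * x` labels one of them has at most
`x / 8` collisions. -/
structure IsHashing (N D x k : ℕ) (l : List (ℕ → ℕ)) : Prop where
  lt : ∀ h ∈ l, ∀ v, h v < k
  few : ∀ Z ⊆ Finset.Icc 1 N, Z.card ≤ D * x → ∃ h ∈ l, (collisions h Z).card ≤ x / 8

/-- Since the failure probability is at most `2 ^ (-x)` while there are only about `N ^ (D * x)`
sets, the number of functions needed does not depend on `x`; the schedule has length of the order of
`x * log N`. The exponent `16 * (D + 1)` makes `q ^ (x / 16 + 1)` at least `2 ^ (D * x) * 2 ^ x`. -/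
theorem exists_isHashing (N D x : ℕ) (hD : 0 < D) (hx : 0 < x) :
    ∃ l, IsHashing N D x (D * x * 2 ^ (16 * (D + 1))) l ∧
      l.length = D * (Nat.log 2 (N + 2) + 1) := by
  obtain ⟨l, hl, hk, hZ⟩ := exists_hashes N (D * x) (2 ^ (16 * (D + 1))) (x / 16) (2 ^ x)
    (D * (Nat.log 2 (N + 2) + 1)) (Nat.mul_pos hD hx) (by positivity)
    (by
      rw [← pow_add, ← pow_mul]
      refine Nat.pow_le_pow_right (by norm_num) ?_
      have : x ≤ 16 * (x / 16 + 1) := by omega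
      nlinarith)
    (by
      rw [← pow_mul, show x * (D * (Nat.log 2 (N + 2) + 1)) =
        (Nat.log 2 (N + 2) + 1) * (D * x) by ring, pow_mul 2]
      exact Nat.pow_lt_pow_left (Nat.lt_pow_succ_log_self one_lt_two _)
        (Nat.mul_pos hD hx).ne')
  refine ⟨l, ⟨hk, fun Z h1 h2 => ?_⟩, hl⟩
  obtain ⟨h, hh, h0⟩ := hZ Z h1 h2
  exact ⟨h, hh, by omega⟩

theorem IsHashing.isSelector {N D x k : ℕ} {l : List (ℕ → ℕ)} (h : IsHashing N D x k l)
    (hD : 0 < D) {y : ℕ} (hy : y + x / 8 ≤ x) : IsSelector N x y (hashSets N k l) := by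
  refine ⟨hashSets_subset, fun A hA hAx => ?_⟩
  obtain ⟨g, hg, hc⟩ := h.few A hA (by rw [hAx]; exact Nat.le_mul_of_pos_left x hD)
  refine ⟨A \ collisions g A, Finset.sdiff_subset, ?_, fun b hb => ?_⟩
  · have := Finset.card_sdiff_add_card_eq_card (s := collisions g A) (t := A) (Finset.filter_subset _ _)
    omega
  · rw [Finset.mem_sdiff] at hb
    exact hashSets_isolates h.lt hA hg hb.1 hb.2

end Hash

end Sinr

namespace Sinr

/-! ## Elimination of contending neighbours -/

section Elimination

variable {V : Type*} {N : ℕ} (M : Model) (net : Network V N)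

open Classical in
/-- The participants left after a round in which those with labels in `S` transmit. -/
noncomputable def elimStep (A : Finset V) (S : Finset ℕ) : Finset V :=
  A.filter fun u => ¬∃ v, Receives M net (A.filter fun w => net.label w ∈ S) v u ∧
    net.label v < net.label u

/-- The participants left after the execution of a schedule. -/
noncomputable def elimRun (A : Finset V) (l : List (Finset ℕ)) : Finset V :=
  l.foldl (elimStep M net) A

open Classical in
theorem elimStep_subset (A : Finset V) (S : Finset ℕ) : elimStep M net A S ⊆ A :=
  Finset.filter_subset _ _

theorem elimRun_subset (A : Finset V) (l : List (Finset ℕ)) : elimRun M net A l ⊆ A := by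
  induction l generalizing A with
  | nil => exact Finset.Subset.refl _
  | cons S l ih => exact (ih _).trans (elimStep_subset M net A S)

open Classical in
theorem elimStep_nonempty {A : Finset V} (hA : A.Nonempty) (S : Finset ℕ) :
    (elimStep M net A S).Nonempty := by
  obtain ⟨v, hv, hmin⟩ := A.exists_min_image net.label hA
  refine ⟨v, Finset.mem_filter.2 ⟨hv, ?_⟩⟩
  rintro ⟨w, hw, hlt⟩
  exact absurd (hmin w (Finset.mem_filter.1 hw.1).1) (by omega)

theorem elimRun_nonempty {A : Finset V} (hA : A.Nonempty) (l : List (Finset ℕ)) :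
    (elimRun M net A l).Nonempty := by
  induction l generalizing A with
  | nil => exact hA
  | cons S l ih => exact ih (elimStep_nonempty M net hA S)

/-- Allows a single slot of the schedule to be examined: of the participants `A'` at that time it
only matters that they are among the initial ones and include all survivors. -/
theorem exists_elimStep_of_mem {l : List (Finset ℕ)} {S : Finset ℕ} (hS : S ∈ l) (A : Finset V) :
    ∃ A' ⊆ A, elimRun M net A l ⊆ elimStep M net A' S := by
  induction l generalizing A with
  | nil => cases hS
  | cons S' l ih =>
    rcases List.mem_cons.1 hS with rfl | h
    · exact ⟨A, Finset.Subset.refl _, elimRun_subset M net _ l⟩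
    · obtain ⟨A', h1, h2⟩ := ih h (elimStep M net A S')
      exact ⟨A', h1.trans (elimStep_subset M net A S'), h2⟩

open Classical in
/-- Few slots of a hash function suffer from interference that comes from far cells. -/
theorem card_noisy_le {near : Finset (Fin 2 → ℤ)} (hn : IsNear M near (M.ε * M.noise / 16))
    {x k : ℕ} {A : Finset V} (hA : Sparse M net A (2 * x)) {h : ℕ → ℕ} (hk : ∀ v, h v < k)
    (b : Fin 2 → ℤ) :
    ((Finset.range k).filter fun y => M.ε * M.noise <
      ∑ w ∈ (A.filter fun w => box M net w - b ∉ near).filter fun w => h (net.label w) = y,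
        gain M (box M net w - b)).card ≤ x / 8 := by
  set W := A.filter fun w => box M net w - b ∉ near with hW
  set Y := (Finset.range k).filter fun y => M.ε * M.noise <
    ∑ w ∈ W.filter fun w => h (net.label w) = y, gain M (box M net w - b) with hY
  have hpos : 0 < M.ε * M.noise := mul_pos M.ε_pos M.noise_pos
  have h1 : (Y.card : ℝ) * (M.ε * M.noise) ≤ ∑ w ∈ W, gain M (box M net w - b) := by
    rw [← Finset.sum_fiberwise_of_maps_to (s := W) (t := Finset.range k)
      (g := fun w => h (net.label w)) (fun w _ => Finset.mem_range.2 (hk _))]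
    calc (Y.card : ℝ) * (M.ε * M.noise) = ∑ y ∈ Y, M.ε * M.noise := by simp
      _ ≤ ∑ y ∈ Y, ∑ w ∈ W.filter fun w => h (net.label w) = y, gain M (box M net w - b) :=
          Finset.sum_le_sum fun y hy => (Finset.mem_filter.1 hy).2.le
      _ ≤ _ := Finset.sum_le_sum_of_subset_of_nonneg (Finset.filter_subset _ _)
          fun y _ _ => Finset.sum_nonneg fun w _ => gain_nonneg M _
  have h2 := sum_gain_le M net hn W (2 * x : ℕ) (by positivity) (fun b' => by
    refine Nat.cast_le.2 ((Finset.card_le_card ?_).trans (hA b'))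
    exact Finset.filter_subset_filter _ (Finset.filter_subset _ _)) b
    (fun w hw => (Finset.mem_filter.1 hw).2)
  -- Every station transmits in one slot of `h` only, so the far interference summed over all slots
  -- is at most `2 * x * (ε * noise / 16)`. Each noisy slot uses up more than `ε * noise` of it.
  have h3 : (Y.card : ℝ) * (M.ε * M.noise) ≤ ((x : ℝ) / 8) * (M.ε * M.noise) := by
    refine (h1.trans h2).trans (le_of_eq ?_)
    push_cast
    ring
  have h4 := le_of_mul_le_mul_right h3 hpos
  have h5 : (Y.card : ℝ) * 8 ≤ x := by linarith
  have h6 : Y.card * 8 ≤ x := by exact_mod_cast h5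
  omega

-- A station of a cell can only survive if it collides with a near station under a suitable hash
-- function, if its slot is noisy, or if it has the smallest label among the remaining stations of
-- the cell. The first two groups have at most `x / 8` members each.
open Classical in
theorem elim_phase {near : Finset (Fin 2 → ℤ)} (hn : IsNear M near (M.ε * M.noise / 16))
    {x k : ℕ} {l : List (ℕ → ℕ)} (hl : IsHashing N (2 * near.card) x k l) {A : Finset V}
    (hA : Sparse M net A (2 * x)) :
    Sparse M net (elimRun M net A (hashSets N k l)) (2 * (x / 8) + 1) := by
  intro b
  set R := elimRun M net A (hashSets N k l) with hR
  have hRA : R ⊆ A := elimRun_subset M net A _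
  set Q : Finset V := A.filter fun w => box M net w - b ∈ near with hQ
  have hZc : (Q.image net.label).card ≤ 2 * near.card * x := by
    refine Finset.card_image_le.trans ?_
    calc Q.card ≤ ∑ o ∈ near, (Q.filter fun w => box M net w - b = o).card :=
          (Finset.card_eq_sum_card_fiberwise fun w hw => (Finset.mem_filter.1 hw).2).le
      _ ≤ ∑ o ∈ near, 2 * x := by
          refine Finset.sum_le_sum fun o _ => le_trans (Finset.card_le_card ?_) (hA (o + b))
          intro w hw
          simp only [hQ, Finset.mem_filter] at hw ⊢
          exact ⟨hw.1.1, by rw [← hw.2]; simp⟩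
      _ = 2 * near.card * x := by simp; ring
  -- The good function depends on the cell `b`; all functions of the list are executed, so every
  -- cell finds its own.
  obtain ⟨h, hh, hcol⟩ := hl.few (Q.image net.label)
    (fun i hi => by obtain ⟨w, -, rfl⟩ := Finset.mem_image.1 hi; exact net.label_mem w) hZc
  set Z := Q.image net.label with hZ
  have hnoisy := card_noisy_le M net hn hA (hl.lt h hh) b
  set Y := (Finset.range k).filter fun y => M.ε * M.noise <
      ∑ w ∈ (A.filter fun w => box M net w - b ∉ near).filter fun w => h (net.label w) = y,
        gain M (box M net w - b) with hY
  set S := R.filter fun v => box M net v = b with hS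
  have hSQ : ∀ v ∈ S, v ∈ Q := fun v hv => by
    have hv' := Finset.mem_filter.1 hv
    exact Finset.mem_filter.2 ⟨hRA hv'.1, by rw [hv'.2, sub_self]; exact hn.nb_subset zero_mem_nb⟩
  have hcoll : ∀ v w, v ∈ Q → w ∈ Q → w ≠ v → h (net.label w) = h (net.label v) →
      net.label v ∈ collisions h Z := fun v w hv hw hne he =>
    Finset.mem_filter.2 ⟨Finset.mem_image_of_mem _ hv, net.label w, Finset.mem_image_of_mem _ hw,
      fun e => hne (net.label_injective e), he⟩
  set S1 := S.filter fun v => net.label v ∈ collisions h Z with hS1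
  set S2 := S.filter fun v => net.label v ∉ collisions h Z ∧ h (net.label v) ∈ Y with hS2
  set S3 := S.filter fun v => net.label v ∉ collisions h Z ∧ h (net.label v) ∉ Y with hS3
  have hc1 : S1.card ≤ x / 8 := by
    refine le_trans ?_ hcol
    rw [← Finset.card_image_of_injective S1 net.label_injective]
    refine Finset.card_le_card fun i hi => ?_
    obtain ⟨v, hv, rfl⟩ := Finset.mem_image.1 hi
    exact (Finset.mem_filter.1 hv).2
  have hc2 : S2.card ≤ x / 8 := by
    -- Stations without collisions occupy distinct slots, so there are at most as many of them in
    -- noisy slots as there are noisy slots.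
    refine le_trans (Finset.card_le_card_of_injOn (fun v => h (net.label v))
      (fun v hv => (Finset.mem_filter.1 hv).2.2) ?_) hnoisy
    intro v hv w hw he
    by_contra hne
    have hv' := Finset.mem_filter.1 hv
    have hw' := Finset.mem_filter.1 hw
    exact hv'.2.1 (hcoll v w (hSQ v hv'.1) (hSQ w hw'.1) (Ne.symm hne) he.symm)
  have hc3 : S3.card ≤ 1 := by
    have key : ∀ v ∈ S3, ∀ v' ∈ S3, ¬net.label v < net.label v' := by
      intro v hv v' hv' hlt
      obtain ⟨hvS, hv1, hv2⟩ := Finset.mem_filter.1 hv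
      obtain ⟨hvS', -, -⟩ := Finset.mem_filter.1 hv'
      have hbv : box M net v = b := (Finset.mem_filter.1 hvS).2
      have hbv' : box M net v' = b := (Finset.mem_filter.1 hvS').2
      have hne : v ≠ v' := fun e => by rw [e] at hlt; exact lt_irrefl _ hlt
      -- In the slot of the smaller label `v`, which is still participating, no other near station
      -- transmits and the far interference is tolerable. So `v'` hears `v` and becomes idle,
      -- contrary to its survival.
      obtain ⟨A', hA', hsub⟩ := exists_elimStep_of_mem M net
        (mem_hashSets.2 ⟨h, hh, h (net.label v), hl.lt h hh _, rfl⟩) A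
      have hmem := hsub (Finset.mem_filter.1 hvS').1
      have hmemv := hsub (Finset.mem_filter.1 hvS).1
      refine (Finset.mem_filter.1 hmem).2 ⟨v, ?_, hlt⟩
      set T := A'.filter fun w => net.label w ∈
        (Finset.Icc 1 N).filter fun i => h i = h (net.label v) with hT
      have hTmem : ∀ w, w ∈ T ↔ w ∈ A' ∧ h (net.label w) = h (net.label v) := fun w => by
        simp only [hT, Finset.mem_filter, net.label_mem w, true_and]
      have hTQ : ∀ w ∈ T, w ≠ v → w ∉ Q := fun w hw hwv hwQ =>
        hv1 (hcoll v w (hSQ v hvS) hwQ hwv ((hTmem w).1 hw).2)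
      refine receives_of_far M net hn.nb_subset ((hTmem v).2
        ⟨elimStep_subset M net _ _ hmemv, rfl⟩) (fun hu => hTQ v' hu hne.symm (hSQ v' hvS'))
        (adj_of_box_eq M net hne (hbv.trans hbv'.symm)) ?_ ?_
      · intro w hw hwv hwn
        rw [hbv'] at hwn
        exact hTQ w hw hwv (Finset.mem_filter.2 ⟨hA' ((hTmem w).1 hw).1, hwn⟩)
      · rw [hbv']
        have hy : ¬ M.ε * M.noise < ∑ w ∈ (A.filter fun w => box M net w - b ∉ near).filter
            fun w => h (net.label w) = h (net.label v), gain M (box M net w - b) := fun hlt' =>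
          hv2 (Finset.mem_filter.2 ⟨Finset.mem_range.2 (hl.lt h hh _), hlt'⟩)
        refine le_trans ?_ (not_lt.1 hy)
        refine Finset.sum_le_sum_of_subset_of_nonneg (fun w hw => ?_)
          fun w _ _ => gain_nonneg M _
        obtain ⟨hwv, hw⟩ := Finset.mem_erase.1 hw
        have hw' := (hTmem w).1 hw
        refine Finset.mem_filter.2 ⟨Finset.mem_filter.2 ⟨hA' hw'.1, fun hwn => ?_⟩, hw'.2⟩
        exact hTQ w hw hwv (Finset.mem_filter.2 ⟨hA' hw'.1, hwn⟩)
    refine Finset.card_le_one.2 fun v hv w hw => net.label_injective ?_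
    have h1 := key v hv w hw
    have h2 := key w hw v hv
    omega
  have hun : S ⊆ S1 ∪ (S2 ∪ S3) := by
    intro v hv
    by_cases c1 : net.label v ∈ collisions h Z
    · exact Finset.mem_union_left _ (Finset.mem_filter.2 ⟨hv, c1⟩)
    · by_cases c2 : h (net.label v) ∈ Y
      · exact Finset.mem_union_right _ (Finset.mem_union_left _ (Finset.mem_filter.2 ⟨hv, c1, c2⟩))
      · exact Finset.mem_union_right _ (Finset.mem_union_right _ (Finset.mem_filter.2 ⟨hv, c1, c2⟩))
  have := Finset.card_le_card hun
  have h4 := Finset.card_union_le S1 (S2 ∪ S3)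
  have h5 := Finset.card_union_le S2 S3
  omega

theorem Sparse.mono {X : Finset V} {a b : ℕ} (h : Sparse M net X a) (hab : a ≤ b) :
    Sparse M net X b := fun c => (h c).trans hab

/-- The size parameter of the selectors. -/
noncomputable def selSize (n i : ℕ) : ℕ := ⌈(2 / 3 : ℝ) ^ i * n⌉₊

/-- `S` is the schedule of suitable hash functions for sets of `2 * D * selSize n i` labels. -/
def IsHashFamily (N D n i : ℕ) (S : List (Finset ℕ)) : Prop :=
  ∃ k l, IsHashing N D (selSize n i) k l ∧ S = hashSets N k l

theorem selSize_pos {n i : ℕ} (hn : 0 < n) : 0 < selSize n i :=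
  Nat.ceil_pos.2 (by positivity)

/-- Consecutive parameters differ by a factor of about `3 / 2`, which is less than the `2` that
`elim_phase` allows. The maximum with `2` takes care of the rounding at the end. -/
theorem selSize_step {n i : ℕ} (hn : 0 < n) :
    max 2 (selSize n i) ≤ 2 * selSize n (i + 1) := by
  have h0 : 0 < selSize n (i + 1) := selSize_pos hn
  refine max_le (by omega) (Nat.ceil_le.2 ?_)
  have h1 : (2 / 3 : ℝ) ^ (i + 1) * n ≤ selSize n (i + 1) := Nat.le_ceil _
  push_cast
  rw [pow_succ] at h1
  have h2 : (0 : ℝ) ≤ (2 / 3 : ℝ) ^ i * n := by positivity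
  nlinarith

/-- The invariant after `j` phases is a bound of `max 2 (selSize n j)` per cell; the next phase,
with `x = selSize n (j + 1)`, leaves `2 * (x / 8) + 1`, which is at most `max 2 x`. -/
theorem elim_all {near : Finset (Fin 2 → ℤ)} (hn : IsNear M near (M.ε * M.noise / 16)) {n : ℕ}
    (hn0 : 0 < n) (sel : List (List (Finset ℕ))) :
    ∀ (j : ℕ) (A : Finset V), (∀ (i : ℕ) (h : i < sel.length),
      IsHashFamily N (2 * near.card) n (j + i + 1) sel[i]) →
      Sparse M net A (max 2 (selSize n j)) →
      Sparse M net (elimRun M net A sel.flatten) (max 2 (selSize n (j + sel.length))) := by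
  induction sel with
  | nil => intro j A _ hA; simpa [elimRun] using hA
  | cons S sel ih =>
    intro j A hsel hA
    have hS := hsel 0 (by simp)
    obtain ⟨k, l, hl, rfl : S = _⟩ := hS
    have h1 := elim_phase M net hn hl (hA.mono M net (selSize_step hn0))
    have h2 : Sparse M net (elimRun M net A (hashSets N k l)) (max 2 (selSize n (j + 1))) := by
      refine h1.mono M net ?_
      have h0 := selSize_pos (i := j + 1) hn0
      simp only [add_zero]
      omega
    have h3 := ih (j + 1) _ (fun i h => by
      have := hsel (i + 1) (by simpa using h)
      simpa [add_assoc, add_comm, add_left_comm] using this) h2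
    have e : elimRun M net A (hashSets N k l :: sel).flatten =
        elimRun M net (elimRun M net A (hashSets N k l)) sel.flatten := by
      simp [elimRun]
    rw [e]
    simpa [add_assoc, add_comm, add_left_comm] using h3

theorem selSize_last {n : ℕ} (hn : 0 < n) : selSize n ⌈Real.logb (3 / 2) n⌉₊ ≤ 1 := by
  refine Nat.ceil_le.2 ?_
  have hn' : (0 : ℝ) < n := by exact_mod_cast hn
  have h1 : (n : ℝ) ≤ (3 / 2 : ℝ) ^ ⌈Real.logb (3 / 2) n⌉₊ := by
    have := Real.rpow_le_rpow_of_exponent_le (x := 3 / 2) (by norm_num)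
      (Nat.le_ceil (Real.logb (3 / 2) n))
    rwa [Real.rpow_logb (by norm_num) (by norm_num) hn', Real.rpow_natCast] at this
  have h2 : (2 / 3 : ℝ) ^ ⌈Real.logb (3 / 2) n⌉₊ * (3 / 2 : ℝ) ^ ⌈Real.logb (3 / 2) n⌉₊ = 1 := by
    rw [← mul_pow]; norm_num
  calc _ ≤ (2 / 3 : ℝ) ^ ⌈Real.logb (3 / 2) n⌉₊ * (3 / 2 : ℝ) ^ ⌈Real.logb (3 / 2) n⌉₊ :=
        mul_le_mul_of_nonneg_left h1 (by positivity)
    _ = ((1 : ℕ) : ℝ) := by rw [h2]; simp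

theorem sparse_survivors {near : Finset (Fin 2 → ℤ)} (hn : IsNear M near (M.ε * M.noise / 16))
    [Fintype V] (hV : 0 < Fintype.card V) {sel : List (List (Finset ℕ))}
    (hlen : sel.length = ⌈Real.logb (3 / 2) (Fintype.card V)⌉₊)
    (hsel : ∀ (i : ℕ) (h : i < sel.length),
      IsHashFamily N (2 * near.card) (Fintype.card V) (i + 1) sel[i]) (A : Finset V) :
    Sparse M net (elimRun M net A sel.flatten) 2 := by
  -- At the beginning the bound holds because `selSize n 0 = n`.
  have h := elim_all M net hn hV sel 0 A (by simpa using hsel) (fun b => by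
    refine (Finset.card_le_univ _).trans (le_max_of_le_right ?_)
    simp [selSize])
  refine h.mono M net (max_le le_rfl ?_)
  rw [zero_add, hlen]
  exact (selSize_last hV).trans (by norm_num)

end Elimination

end Sinr

namespace Sinr

/-! ## Breadth-then-depth search trees -/

/-- Ordered forests; `cons v s t` consists of a tree with root `v`, whose subtrees form the forest
`s`, and of the trees of `t`. -/
inductive Forest (V : Type*)
  | nil
  | cons (v : V) (sub rest : Forest V)

namespace Forest

variable {V : Type*}

def roots : Forest V → List V
  | nil => []
  | cons v _ t => v :: roots t

def verts : Forest V → List V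
  | nil => []
  | cons v s t => v :: (verts s ++ verts t)

/-- The vertices that are not roots. -/
def lower : Forest V → List V
  | nil => []
  | cons _ s t => verts s ++ lower t

/-- The vertices with children. -/
def internals : Forest V → List V
  | nil => []
  | cons v s t => (match s with | nil => [] | cons _ _ _ => [v]) ++ (internals s ++ internals t)

theorem verts_perm (f : Forest V) : f.verts.Perm (f.roots ++ f.lower) := by
  induction f with
  | nil => exact List.Perm.refl _
  | cons v s t _ ih =>
    simp only [verts, roots, lower, List.cons_append]
    refine List.Perm.cons v ?_
    refine (List.Perm.append_left _ ih).trans ?_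
    rw [← List.append_assoc, ← List.append_assoc]
    exact List.Perm.append_right _ List.perm_append_comm

theorem mem_verts {f : Forest V} {x : V} : x ∈ f.verts ↔ x ∈ f.roots ∨ x ∈ f.lower := by
  rw [f.verts_perm.mem_iff, List.mem_append]

theorem roots_eq_nil {f : Forest V} : f.roots = [] ↔ f = nil := by
  cases f <;> simp [roots]

theorem internals_subset {f : Forest V} : ∀ x ∈ f.internals, x ∈ f.verts := by
  induction f with
  | nil => simp [internals]
  | cons v s t ih1 ih2 =>
    intro x hx
    simp only [internals, List.mem_append] at hx
    simp only [verts, List.mem_cons, List.mem_append]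
    rcases hx with hx | hx | hx
    · left
      cases s <;> simp at hx
      exact hx
    · exact .inr (.inl (ih1 x hx))
    · exact .inr (.inr (ih2 x hx))

end Forest

open Forest

section Search

variable {V : Type*} [DecidableEq V]

/-- The vertices in `M` being marked, the roots of the forest are visited one after another. A
visited vertex marks its unmarked neighbours, which become its children and are then visited. `M'`
are the marked vertices in the end. -/
inductive Search (nbrs : V → List V) : Finset V → Forest V → Finset V → Prop
  | nil (M) : Search nbrs M Forest.nil M
  | cons {M M₁ M₂ v s t} : roots s = (nbrs v).filter (fun z => decide (z ∉ M)) →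
      Search nbrs (M ∪ (roots s).toFinset) s M₁ → Search nbrs M₁ t M₂ →
      Search nbrs M (Forest.cons v s t) M₂

variable {nbrs : V → List V} {M M' : Finset V} {f : Forest V}

theorem Search.marked_eq (h : Search nbrs M f M') : M' = M ∪ (lower f).toFinset := by
  induction h with
  | nil M => simp [lower]
  | cons h1 _ _ ih1 ih2 =>
    rw [ih2, ih1]
    ext x
    simp only [lower, Finset.mem_union, List.mem_toFinset, List.mem_append, mem_verts]
    tauto

theorem Search.subset (h : Search nbrs M f M') : M ⊆ M' := by
  rw [h.marked_eq]; exact Finset.subset_union_left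

theorem Search.lower_notMem (h : Search nbrs M f M') : ∀ x ∈ lower f, x ∉ M := by
  induction h with
  | nil M => simp [lower]
  | cons h1 hs ht ih1 ih2 =>
    intro x hx hM
    simp only [lower, List.mem_append, mem_verts] at hx
    rcases hx with (hx | hx) | hx
    · rw [h1] at hx
      simp [hM] at hx
    · exact ih1 x hx (Finset.mem_union_left _ hM)
    · exact ih2 x hx (hs.subset (Finset.mem_union_left _ hM))

theorem Search.nodup (hn : ∀ v, (nbrs v).Nodup) (h : Search nbrs M f M') : (lower f).Nodup := by
  induction h with
  | nil M => simp [lower]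
  | @cons M M₁ M₂ v s t h1 hs ht ih1 ih2 =>
    have hv : (verts s).Nodup := by
      rw [s.verts_perm.nodup_iff, List.nodup_append']
      refine ⟨h1 ▸ (hn v).filter _, ih1, fun x hx hx' => ?_⟩
      exact hs.lower_notMem x hx' (Finset.mem_union_right _ (List.mem_toFinset.2 hx))
    rw [lower, List.nodup_append']
    refine ⟨hv, ih2, fun x hx hx' => ht.lower_notMem x hx' ?_⟩
    rw [hs.marked_eq]
    simp only [Finset.mem_union, List.mem_toFinset]
    rcases mem_verts.1 hx with h | h
    · exact .inl (.inr h)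
    · exact .inr h

theorem Search.verts_nodup (hn : ∀ v, (nbrs v).Nodup) (h : Search nbrs M f M')
    (hr : (roots f).Nodup) (hM : ∀ x ∈ roots f, x ∈ M) : (verts f).Nodup := by
  rw [f.verts_perm.nodup_iff, List.nodup_append']
  exact ⟨hr, h.nodup hn, fun x hx hx' => h.lower_notMem x hx' (hM x hx)⟩

theorem Search.nbrs_subset (h : Search nbrs M f M') : ∀ x ∈ verts f, ∀ y ∈ nbrs x, y ∈ M' := by
  induction h with
  | nil M => simp [verts]
  | @cons M M₁ M₂ v s t h1 hs ht ih1 ih2 =>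
    intro x hx y hy
    simp only [verts, List.mem_cons, List.mem_append] at hx
    rcases hx with rfl | hx | hx
    · refine ht.subset (hs.subset ?_)
      by_cases hyM : y ∈ M
      · exact Finset.mem_union_left _ hyM
      · refine Finset.mem_union_right _ (List.mem_toFinset.2 ?_)
        rw [h1]
        simp [hy, hyM]
    · exact ht.subset (ih1 x hx y hy)
    · exact ih2 x hx y hy

theorem Search.verts_subset (h : Search nbrs M f M') (hM : ∀ x ∈ roots f, x ∈ M) :
    ∀ x ∈ verts f, x ∈ M' := by
  intro x hx
  rw [h.marked_eq, Finset.mem_union, List.mem_toFinset]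
  exact (mem_verts.1 hx).imp_left (hM x)

/-- Induction on the number of unmarked vertices, and for a fixed number on the list of roots. A
root without unmarked neighbours shortens the list; any other root marks at least one vertex. -/
theorem exists_search [Fintype V] (nbrs : V → List V) : ∀ (k : ℕ) (M : Finset V),
    Mᶜ.card ≤ k → ∀ l : List V, ∃ f M', roots f = l ∧ Search nbrs M f M' := by
  intro k
  induction k using Nat.strong_induction_on with
  | _ k ih =>
    intro M hM l
    have step : ∀ v, ∃ s M₁, roots s = (nbrs v).filter (fun z => decide (z ∉ M)) ∧
        Search nbrs (M ∪ (roots s).toFinset) s M₁ ∧ (M₁ = M ∨ M₁ᶜ.card < k) := by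
      intro v
      set c := (nbrs v).filter (fun z => decide (z ∉ M)) with hc
      by_cases he : c = []
      · exact ⟨.nil, M, by rw [he]; rfl, by simpa [roots] using Search.nil M, .inl rfl⟩
      · obtain ⟨z, hz⟩ := List.exists_mem_of_ne_nil c he
        have hzM : z ∉ M := by simpa using (List.mem_filter.1 hz).2
        have hlt : (M ∪ c.toFinset)ᶜ.card < Mᶜ.card := by
          refine Finset.card_lt_card (Finset.compl_ssubset_compl.2 ?_)
          refine Finset.ssubset_iff_subset_ne.2 ⟨Finset.subset_union_left, fun e => hzM ?_⟩
          rw [e]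
          exact Finset.mem_union_right _ (List.mem_toFinset.2 hz)
        obtain ⟨s, M₁, hs, hs'⟩ := ih _ (hlt.trans_le hM) _ le_rfl c
        refine ⟨s, M₁, hs, by rwa [hs], .inr ?_⟩
        exact (Finset.card_le_card (Finset.compl_subset_compl.2 hs'.subset)).trans_lt
          (hlt.trans_le hM)
    induction l with
    | nil => exact ⟨.nil, M, rfl, .nil M⟩
    | cons v l ihl =>
      obtain ⟨s, M₁, h1, h2, h3⟩ := step v
      rcases h3 with rfl | h3
      · obtain ⟨t, M₂, h4, h5⟩ := ihl
        exact ⟨.cons v s t, M₂, by simp [roots, h4], .cons h1 h2 h5⟩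
      · obtain ⟨t, M₂, h4, h5⟩ := ih _ h3 M₁ le_rfl l
        exact ⟨.cons v s t, M₂, by simp [roots, h4], .cons h1 h2 h5⟩

/-! ### Internal nodes of a search tree in one cell -/

section Count

variable {ι : Type*} [DecidableEq ι] (cell : V → ι) (b : ι) (J : Finset ι)

open Classical in
/-- The cells in `J` with an unmarked vertex. -/
noncomputable def openCells (M : Finset V) : Finset ι := J.filter fun i => ∃ x, cell x = i ∧ x ∉ M

theorem card_openCells_le (M : Finset V) : (openCells cell J M).card ≤ J.card := by
  classical
  exact Finset.card_filter_le _ _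

theorem openCells_anti {M M' : Finset V} (h : M ⊆ M') :
    (openCells cell J M').card ≤ (openCells cell J M).card := by
  classical
  refine Finset.card_le_card fun i hi => ?_
  obtain ⟨hi, x, hx, hxM⟩ := Finset.mem_filter.1 hi
  exact Finset.mem_filter.2 ⟨hi, x, hx, fun h' => hxM (h h')⟩

/-- The number of vertices of the forest in the cell `b` that have children. -/
def innerCount (f : Forest V) : ℕ := ((internals f).filter fun v => decide (cell v = b)).length

theorem innerCount_eq_zero (h : ∀ x ∈ verts f, cell x ≠ b) : innerCount cell b f = 0 := by
  rw [innerCount, List.length_eq_zero_iff, List.filter_eq_nil_iff]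
  intro x hx
  simpa using h x (internals_subset x hx)

theorem innerCount_cons (v : V) (s t : Forest V) :
    innerCount cell b (.cons v s t) =
      (match s with | nil => 0 | cons _ _ _ => if cell v = b then 1 else 0) +
        (innerCount cell b s + innerCount cell b t) := by
  cases s <;> by_cases h : cell v = b <;> simp [innerCount, internals, h] <;> omega

variable {cell b J}

/-- The number of cells of `J` with unmarked vertices is a potential. When `b` is completely marked,
every internal node of `b` that is visited lowers it by at least one. -/
theorem Search.innerCount_le_of_marked (hcl : ∀ x y, x ≠ y → cell x = cell y → y ∈ nbrs x)
    (hJ : ∀ x y, cell x = b → y ∈ nbrs x → cell y ∈ J) (h : Search nbrs M f M')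
    (hb : ∀ x, cell x = b → x ∈ M) :
    innerCount cell b f + (openCells cell J M').card ≤ (openCells cell J M).card := by
  classical
  induction h with
  | nil M => simp [innerCount, internals]
  | @cons M M₁ M₂ v s t h1 hs ht _ ih2 =>
    have hMM₁ : M ⊆ M₁ := Finset.subset_union_left.trans hs.subset
    have i2 := ih2 fun x hx => hMM₁ (hb x hx)
    -- The vertices below `v` were unmarked when `v` was visited, so none of them belongs to `b`.
    have h0 : innerCount cell b s = 0 := innerCount_eq_zero cell b fun x hx hxb => by
      rcases mem_verts.1 hx with h | h
      · rw [h1] at h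
        simp [hb x hxb] at h
      · exact hs.lower_notMem x h (Finset.mem_union_left _ (hb x hxb))
    have anti := openCells_anti cell J hMM₁
    rw [innerCount_cons, h0]
    cases s with
    | nil => simp only; omega
    | cons z s' t' =>
      by_cases hv : cell v = b
      · have hz : z ∈ (nbrs v).filter (fun z => decide (z ∉ M)) := by rw [← h1]; simp [roots]
        have hz1 := (List.mem_filter.1 hz).1
        have hz2 : z ∉ M := by simpa using (List.mem_filter.1 hz).2
        -- The cell of the first child `z` contains the unmarked vertex `z` before the visit of `v`.
        -- The visit of `z` marks all its neighbours, in particular its whole cell.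
        have hlt : (openCells cell J M₁).card < (openCells cell J M).card := by
          refine Finset.card_lt_card (Finset.ssubset_iff_of_subset ?_ |>.2 ?_)
          · intro i hi
            obtain ⟨hi, x, hx, hxM⟩ := Finset.mem_filter.1 hi
            exact Finset.mem_filter.2 ⟨hi, x, hx, fun h' => hxM (hMM₁ h')⟩
          · refine ⟨cell z, Finset.mem_filter.2 ⟨hJ v z hv hz1, z, rfl, hz2⟩, fun hmem => ?_⟩
            obtain ⟨-, x, hx, hxM⟩ := Finset.mem_filter.1 hmem
            by_cases hxz : x = z
            · subst hxz
              exact hxM (hs.subset (by simp [roots]))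
            · exact hxM (hs.nbrs_subset z (by simp [verts]) x (hcl z x (Ne.symm hxz) hx.symm))
        simp only [hv, if_true]
        omega
      · simp only [hv, if_false]
        omega

/-- The additional `1` accounts for the first node of `b` that is visited: its visit marks the
clique `b`, and the previous bound applies to everything that follows. -/
theorem Search.innerCount_le (hcl : ∀ x y, x ≠ y → cell x = cell y → y ∈ nbrs x)
    (hJ : ∀ x y, cell x = b → y ∈ nbrs x → cell y ∈ J) (h : Search nbrs M f M')
    (hM : ∀ x ∈ roots f, x ∈ M) :
    innerCount cell b f + (openCells cell J M').card ≤ 1 + (openCells cell J M).card := by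
  induction h with
  | nil M => simp [innerCount, internals]
  | @cons M M₁ M₂ v s t h1 hs ht ih1 ih2 =>
    have hMM₁ : M ⊆ M₁ := Finset.subset_union_left.trans hs.subset
    have i1 := ih1 fun x hx => Finset.mem_union_right _ (List.mem_toFinset.2 hx)
    have i2 := ih2 fun x hx => hMM₁ (hM x (by simp [roots, hx]))
    have anti := openCells_anti cell J (Finset.subset_union_left (s₁ := M) (s₂ := s.roots.toFinset))
    rw [innerCount_cons]
    by_cases hv : cell v = b
    · have hb : ∀ x, cell x = b → x ∈ M ∪ s.roots.toFinset := by
        intro x hx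
        by_cases hxv : x = v
        · subst hxv
          exact Finset.mem_union_left _ (hM x (by simp [roots]))
        · by_cases hxM : x ∈ M
          · exact Finset.mem_union_left _ hxM
          · refine Finset.mem_union_right _ (List.mem_toFinset.2 ?_)
            rw [h1]
            simp [hxM, hcl v x (Ne.symm hxv) (hv.trans hx.symm)]
      have j1 := hs.innerCount_le_of_marked hcl hJ hb
      have j2 := ht.innerCount_le_of_marked hcl hJ fun x hx => hs.subset (hb x hx)
      cases s with
      | nil => simp only; omega
      | cons => simp only [hv, if_true]; omega
    · have e : (match s with | Forest.nil => 0 | Forest.cons _ _ _ => if cell v = b then 1 else 0) = 0 := by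
        cases s <;> simp [hv]
      rw [e]
      -- If the subtrees of `v` contain a node of `b`, its visit has marked `b` before the trees of
      -- `t` are visited, so the `1` is spent in `s`; otherwise it is still available for `t`.
      by_cases hex : ∃ x ∈ verts s, cell x = b
      · obtain ⟨x, hx, hxb⟩ := hex
        have hb : ∀ y, cell y = b → y ∈ M₁ := by
          intro y hy
          by_cases hxy : y = x
          · subst hxy
            exact hs.verts_subset (fun x hx => Finset.mem_union_right _ (List.mem_toFinset.2 hx))
              y hx
          · exact hs.nbrs_subset x hx y (hcl x y (Ne.symm hxy) (hxb.trans hy.symm))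
        have j2 := ht.innerCount_le_of_marked hcl hJ hb
        omega
      · push Not at hex
        rw [innerCount_eq_zero cell b hex]
        have := openCells_anti cell J hMM₁
        omega

end Count

end Search

end Sinr

namespace Sinr

/-! ## The undisturbed traversal of one token -/

open Trav

/-- `State.advance` on the level of records. -/
def advanceBtd (id : ℕ) (b : Btd) : Btd × Option Pass :=
  match b.unmarked, b.queue, b.parent with
  | z :: l, _, _ => ({ b with unmarked := l }, some ⟨.check, b.tok, id, z⟩)
  | [], z :: l, _ => ({ b with queue := l }, some ⟨.token, b.tok, id, z⟩)
  | [], [], some p => (b, some ⟨.token, b.tok, id, p⟩)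
  | [], [], none => (b, none)

/-- `State.handle` on the level of records. -/
def handleBtd (id : ℕ) (b : Btd) (m : Pass) : Btd × Option Pass :=
  if m.dst = id then
    match m.kind with
    | .token =>
      if b.visited then advanceBtd id b
      else advanceBtd id { b with visited := true, parent := some m.src }
    | .check => ({ b with marked := true }, some ⟨.reply, b.tok, id, m.src⟩)
    | .reply =>
      advanceBtd id { b with queue := b.queue ++ [m.src], children := b.children ++ [m.src] }
  else
    match m.kind with
    | .token => (b, none)
    | .check => (if b.visited then b else { b with unmarked := b.unmarked.erase m.dst }, none)
    | .reply => ({ b with unmarked := b.unmarked.erase m.src }, none)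

/-- The records of all nodes and the message to be sent by the holder of the token. -/
abbrev Cfg (V : Type*) := (V → Btd) × Option Pass

section Deliver

variable {V : Type*} (G : SimpleGraph V) (lab : V → ℕ)

open Classical in
/-- All neighbours of the holder receive its message. -/
noncomputable def deliver (σ : Cfg V) : Cfg V :=
  match σ.2 with
  | none => σ
  | some m =>
    (fun v => if ∃ u, lab u = m.src ∧ G.Adj u v then (handleBtd (lab v) (σ.1 v) m).1 else σ.1 v,
      if h : ∃ z, lab z = m.dst then (handleBtd m.dst (σ.1 h.choose) m).2 else none)

open Classical in
theorem deliver_eq {lab : V → ℕ} (hlab : Function.Injective lab) (r : V → Btd) (k : Kind) (τ : ℕ)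
    (h z : V) :
    deliver G lab (r, some ⟨k, τ, lab h, lab z⟩) =
      (fun v => if G.Adj h v then (handleBtd (lab v) (r v) ⟨k, τ, lab h, lab z⟩).1 else r v,
        (handleBtd (lab z) (r z) ⟨k, τ, lab h, lab z⟩).2) := by
  have hz : ∃ z', lab z' = lab z := ⟨z, rfl⟩
  have e1 : hz.choose = z := hlab hz.choose_spec
  have e2 : ∀ v, (∃ u, lab u = lab h ∧ G.Adj u v) ↔ G.Adj h v := fun v =>
    ⟨fun ⟨u, hu, ha⟩ => hlab hu ▸ ha, fun ha => ⟨h, rfl, ha⟩⟩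
  simp only [deliver, e2, dif_pos hz, e1]

variable [DecidableEq V]

/-- The record of a node that has not been visited yet, the nodes in `M` being marked. -/
def blank (lab : V → ℕ) (nbrs : V → List V) (τ : ℕ) (M : Finset V) (x : V) : Btd :=
  ⟨τ, false, decide (x ∈ M), none, ((nbrs x).filter fun z => decide (z ∉ M)).map lab, [], []⟩

/-- The configuration after the node `w` goes on. -/
def goOn (lab : V → ℕ) (r : V → Btd) (w : V) : Cfg V :=
  (Function.update r w (advanceBtd (lab w) (r w)).1, (advanceBtd (lab w) (r w)).2)

/-- In `r`, the nodes of the forest have completed their work; `p` is the parent of the roots. -/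
def Served (lab : V → ℕ) (τ : ℕ) (r : V → Btd) : V → Forest V → Prop
  | _, .nil => True
  | p, .cons v s t => r v = ⟨τ, true, true, some (lab p), [], [], s.roots.map lab⟩ ∧
      Served lab τ r v s ∧ Served lab τ r p t

theorem Served.congr {lab : V → ℕ} {τ : ℕ} {r r' : V → Btd} {p : V} {f : Forest V}
    (h : Served lab τ r p f) (he : ∀ x ∈ f.verts, r' x = r x) : Served lab τ r' p f := by
  induction f generalizing p with
  | nil => trivial
  | cons v s t ih1 ih2 =>
    obtain ⟨h1, h2, h3⟩ := h
    refine ⟨by rw [he v (by simp [Forest.verts]), h1], ih1 h2 fun x hx => he x ?_,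
      ih2 h3 fun x hx => he x ?_⟩ <;> simp [Forest.verts, hx]

/-- The number of messages sent in the visits of the trees of a forest. -/
def Forest.cost : Forest V → ℕ
  | .nil => 0
  | .cons _ s t => 1 + (2 * s.roots.length + (s.cost + (1 + t.cost)))

/-- Every vertex causes four messages: it is checked, it replies, it gets the token and it returns
it. The checks and replies of the roots are not part of `Forest.cost`. -/
theorem Forest.cost_le (f : Forest V) : f.cost + 2 * f.roots.length ≤ 4 * f.verts.length := by
  induction f with
  | nil => simp [Forest.cost, Forest.roots]
  | cons v s t ih1 ih2 =>
    simp only [Forest.cost, Forest.roots, Forest.verts, List.length_cons, List.length_append]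
    omega

variable {G lab} {nbrs : V → List V} {τ : ℕ}

theorem blank_erase (hlab : Function.Injective lab) (hn : ∀ v, (nbrs v).Nodup) (M : Finset V)
    (x z : V) : (blank lab nbrs τ M x).unmarked.erase (lab z) =
      (blank lab nbrs τ (insert z M) x).unmarked := by
  simp only [blank]
  rw [← List.map_erase hlab, List.Nodup.erase_eq_filter ((hn x).filter _), List.filter_filter]
  congr 1
  refine List.filter_congr fun y _ => ?_
  by_cases h1 : y = z <;> by_cases h2 : y ∈ M <;> simp [h1, h2]

theorem blank_unmarked_of_notMem {M : Finset V} {x z : V} (hz : z ∉ nbrs x) :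
    (blank lab nbrs τ M x).unmarked = (blank lab nbrs τ (insert z M) x).unmarked := by
  simp only [blank]
  congr 1
  refine List.filter_congr fun y hy => ?_
  have : y ≠ z := fun e => hz (e ▸ hy)
  simp [this]

/-- The holder `w` checks the node `z`. -/
theorem deliver_check (hlab : Function.Injective lab) (hn : ∀ v, (nbrs v).Nodup)
    (hadj : ∀ x y, y ∈ nbrs x ↔ G.Adj x y) {r : V → Btd} {w z : V} {M Un : Finset V} {a : Bool}
    {p : Option ℕ} {l q c : List ℕ} (hw : r w = ⟨τ, true, a, p, lab z :: l, q, c⟩) (hwU : w ∉ Un)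
    (hU : ∀ x ∈ Un, r x = blank lab nbrs τ M x)
    (hV : ∀ x, x ∉ Un → x ≠ w → (r x).visited = true ∧ (r x).unmarked = [])
    (hz : z ∈ Un) (hwz : G.Adj w z) (hlz : lab z ∉ l) :
    ∃ r', (deliver G lab)^[2] (goOn lab r w) = goOn lab r' w ∧
      r' w = ⟨τ, true, a, p, l, q ++ [lab z], c ++ [lab z]⟩ ∧
      (∀ x ∈ Un, r' x = blank lab nbrs τ (insert z M) x) ∧
      (∀ x, x ∉ Un → x ≠ w → r' x = r x) := by
  classical
  have hzw : z ≠ w := fun e => G.ne_of_adj hwz e.symm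
  have hlzw : lab z ≠ lab w := fun e => hzw (hlab e)
  set r₁ : V → Btd := Function.update r w ⟨τ, true, a, p, l, q, c⟩ with hr₁
  have hr₁w : r₁ w = ⟨τ, true, a, p, l, q, c⟩ := Function.update_self ..
  have hr₁x : ∀ x, x ≠ w → r₁ x = r x := fun x hx => Function.update_of_ne hx _ _
  have e0 : goOn lab r w = (r₁, some ⟨.check, τ, lab w, lab z⟩) := by
    simp [goOn, advanceBtd, hw, hr₁]
  set r₂ : V → Btd := fun v =>
    if G.Adj w v then (handleBtd (lab v) (r₁ v) ⟨.check, τ, lab w, lab z⟩).1 else r₁ v with hr₂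
  have e1 : deliver G lab (goOn lab r w) = (r₂, some ⟨.reply, τ, lab z, lab w⟩) := by
    rw [e0, deliver_eq G hlab]
    refine Prod.ext rfl ?_
    simp [handleBtd, hr₁x z hzw, hU z hz, blank]
  have hr₂w : r₂ w = ⟨τ, true, a, p, l, q, c⟩ := by simp [hr₂, hr₁w]
  have hr₂z : r₂ z = { blank lab nbrs τ M z with marked := true } := by
    simp [hr₂, hwz, handleBtd, hr₁x z hzw, hU z hz]
  have hr₂V : ∀ x, x ∉ Un → x ≠ w → r₂ x = r x := by
    intro x hx hxw
    have hxz : x ≠ z := fun e => hx (e ▸ hz)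
    have : lab z ≠ lab x := fun e => hxz (hlab e).symm
    simp [hr₂, handleBtd, this, hr₁x x hxw, (hV x hx hxw).1]
  -- After the check only the neighbours of `w` have removed `z`. The reply reaches the neighbours
  -- of `z`, and all others never had `z` on their lists. So after both messages the lists of all
  -- unvisited nodes are those of `blank` with `z` marked.
  have hr₂U : ∀ x ∈ Un, x ≠ z → r₂ x = if G.Adj w x then
      { blank lab nbrs τ M x with unmarked := (blank lab nbrs τ (insert z M) x).unmarked }
      else blank lab nbrs τ M x := by
    intro x hx hxz
    have hxw : x ≠ w := fun e => hwU (e ▸ hx)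
    have : lab z ≠ lab x := fun e => hxz (hlab e).symm
    have hvis : (blank lab nbrs τ M x).visited = false := rfl
    simp only [hr₂, handleBtd, this, hr₁x x hxw, hU x hx, if_false, hvis, blank_erase hlab hn,
      Bool.false_eq_true]
  set b : Btd := ⟨τ, true, a, p, l, q ++ [lab z], c ++ [lab z]⟩ with hb
  set r₃ : V → Btd := fun v =>
    if G.Adj z v then (handleBtd (lab v) (r₂ v) ⟨.reply, τ, lab z, lab w⟩).1 else r₂ v with hr₃
  have e2 : deliver G lab (deliver G lab (goOn lab r w)) = (r₃, (advanceBtd (lab w) b).2) := by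
    rw [e1, deliver_eq G hlab]
    refine Prod.ext rfl ?_
    simp [handleBtd, hr₂w, hb]
  -- In `r₃` the record of `w` has already been advanced; as `goOn` does this, the witness restores
  -- the record `b` from before.
  refine ⟨Function.update r₃ w b, ?_, Function.update_self .., ?_, ?_⟩
  · change deliver G lab (deliver G lab (goOn lab r w)) = _
    rw [e2]
    unfold goOn
    rw [Function.update_self, Function.update_idem]
    refine Prod.ext ?_ rfl
    refine (Function.update_eq_self_iff.2 ?_).symm
    simp [hr₃, hwz.symm, handleBtd, hr₂w, hb]
  · intro x hx
    have hxw : x ≠ w := fun e => hwU (e ▸ hx)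
    have hlw : lab w ≠ lab x := fun e => hxw (hlab e).symm
    rw [Function.update_of_ne hxw]
    by_cases hxz : x = z
    · subst hxz
      have : ¬G.Adj x x := G.irrefl
      simp only [hr₃, this, if_false, hr₂z]
      have hu := blank_unmarked_of_notMem (lab := lab) (τ := τ) (M := M)
        (show x ∉ nbrs x from fun h => this ((hadj x x).1 h))
      have : decide (x ∈ insert x M) = true := by simp
      unfold blank at hu ⊢
      simp only at hu
      rw [this, hu]
    · have hmk : (blank lab nbrs τ (insert z M) x) =
          { blank lab nbrs τ M x with unmarked := (blank lab nbrs τ (insert z M) x).unmarked } := by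
        simp [blank, hxz]
      by_cases hzx : G.Adj z x
      · simp only [hr₃, hzx, if_true, handleBtd, hlw, if_false, hr₂U x hx hxz]
        by_cases hwx : G.Adj w x
        · simp only [hwx, if_true]
          rw [blank_erase hlab hn, Finset.insert_idem, ← hmk]
        · simp only [hwx, if_false]
          rw [blank_erase hlab hn, ← hmk]
      · simp only [hr₃, hzx, if_false, hr₂U x hx hxz]
        by_cases hwx : G.Adj w x
        · simp only [hwx, if_true]
          rw [← hmk]
        · simp only [hwx, if_false]
          rw [hmk, ← blank_unmarked_of_notMem]
          exact fun h => hzx ((hadj x z).1 h).symm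
  · intro x hx hxw
    have hlw : lab w ≠ lab x := fun e => hxw (hlab e).symm
    rw [Function.update_of_ne hxw]
    simp only [hr₃, handleBtd, hlw, if_false, hr₂V x hx hxw, (hV x hx hxw).2, List.erase_nil]
    split_ifs
    · rw [← (hV x hx hxw).2]
    · rfl

/-- The holder `w` checks all nodes that are left on its list. -/
theorem deliver_checks (hlab : Function.Injective lab) (hn : ∀ v, (nbrs v).Nodup)
    (hadj : ∀ x y, y ∈ nbrs x ↔ G.Adj x y) {w : V} {Un : Finset V} {a : Bool}
    {p : Option ℕ} (hwU : w ∉ Un) (l : List V) : ∀ (r : V → Btd) (M : Finset V) (q c : List ℕ),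
    r w = ⟨τ, true, a, p, l.map lab, q, c⟩ →
    (∀ x ∈ Un, r x = blank lab nbrs τ M x) →
    (∀ x, x ∉ Un → x ≠ w → (r x).visited = true ∧ (r x).unmarked = []) →
    (∀ z ∈ l, z ∈ Un ∧ G.Adj w z) → l.Nodup →
    ∃ r', (deliver G lab)^[2 * l.length] (goOn lab r w) = goOn lab r' w ∧
      r' w = ⟨τ, true, a, p, [], q ++ l.map lab, c ++ l.map lab⟩ ∧
      (∀ x ∈ Un, r' x = blank lab nbrs τ (M ∪ l.toFinset) x) ∧
      (∀ x, x ∉ Un → x ≠ w → r' x = r x) := by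
  induction l with
  | nil =>
    intro r M q c hw hU hV _ _
    exact ⟨r, rfl, by simpa using hw, by simpa using hU, fun _ _ _ => rfl⟩
  | cons z l ih =>
    intro r M q c hw hU hV hz hnd
    rw [List.nodup_cons] at hnd
    obtain ⟨hz1, hz2⟩ := hz z List.mem_cons_self
    obtain ⟨r₁, e1, h1, h2, h3⟩ := deliver_check hlab hn hadj (l := l.map lab) hw hwU hU hV hz1 hz2
      (fun h => by
        obtain ⟨y, hy, e⟩ := List.mem_map.1 h
        exact hnd.1 (hlab e ▸ hy))
    obtain ⟨r₂, e2, h4, h5, h6⟩ := ih r₁ (insert z M) _ _ h1 h2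
      (fun x hx hxw => by rw [h3 x hx hxw]; exact hV x hx hxw)
      (fun y hy => hz y (List.mem_cons_of_mem _ hy)) hnd.2
    refine ⟨r₂, ?_, by simpa using h4, fun x hx => ?_, fun x hx hxw => ?_⟩
    · rw [List.length_cons, Nat.mul_add, Function.iterate_add_apply, mul_one, e1, e2]
    · rw [h5 x hx]
      congr 1
      ext y
      simp
    · rw [h6 x hx hxw, h3 x hx hxw]

/-- The holder `w` passes the token to its children in turn. -/
theorem deliver_serve (hlab : Function.Injective lab) (hn : ∀ v, (nbrs v).Nodup)
    (hadj : ∀ x y, y ∈ nbrs x ↔ G.Adj x y) {M M' : Finset V} {f : Forest V}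
    (hs : Search nbrs M f M') :
    ∀ (r : V → Btd) (w : V) (Un : Finset V) (a : Bool) (p : Option ℕ) (c : List ℕ),
    r w = ⟨τ, true, a, p, [], f.roots.map lab, c⟩ → w ∉ Un →
    (∀ x ∈ Un, r x = blank lab nbrs τ M x) →
    (∀ x, x ∉ Un → x ≠ w → (r x).visited = true ∧ (r x).unmarked = []) →
    (∀ z ∈ f.roots, G.Adj w z ∧ z ∈ Un ∧ z ∈ M) → f.roots.Nodup → (∀ x, x ∉ M → x ∈ Un) →
    ∃ r', (deliver G lab)^[f.cost] (goOn lab r w) = goOn lab r' w ∧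
      r' w = ⟨τ, true, a, p, [], [], c⟩ ∧
      (∀ x ∈ Un, x ∉ f.verts → r' x = blank lab nbrs τ M' x) ∧
      (∀ x, x ∉ Un → x ≠ w → r' x = r x) ∧ Served lab τ r' w f := by
  classical
  induction hs with
  | nil M =>
    intro r w Un a p c hw _ hU _ _ _ _
    exact ⟨r, rfl, hw, fun x hx _ => hU x hx, fun _ _ _ => rfl, trivial⟩
  | @cons M M₁ M₂ v s t hroots hs ht ihs iht =>
    intro r w Un a p c hw hwU hU hV hr hnd hMU
    simp only [Forest.roots, List.map_cons] at hw hr hnd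
    rw [List.nodup_cons] at hnd
    obtain ⟨hwv, hvU, hvM⟩ := hr v List.mem_cons_self
    have hvw : v ≠ w := fun e => G.ne_of_adj hwv e.symm
    have hlvw : lab v ≠ lab w := fun e => hvw (hlab e)
    -- the token is passed to `v`
    set rw₁ : Btd := ⟨τ, true, a, p, [], t.roots.map lab, c⟩ with hrw₁
    set bv : Btd := ⟨τ, true, true, some (lab w), (s.roots).map lab, [], []⟩ with hbv
    set r₁ : V → Btd := Function.update (Function.update r w rw₁) v bv with hr₁
    have hr₁v : r₁ v = bv := Function.update_self ..
    have hr₁w : r₁ w = rw₁ := by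
      rw [hr₁, Function.update_of_ne hvw.symm, Function.update_self]
    have hr₁x : ∀ x, x ≠ v → x ≠ w → r₁ x = r x := fun x h1 h2 => by
      rw [hr₁, Function.update_of_ne h1, Function.update_of_ne h2]
    have e1 : deliver G lab (goOn lab r w) = goOn lab r₁ v := by
      have e0 : goOn lab r w = (Function.update r w rw₁, some ⟨.token, τ, lab w, lab v⟩) := by
        simp [goOn, advanceBtd, hw, hrw₁]
      have ev : (Function.update r w rw₁) v = blank lab nbrs τ M v := by
        rw [Function.update_of_ne hvw, hU v hvU]
      have eb : handleBtd (lab v) (blank lab nbrs τ M v) ⟨.token, τ, lab w, lab v⟩ =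
          advanceBtd (lab v) bv := by
        simp [handleBtd, blank, hbv, hroots, hvM]
      rw [e0, deliver_eq G hlab]
      unfold goOn
      rw [ev, eb, hr₁v]
      refine Prod.ext (funext fun x => ?_) rfl
      simp only
      by_cases hxv : x = v
      · subst hxv
        rw [if_pos hwv, ev, eb, Function.update_self]
      · rw [Function.update_of_ne hxv]
        have hlx : lab v ≠ lab x := fun e => hxv (hlab e).symm
        have : (handleBtd (lab x) (Function.update r w rw₁ x) ⟨.token, τ, lab w, lab v⟩).1 =
            Function.update r w rw₁ x := by simp [handleBtd, hlx]
        rw [this, ite_self, hr₁, Function.update_of_ne hxv]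
    -- `v` checks its neighbours
    set Un₁ := Un.erase v with hUn₁
    have hvU₁ : v ∉ Un₁ := Finset.notMem_erase v Un
    have hsroot : ∀ z ∈ s.roots, z ∉ M ∧ G.Adj v z := fun z hz => by
      rw [hroots] at hz
      have := List.mem_filter.1 hz
      exact ⟨by simpa using this.2, (hadj v z).1 this.1⟩
    have hsU : ∀ z ∈ s.roots, z ∈ Un₁ ∧ G.Adj v z := fun z hz =>
      ⟨Finset.mem_erase.2 ⟨fun e => (hsroot z hz).1 (e ▸ hvM), hMU z (hsroot z hz).1⟩,
        (hsroot z hz).2⟩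
    have hsnd : s.roots.Nodup := hroots ▸ (hn v).filter _
    have hU₁w : ∀ x ∈ Un₁, x ≠ v ∧ x ≠ w ∧ x ∈ Un := fun x hx => by
      have := Finset.mem_erase.1 hx
      exact ⟨this.1, fun e => hwU (e ▸ this.2), this.2⟩
    have hV₁ : ∀ x, x ∉ Un₁ → x ≠ v → (r₁ x).visited = true ∧ (r₁ x).unmarked = [] := by
      intro x hx hxv
      by_cases hxw : x = w
      · rw [hxw, hr₁w]; exact ⟨rfl, rfl⟩
      · rw [hr₁x x hxv hxw]
        exact hV x (fun h => hx (Finset.mem_erase.2 ⟨hxv, h⟩)) hxw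
    obtain ⟨r₂, e2, h2v, h2U, h2V⟩ := deliver_checks hlab hn hadj hvU₁ s.roots r₁ M [] [] hr₁v
      (fun x hx => by
        obtain ⟨h1, h2, h3⟩ := hU₁w x hx
        rw [hr₁x x h1 h2, hU x h3]) hV₁ hsU hsnd
    -- the children of `v` are served
    simp only [List.nil_append] at h2v
    obtain ⟨r₃, e3, h3v, h3U, h3V, h3S⟩ := ihs r₂ v Un₁ true (some (lab w)) (s.roots.map lab) h2v
      hvU₁ h2U (fun x hx hxv => by rw [h2V x hx hxv]; exact hV₁ x hx hxv)
      (fun z hz => ⟨(hsU z hz).2, (hsU z hz).1,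
        Finset.mem_union_right _ (List.mem_toFinset.2 hz)⟩) hsnd
      (fun x hx => by
        rw [Finset.mem_union, not_or] at hx
        exact Finset.mem_erase.2 ⟨fun e => hx.1 (e ▸ hvM), hMU x hx.1⟩)
    have h3w : r₃ w = rw₁ := by
      have : w ∉ Un₁ := fun h => (hU₁w w h).2.1 rfl
      rw [h3V w this hvw.symm, h2V w this hvw.symm, hr₁w]
    -- the token returns
    have e4 : deliver G lab (goOn lab r₃ v) = goOn lab r₃ w := by
      have e0 : goOn lab r₃ v = (r₃, some ⟨.token, τ, lab v, lab w⟩) := by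
        simp only [goOn, advanceBtd, h3v]
        rw [← h3v, Function.update_eq_self]
      have eb : handleBtd (lab w) (r₃ w) ⟨.token, τ, lab v, lab w⟩ =
          advanceBtd (lab w) (r₃ w) := by
        simp [handleBtd, h3w, hrw₁]
      rw [e0, deliver_eq G hlab]
      unfold goOn
      refine Prod.ext (funext fun x => ?_) (by rw [eb])
      simp only
      by_cases hxw : x = w
      · subst hxw
        rw [if_pos hwv.symm, eb, Function.update_self]
      · rw [Function.update_of_ne hxw]
        have hlx : lab w ≠ lab x := fun e => hxw (hlab e).symm
        have : (handleBtd (lab x) (r₃ x) ⟨.token, τ, lab v, lab w⟩).1 = r₃ x := by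
          simp [handleBtd, hlx]
        rw [this, ite_self]
    -- the other children of `w` are served
    set Un₃ := Un₁.filter fun x => x ∉ s.verts with hUn₃
    have hMM₁ : M ⊆ M₁ := Finset.subset_union_left.trans hs.subset
    -- The vertices below `v` were unmarked when `v` got the token. The other children of `w` were
    -- marked by then, so they are not visited from `v` and are still unvisited.
    have hsvM : ∀ x ∈ s.verts, x ∉ M := fun x hx hxM => by
      rcases Forest.mem_verts.1 hx with h | h
      · exact (hsroot x h).1 hxM
      · exact hs.lower_notMem x h (Finset.mem_union_left _ hxM)
    have hsvM₁ : ∀ x ∈ s.verts, x ∈ M₁ :=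
      hs.verts_subset fun x hx => Finset.mem_union_right _ (List.mem_toFinset.2 hx)
    have hsvU : ∀ x ∈ s.verts, x ∈ Un₁ := fun x hx =>
      Finset.mem_erase.2 ⟨fun e => hsvM x hx (e ▸ hvM), hMU x (hsvM x hx)⟩
    have hvis : ∀ f : Forest V, ∀ q, Served lab τ r₃ q f →
        ∀ x ∈ f.verts, (r₃ x).visited = true ∧ (r₃ x).unmarked = [] := by
      intro f
      induction f with
      | nil => simp [Forest.verts]
      | cons y f1 f2 i1 i2 =>
        rintro q ⟨g1, g2, g3⟩ x hx
        simp only [Forest.verts, List.mem_cons, List.mem_append] at hx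
        rcases hx with rfl | hx | hx
        · rw [g1]; exact ⟨rfl, rfl⟩
        · exact i1 _ g2 x hx
        · exact i2 _ g3 x hx
    obtain ⟨r₄, e5, h5w, h5U, h5V, h5S⟩ := iht r₃ w Un₃ a p c h3w
      (fun h => (hU₁w w (Finset.mem_filter.1 h).1).2.1 rfl)
      (fun x hx => h3U x (Finset.mem_filter.1 hx).1 (Finset.mem_filter.1 hx).2)
      (fun x hx hxw => by
        by_cases hxs : x ∈ s.verts
        · exact hvis s v h3S x hxs
        · have hx1 : x ∉ Un₁ := fun h => hx (Finset.mem_filter.2 ⟨h, hxs⟩)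
          by_cases hxv : x = v
          · rw [hxv, h3v]; exact ⟨rfl, rfl⟩
          · rw [h3V x hx1 hxv, h2V x hx1 hxv]
            exact hV₁ x hx1 hxv)
      (fun z hz => by
        obtain ⟨g1, g2, g3⟩ := hr z (List.mem_cons_of_mem _ hz)
        refine ⟨g1, Finset.mem_filter.2 ⟨Finset.mem_erase.2 ⟨fun e => hnd.1 (e ▸ hz), g2⟩,
          fun h => hsvM z h g3⟩, hMM₁ g3⟩) hnd.2
      (fun x hx => Finset.mem_filter.2 ⟨Finset.mem_erase.2
        ⟨fun e => hx (hMM₁ (e ▸ hvM)), hMU x fun h => hx (hMM₁ h)⟩, fun h => hx (hsvM₁ x h)⟩)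
    have hU₃v : v ∉ Un₃ := fun h => hvU₁ (Finset.mem_filter.1 h).1
    refine ⟨r₄, ?_, h5w, ?_, ?_, ?_, ?_, h5S⟩
    · rw [Forest.cost, Nat.add_comm 1, Function.iterate_add_apply, Function.iterate_one, e1,
        Nat.add_comm (2 * _), Function.iterate_add_apply, e2, Nat.add_comm s.cost,
        Function.iterate_add_apply, e3, Nat.add_comm 1, Function.iterate_add_apply,
        Function.iterate_one, e4, e5]
    · intro x hx hxv
      simp only [Forest.verts, List.mem_cons, List.mem_append, not_or] at hxv
      exact h5U x (Finset.mem_filter.2 ⟨Finset.mem_erase.2 ⟨hxv.1, hx⟩, hxv.2.1⟩) hxv.2.2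
    · intro x hx hxw
      have hxv : x ≠ v := fun e => hx (e ▸ hvU)
      have hx1 : x ∉ Un₁ := fun h => hx (Finset.mem_of_mem_erase h)
      have hx3 : x ∉ Un₃ := fun h => hx1 (Finset.mem_filter.1 h).1
      rw [h5V x hx3 hxw, h3V x hx1 hxv, h2V x hx1 hxv, hr₁x x hxv hxw]
    · rw [h5V v hU₃v hvw, h3v]
    · refine h3S.congr fun x hx => h5V x (fun h => (Finset.mem_filter.1 h).2 hx) fun e => ?_
      exact hwU (e ▸ (hU₁w x (hsvU x hx)).2.2)

end Deliver

end Sinr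

namespace Sinr

open Trav

/-! ### The complete traversal of one token; its messages go along edges -/

section Traversal

variable {V : Type*} [DecidableEq V] {G : SimpleGraph V} {lab : V → ℕ} {nbrs : V → List V} {τ : ℕ}

/-- The edges from parents to children are edges of the graph; `p` is the parent of the roots. -/
def Linked (G : SimpleGraph V) : V → Forest V → Prop
  | _, .nil => True
  | p, .cons v s t => G.Adj p v ∧ Linked G v s ∧ Linked G p t

theorem Search.linked (hadj : ∀ x y, y ∈ nbrs x ↔ G.Adj x y) {M M' : Finset V} {f : Forest V}
    (h : Search nbrs M f M') : ∀ p, (∀ z ∈ f.roots, G.Adj p z) → Linked G p f := by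
  induction h with
  | nil M => exact fun _ _ => trivial
  | @cons M M₁ M₂ v s t h1 hs ht ih1 ih2 =>
    intro p hp
    refine ⟨hp v (by simp [Forest.roots]), ih1 v fun z hz => ?_,
      ih2 p fun z hz => hp z (by simp [Forest.roots, hz])⟩
    rw [h1] at hz
    exact (hadj v z).1 (List.mem_filter.1 hz).1

/-- The configuration in which the root `ρ` has just issued its token. -/
def startCfg (lab : V → ℕ) (nbrs : V → List V) (τ : ℕ) (ρ : V) : Cfg V :=
  goOn lab (Function.update (blank lab nbrs τ {ρ}) ρ
    ⟨τ, true, false, none, (blank lab nbrs τ {ρ} ρ).unmarked, [], []⟩) ρ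

/-- The undisturbed traversal visits all nodes and constructs a spanning tree in which each cell
contains only a bounded number of internal nodes. -/
theorem exists_traversal [Fintype V] (hlab : Function.Injective lab) (hn : ∀ v, (nbrs v).Nodup)
    (hadj : ∀ x y, y ∈ nbrs x ↔ G.Adj x y) (hG : G.Connected) (τ : ℕ) (ρ : V) :
    ∃ (r : V → Btd) (f : Forest V) (k : ℕ), k ≤ 4 * Fintype.card V ∧
      (deliver G lab)^[k] (startCfg lab nbrs τ ρ) = (r, none) ∧
      r ρ = ⟨τ, true, false, none, [], [], f.roots.map lab⟩ ∧ Served lab τ r ρ f ∧ Linked G ρ f ∧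
      (∀ x, x ∈ f.verts ↔ x ≠ ρ) ∧ f.verts.Nodup ∧
      ∀ {ι : Type} [DecidableEq ι] (cell : V → ι) (b : ι) (J : Finset ι),
        (∀ x y, x ≠ y → cell x = cell y → y ∈ nbrs x) →
        (∀ x y, cell x = b → y ∈ nbrs x → cell y ∈ J) →
        innerCount cell b (.cons ρ f .nil) ≤ 1 + J.card := by
  classical
  -- The tree comes from the abstract search, and the records are then shown to follow it. The root
  -- counts as marked from the start, as no list contains it.
  obtain ⟨f', M', hroots, hs⟩ := exists_search nbrs _ {ρ} le_rfl [ρ]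
  cases hs with
  | nil => simp [Forest.roots] at hroots
  | @cons _ M₁ _ v f t h1 hf ht =>
  simp only [Forest.roots, List.cons.injEq, Forest.roots_eq_nil] at hroots
  obtain ⟨rfl, rfl⟩ := hroots
  cases ht
  have hfull : Search nbrs {v} (.cons v f .nil) M' := .cons h1 hf (.nil _)
  have hroot : ∀ x ∈ (Forest.cons v f .nil).roots, x ∈ ({v} : Finset V) := by simp [Forest.roots]
  have hnd : (v :: f.verts).Nodup := by
    simpa [Forest.verts] using hfull.verts_nodup hn (by simp [Forest.roots]) hroot
  -- The visited vertices are closed under adjacency, because all neighbours of a visited vertex are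
  -- marked in the end and the marked vertices are the root and the vertices below it.
  have hall : ∀ x, x ∈ v :: f.verts := by
    have hcl : ∀ x ∈ v :: f.verts, ∀ y, G.Adj x y → y ∈ v :: f.verts := by
      intro x hx y hxy
      have := hfull.nbrs_subset x (by simpa [Forest.verts] using hx) y ((hadj x y).2 hxy)
      rw [hfull.marked_eq] at this
      simpa [Forest.lower] using this
    intro x
    obtain ⟨p⟩ := hG.preconnected v x
    have : ∀ (a b : V) (_ : G.Walk a b), a ∈ v :: f.verts → b ∈ v :: f.verts := by
      intro a b p
      induction p with
      | nil => exact id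
      | cons h _ ih => exact fun ha => ih (hcl _ ha _ h)
    exact this v x p List.mem_cons_self
  rw [List.nodup_cons] at hnd
  have hverts : ∀ x, x ∈ f.verts ↔ x ≠ v := fun x => by
    constructor
    · rintro hx rfl; exact hnd.1 hx
    · intro hx
      rcases List.mem_cons.1 (hall x) with h | h
      · exact absurd h hx
      · exact h
  have hfr : ∀ z ∈ f.roots, z ≠ v ∧ G.Adj v z := fun z hz => by
    rw [h1] at hz
    have := List.mem_filter.1 hz
    exact ⟨by simpa using this.2, (hadj v z).1 this.1⟩
  have hfnd : f.roots.Nodup := h1 ▸ (hn v).filter _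
  set r₀ : V → Btd := Function.update (blank lab nbrs τ {v}) v
    ⟨τ, true, false, none, (blank lab nbrs τ {v} v).unmarked, [], []⟩ with hr₀
  set Un : Finset V := Finset.univ.erase v with hUn
  have hvU : v ∉ Un := Finset.notMem_erase _ _
  have hU : ∀ x, x ∈ Un ↔ x ≠ v := by simp [hUn]
  obtain ⟨r₁, e1, h1v, h1U, -⟩ := deliver_checks (τ := τ) (a := false) (p := none) hlab hn hadj hvU
    f.roots r₀ {v} [] [] (by rw [hr₀, Function.update_self, h1]; simp [blank])
    (fun x hx => by rw [hr₀, Function.update_of_ne ((hU x).1 hx)])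
    (fun x hx hxv => absurd ((hU x).2 hxv) hx)
    (fun z hz => ⟨(hU z).2 (hfr z hz).1, (hfr z hz).2⟩) hfnd
  simp only [List.nil_append] at h1v
  obtain ⟨r₂, e2, h2v, -, -, h2S⟩ := deliver_serve hlab hn hadj hf r₁ v Un false none _ h1v hvU h1U
    (fun x hx hxv => absurd ((hU x).2 hxv) hx)
    (fun z hz => ⟨(hfr z hz).2, (hU z).2 (hfr z hz).1,
      Finset.mem_union_right _ (List.mem_toFinset.2 hz)⟩) hfnd
    (fun x hx => (hU x).2 fun e => hx (by simp [e]))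
  refine ⟨r₂, f, f.cost + 2 * f.roots.length, ?_, ?_, h2v, h2S,
    hf.linked hadj v fun z hz => (hfr z hz).2, hverts, hnd.2, ?_⟩
  · refine f.cost_le.trans (Nat.mul_le_mul_left 4 ?_)
    exact List.Nodup.length_le_card hnd.2
  · change (deliver G lab)^[f.cost + 2 * f.roots.length] (goOn lab r₀ v) = _
    rw [Function.iterate_add_apply, e1, e2]
    simp only [goOn, advanceBtd, h2v]
    rw [← h2v, Function.update_eq_self]
  · intro ι _ cell b J hcl hJ
    have h := hfull.innerCount_le hcl hJ hroot
    have := card_openCells_le cell J {v}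
    omega

/-- All labels in the record of `x` belong to neighbours. -/
structure BtdWf (G : SimpleGraph V) (lab : V → ℕ) (τ : ℕ) (x : V) (b : Btd) : Prop where
  tok : b.tok = τ
  unmarked : ∀ i ∈ b.unmarked, ∃ y, G.Adj x y ∧ i = lab y
  queue : ∀ i ∈ b.queue, ∃ y, G.Adj x y ∧ i = lab y
  parent : ∀ i, b.parent = some i → ∃ y, G.Adj x y ∧ i = lab y

structure CfgWf (G : SimpleGraph V) (lab : V → ℕ) (τ : ℕ) (σ : Cfg V) : Prop where
  btd : ∀ x, BtdWf G lab τ x (σ.1 x)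
  msg : ∀ m, σ.2 = some m → ∃ k h z, G.Adj h z ∧ m = ⟨k, τ, lab h, lab z⟩

theorem BtdWf.advance {x : V} {b : Btd} (h : BtdWf G lab τ x b) :
    BtdWf G lab τ x (advanceBtd (lab x) b).1 ∧
      ∀ m, (advanceBtd (lab x) b).2 = some m → ∃ k z, G.Adj x z ∧ m = ⟨k, τ, lab x, lab z⟩ := by
  obtain ⟨tok, vis, mk, par, un, q, c⟩ := b
  obtain ⟨rfl, h2, h3, h4⟩ := h
  simp only at h2 h3 h4
  unfold advanceBtd
  cases un with
  | cons z l =>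
    refine ⟨⟨rfl, fun i hi => h2 i (List.mem_cons_of_mem _ hi), h3, h4⟩, fun m hm => ?_⟩
    obtain ⟨y, hy, rfl⟩ := h2 z List.mem_cons_self
    exact ⟨_, y, hy, (Option.some.inj hm).symm⟩
  | nil =>
    cases q with
    | cons z l =>
      refine ⟨⟨rfl, h2, fun i hi => h3 i (List.mem_cons_of_mem _ hi), h4⟩, fun m hm => ?_⟩
      obtain ⟨y, hy, rfl⟩ := h3 z List.mem_cons_self
      exact ⟨_, y, hy, (Option.some.inj hm).symm⟩
    | nil =>
      cases par with
      | none => exact ⟨⟨rfl, h2, h3, h4⟩, fun m hm => by cases hm⟩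
      | some p =>
        refine ⟨⟨rfl, h2, h3, h4⟩, fun m hm => ?_⟩
        obtain ⟨y, hy, rfl⟩ := h4 p rfl
        exact ⟨_, y, hy, (Option.some.inj hm).symm⟩

theorem BtdWf.handle {x u : V} {b : Btd} (h : BtdWf G lab τ x b) (hux : G.Adj u x) (k : Kind)
    (d : ℕ) :
    BtdWf G lab τ x (handleBtd (lab x) b ⟨k, τ, lab u, d⟩).1 ∧
      ∀ m, (handleBtd (lab x) b ⟨k, τ, lab u, d⟩).2 = some m →
        ∃ k z, G.Adj x z ∧ m = ⟨k, τ, lab x, lab z⟩ := by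
  have hsrc : ∃ y, G.Adj x y ∧ lab u = lab y := ⟨u, hux.symm, rfl⟩
  unfold handleBtd
  by_cases hd : d = lab x
  · simp only [hd, if_true]
    cases k with
    | token =>
      simp only
      split_ifs
      · exact h.advance
      · exact BtdWf.advance ⟨h.tok, h.unmarked, h.queue, fun i hi => Option.some.inj hi ▸ hsrc⟩
    | check =>
      refine ⟨⟨h.tok, h.unmarked, h.queue, h.parent⟩, fun m hm => ?_⟩
      refine ⟨.reply, u, hux.symm, (Option.some.inj hm).symm.trans ?_⟩
      rw [h.tok]
    | reply =>
      refine BtdWf.advance ⟨h.tok, h.unmarked, fun i hi => ?_, h.parent⟩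
      rcases List.mem_append.1 hi with hi | hi
      · exact h.queue i hi
      · rw [List.mem_singleton.1 hi]; exact hsrc
  · simp only [hd, if_false]
    cases k with
    | token => exact ⟨h, fun m hm => by cases hm⟩
    | check =>
      refine ⟨?_, fun m hm => by cases hm⟩
      simp only
      split_ifs
      · exact h
      · exact ⟨h.tok, fun i hi => h.unmarked i (List.mem_of_mem_erase hi), h.queue, h.parent⟩
    | reply =>
      exact ⟨⟨h.tok, fun i hi => h.unmarked i (List.mem_of_mem_erase hi), h.queue, h.parent⟩,
        fun m hm => by cases hm⟩

theorem CfgWf.deliver (hlab : Function.Injective lab) {σ : Cfg V} (h : CfgWf G lab τ σ) :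
    CfgWf G lab τ (deliver G lab σ) := by
  classical
  obtain ⟨r, o⟩ := σ
  cases o with
  | none => exact h
  | some m =>
    obtain ⟨k, u, z, huz, rfl⟩ := h.msg m rfl
    rw [deliver_eq G hlab]
    refine ⟨fun x => ?_, fun m hm => ?_⟩
    · by_cases hux : G.Adj u x
      · simp only [hux, if_true]
        exact ((h.btd x).handle hux k _).1
      · simp only [hux, if_false]
        exact h.btd x
    · obtain ⟨k', z', h1, h2⟩ := ((h.btd z).handle huz k _).2 m hm
      exact ⟨k', z, z', h1, h2⟩

theorem CfgWf.start (hadj : ∀ x y, y ∈ nbrs x ↔ G.Adj x y) (ρ : V) :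
    CfgWf G lab τ (startCfg lab nbrs τ ρ) := by
  have hb : ∀ x, ∀ i ∈ (blank lab nbrs τ {ρ} x).unmarked, ∃ y, G.Adj x y ∧ i = lab y := by
    intro x i hi
    obtain ⟨y, hy, rfl⟩ := List.mem_map.1 hi
    exact ⟨y, (hadj x y).1 (List.mem_filter.1 hy).1, rfl⟩
  have hρ : BtdWf G lab τ ρ ⟨τ, true, false, none, (blank lab nbrs τ {ρ} ρ).unmarked, [], []⟩ :=
    ⟨rfl, hb ρ, by simp, by simp⟩
  unfold startCfg goOn
  rw [Function.update_self, Function.update_idem]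
  refine ⟨fun x => ?_, fun m hm => ?_⟩
  · by_cases hx : x = ρ
    · subst hx
      simp only [Function.update_self]
      exact hρ.advance.1
    · simp only [Function.update_of_ne hx]
      exact ⟨rfl, hb x, by simp [blank], by simp [blank]⟩
  · obtain ⟨k, z, h1, h2⟩ := hρ.advance.2 m hm
    exact ⟨k, ρ, z, h1, h2⟩

theorem handleBtd_visited {id : ℕ} {b : Btd} {m : Pass} (h : m.dst ≠ id) :
    (handleBtd id b m).1.visited = b.visited := by
  unfold handleBtd
  rw [if_neg h]
  cases m.kind
  · rfl
  · simp only; split_ifs <;> rfl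
  · rfl

/-- Only the destination of a message becomes visited. -/
theorem dst_of_visited {σ : Cfg V} {v : V} (h0 : (σ.1 v).visited = false)
    (h1 : ((deliver G lab σ).1 v).visited = true) : ∃ m, σ.2 = some m ∧ m.dst = lab v := by
  classical
  obtain ⟨r, o⟩ := σ
  cases o with
  | none => rw [deliver] at h1; simp only at h0 h1; rw [h0] at h1; cases h1
  | some m =>
    refine ⟨m, rfl, by_contra fun hne => ?_⟩
    simp only [deliver] at h0 h1
    split_ifs at h1 with hc
    · rw [handleBtd_visited hne, h0] at h1; cases h1
    · rw [h0] at h1; cases h1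

end Traversal

/-! ## Eulerian walks -/

section Walks

variable {V : Type*} [DecidableEq V] (G : SimpleGraph V) (lab : V → ℕ) (par : V → Option V)
  (ch : V → List V) (n : ℕ) (cnt sync : Bool)

/-- The vertices in the forest, whose roots have parent `p`, have these parents and children. -/
def TreeShape : V → Forest V → Prop
  | _, .nil => True
  | p, .cons v s t => par v = some p ∧ ch v = s.roots ∧ G.Adj p v ∧ TreeShape v s ∧ TreeShape p t

/-- The tours after `h` has sent the walk token `w` to `z`. -/
def moved (h z : V) (w : Walk) (θ : V → Tour) (x : V) : Tour :=
  let T := ((θ x).depart ((par x).map lab)).tick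
  if x = z then
    T.arrive ((par x).map lab) ((ch x).map lab) cnt w.sync (lab h) w.num w.step
  else T

/-- A move of the walk: `h` sends the token. -/
structure Move (h : V) (θ θ' : V → Tour) : Prop where
  intro ::
  exists_move : ∃ z w, G.Adj h z ∧ (θ h).token = some w ∧ w.sync = sync ∧ w.num ≤ n ∧
    w.step < 2 * n ∧ (θ h).pending.head?.or ((par h).map lab) = some (lab z) ∧
    θ' = moved lab par ch cnt h z w θ
  others : ∀ x, x ≠ h → (θ x).token = none
  timer : ∀ x, (θ x).timer ≠ some 0
  first : sync = false → ∀ x, (θ x).timer = none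

/-- A sequence of moves by the nodes in the list. -/
inductive MovePath : List V → (V → Tour) → (V → Tour) → Prop
  | nil (θ) : MovePath [] θ θ
  | cons {h hs θ θ' θ''} : Move G lab par ch n cnt sync h θ θ' → MovePath hs θ' θ'' →
      MovePath (h :: hs) θ θ''

variable {G lab par ch n cnt sync}

theorem MovePath.append {a b : List V} {θ θ' θ'' : V → Tour}
    (h : MovePath G lab par ch n cnt sync a θ θ') (h' : MovePath G lab par ch n cnt sync b θ' θ'') :
    MovePath G lab par ch n cnt sync (a ++ b) θ θ'' := by
  induction h with
  | nil => exact h'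
  | cons h1 _ ih => exact .cons h1 (ih h')

theorem Tour.turn_eq {parent : Option ℕ} {children : List ℕ} {T : Tour}
    (h : T.token = none ∨ T.pending.head?.or parent ≠ none) : T.turn parent children = T := by
  obtain ⟨tok, pend, tm, sz⟩ := T
  cases tok <;> cases pend <;> cases parent <;> simp_all [Tour.turn]

theorem Move.turn_eq {h : V} {θ θ' : V → Tour} (hm : Move G lab par ch n cnt sync h θ θ') (x : V) :
    (θ x).turn ((par x).map lab) ((ch x).map lab) = θ x := by
  refine Tour.turn_eq ?_
  by_cases hx : x = h
  · subst hx
    obtain ⟨z, w, -, -, -, -, -, hp, -⟩ := hm.exists_move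
    exact .inr (by rw [hp]; simp)
  · exact .inl (hm.others x hx)

/-- The timers after `step` moves. -/
def TimersOk (n : ℕ) (sync : Bool) (step : ℕ) (θ : V → Tour) : Prop :=
  (sync = false → ∀ x, (θ x).timer = none) ∧
  (sync = true → ∀ x a, (θ x).timer = some a → a = 2 * n - 2 - step ∧ (θ x).size = n)

theorem Tour.depart_of_none {parent : Option ℕ} {T : Tour} (h : T.token = none) :
    T.depart parent = T := by
  simp [Tour.depart, h]

theorem Tour.depart_of_some {parent : Option ℕ} {T : Tour} {w : Walk} {z : ℕ}
    (h : T.token = some w) (hz : T.pending.head?.or parent = some z) :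
    T.depart parent = { T with token := none, pending := T.pending.tail } := by
  simp [Tour.depart, h, hz]

theorem Tour.depart_timer (parent : Option ℕ) (T : Tour) : (T.depart parent).timer = T.timer := by
  unfold Tour.depart; split_ifs <;> rfl

theorem Tour.depart_size (parent : Option ℕ) (T : Tour) : (T.depart parent).size = T.size := by
  unfold Tour.depart; split_ifs <;> rfl

section MovedFacts

variable {h z : V} {w : Walk} {θ : V → Tour}

theorem moved_of_ne {x : V} (hx : x ≠ z) :
    moved lab par ch cnt h z w θ x = ((θ x).depart ((par x).map lab)).tick := by
  simp [moved, hx]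

theorem moved_self : moved lab par ch cnt h z w θ z =
    ((θ z).depart ((par z).map lab)).tick.arrive ((par z).map lab) ((ch z).map lab) cnt w.sync
      (lab h) w.num w.step := by
  simp [moved]

/-- A timer that has been set shows the number of moves left: the receiver computes it from the
counter in the message, and every other one decreases by one in the round. -/
theorem moved_timersOk {step : ℕ} (hT : TimersOk n sync step θ) (hs : w.sync = sync)
    (hstep : w.step = step) (hnum : sync = true → w.num = n) :
    TimersOk n sync (step + 1) (moved lab par ch cnt h z w θ) := by
  refine ⟨fun hf x => ?_, fun ht x a hxa => ?_⟩
  · have h0 := hT.1 hf x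
    by_cases hx : x = z
    · subst hx
      rw [moved_self]
      simp [Tour.arrive, hs, hf, Tour.tick, Tour.depart_timer, h0]
    · rw [moved_of_ne hx]
      simp [Tour.tick, Tour.depart_timer, h0]
  · by_cases hx : x = z
    · subst hx
      rw [moved_self] at hxa ⊢
      simp only [Tour.arrive, hs, ht, if_true, Option.some.injEq] at hxa ⊢
      rw [hnum ht, hstep] at hxa
      exact ⟨hxa.symm, hnum ht⟩
    · rw [moved_of_ne hx] at hxa ⊢
      simp only [Tour.tick, Tour.depart_timer, Tour.depart_size, Option.map_eq_some_iff] at hxa ⊢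
      obtain ⟨a', ha', rfl⟩ := hxa
      obtain ⟨h1, h2⟩ := hT.2 ht x a' ha'
      exact ⟨by omega, h2⟩

theorem moved_timer_isSome {x : V} (hx : (θ x).timer.isSome) :
    (moved lab par ch cnt h z w θ x).timer.isSome := by
  by_cases hxz : x = z
  · subst hxz
    rw [moved_self]
    unfold Tour.arrive
    by_cases hs : w.sync = true <;> simp [hs, Tour.tick, Tour.depart_timer, hx]
  · rw [moved_of_ne hxz]
    simpa [Tour.tick, Tour.depart_timer] using hx

theorem moved_timer_isSome_dst (hs : w.sync = true) :
    (moved lab par ch cnt h z w θ z).timer.isSome := by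
  rw [moved_self]
  simp [Tour.arrive, hs]

end MovedFacts

theorem TimersOk.ne_zero {step : ℕ} {θ : V → Tour} (hT : TimersOk n sync step θ)
    (hstep : step < 2 * n - 2) (x : V) : (θ x).timer ≠ some 0 := by
  intro h
  cases sync with
  | false => rw [hT.1 rfl x] at h; cases h
  | true =>
    have := (hT.2 rfl x 0 h).1
    omega

/-- The increase of the number of nodes counted in the visit of `k` nodes. -/
def counted (cnt sync : Bool) (k : ℕ) : ℕ := if cnt && !sync then k else 0

/-- Induction on the forest: a move to `v`, the walk below `v`, a move back to `w`, and the walk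
through the other trees, hence two moves per vertex. No vertex of the forest may be the parent of
`w`, since a node takes a token from its parent for a first visit and would start again with all its
children. -/
theorem exists_walk (hlab : Function.Injective lab) (f : Forest V) :
    ∀ (w : V) (θ : V → Tour) (num step : ℕ), TreeShape G par ch w f →
    (θ w).token = some ⟨sync, num, step⟩ → (θ w).pending = f.roots.map lab →
    (∀ x, x ≠ w → (θ x).token = none) → w ∉ f.verts → f.verts.Nodup →
    (∀ y ∈ f.verts, par w ≠ some y) → (sync = true → num = n) →
    num + counted cnt sync f.verts.length ≤ n → step + 2 * f.verts.length ≤ 2 * n - 2 →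
    TimersOk n sync step θ →
    ∃ hs θ', MovePath G lab par ch n cnt sync hs θ θ' ∧ hs.length = 2 * f.verts.length ∧
      (∀ x ∈ f.verts, x ∈ hs) ∧
      (θ' w).token = some ⟨sync, num + counted cnt sync f.verts.length,
        step + 2 * f.verts.length⟩ ∧ (θ' w).pending = [] ∧
      (∀ x, x ≠ w → (θ' x).token = none) ∧ (∀ x, x ∉ f.verts → x ≠ w →
        (θ' x).pending = (θ x).pending) ∧
      TimersOk n sync (step + 2 * f.verts.length) θ' ∧
      (∀ x, (θ x).timer.isSome → (θ' x).timer.isSome) ∧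
      (sync = true → ∀ x ∈ f.verts, (θ' x).timer.isSome) ∧
      (sync = true → f.verts ≠ [] → (θ' w).timer.isSome) := by
  induction f with
  | nil =>
    intro w θ num step _ htok hpend hoth _ _ _ _ _ _ hT
    refine ⟨[], θ, .nil θ, rfl, by simp [Forest.verts], ?_, by simpa [Forest.roots] using hpend,
      hoth, fun _ _ _ => rfl, hT, fun _ h => h, by simp [Forest.verts], by simp [Forest.verts]⟩
    simp [Forest.verts, counted, htok]
  | cons v s t ihs iht =>
    intro w θ num step hshape htok hpend hoth hwf hnd hparw hnum hle hstep hT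
    obtain ⟨hpv, hcv, hadj, hshs, hsht⟩ := hshape
    simp only [Forest.verts, List.mem_cons, List.mem_append, not_or] at hwf hparw
    simp only [Forest.verts, List.nodup_cons, List.mem_append, not_or, List.nodup_append'] at hnd
    obtain ⟨⟨hvs, hvt⟩, hnds, hndt, hdisj⟩ := hnd
    obtain ⟨hwv, hws, hwt⟩ := hwf
    simp only [Forest.verts, List.length_cons, List.length_append] at hle hstep ⊢
    have hcadd : ∀ a b, counted cnt sync (a + b) = counted cnt sync a + counted cnt sync b := by
      intro a b; unfold counted; split_ifs <;> rfl
    have hcount : counted cnt sync (s.verts.length + t.verts.length + 1) =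
        counted cnt sync 1 + counted cnt sync s.verts.length + counted cnt sync t.verts.length := by
      rw [hcadd, hcadd]; ring
    rw [hcount] at hle ⊢
    simp only [Forest.roots, List.map_cons] at hpend
    -- the first move
    set w₀ : Walk := ⟨sync, num, step⟩ with hw₀
    set θ₁ := moved lab par ch cnt w v w₀ θ with hθ₁
    have m1 : Move G lab par ch n cnt sync w θ θ₁ :=
      ⟨⟨v, w₀, hadj, htok, rfl, by simp only [hw₀]; omega, by simp only [hw₀]; omega,
        by rw [hpend]; rfl, rfl⟩, hoth, hT.ne_zero (by omega), hT.1⟩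
    have hT₁ : TimersOk n sync (step + 1) θ₁ := moved_timersOk hT rfl rfl hnum
    have hdv : (θ v).depart ((par v).map lab) = θ v := Tour.depart_of_none (hoth v (Ne.symm hwv))
    have hθ₁v : (θ₁ v).token = some ⟨sync, num + counted cnt sync 1, step + 1⟩ ∧
        (θ₁ v).pending = s.roots.map lab := by
      rw [hθ₁, moved_self]
      simp only [Tour.arrive, hpv, hw₀, Option.map_some, decide_true, if_true, hcv, and_true,
        Bool.and_true]
      unfold counted
      split_ifs <;> rfl
    have hθ₁w : (θ₁ w).token = none ∧ (θ₁ w).pending = t.roots.map lab := by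
      rw [hθ₁, moved_of_ne hwv, Tour.depart_of_some htok (by rw [hpend]; rfl)]
      exact ⟨rfl, by simp [Tour.tick, hpend]⟩
    have hθ₁x : ∀ x, x ≠ v → x ≠ w → (θ₁ x).token = none ∧ (θ₁ x).pending = (θ x).pending := by
      intro x hxv hxw
      rw [hθ₁, moved_of_ne hxv, Tour.depart_of_none (hoth x hxw)]
      exact ⟨hoth x hxw, rfl⟩
    -- the subtree of `v`
    obtain ⟨hs₁, θ₂, p₁, l₁, c₁, k₁, e₁, o₁, u₁, T₁, i₁, j₁, -⟩ := ihs v θ₁ _ _ hshs hθ₁v.1 hθ₁v.2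
      (fun x hxv => by
        by_cases hxw : x = w
        · rw [hxw]; exact hθ₁w.1
        · exact (hθ₁x x hxv hxw).1) hvs hnds
      (fun y hy e => by
        rw [hpv] at e
        exact hws (Option.some.inj e ▸ hy))
      (fun h => by simp [counted, h, hnum h]) (by omega) (by omega) hT₁
    -- the token returns
    set w₂ : Walk := ⟨sync, num + counted cnt sync 1 + counted cnt sync s.verts.length,
      step + 1 + 2 * s.verts.length⟩ with hw₂
    set θ₃ := moved lab par ch cnt v w w₂ θ₂ with hθ₃
    have m2 : Move G lab par ch n cnt sync v θ₂ θ₃ :=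
      ⟨⟨w, w₂, hadj.symm, k₁, rfl, by simp only [hw₂]; omega, by simp only [hw₂]; omega,
        by rw [e₁, hpv]; rfl, rfl⟩, o₁, T₁.ne_zero (by omega), T₁.1⟩
    have hT₃ : TimersOk n sync (step + 1 + 2 * s.verts.length + 1) θ₃ :=
      moved_timersOk T₁ rfl rfl fun h => by simp [hw₂, counted, h, hnum h]
    have hparwv : (par w).map lab ≠ some (lab v) := by
      intro h
      obtain ⟨y, hy, hy'⟩ := Option.map_eq_some_iff.1 h
      exact hparw v (.inl rfl) (hlab hy' ▸ hy)
    have hθ₃w : (θ₃ w).token = some ⟨sync, num + counted cnt sync 1 +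
        counted cnt sync s.verts.length, step + 1 + 2 * s.verts.length + 1⟩ ∧
        (θ₃ w).pending = t.roots.map lab := by
      rw [hθ₃, moved_self, Tour.depart_of_none (o₁ w hwv)]
      simp only [Tour.arrive, hparwv, decide_false, Bool.and_false, hw₂, Bool.false_eq_true,
        if_false, Tour.tick, u₁ w hws hwv, hθ₁w.2, and_self]
    have hθ₃v : (θ₃ v).token = none := by
      rw [hθ₃, moved_of_ne (Ne.symm hwv), Tour.depart_of_some k₁ (by rw [e₁, hpv]; rfl)]
      rfl
    have hθ₃x : ∀ x, x ≠ v → x ≠ w → (θ₃ x).token = none ∧ (θ₃ x).pending = (θ₂ x).pending := by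
      intro x hxv hxw
      rw [hθ₃, moved_of_ne hxw, Tour.depart_of_none (o₁ x hxv)]
      exact ⟨o₁ x hxv, rfl⟩
    -- the other trees
    obtain ⟨hs₂, θ₄, p₂, l₂, c₂, k₂, e₂, o₂, u₂, T₂, i₂, j₂, -⟩ := iht w θ₃ _ _ hsht hθ₃w.1 hθ₃w.2
      (fun x hxw => by
        by_cases hxv : x = v
        · rw [hxv]; exact hθ₃v
        · exact (hθ₃x x hxv hxw).1) hwt hndt (fun y hy => hparw y (.inr (.inr hy)))
      (fun h => by simp [counted, h, hnum h]) (by omega) (by omega) hT₃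
    have hsteps : step + 1 + 2 * s.verts.length + 1 + 2 * t.verts.length =
        step + 2 * (s.verts.length + t.verts.length + 1) := by ring
    refine ⟨w :: (hs₁ ++ (v :: hs₂)), θ₄, .cons m1 (p₁.append (.cons m2 p₂)), ?_, ?_, ?_, e₂, o₂,
      ?_, ?_, ?_, ?_, ?_⟩
    · simp only [List.length_cons, List.length_append, l₁, l₂]; ring
    · intro x hx
      simp only [List.mem_cons, List.mem_append] at hx ⊢
      rcases hx with rfl | hx | hx
      · exact .inr (.inr (.inl rfl))
      · exact .inr (.inl (c₁ x hx))
      · exact .inr (.inr (.inr (c₂ x hx)))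
    · rw [k₂, hsteps]
      simp only [Nat.add_assoc]
    · intro x hx hxw
      simp only [List.mem_cons, List.mem_append, not_or] at hx
      rw [u₂ x hx.2.2 hxw, (hθ₃x x hx.1 hxw).2, u₁ x hx.2.1 hx.1, (hθ₁x x hx.1 hxw).2]
    · rw [← hsteps]; exact T₂
    · intro x hx
      exact i₂ x (moved_timer_isSome (i₁ x (moved_timer_isSome hx)))
    · intro hsy x hx
      simp only [List.mem_cons, List.mem_append] at hx
      rcases hx with rfl | hx | hx
      · exact i₂ _ (moved_timer_isSome (i₁ _ (moved_timer_isSome_dst hsy)))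
      · exact i₂ x (moved_timer_isSome (j₁ hsy x hx))
      · exact j₂ hsy x hx
    · intro hsy _
      exact i₂ w (moved_timer_isSome_dst hsy)

end Walks

end Sinr

namespace Sinr

open Trav

/-! ## Spanning trees and pairs of walks -/

section Labels

variable {V : Type*} (lab : V → ℕ)

open Classical in
/-- The vertex with a given label. -/
noncomputable def ofLabel (i : ℕ) : Option V :=
  if h : ∃ y, lab y = i then some h.choose else none

variable {lab}

theorem ofLabel_lab (hlab : Function.Injective lab) (v : V) : ofLabel lab (lab v) = some v := by
  have h : ∃ y, lab y = lab v := ⟨v, rfl⟩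
  rw [ofLabel, dif_pos h, hlab h.choose_spec]

theorem filterMap_ofLabel (hlab : Function.Injective lab) (l : List V) :
    (l.map lab).filterMap (ofLabel lab) = l := by
  induction l with
  | nil => rfl
  | cons v l ih => simp [ofLabel_lab hlab, ih]

theorem map_filterMap_ofLabel (hlab : Function.Injective lab) (l : List ℕ)
    (h : ∀ i ∈ l, ∃ y, lab y = i) : (l.filterMap (ofLabel lab)).map lab = l := by
  induction l with
  | nil => rfl
  | cons i l ih =>
    obtain ⟨y, rfl⟩ := h i List.mem_cons_self
    simp [ofLabel_lab hlab, ih fun i hi => h i (List.mem_cons_of_mem _ hi)]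

end Labels

section Trees

variable {V : Type*} [DecidableEq V] {G : SimpleGraph V} {lab : V → ℕ} {τ : ℕ}

/-- `f` is the forest of the subtrees of a spanning tree with root `ρ`. -/
structure IsTree (G : SimpleGraph V) (par : V → Option V) (ch : V → List V) (ρ : V)
    (f : Forest V) : Prop where
  par_root : par ρ = none
  ch_root : ch ρ = f.roots
  shape : TreeShape G par ch ρ f
  mem_verts : ∀ x, x ∈ f.verts ↔ x ≠ ρ
  nodup : f.verts.Nodup

/-- The parents according to the records `r`. -/
noncomputable def parOf (lab : V → ℕ) (r : V → Btd) (v : V) : Option V :=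
  (r v).parent.bind (ofLabel lab)

/-- The children according to the records `r`. -/
noncomputable def chOf (lab : V → ℕ) (r : V → Btd) (v : V) : List V :=
  (r v).children.filterMap (ofLabel lab)

theorem Served.treeShape (hlab : Function.Injective lab) {r : V → Btd} {p : V} {f : Forest V}
    (h : Served lab τ r p f) (hl : Linked G p f) :
    TreeShape G (parOf lab r) (chOf lab r) p f ∧
      ∀ v ∈ f.verts, (r v).tok = τ ∧ (r v).visited = true ∧
        (parOf lab r v).map lab = (r v).parent ∧ (chOf lab r v).map lab = (r v).children ∧
        parOf lab r v ≠ none := by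
  induction f generalizing p with
  | nil => exact ⟨trivial, by simp [Forest.verts]⟩
  | cons v s t ih1 ih2 =>
    obtain ⟨h1, h2, h3⟩ := h
    obtain ⟨l1, l2, l3⟩ := hl
    obtain ⟨a1, b1⟩ := ih1 h2 l2
    obtain ⟨a2, b2⟩ := ih2 h3 l3
    have e1 : parOf lab r v = some p := by simp [parOf, h1, ofLabel_lab hlab]
    have e2 : chOf lab r v = s.roots := by simp [chOf, h1, filterMap_ofLabel hlab]
    refine ⟨⟨e1, e2, l1, a1, a2⟩, fun x hx => ?_⟩
    simp only [Forest.verts, List.mem_cons, List.mem_append] at hx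
    rcases hx with rfl | hx | hx
    · rw [e1, e2, h1]; simp
    · exact b1 x hx
    · exact b2 x hx

/-- Internal nodes of a tree appear in its list of internal vertices. -/
theorem TreeShape.mem_internals {par : V → Option V} {ch : V → List V} {p : V} {f : Forest V}
    (h : TreeShape G par ch p f) {v : V} (hv : v ∈ f.verts) (hc : ch v ≠ []) :
    v ∈ f.internals := by
  induction f generalizing p with
  | nil => simp [Forest.verts] at hv
  | cons w s t ih1 ih2 =>
    obtain ⟨_, h2, _, h4, h5⟩ := h
    simp only [Forest.verts, List.mem_cons, List.mem_append] at hv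
    simp only [Forest.internals, List.mem_append]
    rcases hv with rfl | hv | hv
    · left
      cases s with
      | nil => exact absurd h2 hc
      | cons => simp
    · exact .inr (.inl (ih1 h4 hv))
    · exact .inr (.inr (ih2 h5 hv))

theorem TreeShape.adj_of_par {par : V → Option V} {ch : V → List V} {p : V} {f : Forest V}
    (h : TreeShape G par ch p f) {v : V} (hv : v ∈ f.verts) :
    ∃ q, par v = some q ∧ G.Adj q v ∧ (q = p ∨ q ∈ f.verts ∧ ch q ≠ []) := by
  induction f generalizing p with
  | nil => simp [Forest.verts] at hv
  | cons w s t ih1 ih2 =>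
    obtain ⟨h1, h2, h3, h4, h5⟩ := h
    simp only [Forest.verts, List.mem_cons, List.mem_append] at hv ⊢
    rcases hv with rfl | hv | hv
    · exact ⟨p, h1, h3, .inl rfl⟩
    · obtain ⟨q, g1, g2, g3⟩ := ih1 h4 hv
      refine ⟨q, g1, g2, .inr ?_⟩
      rcases g3 with rfl | ⟨g3, g4⟩
      · refine ⟨.inl rfl, ?_⟩
        rw [h2]
        cases s with
        | nil => simp [Forest.verts] at hv
        | cons => simp [Forest.roots]
      · exact ⟨.inr (.inl g3), g4⟩
    · obtain ⟨q, g1, g2, g3⟩ := ih2 h5 hv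
      exact ⟨q, g1, g2, g3.imp_right fun h => ⟨.inr (.inr h.1), h.2⟩⟩

variable {par : V → Option V} {ch : V → List V}

theorem IsTree.length_verts [Fintype V] {ρ : V} {f : Forest V} (ht : IsTree G par ch ρ f) :
    f.verts.length + 1 = Fintype.card V := by
  have h1 : f.verts.toFinset = Finset.univ.erase ρ := by
    ext x; simp [ht.mem_verts]
  have h2 := List.toFinset_card_of_nodup ht.nodup
  rw [h1, Finset.card_erase_of_mem (Finset.mem_univ _), Finset.card_univ] at h2
  have : 0 < Fintype.card V := Fintype.card_pos_iff.2 ⟨ρ⟩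
  omega

theorem IsTree.par_ne_none {ρ : V} {f : Forest V} (ht : IsTree G par ch ρ f) {v : V}
    (hv : v ≠ ρ) : ∃ q, par v = some q ∧ G.Adj q v ∧ (q = ρ ∨ ch q ≠ []) := by
  obtain ⟨q, h1, h2, h3⟩ := ht.shape.adj_of_par ((ht.mem_verts v).2 hv)
  exact ⟨q, h1, h2, h3.imp_right And.right⟩

theorem exists_walks [Fintype V] (hlab : Function.Injective lab) {ρ : V} {f : Forest V}
    (ht : IsTree G par ch ρ f) {n : ℕ} (hn : Fintype.card V = n) (hn2 : 2 ≤ n) (cnt : Bool)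
    (θ₀ : V → Tour) (h0 : (θ₀ ρ).token = some ⟨false, if cnt then 1 else n, 0⟩)
    (h1 : (θ₀ ρ).pending = (ch ρ).map lab) (h2 : ∀ x, x ≠ ρ → (θ₀ x).token = none)
    (h3 : ∀ x, (θ₀ x).timer = none) :
    ∃ hs₁ θ₁ hs₂ θ₂, MovePath G lab par ch n cnt false hs₁ θ₀ θ₁ ∧ hs₁.length = 2 * n - 2 ∧
      (∀ x, x ≠ ρ → x ∈ hs₁) ∧ (∀ x, (θ₁ x).timer = none) ∧
      MovePath G lab par ch n cnt true hs₂
        (fun x => (θ₁ x).turn ((par x).map lab) ((ch x).map lab)) θ₂ ∧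
      hs₂.length = 2 * n - 2 ∧ ∀ x, (θ₂ x).timer = some 0 ∧ (θ₂ x).size = n := by
  have hlen := ht.length_verts
  rw [hn] at hlen
  have hρf : ρ ∉ f.verts := fun h => (ht.mem_verts ρ).1 h rfl
  have hparρ : ∀ y ∈ f.verts, par ρ ≠ some y := fun y _ h => by rw [ht.par_root] at h; cases h
  have hlen' : 2 * f.verts.length = 2 * n - 2 := by omega
  obtain ⟨hs₁, θ₁, p₁, l₁, c₁, k₁, e₁, o₁, -, T₁, -, -, -⟩ := exists_walk (G := G) (par := par)
    (ch := ch) (n := n) (cnt := cnt) (sync := false) hlab f ρ θ₀ _ 0 ht.shape h0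
    (by rw [h1, ht.ch_root]) h2 hρf ht.nodup hparρ (by simp)
    (by cases cnt <;> simp [counted]; omega) (by omega) ⟨fun _ => h3, by simp⟩
  set θ₁' : V → Tour := fun x => (θ₁ x).turn ((par x).map lab) ((ch x).map lab) with hθ₁'
  have hcount : (if cnt then 1 else n) + counted cnt false f.verts.length = n := by
    cases cnt <;> simp [counted]; omega
  have hρ' : θ₁' ρ = ⟨some ⟨true, n, 0⟩, (ch ρ).map lab, none, n⟩ := by
    simp only [hθ₁', ht.par_root]
    unfold Tour.turn
    rw [k₁, e₁, hcount]
    rfl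
  have hx' : ∀ x, x ≠ ρ → θ₁' x = θ₁ x := fun x hx => Tour.turn_eq (.inl (o₁ x hx))
  obtain ⟨hs₂, θ₂, p₂, l₂, -, -, -, -, -, T₂, -, j₂, r₂⟩ := exists_walk (G := G) (par := par)
    (ch := ch) (n := n) (cnt := cnt) (sync := true) hlab f ρ θ₁' n 0 ht.shape (by rw [hρ'])
    (by rw [hρ', ht.ch_root]) (fun x hx => by rw [hx' x hx]; exact o₁ x hx) hρf ht.nodup hparρ
    (fun _ => rfl) (by simp [counted]) (by omega) ⟨by simp, fun _ x a hxa => by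
      by_cases hx : x = ρ
      · rw [hx, hρ'] at hxa; cases hxa
      · rw [hx' x hx, T₁.1 rfl x] at hxa; cases hxa⟩
  refine ⟨hs₁, θ₁, hs₂, θ₂, p₁, by omega, fun x hx => c₁ x ((ht.mem_verts x).2 hx), T₁.1 rfl, p₂,
    by omega, fun x => ?_⟩
  -- The second walk enters every node, the root on its return; this needs at least one move. So all
  -- timers are set, and after `2 * n - 2` moves all of them show `0`.
  have hsome : (θ₂ x).timer.isSome := by
    by_cases hx : x = ρ
    · rw [hx]
      exact r₂ rfl fun h => by rw [h] at hlen; simp at hlen; omega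
    · exact j₂ rfl x ((ht.mem_verts x).2 hx)
  obtain ⟨a, ha⟩ := Option.isSome_iff_exists.1 hsome
  obtain ⟨b1, b2⟩ := T₂.2 rfl x a ha
  exact ⟨by rw [ha, b1]; congr 1; omega, b2⟩

end Trees

/-! ## Neighbour lists -/

section Neighbours

variable {V : Type*} [Fintype V] {N : ℕ} (M : Model) (net : Network V N)

/-- The labels of the neighbours in increasing order. -/
noncomputable def nbrLabels (v : V) : List ℕ := (knowledge M net v).nbrs.sort (· ≤ ·)

/-- The neighbours in the order of their labels. -/
noncomputable def nbrList (v : V) : List V := (nbrLabels M net v).filterMap (ofLabel net.label)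

theorem mem_nbrLabels {v : V} {i : ℕ} :
    i ∈ nbrLabels M net v ↔ ∃ u, (commGraph M net).Adj v u ∧ net.label u = i := by
  classical
  simp only [nbrLabels, knowledge, Finset.mem_sort, Finset.mem_image, Finset.mem_filter,
    Finset.mem_univ, true_and]
  constructor
  · rintro ⟨u, h, rfl⟩; exact ⟨u, h.symm, rfl⟩
  · rintro ⟨u, h, rfl⟩; exact ⟨u, h.symm, rfl⟩

theorem map_nbrList (v : V) : (nbrList M net v).map net.label = nbrLabels M net v :=
  map_filterMap_ofLabel net.label_injective _ fun _ hi =>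
    let ⟨u, _, hu⟩ := (mem_nbrLabels M net).1 hi
    ⟨u, hu⟩

theorem mem_nbrList {v u : V} : u ∈ nbrList M net v ↔ (commGraph M net).Adj v u := by
  rw [← List.mem_map_of_injective net.label_injective, map_nbrList, mem_nbrLabels]
  constructor
  · rintro ⟨w, h, e⟩; exact net.label_injective e ▸ h
  · intro h; exact ⟨u, h, rfl⟩

theorem nbrList_nodup (v : V) : (nbrList M net v).Nodup := by
  refine List.Nodup.of_map net.label ?_
  rw [map_nbrList]
  exact Finset.sort_nodup _ _

end Neighbours

end Sinr

namespace Sinr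

open Trav

/-! ## The execution as seen by nodes that are all awake -/

section Sim

variable {V : Type*} [Fintype V] {N : ℕ} (M : Model) (net : Network V N) {R : Type*}
  [DecidableEq R] (F : Families) (hold : V → List R)

/-- The execution of the algorithm. -/
noncomputable abbrev run (t : ℕ) : V → Option (NodeState R) :=
  states M net (btdProtocol R F) hold t

/-- At time `t` the states of the nodes are `s`; a sleeping node has the state in which it would wake
up. -/
def Sim (t : ℕ) (s : V → Trav.State) : Prop :=
  ∀ v, (s v).clock = t ∧ (run M net F hold t v = some (.traversing (s v) (hold v)) ∨
    run M net F hold t v = none ∧ hold v = [] ∧ s v = init (knowledge M net v) t false)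

/-- What `v` hears if the nodes are in the states `s`. -/
noncomputable def heard (s : V → Trav.State) (v : V) : Option Ctl :=
  hear M net (fun v => (s v).send F) v

theorem Tour.turn_idle (parent : Option ℕ) (children : List ℕ) :
    Tour.idle.turn parent children = Tour.idle := rfl

theorem Tour.send_idle (id : ℕ) (parent : Option ℕ) : Tour.idle.send id parent = none := rfl

theorem Tour.depart_idle (parent : Option ℕ) : Tour.idle.depart parent = Tour.idle := by
  simp [Tour.depart, Tour.idle]

theorem Tour.tick_idle : Tour.idle.tick = Tour.idle := rfl

theorem init_prepare (K : Knowledge) (t : ℕ) : (init K t false).prepare F = init K t false := by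
  simp [State.prepare, State.issue, init, Tour.turn_idle]

theorem init_send (K : Knowledge) (t : ℕ) : (init K t false).send F = none := by
  unfold State.send
  rw [init_prepare]
  simp [State.emit, init, Tour.send_idle, List.min?]

/-- Together with `init_send`: an inactive station without a record is silent and, as long as it
hears nothing, only its clock advances. Hence a sleeping station can be treated as an awake one in
this state. -/
theorem init_recv (K : Knowledge) (t : ℕ) :
    (init K t false).recv F none = init K (t + 1) false := by
  unfold State.recv
  rw [init_prepare]
  simp [init, Tour.depart_idle, Tour.tick_idle, State.settle, List.min?]

variable {M net F hold}

theorem Sim.transmitted_eq {t : ℕ} {s : V → Trav.State} (hs : Sim M net F hold t s) (v : V) :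
    transmitted (btdProtocol R F) (run M net F hold t) v =
      ((s v).send F).map fun c => ⟨c, none⟩ := by
  obtain ⟨-, h | ⟨h, -, h'⟩⟩ := hs v
  · simp [transmitted, h, btdProtocol]
  · rw [h', init_send]
    simp only [transmitted, h]
    rfl

theorem Sim.received_eq {t : ℕ} {s : V → Trav.State} (hs : Sim M net F hold t s) (v : V) :
    received M net (btdProtocol R F) (run M net F hold t) v =
      (heard M net F s v).map fun c => ⟨c, none⟩ := by
  rw [received_eq_hear]
  have : transmitted (btdProtocol R F) (run M net F hold t) =
      fun v => ((s v).send F).map fun c => ⟨c, none⟩ := funext hs.transmitted_eq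
  rw [this]
  exact hear_map M net _ _ v

theorem run_succ (t : ℕ) (v : V) : run M net F hold (t + 1) v =
    match run M net F hold t v,
      received M net (btdProtocol R F) (run M net F hold t) v with
    | none, none => none
    | none, some m => some ((btdProtocol R F).wake (knowledge M net v) m)
    | some s, m => some ((btdProtocol R F).recv s m) := by
  unfold run
  simp only [states]
  cases states M net (btdProtocol R F) hold t v <;>
    cases received M net (btdProtocol R F) (states M net (btdProtocol R F) hold t) v <;> rfl

/-- A sleeping station sets its clock by the first message. If this reading is `t`, as `hw`
guarantees, waking up leads to the same state as receiving the message in the simulated state. -/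
theorem Sim.run_succ_eq {t : ℕ} {s : V → Trav.State} (hs : Sim M net F hold t s)
    (hw : ∀ v m, (s v).btd = none → heard M net F s v = some m → clockOf m = t) (v : V) :
    run M net F hold (t + 1) v =
        some (proceed ((s v).recv F (heard M net F s v)) (hold v)) ∨
      run M net F hold (t + 1) v = none ∧ hold v = [] ∧ s v = init (knowledge M net v) t false ∧
        heard M net F s v = none := by
  rw [run_succ, hs.received_eq]
  obtain ⟨-, h | ⟨h, h0, h'⟩⟩ := hs v
  · left
    rw [h]
    simp only [btdProtocol, Option.map_map]
    congr 3
    cases heard M net F s v <;> rfl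
  · rw [h]
    cases hm : heard M net F s v with
    | none => exact .inr ⟨rfl, h0, h', rfl⟩
    | some m =>
      left
      have := hw v m (by rw [h']; rfl) hm
      simp [btdProtocol, h', h0, this]

/-- The message heard in a round, if any, is recorded. -/
def Trav.State.listen (s : Trav.State) : Option Ctl → Trav.State
  | some c => s.absorb c
  | none => s

/-- The state at the end of a round, before the clock is advanced. -/
def Trav.State.close (F : Families) (t : ℕ) (s : Trav.State) : Trav.State :=
  if F.sel.flatten.length ≤ t ∧ (t - F.sel.flatten.length) % (2 * F.ssf.length) + 1 =
    2 * F.ssf.length then s.settle else s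

/-- The walk after a round in which nothing is received. -/
def Trav.State.goes (s : Trav.State) : Trav.State :=
  { s with tour := (s.tour.depart s.parent).tick }

/-- The clock advances. -/
def Trav.State.bump (s : Trav.State) : Trav.State := { s with clock := s.clock + 1 }

theorem advance_clock (s : Trav.State) (b : Btd) : (s.advance b).clock = s.clock := by
  unfold State.advance
  split <;> rfl

theorem prepare_clock (s : Trav.State) : (s.prepare F).clock = s.clock := by
  unfold State.prepare State.issue
  simp only
  split_ifs
  · exact advance_clock _ _
  · rfl

theorem listen_clock (s : Trav.State) (c : Option Ctl) : (s.listen c).clock = s.clock := by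
  unfold State.listen State.absorb
  cases c with
  | none => rfl
  | some c => cases c <;> simp only <;> split_ifs <;> rfl

theorem settle_clock (s : Trav.State) : s.settle.clock = s.clock := by
  have h4 : ∀ s : Trav.State, ∀ b m, (s.handle b m).clock = s.clock := by
    intro s b m
    unfold State.handle
    split_ifs <;> cases m.kind <;> simp only <;> first
      | rfl
      | exact advance_clock _ _
  unfold State.settle
  split
  · rfl
  · simp only
    split
    · rfl
    · exact h4 _ _ _

theorem recv_eq (s : Trav.State) (c : Option Ctl) :
    s.recv F c = (((s.prepare F).goes.listen c).close F s.clock).bump := by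
  have h : ((s.prepare F).goes.listen c).clock = s.clock :=
    (listen_clock _ _).trans (prepare_clock s)
  unfold State.close
  rw [← h]
  cases c <;> rfl

theorem recv_clock (s : Trav.State) (c : Option Ctl) : (s.recv F c).clock = s.clock + 1 := by
  rw [recv_eq]
  refine congrArg (· + 1) ?_
  unfold State.close
  split_ifs
  · rw [settle_clock, listen_clock]
    exact prepare_clock s
  · rw [listen_clock]
    exact prepare_clock s

theorem Sim.step {t : ℕ} {s : V → Trav.State} (hs : Sim M net F hold t s)
    (hw : ∀ v m, (s v).btd = none → heard M net F s v = some m → clockOf m = t)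
    (ht : ∀ v, ((s v).recv F (heard M net F s v)).tour.timer ≠ some 0) :
    Sim M net F hold (t + 1) fun v => (s v).recv F (heard M net F s v) := by
  intro v
  refine ⟨by rw [recv_clock, (hs v).1], ?_⟩
  rcases hs.run_succ_eq hw v with h | ⟨h, h1, h2, h3⟩
  · left
    rw [h, proceed, if_neg (ht v)]
  · right
    refine ⟨h, h1, ?_⟩
    change (s v).recv F (heard M net F s v) = _
    rw [h3, h2, init_recv]

theorem Sim.finish {t : ℕ} {s : V → Trav.State} (hs : Sim M net F hold t s)
    (hb : ∀ v, (s v).btd ≠ none)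
    (ht : ∀ v, ((s v).recv F (heard M net F s v)).tour.timer = some 0) (v : V) :
    run M net F hold (t + 1) v =
      some (.broadcasting (let s' := (s v).recv F (heard M net F s v)
        Mb.init s'.id s'.parent s'.children s'.tour.size (hold v))) := by
  rcases hs.run_succ_eq (fun v m h _ => absurd h (hb v)) v with h | ⟨-, -, h2, -⟩
  · rw [h, proceed, if_pos (ht v)]
  · exact absurd (by rw [h2]; rfl) (hb v)

/-! ## The elimination -/

open Classical in
/-- The nodes that hold rumours initially. -/
noncomputable def sources (hold : V → List R) : Finset V := Finset.univ.filter fun v => hold v ≠ []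

variable (M net F hold)

/-- The participants at time `t` of the elimination. -/
noncomputable def participants (t : ℕ) : Finset V :=
  elimRun M net (sources hold) (F.sel.flatten.take t)

theorem participants_succ {t : ℕ} (ht : t < F.sel.flatten.length) :
    participants M net F hold (t + 1) =
      elimStep M net (participants M net F hold t) F.sel.flatten[t] := by
  unfold participants elimRun
  rw [List.take_succ_eq_append_getElem ht, List.foldl_append]
  rfl

open Classical in
/-- The state of `v` at time `t` of the elimination. -/
noncomputable def elimState (t : ℕ) (v : V) : Trav.State :=
  init (knowledge M net v) t (decide (v ∈ participants M net F hold t))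

theorem sim_zero : Sim M net F hold 0 (elimState M net F hold 0) := by
  classical
  intro v
  refine ⟨rfl, ?_⟩
  simp only [run, states]
  cases hv : hold v with
  | nil =>
    right
    refine ⟨rfl, rfl, ?_⟩
    simp [elimState, participants, elimRun, sources, hv]
  | cons r l =>
    left
    simp [elimState, participants, elimRun, sources, hv, btdProtocol]

variable {M net F hold}

theorem init_prepare_of_lt {K : Knowledge} {t : ℕ} {a : Bool} (ht : t < F.sel.flatten.length) :
    (init K t a).prepare F = init K t a := by
  have h : (init K t a).issue F = init K t a := if_neg fun h => ht.ne h.1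
  unfold State.prepare
  rw [h]
  rfl

open Classical in
theorem elimState_send {t : ℕ} (ht : t < F.sel.flatten.length) (v : V) :
    (elimState M net F hold t v).send F =
      if v ∈ participants M net F hold t ∧ net.label v ∈ F.sel.flatten[t] then
        some (Ctl.elim t (net.label v)) else none := by
  unfold State.send elimState
  rw [init_prepare_of_lt ht]
  unfold State.emit
  have : (init (knowledge M net v) t (decide (v ∈ participants M net F hold t))).tour.send
    (knowledge M net v).id none = none := rfl
  by_cases h1 : v ∈ participants M net F hold t <;> by_cases h2 : net.label v ∈ F.sel.flatten[t] <;>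
    simp only [init, Tour.send_idle, ht, if_true, h1, h2, decide_true, decide_false, Bool.true_and,
      Bool.false_and, fires_iff ht, knowledge, and_self, and_false, false_and, if_false,
      Bool.false_eq_true]

theorem close_of_lt {t : ℕ} (ht : t < F.sel.flatten.length) (s : Trav.State) :
    s.close F t = s :=
  if_neg fun h => absurd h.1 (not_le.2 ht)

theorem init_recv_of_lt {K : Knowledge} {t : ℕ} {a : Bool} (ht : t < F.sel.flatten.length) :
    (init K t a).recv F none = init K (t + 1) a := by
  rw [recv_eq, init_prepare_of_lt ht]
  exact congrArg State.bump (close_of_lt ht _)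

theorem init_recv_elim {K : Knowledge} {t i : ℕ} {a : Bool} (ht : t < F.sel.flatten.length) :
    (init K t a).recv F (some (Ctl.elim t i)) =
      init K (t + 1) (if i < K.id then false else a) := by
  rw [recv_eq, init_prepare_of_lt ht, close_of_lt (t := (init K t a).clock) ht]
  by_cases h : i < K.id
  · rw [if_pos h]
    exact congrArg State.bump (if_pos h)
  · rw [if_neg h]
    exact congrArg State.bump (if_neg h)

theorem heard_elim {t : ℕ} (ht : t < F.sel.flatten.length) {v : V} {m : Ctl}
    (hm : heard M net F (elimState M net F hold t) v = some m) : ∃ i, m = Ctl.elim t i := by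
  obtain ⟨u, -, hu⟩ := adj_of_hear M net hm
  rw [elimState_send ht] at hu
  split_ifs at hu
  exact ⟨_, (Option.some.inj hu).symm⟩

/-- Identifies the execution with the combinatorial process `elimStep`. Since a station receives at
most one message per round, the sender with a smaller label in `elimStep` is the one that is heard.
-/
theorem elimState_recv {t : ℕ} (ht : t < F.sel.flatten.length) (v : V) :
    (elimState M net F hold t v).recv F (heard M net F (elimState M net F hold t) v) =
      elimState M net F hold (t + 1) v := by
  classical
  have hS : senders (fun v => (elimState M net F hold t v).send F) =
      (participants M net F hold t).filter fun w => net.label w ∈ F.sel.flatten[t] := by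
    ext w
    rw [mem_senders, elimState_send ht, Finset.mem_filter]
    split_ifs with h <;> simp [h]
  have hsucc : ∀ a, a = decide (v ∈ participants M net F hold (t + 1)) →
      init (knowledge M net v) (t + 1) a = elimState M net F hold (t + 1) v := by
    rintro a rfl
    rfl
  cases hm : heard M net F (elimState M net F hold t) v with
  | none =>
    refine (init_recv_of_lt ht).trans (hsucc _ ?_)
    rw [participants_succ M net F hold ht]
    unfold elimStep
    simp only [Finset.mem_filter]
    refine decide_eq_decide.2 ⟨fun h => ⟨h, ?_⟩, And.left⟩
    rintro ⟨u, hu, -⟩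
    rw [← hS] at hu
    have h1 := hear_of_receives M net hu
    change heard M net F (elimState M net F hold t) v = _ at h1
    rw [hm] at h1
    exact mem_senders.1 hu.1 h1.symm
  | some m =>
    obtain ⟨i, rfl⟩ := heard_elim ht hm
    refine (init_recv_elim ht).trans (hsucc _ ?_)
    rw [participants_succ M net F hold ht]
    unfold elimStep
    simp only [Finset.mem_filter]
    obtain ⟨u, hu, hum⟩ := exists_of_hear M net hm
    rw [hS] at hu
    have hi : i = net.label u := by
      rw [elimState_send ht] at hum
      split_ifs at hum
      simp only [Option.some.injEq, Ctl.elim.injEq, true_and] at hum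
      exact hum.symm
    change (if i < net.label v then _ else _) = _
    by_cases hlt : i < net.label v
    · rw [if_pos hlt]
      refine (decide_eq_false ?_).symm
      rintro ⟨-, h⟩
      exact h ⟨u, hu, hi ▸ hlt⟩
    · rw [if_neg hlt]
      refine decide_eq_decide.2 ⟨fun h => ⟨h, ?_⟩, And.left⟩
      rintro ⟨u', hu', hlt'⟩
      rw [hu'.unique hu] at hlt'
      exact hlt (hi ▸ hlt')

theorem sim_elim {t : ℕ} (ht : t ≤ F.sel.flatten.length) :
    Sim M net F hold t (elimState M net F hold t) := by
  induction t with
  | zero => exact sim_zero M net F hold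
  | succ t ih =>
    have ht' : t < F.sel.flatten.length := ht
    have h := (ih ht'.le).step (fun v m _ hm => by
      obtain ⟨i, rfl⟩ := heard_elim ht' hm
      rfl) (fun v => by
      rw [elimState_recv ht']
      simp [elimState, init, Tour.idle])
    simpa only [elimState_recv ht'] using h

end Sim

end Sinr

namespace Sinr

open Trav

/-! ## Executions of a family of sets -/

section Collect

variable {V : Type*} [Fintype V] {N : ℕ} (M : Model) (net : Network V N) {μ : Type*}

/-- What `v` hears in round `q` of an execution of `S` with the messages `x`. -/
noncomputable def hears (S : List (Finset ℕ)) (x : V → Option μ) (q : ℕ) (v : V) : Option μ :=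
  hear M net (fun u => if fires S q (net.label u) then x u else none) v

/-- What `v` hears in the first `q` rounds of an execution of `S` with the messages `x`. -/
noncomputable def collect (S : List (Finset ℕ)) (x : V → Option μ) (q : ℕ) (v : V) : List μ :=
  (List.range q).filterMap fun i => hears M net S x i v

theorem collect_succ (S : List (Finset ℕ)) (x : V → Option μ) (q : ℕ) (v : V) :
    collect M net S x (q + 1) v = collect M net S x q v ++ (hears M net S x q v).toList := by
  unfold collect
  rw [List.range_succ, List.filterMap_append]
  cases h : hears M net S x q v <;> simp [h]

open Classical in
/-- When the stations of a set with at most `δ` stations in each box execute `S`, each of them is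
received by all its neighbours. -/
def Spreads (S : List (Finset ℕ)) (δ : ℕ) : Prop :=
  ∀ X : Finset V, Sparse M net X δ → ∀ v ∈ X, ∀ u, (commGraph M net).Adj v u →
    ∃ q < S.length, Receives M net (X.filter fun w => fires S q (net.label w) = true) v u

variable {M net}

/-- Each station is made to send its own identity as message; what is heard then tells who was
received. -/
theorem IsSSF.spreads {near : Finset (Fin 2 → ℤ)} {δ c : ℕ} {S : List (Finset ℕ)}
    (hS : IsSSF N c S) (hn : IsNear M near (M.ε * M.noise / (δ + 1))) (hc : δ * near.card ≤ c) :
    Spreads M net S δ := by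
  classical
  intro X hX v hv u hvu
  let e : ℕ → V → Option V := fun q w =>
    if w ∈ X ∧ fires S q (net.label w) = true then some w else none
  obtain ⟨q, hq, h1, h2⟩ := exists_hear M net hS hn hc hX e
    (fun q _ w => by by_cases h : w ∈ X ∧ fires S q (net.label w) = true <;> simp [e, h]) hv hvu
  refine ⟨q, hq, ?_⟩
  have h3 : e q v = some v := by
    by_contra h
    exact h1 (if_neg fun hh => h (if_pos hh))
  rw [h3] at h2
  obtain ⟨w, hw, hw2⟩ := exists_of_hear M net h2
  have : w = v := by
    by_cases h : w ∈ X ∧ fires S q (net.label w) = true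
    · simpa [e, h] using hw2
    · simp only [e, if_neg h] at hw2
      cases hw2
  subst this
  convert hw using 1
  ext w
  rw [mem_senders, Finset.mem_filter]
  by_cases h : w ∈ X ∧ fires S q (net.label w) = true <;> simp [e, h]

theorem Spreads.mono {S : List (Finset ℕ)} {δ δ' : ℕ} (h : Spreads M net S δ) (hd : δ' ≤ δ) :
    Spreads M net S δ' :=
  fun X hX => h X fun b => (hX b).trans hd

/-- The interface to the algorithms: for sparse senders, an execution of the SSF acts like an
interference-free exchange with all neighbours, up to order and repetition. From here on the
geometry is only needed to show sparsity. -/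
theorem Spreads.mem_collect {S : List (Finset ℕ)} {δ : ℕ} (h : Spreads M net S δ)
    {x : V → Option μ} (hx : Sparse M net (senders x) δ) {v : V} {m : μ} :
    m ∈ collect M net S x S.length v ↔ ∃ u, (commGraph M net).Adj u v ∧ x u = some m := by
  classical
  unfold collect
  rw [List.mem_filterMap]
  constructor
  · rintro ⟨q, -, hq⟩
    obtain ⟨u, hu, hm⟩ := adj_of_hear M net hq
    refine ⟨u, hu, ?_⟩
    by_cases hf : fires S q (net.label u) = true
    · rwa [if_pos hf] at hm
    · rw [if_neg hf] at hm
      cases hm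
  · rintro ⟨u, hu, hm⟩
    obtain ⟨q, hq, hr⟩ := h _ hx u (mem_senders.2 (by rw [hm]; exact Option.some_ne_none m)) v hu
    refine ⟨q, List.mem_range.2 hq, ?_⟩
    have hs : senders (fun w => if fires S q (net.label w) then x w else none) =
        (senders x).filter fun w => fires S q (net.label w) = true := by
      ext w
      rw [mem_senders, Finset.mem_filter, mem_senders]
      by_cases hf : fires S q (net.label w) = true <;> simp [hf]
    rw [← hs] at hr
    have hf : fires S q (net.label u) = true := by
      by_contra hf
      have := mem_senders.1 hr.1
      rw [if_neg hf] at this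
      exact this rfl
    unfold hears
    rw [hear_of_receives M net hr, if_pos hf, hm]

end Collect

/-! ## One execution of `Smallest_Token` -/

theorem Trav.State.advance_eq {s : Trav.State} (b : Btd) :
    s.advance b = { s with
      btd := some (advanceBtd s.id b).1
      out := (advanceBtd s.id b).2
      tour := if (advanceBtd s.id b).2 = none then Tour.start b.children 1 else s.tour } := by
  obtain ⟨tok, vis, mk, par, un, q, c⟩ := b
  cases un <;> cases q <;> cases par <;> rfl

theorem advanceBtd_children (id : ℕ) (b : Btd) :
    (advanceBtd id b).1.children = b.children := by
  obtain ⟨tok, vis, mk, par, un, q, c⟩ := b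
  cases un <;> cases q <;> cases par <;> rfl

/-- Separates the evolution of the records, which is compared with the undisturbed traversal, from
the start of the walk, which takes place when the destination has nothing left to send. -/
theorem Trav.State.handle_eq {s : Trav.State} {b : Btd} (m : Pass) (hb : s.btd = some b)
    (ho : s.out = none) :
    s.handle b m = { s with
      btd := some (handleBtd s.id b m).1
      out := (handleBtd s.id b m).2
      tour := if m.dst = s.id ∧ (handleBtd s.id b m).2 = none then
        Tour.start (handleBtd s.id b m).1.children 1 else s.tour } := by
  obtain ⟨id, nbrs, clock, active, btd, out, inbox, claims, tour⟩ := s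
  simp only at hb ho
  subst hb ho
  unfold State.handle handleBtd
  by_cases hd : m.dst = id
  · simp only [hd, if_true, true_and]
    cases m.kind with
    | token =>
      simp only
      split_ifs <;> rw [State.advance_eq] <;> simp_all [advanceBtd_children]
    | check => simp
    | reply =>
      simp only
      rw [State.advance_eq]
      simp only [advanceBtd_children]
  · simp only [hd, if_false, false_and]
    cases m.kind with
    | token => rfl
    | check =>
      simp only
      split_ifs <;> rfl
    | reply => rfl

/-- The smallest token id among the messages addressed to the node `id`. -/
def claimTok (id : ℕ) (I : List Pass) : Option ℕ :=
  ((I.filter fun m => decide (m.dst = id)).map Pass.tok).min?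

/-- Control parts all of whose fields are at most `B`. -/
def Ctl.Bounded (B : ℕ) (c : Ctl) : Prop := ∀ x ∈ c.fields, x ≤ B

section Superround

variable {V : Type*} [Fintype V] {N : ℕ} (M : Model) (net : Network V N) {R : Type*}
  [DecidableEq R] (F : Families) (hold : V → List R)

/-- The state of `v` in an execution of `Smallest_Token`. -/
noncomputable def calm (t : ℕ) (a : V → Bool) (b : V → Option Btd) (o : V → Option Pass)
    (I : V → List Pass) (C : V → List ℕ) (v : V) : Trav.State :=
  ⟨net.label v, nbrLabels M net v, t, a v, b v, o v, I v, C v, Tour.idle⟩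

/-- At time `t` the prepared states are given by `calm`. -/
def At (t : ℕ) (a : V → Bool) (b : V → Option Btd) (o : V → Option Pass)
    (I : V → List Pass) (C : V → List ℕ) : Prop :=
  ∃ s, Sim M net F hold t s ∧ ∀ v, (s v).prepare F = calm M net t a b o I C v

variable {M net F hold} {t : ℕ} {a : V → Bool} {b : V → Option Btd} {o : V → Option Pass}
  {I : V → List Pass} {C : V → List ℕ}

theorem prepare_calm (ht : F.sel.flatten.length < t) (v : V) :
    (calm M net t a b o I C v).prepare F = calm M net t a b o I C v := by
  have h : (calm M net t a b o I C v).issue F = calm M net t a b o I C v :=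
    if_neg fun h => ht.ne' h.1
  unfold State.prepare
  rw [h]
  rfl

theorem Sim.at (ht : F.sel.flatten.length < t) (h : Sim M net F hold t (calm M net t a b o I C)) :
    At M net F hold t a b o I C :=
  ⟨_, h, fun v => prepare_calm ht v⟩

theorem round_mod {L l j q : ℕ} (hq : q < 2 * l) : (L + 2 * l * j + q - L) % (2 * l) = q := by
  rw [Nat.add_assoc, Nat.add_sub_cancel_left, Nat.mul_add_mod, Nat.mod_eq_of_lt hq]

variable {j q : ℕ} (ht : t = F.sel.flatten.length + 2 * F.ssf.length * j + q)

include ht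

theorem emit_pass (hq : q < F.ssf.length) (v : V) : (calm M net t a b o I C v).emit F =
    (if fires F.ssf q (net.label v) then o v else none).map (Ctl.pass t) := by
  have h1 : ¬t < F.sel.flatten.length := by omega
  have h2 : (calm M net t a b o I C v).position F = q := by
    unfold State.position
    change (t - _) % _ = _
    rw [ht, round_mod (by omega)]
  unfold State.emit
  rw [h2]
  change (if t < F.sel.flatten.length then _ else
    if q < F.ssf.length then match o v with
      | some m => if fires F.ssf q (net.label v) then some (Ctl.pass t m) else none
      | none => none else _) = _
  rw [if_neg h1, if_pos hq]
  cases o v <;> split_ifs <;> rfl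

theorem emit_claim (hq : F.ssf.length ≤ q) (hq' : q < 2 * F.ssf.length) (v : V) :
    (calm M net t a b o I C v).emit F =
      (if fires F.ssf (q - F.ssf.length) (net.label v) then
        claimTok (net.label v) (I v) else none).map (Ctl.claim t) := by
  have h1 : ¬t < F.sel.flatten.length := by omega
  have h2 : (calm M net t a b o I C v).position F = q := by
    unfold State.position
    change (t - _) % _ = _
    rw [ht, round_mod hq']
  unfold State.emit
  rw [h2]
  change (if t < F.sel.flatten.length then _ else
    if q < F.ssf.length then _ else match claimTok (net.label v) (I v) with
      | some m => if fires F.ssf (q - F.ssf.length) (net.label v) then some (Ctl.claim t m) else none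
      | none => none) = _
  rw [if_neg h1, if_neg (not_lt.2 hq)]
  cases claimTok (net.label v) (I v) <;> split_ifs <;> rfl

theorem close_eq_of_lt (hq : q + 1 < 2 * F.ssf.length) (s : Trav.State) : s.close F t = s := by
  refine if_neg fun h => ?_
  rw [ht, round_mod (by omega)] at h
  omega

theorem close_eq_settle (hq : q + 1 = 2 * F.ssf.length) (s : Trav.State) :
    s.close F t = s.settle := by
  refine if_pos ⟨by omega, ?_⟩
  rw [ht, round_mod (by omega)]
  exact hq

omit ht

theorem calm_goes (v : V) : (calm M net t a b o I C v).goes = calm M net t a b o I C v := by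
  unfold State.goes calm
  simp only [Tour.depart_idle, Tour.tick_idle]

theorem recv_pass {s : Trav.State} {v : V} (hs : s.prepare F = calm M net t a b o I C v)
    (x : Option Pass) : s.recv F (x.map (Ctl.pass t)) =
      ((calm M net t a b o (fun v => I v ++ x.toList) C v).close F t).bump := by
  have hc : s.clock = t := by rw [← prepare_clock (F := F) s, hs]; rfl
  rw [recv_eq, hs, hc, calm_goes]
  cases x with
  | none => simp only [Option.toList_none, List.append_nil]; rfl
  | some m => rfl

theorem recv_claim {s : Trav.State} {v : V} (hs : s.prepare F = calm M net t a b o I C v)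
    (x : Option ℕ) : s.recv F (x.map (Ctl.claim t)) =
      ((calm M net t a b o I (fun v => C v ++ x.toList) v).close F t).bump := by
  have hc : s.clock = t := by rw [← prepare_clock (F := F) s, hs]; rfl
  rw [recv_eq, hs, hc, calm_goes]
  cases x with
  | none => simp only [Option.toList_none, List.append_nil]; rfl
  | some m => rfl

include ht

theorem At.round_pass (h : At M net F hold t a b o I C) (hq : q < F.ssf.length) :
    At M net F hold (t + 1) a b o (fun v => I v ++ (hears M net F.ssf o q v).toList) C := by
  obtain ⟨s, hs, hp⟩ := h
  have h1 : ∀ v, heard M net F s v = (hears M net F.ssf o q v).map (Ctl.pass t) := by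
    intro v
    have : (fun v => (s v).send F) = fun v =>
        (if fires F.ssf q (net.label v) then o v else none).map (Ctl.pass t) := by
      funext v
      unfold State.send
      rw [hp, emit_pass ht hq]
    unfold heard
    rw [this]
    exact hear_map M net _ _ v
  have h2 : ∀ v, (s v).recv F (heard M net F s v) = calm M net (t + 1) a b o
      (fun v => I v ++ (hears M net F.ssf o q v).toList) C v := by
    intro v
    rw [h1, recv_pass (hp v), close_eq_of_lt ht (by omega)]
    rfl
  have h3 := hs.step (fun v m _ hm => by
    rw [h1] at hm
    obtain ⟨p, -, rfl⟩ := Option.map_eq_some_iff.1 hm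
    rfl) (fun v => by rw [h2]; simp [calm, Tour.idle])
  simp only [h2] at h3
  exact Sim.at (by omega) h3

theorem At.heard_claim {s : V → Trav.State} (hp : ∀ v, (s v).prepare F = calm M net t a b o I C v)
    (hq : F.ssf.length ≤ q) (hq' : q < 2 * F.ssf.length) (v : V) :
    heard M net F s v = (hears M net F.ssf (fun v => claimTok (net.label v) (I v))
      (q - F.ssf.length) v).map (Ctl.claim t) := by
  have : (fun v => (s v).send F) = fun v =>
      (if fires F.ssf (q - F.ssf.length) (net.label v) then
        claimTok (net.label v) (I v) else none).map (Ctl.claim t) := by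
    funext v
    unfold State.send
    rw [hp, emit_claim ht hq hq']
  unfold heard
  rw [this]
  exact hear_map M net _ _ v

theorem At.round_claim (h : At M net F hold t a b o I C) (hq : F.ssf.length ≤ q)
    (hq' : q + 1 < 2 * F.ssf.length) :
    At M net F hold (t + 1) a b o I fun v => C v ++
      (hears M net F.ssf (fun v => claimTok (net.label v) (I v)) (q - F.ssf.length) v).toList := by
  obtain ⟨s, hs, hp⟩ := h
  have h1 := At.heard_claim ht hp hq (by omega)
  have h2 : ∀ v, (s v).recv F (heard M net F s v) = calm M net (t + 1) a b o I (fun v => C v ++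
      (hears M net F.ssf (fun v => claimTok (net.label v) (I v))
        (q - F.ssf.length) v).toList) v := by
    intro v
    rw [h1, recv_claim (hp v), close_eq_of_lt ht hq']
    rfl
  have h3 := hs.step (fun v m _ hm => by
    rw [h1] at hm
    obtain ⟨p, -, rfl⟩ := Option.map_eq_some_iff.1 hm
    rfl) (fun v => by rw [h2]; simp [calm, Tour.idle])
  simp only [h2] at h3
  exact Sim.at (by omega) h3

omit ht

theorem settle_timer {s : Trav.State} (h : s.tour.timer = none) : s.settle.tour.timer = none := by
  unfold State.settle
  split
  · exact h
  · simp only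
    split
    · exact h
    · rw [State.handle_eq _ rfl rfl]
      simp only
      split_ifs
      · rfl
      · exact h

include ht

theorem At.round_settle (h : At M net F hold t a b o I C) (hq : F.ssf.length ≤ q)
    (hq' : q + 1 = 2 * F.ssf.length) :
    Sim M net F hold (t + 1) fun v => (calm M net t a b o I (fun v => C v ++
      (hears M net F.ssf (fun v => claimTok (net.label v) (I v))
        (q - F.ssf.length) v).toList) v).settle.bump := by
  obtain ⟨s, hs, hp⟩ := h
  have h1 := At.heard_claim ht hp hq (by omega)
  have h2 : ∀ v, (s v).recv F (heard M net F s v) = (calm M net t a b o I (fun v => C v ++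
      (hears M net F.ssf (fun v => claimTok (net.label v) (I v))
        (q - F.ssf.length) v).toList) v).settle.bump := by
    intro v
    rw [h1, recv_claim (hp v), close_eq_settle ht hq']
    rfl
  have h3 := hs.step (fun v m _ hm => by
    rw [h1] at hm
    obtain ⟨p, -, rfl⟩ := Option.map_eq_some_iff.1 hm
    rfl) (fun v => by
      rw [h2]
      exact fun h => by
        have h' := settle_timer (s := calm M net t a b o I (fun v => C v ++
          (hears M net F.ssf (fun v => claimTok (net.label v) (I v))
            (q - F.ssf.length) v).toList) v) rfl
        exact Option.some_ne_none 0 (h.symm.trans h'))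
  simp only [h2] at h3
  exact h3

omit ht

theorem At.transmitted (h : At M net F hold t a b o I C) {v : V} {m : Msg Ctl R}
    (hm : transmitted (btdProtocol R F) (run M net F hold t) v = some m) :
    (calm M net t a b o I C v).emit F = some m.ctl := by
  obtain ⟨s, hs, hp⟩ := h
  rw [hs.transmitted_eq] at hm
  unfold State.send at hm
  rw [hp] at hm
  obtain ⟨c, hc, rfl⟩ := Option.map_eq_some_iff.1 hm
  exact hc

/-- An execution of `Smallest_Token`. -/
theorem At.superround (hl : 0 < F.ssf.length)
    (ht : t = F.sel.flatten.length + 2 * F.ssf.length * j)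
    (h : At M net F hold t a b o (fun _ => []) fun _ => []) :
    (Sim M net F hold (t + 2 * F.ssf.length) fun v =>
      (calm M net (t + (2 * F.ssf.length - 1)) a b o (collect M net F.ssf o F.ssf.length)
        (collect M net F.ssf (fun v => claimTok (net.label v)
          (collect M net F.ssf o F.ssf.length v)) F.ssf.length) v).settle.bump) ∧
    ∀ B, 5 ≤ B → t + 2 * F.ssf.length ≤ B →
      (∀ v m, o v = some m → m.tok ≤ B ∧ m.src ≤ B ∧ m.dst ≤ B) →
      ∀ q < 2 * F.ssf.length, ∀ v (m : Msg Ctl R),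
        Sinr.transmitted (btdProtocol R F) (run M net F hold (t + q)) v = some m →
          m.ctl.Bounded B := by
  have h1 : ∀ q ≤ F.ssf.length,
      At M net F hold (t + q) a b o (collect M net F.ssf o q) fun _ => [] := by
    intro q hq
    induction q with
    | zero => exact h
    | succ q ih =>
      have := (ih (by omega)).round_pass (j := j) (q := q) (by omega) (by omega)
      have e : collect M net F.ssf o (q + 1) = _ := funext (collect_succ M net F.ssf o q)
      rw [e]
      exact this
  set I := collect M net F.ssf o F.ssf.length with hI
  set x : V → Option ℕ := fun v => claimTok (net.label v) (I v) with hx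
  have h2 : ∀ q < F.ssf.length,
      At M net F hold (t + F.ssf.length + q) a b o I (collect M net F.ssf x q) := by
    intro q hq
    induction q with
    | zero => exact h1 _ le_rfl
    | succ q ih =>
      have := (ih (by omega)).round_claim (j := j) (q := F.ssf.length + q) (by omega) (by omega)
        (by omega)
      rw [Nat.add_sub_cancel_left] at this
      have e : collect M net F.ssf x (q + 1) = _ := funext (collect_succ M net F.ssf x q)
      rw [e]
      exact this
  constructor
  · have := (h2 (F.ssf.length - 1) (by omega)).round_settle (j := j)
      (q := F.ssf.length + (F.ssf.length - 1)) (by omega) (by omega) (by omega)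
    rw [Nat.add_sub_cancel_left] at this
    have e1 : t + F.ssf.length + (F.ssf.length - 1) = t + (2 * F.ssf.length - 1) := by omega
    have e2 : t + (2 * F.ssf.length - 1) + 1 = t + 2 * F.ssf.length := by omega
    have e3 : F.ssf.length - 1 + 1 = F.ssf.length := by omega
    rw [e1, e2] at this
    simp only [← collect_succ, ← hx] at this
    rw [e3] at this
    exact this
  · intro B hB htB ho q hq v m hm
    rcases lt_or_ge q F.ssf.length with hql | hql
    · have := (h1 q hql.le).transmitted hm
      rw [emit_pass (j := j) (by omega) hql] at this
      obtain ⟨p, hp, hpm⟩ := Option.map_eq_some_iff.1 this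
      have hp' : o v = some p := by
        split_ifs at hp
        exact hp
      obtain ⟨k1, k2, k3⟩ := ho v p hp'
      have hk : p.kind.code ≤ 2 := by cases p.kind <;> simp [Kind.code]
      rw [← hpm]
      intro y hy
      simp only [Ctl.fields, List.mem_cons, List.not_mem_nil, or_false] at hy
      omega
    · have := (h2 (q - F.ssf.length) (by omega)).transmitted (by
        rwa [show t + F.ssf.length + (q - F.ssf.length) = t + q by omega])
      rw [emit_claim (j := j) (q := q) (by omega) hql hq] at this
      obtain ⟨τ, hp, hpm⟩ := Option.map_eq_some_iff.1 this
      have hp' : claimTok (net.label v) (I v) = some τ := by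
        split_ifs at hp
        exact hp
      have hτ := List.min?_mem hp'
      obtain ⟨p, hp1, rfl⟩ := List.mem_map.1 hτ
      have hp2 := (List.mem_filter.1 hp1).1
      rw [hI] at hp2
      obtain ⟨i, -, hi⟩ := List.mem_filterMap.1 hp2
      obtain ⟨u, -, hu⟩ := adj_of_hear M net hi
      have hu' : o u = some p := by
        split_ifs at hu
        exact hu
      obtain ⟨k1, k2, k3⟩ := ho u p hu'
      rw [← hpm]
      intro y hy
      simp only [Ctl.fields, List.mem_cons, List.not_mem_nil, or_false] at hy
      omega

end Superround

end Sinr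

namespace Sinr

open Trav

/-! ## The end of an execution of `Smallest_Token` -/

/-- The record of a node that joins the traversal of `τ`, the labels of its neighbours being `l`. -/
def freshBtd (l : List ℕ) (τ : ℕ) : Btd := ⟨τ, false, false, none, l.erase τ, [], []⟩

/-- The token ids known to a node. -/
def toks (b : Option Btd) (I : List Pass) (C : List ℕ) : List ℕ :=
  (b.map Btd.tok).toList ++ I.map Pass.tok ++ C

/-- The record with which a node takes part in the traversal of `τ`. -/
def joined (l : List ℕ) (b : Option Btd) (τ : ℕ) : Btd :=
  match b with
  | some b => if b.tok = τ then b else freshBtd l τ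
  | none => freshBtd l τ

/-- The record and the message of a node after an execution of `Smallest_Token`, and whether it has
found out that the traversal is complete. -/
def settled (id : ℕ) (l : List ℕ) (b : Option Btd) (I : List Pass) (C : List ℕ) :
    Option Btd × Option Pass × Bool :=
  match (toks b I C).min? with
  | none => (b, none, false)
  | some τ =>
    match I.find? (fun m => decide (m.tok = τ)) with
    | none => (some (joined l b τ), none, false)
    | some m => (some (handleBtd id (joined l b τ) m).1, (handleBtd id (joined l b τ) m).2,
        decide (m.dst = id ∧ (handleBtd id (joined l b τ) m).2 = none))

theorem settled_cases (id : ℕ) (l : List ℕ) (b : Option Btd) (I : List Pass) (C : List ℕ) :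
    (toks b I C = [] ∧ settled id l b I C = (b, none, false)) ∨
    ∃ τ ∈ toks b I C, (∀ σ ∈ toks b I C, τ ≤ σ) ∧
      (((∀ m ∈ I, m.tok ≠ τ) ∧ settled id l b I C = (some (joined l b τ), none, false)) ∨
        ∃ m ∈ I, m.tok = τ ∧ settled id l b I C =
          (some (handleBtd id (joined l b τ) m).1, (handleBtd id (joined l b τ) m).2,
            decide (m.dst = id ∧ (handleBtd id (joined l b τ) m).2 = none))) := by
  unfold settled
  cases h : (toks b I C).min? with
  | none => exact .inl ⟨List.min?_eq_none_iff.1 h, rfl⟩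
  | some τ =>
    obtain ⟨h1, h2⟩ := List.min?_eq_some_iff.1 h
    refine .inr ⟨τ, h1, h2, ?_⟩
    cases hf : I.find? (fun m => decide (m.tok = τ)) with
    | none =>
      left
      exact ⟨fun m hm => by simpa using List.find?_eq_none.1 hf m hm, by simp only [hf]⟩
    | some m =>
      right
      exact ⟨m, List.mem_of_find?_eq_some hf, by simpa using List.find?_some hf,
        by simp only [hf]⟩

theorem handleBtd_tok (id : ℕ) (b : Btd) (m : Pass) : (handleBtd id b m).1.tok = b.tok := by
  have h : ∀ b : Btd, (advanceBtd id b).1.tok = b.tok := by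
    rintro ⟨tok, vis, mk, par, un, q, c⟩
    cases un <;> cases q <;> cases par <;> rfl
  unfold handleBtd
  split_ifs <;> cases m.kind <;> simp only <;> (try rw [h])

theorem joined_tok (l : List ℕ) (b : Option Btd) (τ : ℕ) : (joined l b τ).tok = τ := by
  unfold joined
  cases b with
  | none => rfl
  | some b =>
    simp only
    split_ifs with h
    · exact h
    · rfl

theorem handleBtd_snd_of_ne {id : ℕ} {b : Btd} {m : Pass} (h : m.dst ≠ id) :
    (handleBtd id b m).2 = none := by
  unfold handleBtd
  rw [if_neg h]
  cases m.kind <;> rfl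

/-- A destination that has nothing to send has no parent; thus a traversal can only be completed at
its root. -/
theorem handleBtd_parent_of_none {id : ℕ} {b : Btd} {m : Pass} (h : m.dst = id)
    (h' : (handleBtd id b m).2 = none) : (handleBtd id b m).1.parent = none := by
  have key : ∀ b : Btd, (advanceBtd id b).2 = none → (advanceBtd id b).1.parent = none := by
    rintro ⟨tok, vis, mk, par, un, q, c⟩
    cases un <;> cases q <;> cases par <;> simp [advanceBtd]
  unfold handleBtd at h' ⊢
  simp only [if_pos h] at h' ⊢
  cases hk : m.kind <;> simp only [hk] at h' ⊢
  · split_ifs at h' ⊢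
    · exact key _ h'
    · exact key _ h'
  · cases h'
  · exact key _ h'

section Contest

variable {V : Type*} [Fintype V] {N : ℕ} (M : Model) (net : Network V N)

theorem settle_mk (id : ℕ) (l : List ℕ) (t : ℕ) (a : Bool) (b : Option Btd) (o : Option Pass)
    (I : List Pass) (C : List ℕ) :
    (⟨id, l, t, a, b, o, I, C, Tour.idle⟩ : Trav.State).settle =
      ⟨id, l, t, a, (settled id l b I C).1, (settled id l b I C).2.1, [], [],
        if (settled id l b I C).2.2 then
          Tour.start (((settled id l b I C).1.map Btd.children).getD []) 1 else Tour.idle⟩ := by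
  unfold State.settle settled
  change (match (toks b I C).min? with
    | none => _
    | some τ => _) = _
  cases b <;> cases h : (toks _ I C).min? with
  | none => rfl
  | some τ =>
    simp only
    cases hf : I.find? (fun m => decide (m.tok = τ)) with
    | none => rfl
    | some m =>
      simp only
      rw [State.handle_eq m rfl rfl]
      simp [joined, State.fresh, freshBtd]
      exact if_congr decide_eq_true_iff.symm rfl rfl

theorem settle_calm (t : ℕ) (a : V → Bool) (b : V → Option Btd) (o : V → Option Pass)
    (I : V → List Pass) (C : V → List ℕ) (v : V) :
    (calm M net t a b o I C v).settle =
      let S := settled (net.label v) (nbrLabels M net v) (b v) (I v) (C v)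
      ⟨net.label v, nbrLabels M net v, t, a v, S.1, S.2.1, [], [],
        if S.2.2 then Tour.start ((S.1.map Btd.children).getD []) 1 else Tour.idle⟩ :=
  settle_mk _ _ _ _ _ _ _ _

open Classical in
/-- The state of the undisturbed traversal of the token of `ρ` after `j` messages. -/
noncomputable def tokenCfg (ρ : V) (j : ℕ) : Cfg V :=
  (deliver (commGraph M net) net.label)^[j]
    (startCfg net.label (nbrList M net) (net.label ρ) ρ)

theorem tokenCfg_succ (ρ : V) (j : ℕ) : tokenCfg M net ρ (j + 1) =
    deliver (commGraph M net) net.label (tokenCfg M net ρ j) :=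
  Function.iterate_succ_apply' _ _ _

variable {M net}

theorem tokenCfg_wf (ρ : V) (j : ℕ) :
    CfgWf (commGraph M net) net.label (net.label ρ) (tokenCfg M net ρ j) := by
  classical
  induction j with
  | zero => exact CfgWf.start (fun x y => mem_nbrList M net) ρ
  | succ j ih =>
    rw [tokenCfg_succ]
    exact ih.deliver net.label_injective

theorem tokenCfg_eq_of_none {ρ : V} {j k : ℕ} (hj : (tokenCfg M net ρ j).2 = none) (h : j ≤ k) :
    tokenCfg M net ρ k = tokenCfg M net ρ j := by
  induction k, h using Nat.le_induction with
  | base => rfl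
  | succ k _ ih =>
    rw [tokenCfg_succ, ih, deliver, hj]

/-- The traversals as they are at the beginning of an execution of `Smallest_Token`: `b` are the
records of the nodes and `o` the messages that they intend to send; `A` is the set of all roots and
`ρ₀` the root with the smallest label. -/
structure Contest (M : Model) (net : Network V N) (A : Finset V) (ρ₀ : V) (j : ℕ)
    (b : V → Option Btd) (o : V → Option Pass) : Prop where
  tok : ∀ v x, b v = some x → ∃ ρ ∈ A, x.tok = net.label ρ
  out : ∀ v m, o v = some m → ∃ ρ ∈ A, m.tok = net.label ρ ∧ m.src = net.label v ∧
    (tokenCfg M net ρ j).2 = some m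
  -- This clause and the next one concern tokens that are still held, and the smallest one. Nodes
  -- that know only larger ids, or none, are untouched by the undisturbed traversal of `ρ`, and
  -- nodes that have joined it have the right records. About nodes with smaller ids nothing is
  -- claimed: the token dies when it is addressed to one of them.
  behind : ∀ ρ ∈ A, ((∃ v m, o v = some m ∧ m.tok = net.label ρ) ∨ ρ = ρ₀) → ∀ v,
    (∀ x, b v = some x → net.label ρ < x.tok) →
      (tokenCfg M net ρ j).1 v = freshBtd (nbrLabels M net v) (net.label ρ)
  same : ∀ ρ ∈ A, ((∃ v m, o v = some m ∧ m.tok = net.label ρ) ∨ ρ = ρ₀) → ∀ v x,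
    b v = some x → x.tok = net.label ρ → (tokenCfg M net ρ j).1 v = x
  -- The smallest root never joins another traversal, so rivals that are still held have not visited
  -- it. This keeps them from becoming complete.
  unvisited : ∀ ρ ∈ A, ρ ≠ ρ₀ → (∃ v m, o v = some m ∧ m.tok = net.label ρ) →
    ((tokenCfg M net ρ j).1 ρ₀).visited = false
  root : ∃ x, b ρ₀ = some x ∧ x.tok = net.label ρ₀
  holder : ∀ m, (tokenCfg M net ρ₀ j).2 = some m → ∃ v, o v = some m
  held : ∀ v m, o v = some m → ∃ x, b v = some x ∧ x.tok = m.tok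

variable {A : Finset V} {ρ₀ : V} {j : ℕ} {b : V → Option Btd} {o : V → Option Pass}
  {I : V → List Pass} {C : V → List ℕ}

/-- A message in circulation is the one that the undisturbed traversal of its token sends at step
`j`, so the token id determines the message and its sender. -/
theorem Contest.unique (h : Contest M net A ρ₀ j b o) {u u' : V} {m m' : Pass} (hu : o u = some m)
    (hu' : o u' = some m') (ht : m.tok = m'.tok) : m = m' ∧ u = u' := by
  obtain ⟨ρ, -, h1, h2, h3⟩ := h.out u m hu
  obtain ⟨ρ', -, h1', h2', h3'⟩ := h.out u' m' hu'
  have hρ : ρ = ρ' := net.label_injective (by rw [← h1, ← h1', ht])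
  subst hρ
  rw [h3] at h3'
  have hm := Option.some.inj h3'
  refine ⟨hm, net.label_injective ?_⟩
  rw [← h2, ← h2', hm]

/-- What a node does at the end of `Smallest_Token`. -/
theorem Contest.cases (h : Contest M net A ρ₀ j b o) (hρ : ρ₀ ∈ A)
    (hI : ∀ v m, m ∈ I v ↔ ∃ u, (commGraph M net).Adj u v ∧ o u = some m)
    (hC : ∀ v τ, τ ∈ C v ↔ ∃ u, (commGraph M net).Adj u v ∧ claimTok (net.label u) (I u) = some τ)
    (v : V) :
    (toks (b v) (I v) (C v) = [] ∧
      settled (net.label v) (nbrLabels M net v) (b v) (I v) (C v) = (none, none, false)) ∨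
    ∃ ρ ∈ A, net.label ρ ∈ toks (b v) (I v) (C v) ∧
      (∀ σ ∈ toks (b v) (I v) (C v), net.label ρ ≤ σ) ∧
      (((∀ m ∈ I v, m.tok ≠ net.label ρ) ∧
        settled (net.label v) (nbrLabels M net v) (b v) (I v) (C v) =
          (some (joined (nbrLabels M net v) (b v) (net.label ρ)), none, false) ∧
        (ρ = ρ₀ → joined (nbrLabels M net v) (b v) (net.label ρ) = (tokenCfg M net ρ j).1 v) ∧
        ((∃ v m, o v = some m ∧ m.tok = net.label ρ) →
          joined (nbrLabels M net v) (b v) (net.label ρ) = (tokenCfg M net ρ j).1 v)) ∨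
      ∃ u m, (commGraph M net).Adj u v ∧ o u = some m ∧ m.tok = net.label ρ ∧ m ∈ I v ∧
        (tokenCfg M net ρ j).2 = some m ∧ m.src = net.label u ∧
        settled (net.label v) (nbrLabels M net v) (b v) (I v) (C v) =
          (some (handleBtd (net.label v) ((tokenCfg M net ρ j).1 v) m).1,
            (handleBtd (net.label v) ((tokenCfg M net ρ j).1 v) m).2,
            decide (m.dst = net.label v ∧
              (handleBtd (net.label v) ((tokenCfg M net ρ j).1 v) m).2 = none))) := by
  have hclaim : ∀ u τ, claimTok (net.label u) (I u) = some τ → ∃ m ∈ I u, m.tok = τ := by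
    intro u τ hu
    obtain ⟨m, hm, hmt⟩ := List.mem_map.1 (List.min?_mem hu)
    exact ⟨m, (List.mem_filter.1 hm).1, hmt⟩
  have htok : ∀ v, ∀ m ∈ I v, ∃ ρ ∈ A, m.tok = net.label ρ := by
    intro v m hm
    obtain ⟨u, -, hu⟩ := (hI v m).1 hm
    obtain ⟨ρ, h1, h2, -⟩ := h.out u m hu
    exact ⟨ρ, h1, h2⟩
  rcases settled_cases (net.label v) (nbrLabels M net v) (b v) (I v) (C v) with
    ⟨h1, h2⟩ | ⟨τ, h1, h2, h3⟩
  · refine .inl ⟨h1, ?_⟩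
    have : b v = none := by
      cases hb : b v with
      | none => rfl
      | some x => rw [hb] at h1; simp [toks] at h1
    rw [h2, this]
  · right
    obtain ⟨ρ, hρA, rfl⟩ : ∃ ρ ∈ A, τ = net.label ρ := by
      rcases List.mem_append.1 h1 with h1 | h1
      · rcases List.mem_append.1 h1 with h1 | h1
        · cases hb : b v with
          | none => rw [hb] at h1; simp at h1
          | some x =>
            rw [hb] at h1
            obtain rfl : τ = x.tok := by simpa using h1
            exact h.tok v x hb
        · obtain ⟨m, hm, rfl⟩ := List.mem_map.1 h1
          exact htok v m hm
      · obtain ⟨u, -, hu⟩ := (hC v τ).1 h1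
        obtain ⟨m, hm, rfl⟩ := hclaim u τ hu
        exact htok u m hm
    -- A node that already belongs to `ρ` keeps its record; any other one has no record or, by
    -- minimality, one with a larger id, and starts with a fresh record. Both agree with the
    -- undisturbed traversal.
    have hj : ((∃ v m, o v = some m ∧ m.tok = net.label ρ) ∨ ρ = ρ₀) →
        joined (nbrLabels M net v) (b v) (net.label ρ) = (tokenCfg M net ρ j).1 v := by
      intro hal
      unfold joined
      cases hb : b v with
      | none => exact (h.behind ρ hρA hal v (by simp [hb])).symm
      | some x =>
        simp only
        split_ifs with hx
        · exact (h.same ρ hρA hal v x hb hx).symm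
        · refine (h.behind ρ hρA hal v fun y hy => ?_).symm
          obtain rfl : x = y := Option.some.inj (hb.symm.trans hy)
          refine lt_of_le_of_ne (h2 _ ?_) (Ne.symm hx)
          simp [toks, hb]
    refine ⟨ρ, hρA, h1, h2, ?_⟩
    rcases h3 with ⟨h3, h4⟩ | ⟨m, hm, hmt, h4⟩
    · exact .inl ⟨h3, h4, fun hr => hj (.inr hr), fun hr => hj (.inl hr)⟩
    · right
      obtain ⟨u, hu, hum⟩ := (hI v m).1 hm
      obtain ⟨ρ', -, h5, h6, h7⟩ := h.out u m hum
      obtain rfl : ρ' = ρ := net.label_injective (by rw [← h5, hmt])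
      rw [hj (.inl ⟨u, m, hum, hmt⟩)] at h4
      exact ⟨u, m, hu, hum, hmt, hm, h7, h6, h4⟩

open Classical in
theorem tokenCfg_succ_of_some {ρ u : V} {m : Pass} (hm : (tokenCfg M net ρ j).2 = some m)
    (hu : m.src = net.label u) :
    ∃ z, (commGraph M net).Adj u z ∧ m.dst = net.label z ∧
      (tokenCfg M net ρ (j + 1)).1 = (fun v => if (commGraph M net).Adj u v then
        (handleBtd (net.label v) ((tokenCfg M net ρ j).1 v) m).1 else (tokenCfg M net ρ j).1 v) ∧
      (tokenCfg M net ρ (j + 1)).2 = (handleBtd (net.label z) ((tokenCfg M net ρ j).1 z) m).2 := by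
  obtain ⟨k, h', z, hz, rfl⟩ := (tokenCfg_wf ρ j).msg m hm
  obtain rfl : h' = u := net.label_injective hu
  refine ⟨z, hz, rfl, ?_⟩
  have : tokenCfg M net ρ j = ((tokenCfg M net ρ j).1, some ⟨k, net.label ρ, net.label h',
    net.label z⟩) := by rw [← hm]
  rw [tokenCfg_succ, this, deliver_eq _ net.label_injective]
  exact ⟨rfl, rfl⟩

/-- An execution of `Smallest_Token`: the traversal of the smallest token is not disturbed. -/
theorem Contest.step (h : Contest M net A ρ₀ j b o) (hρ : ρ₀ ∈ A)
    (hmin : ∀ ρ ∈ A, net.label ρ₀ ≤ net.label ρ)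
    (hI : ∀ v m, m ∈ I v ↔ ∃ u, (commGraph M net).Adj u v ∧ o u = some m)
    (hC : ∀ v τ, τ ∈ C v ↔ ∃ u, (commGraph M net).Adj u v ∧
      claimTok (net.label u) (I u) = some τ)
    (S : V → Option Btd × Option Pass × Bool)
    (hS : ∀ v, S v = settled (net.label v) (nbrLabels M net v) (b v) (I v) (C v)) :
    Contest M net A ρ₀ (j + 1) (fun v => (S v).1) (fun v => (S v).2.1) := by
  classical
  have key := fun v => hS v ▸ h.cases hρ hI hC v
  have hsub : ∀ v x, b v = some x → x.tok ∈ toks (b v) (I v) (C v) := by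
    intro v x hx
    simp [toks, hx]
  have hsubI : ∀ v, ∀ m ∈ I v, m.tok ∈ toks (b v) (I v) (C v) := by
    intro v m hm
    exact List.mem_append_left _ (List.mem_append_right _ (List.mem_map_of_mem hm))
  -- messages of the next execution come from messages of this one
  have hout : ∀ v m', (S v).2.1 = some m' → ∃ ρ ∈ A, ∃ u m, o u = some m ∧
      m.tok = net.label ρ ∧ m.src = net.label u ∧ (tokenCfg M net ρ j).2 = some m ∧
      m.dst = net.label v ∧ m'.tok = net.label ρ ∧ m'.src = net.label v ∧
      (tokenCfg M net ρ (j + 1)).2 = some m' ∧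
      (∀ σ ∈ toks (b v) (I v) (C v), net.label ρ ≤ σ) := by
    intro v m' hm'
    rcases key v with ⟨-, h2⟩ | ⟨ρ, hA, -, h2, ⟨-, h3, -⟩ | ⟨u, m, h3, h4, h5, h6, h7, h8, h9⟩⟩
    · rw [h2] at hm'; cases hm'
    · rw [h3] at hm'; cases hm'
    · rw [h9] at hm'
      simp only at hm'
      obtain ⟨z, hz, hd, -, hc⟩ := tokenCfg_succ_of_some h7 h8
      have hzv : m.dst = net.label v := by
        by_contra hne
        rw [handleBtd_snd_of_ne hne] at hm'
        cases hm'
      obtain rfl : z = v := net.label_injective (hd ▸ hzv)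
      rw [hm'] at hc
      obtain ⟨k, x, y, hxy, he⟩ := (tokenCfg_wf ρ (j + 1)).msg m' hc
      refine ⟨ρ, hA, u, m, h4, h5, h8, h7, hzv, by rw [he], ?_, hc, h2⟩
      obtain ⟨k', h', w, hw, rfl⟩ := (tokenCfg_wf ρ j).msg m h7
      obtain rfl : w = z := net.label_injective hd
      obtain ⟨k'', w', -, he'⟩ := (((tokenCfg_wf ρ j).btd w).handle hw k' (net.label w)).2 m' hm'
      rw [he']
  -- the record of a node after the execution
  have htok : ∀ v x, (S v).1 = some x → ∃ ρ ∈ A, x.tok = net.label ρ ∧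
      (∀ σ ∈ toks (b v) (I v) (C v), net.label ρ ≤ σ) ∧
      (((∃ v m, o v = some m ∧ m.tok = net.label ρ) ∨ ρ = ρ₀) →
        (tokenCfg M net ρ (j + 1)).1 v = x) := by
    intro v x hx
    rcases key v with ⟨-, h2⟩ | ⟨ρ, hA, h1, h2, ⟨h3, h4, h5, h6⟩ | ⟨u, m, h3, h4, h5, h6, h7, h8, h9⟩⟩
    · rw [h2] at hx; cases hx
    · rw [h4] at hx
      obtain rfl := Option.some.inj hx
      refine ⟨ρ, hA, joined_tok _ _ _, h2, fun hal => ?_⟩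
      have hj : joined (nbrLabels M net v) (b v) (net.label ρ) = (tokenCfg M net ρ j).1 v := by
        rcases hal with hal | hal
        · exact h6 hal
        · exact h5 hal
      rw [hj]
      -- As `v` has heard no message of this token, it is not adjacent to the holder, and the
      -- undisturbed traversal does not change its record either.
      cases hm : (tokenCfg M net ρ j).2 with
      | none => rw [tokenCfg_eq_of_none hm j.le_succ]
      | some m =>
        obtain ⟨u, hu⟩ : ∃ u, o u = some m := by
          rcases hal with ⟨u, m', hu, hmt⟩ | rfl
          · obtain ⟨ρ', -, k1, k2, k3⟩ := h.out u m' hu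
            obtain rfl : ρ' = ρ := net.label_injective (k1 ▸ hmt)
            rw [hm] at k3
            exact ⟨u, by rw [hu, k3]⟩
          · exact h.holder m hm
        obtain ⟨ρ', -, k1, k2, k3⟩ := h.out u m hu
        obtain ⟨k, x, y, hxy, he⟩ := (tokenCfg_wf ρ j).msg m hm
        have hmt : m.tok = net.label ρ := by rw [he]
        obtain ⟨z, -, -, hc, -⟩ := tokenCfg_succ_of_some hm k2
        rw [hc]
        refine if_neg fun huv => h3 m ((hI v m).2 ⟨u, huv, hu⟩) hmt
    · rw [h9] at hx
      obtain rfl := Option.some.inj hx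
      have hb := (tokenCfg_wf (M := M) (net := net) ρ j).btd v
      refine ⟨ρ, hA, by rw [handleBtd_tok, hb.tok], h2, fun _ => ?_⟩
      obtain ⟨z, -, -, hc, -⟩ := tokenCfg_succ_of_some h7 h8
      rw [hc]
      exact if_pos h3
  have halive : ∀ ρ, (∃ v m, (S v).2.1 = some m ∧ m.tok = net.label ρ) →
      ∃ v m, o v = some m ∧ m.tok = net.label ρ := by
    rintro ρ ⟨v, m', hm', ht⟩
    obtain ⟨ρ', -, u, m, h1, h2, -, -, -, h3, -⟩ := hout v m' hm'
    exact ⟨u, m, h1, by rw [h2, ← h3, ht]⟩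
  -- No token beats the smallest one: every node that hears it, and its root, settle on it.
  have hroot : ∀ v, (∃ m ∈ I v, m.tok = net.label ρ₀) ∨ v = ρ₀ → ∀ ρ ∈ A,
      (∀ σ ∈ toks (b v) (I v) (C v), net.label ρ ≤ σ) → ρ = ρ₀ := by
    intro v hv ρ hA hle
    refine net.label_injective (le_antisymm ?_ (hmin ρ hA))
    rcases hv with ⟨m, hm, ht⟩ | rfl
    · exact ht ▸ hle _ (hsubI v m hm)
    · obtain ⟨x, hx, ht⟩ := h.root
      exact ht ▸ hle _ (hsub v x hx)
  refine ⟨?_, ?_, ?_, ?_, ?_, ?_, ?_, ?_⟩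
  · intro v x hx
    obtain ⟨ρ, h1, h2, -⟩ := htok v x hx
    exact ⟨ρ, h1, h2⟩
  · intro v m' hm'
    obtain ⟨ρ, h1, u, m, -, -, -, -, -, h2, h3, h4, -⟩ := hout v m' hm'
    exact ⟨ρ, h1, h2, h3, h4⟩
  · intro ρ hA hal v hx
    have hal' : (∃ v m, o v = some m ∧ m.tok = net.label ρ) ∨ ρ = ρ₀ := hal.imp_left (halive ρ)
    -- all token ids known to `v` are larger
    have hlt : ∀ σ ∈ toks (b v) (I v) (C v), net.label ρ < σ := by
      intro σ hσ
      rcases key v with ⟨h1, -⟩ | ⟨ρ', hA', h1, h2, h3⟩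
      · rw [h1] at hσ; cases hσ
      · refine lt_of_lt_of_le ?_ (h2 σ hσ)
        rcases h3 with ⟨-, h4, -⟩ | ⟨u, m, -, -, -, -, -, -, h9⟩
        · have := hx _ (by rw [h4])
          rwa [joined_tok] at this
        · have := hx _ (by rw [h9])
          rwa [handleBtd_tok, ((tokenCfg_wf ρ' j).btd v).tok] at this
    rw [← h.behind ρ hA hal' v fun x hx => hlt _ (hsub v x hx)]
    cases hm : (tokenCfg M net ρ j).2 with
    | none => rw [tokenCfg_eq_of_none hm j.le_succ]
    | some m =>
      obtain ⟨u, hu⟩ : ∃ u, o u = some m := by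
        rcases hal' with ⟨u, m', hu, hmt⟩ | rfl
        · obtain ⟨ρ', -, k1, k2, k3⟩ := h.out u m' hu
          obtain rfl : ρ' = ρ := net.label_injective (k1 ▸ hmt)
          rw [hm] at k3
          exact ⟨u, by rw [hu, k3]⟩
        · exact h.holder m hm
      obtain ⟨ρ', -, k1, k2, k3⟩ := h.out u m hu
      obtain ⟨k, x, y, hxy, he⟩ := (tokenCfg_wf ρ j).msg m hm
      have hmt : m.tok = net.label ρ := by rw [he]
      obtain ⟨z, -, -, hc, -⟩ := tokenCfg_succ_of_some hm k2
      rw [hc]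
      refine if_neg fun huv => ?_
      exact (hlt _ (hsubI v m ((hI v m).2 ⟨u, huv, hu⟩))).ne' hmt
  · intro ρ hA hal v x hx hxt
    obtain ⟨ρ', -, h1, -, h2⟩ := htok v x hx
    obtain rfl : ρ' = ρ := net.label_injective (h1 ▸ hxt)
    exact h2 (hal.imp_left (halive ρ'))
  -- If a rival visited `ρ₀` in this step, its message would be addressed to `ρ₀`. As the token is
  -- still held, `ρ₀` would have accepted it, which `hroot` excludes.
  · intro ρ hA hne hal
    by_contra hv
    obtain ⟨v, m', hm', ht⟩ := hal
    obtain ⟨m₁, h1, h2⟩ := dst_of_visited (h.unvisited ρ hA hne (halive ρ ⟨v, m', hm', ht⟩))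
      (by rw [← tokenCfg_succ]; simpa using hv)
    obtain ⟨ρ', -, u, m, -, k2, -, k4, k5, k6, -, -, k9⟩ := hout v m' hm'
    obtain rfl : ρ' = ρ := net.label_injective (k6 ▸ ht)
    obtain rfl : m₁ = m := Option.some.inj (h1.symm.trans k4)
    obtain rfl : v = ρ₀ := net.label_injective (k5 ▸ h2)
    exact hne (hroot v (.inr rfl) ρ' hA k9)
  · rcases key ρ₀ with ⟨h1, -⟩ | ⟨ρ, hA, h1, h2, h3⟩
    · obtain ⟨x, hx, -⟩ := h.root
      have := hsub _ x hx
      rw [h1] at this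
      cases this
    · obtain rfl := hroot ρ₀ (.inr rfl) ρ hA h2
      rcases h3 with ⟨-, h4, -⟩ | ⟨u, m, -, -, -, -, -, -, h9⟩
      · exact ⟨_, by rw [h4], joined_tok _ _ _⟩
      · exact ⟨_, by rw [h9], by rw [handleBtd_tok, ((tokenCfg_wf ρ j).btd ρ).tok]⟩
  · intro m' hm'
    cases hm : (tokenCfg M net ρ₀ j).2 with
    | none =>
      rw [tokenCfg_eq_of_none hm j.le_succ, hm] at hm'
      cases hm'
    | some m =>
      obtain ⟨u, hu⟩ := h.holder m hm
      obtain ⟨ρ', -, k1, k2, k3⟩ := h.out u m hu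
      obtain ⟨k, x, y, hxy, he⟩ := (tokenCfg_wf ρ₀ j).msg m hm
      have hmt : m.tok = net.label ρ₀ := by rw [he]
      obtain ⟨z, hz, hd, -, hc⟩ := tokenCfg_succ_of_some hm k2
      have hmz := (hI z m).2 ⟨u, hz, hu⟩
      refine ⟨z, ?_⟩
      rcases key z with ⟨h1, -⟩ | ⟨ρ, hA, h1, h2, h3⟩
      · have := hsubI z m hmz
        rw [h1] at this
        cases this
      · obtain rfl := hroot z (.inl ⟨m, hmz, hmt⟩) ρ hA h2
        rcases h3 with ⟨h3, -⟩ | ⟨u', m₁, -, -, -, -, k7, -, k9⟩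
        · exact absurd hmt (h3 m hmz)
        · obtain rfl : m = m₁ := Option.some.inj (hm.symm.trans k7)
          rw [k9, ← hm', hc]
  · intro v m' hm'
    rcases key v with ⟨-, h2⟩ | ⟨ρ, hA, -, h2, ⟨-, h3, -⟩ | ⟨u, m, h3, h4, h5, h6, h7, h8, h9⟩⟩
    · rw [h2] at hm'; cases hm'
    · rw [h3] at hm'; cases hm'
    · obtain ⟨ρ', -, u', m₁, -, k2, -, -, -, k6, -, -, k9⟩ := hout v m' hm'
      refine ⟨_, by rw [h9], ?_⟩
      rw [handleBtd_tok, ((tokenCfg_wf ρ j).btd v).tok, k6]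
      obtain ⟨z, hz, hd, -, hc⟩ := tokenCfg_succ_of_some h7 h8
      rw [h9] at hm'
      have hzv : m.dst = net.label v := by
        by_contra hne
        simp only [handleBtd_snd_of_ne hne] at hm'
        cases hm'
      obtain rfl : z = v := net.label_injective (hd ▸ hzv)
      obtain ⟨k, x, y, hxy, he⟩ := (tokenCfg_wf ρ (j + 1)).msg m' (hc.trans hm')
      rw [← k6, he]

end Contest

end Sinr

namespace Sinr

open Trav

/-! ### Completion of the smallest traversal, and sparsity of the holders -/

section Contest

variable {V : Type*} [Fintype V] {N : ℕ} {M : Model} {net : Network V N}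
  {A : Finset V} {ρ₀ : V} {j : ℕ} {b : V → Option Btd} {o : V → Option Pass}
  {I : V → List Pass} {C : V → List ℕ}

theorem Contest.eq_root (h : Contest M net A ρ₀ j b o)
    (hmin : ∀ ρ ∈ A, net.label ρ₀ ≤ net.label ρ) {v ρ : V} (hA : ρ ∈ A)
    (hle : ∀ σ ∈ toks (b v) (I v) (C v), net.label ρ ≤ σ)
    (hv : (∃ m ∈ I v, m.tok = net.label ρ₀) ∨ v = ρ₀) : ρ = ρ₀ := by
  refine net.label_injective (le_antisymm ?_ (hmin ρ hA))
  rcases hv with ⟨m, hm, ht⟩ | rfl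
  · exact ht ▸ hle _ (List.mem_append_left _ (List.mem_append_right _ (List.mem_map_of_mem hm)))
  · obtain ⟨x, hx, ht⟩ := h.root
    exact ht ▸ hle _ (by simp [toks, hx])

/-- The traversal that is complete first is that of the smallest token, and it is completed at its
root. -/
theorem Contest.started (h : Contest M net A ρ₀ j b o) (hρ : ρ₀ ∈ A)
    (hmin : ∀ ρ ∈ A, net.label ρ₀ ≤ net.label ρ)
    (hfin : ∀ ρ j, (tokenCfg M net ρ j).2 = none → ∀ v,
      ((tokenCfg M net ρ j).1 v).visited = true ∧
        (v ≠ ρ → ((tokenCfg M net ρ j).1 v).parent ≠ none))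
    (hI : ∀ v m, m ∈ I v ↔ ∃ u, (commGraph M net).Adj u v ∧ o u = some m)
    (hC : ∀ v τ, τ ∈ C v ↔ ∃ u, (commGraph M net).Adj u v ∧
      claimTok (net.label u) (I u) = some τ) (v : V) :
    (settled (net.label v) (nbrLabels M net v) (b v) (I v) (C v)).2.2 = true ↔
      v = ρ₀ ∧ (tokenCfg M net ρ₀ j).2 ≠ none ∧ (tokenCfg M net ρ₀ (j + 1)).2 = none := by
  classical
  have hto : ∀ v, (settled (net.label v) (nbrLabels M net v) (b v) (I v) (C v)).2.2 = true →
      v = ρ₀ ∧ (tokenCfg M net ρ₀ j).2 ≠ none ∧ (tokenCfg M net ρ₀ (j + 1)).2 = none := by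
    intro v hv
    rcases h.cases hρ hI hC v with
      ⟨-, h2⟩ | ⟨ρ, hA, -, h2, ⟨-, h3, -⟩ | ⟨u, m, h3, h4, h5, h6, h7, h8, h9⟩⟩
    · rw [h2] at hv; cases hv
    · rw [h3] at hv; cases hv
    · rw [h9] at hv
      obtain ⟨hd, hn⟩ := of_decide_eq_true hv
      obtain ⟨z, -, hz, hc1, hc2⟩ := tokenCfg_succ_of_some h7 h8
      obtain rfl : z = v := net.label_injective (hz ▸ hd)
      rw [hn] at hc2
      have hf := hfin ρ (j + 1) hc2
      -- A complete traversal has visited `ρ₀`. A rival had not done so before this step, hence its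
      -- last message was addressed to `ρ₀`, which settles only on its own token.
      have hρρ : ρ = ρ₀ := by
        by_contra hne
        obtain ⟨m₁, k1, k2⟩ := dst_of_visited (h.unvisited ρ hA hne ⟨u, m, h4, h5⟩)
          (by rw [← tokenCfg_succ]; exact (hf ρ₀).1)
        obtain rfl : m = m₁ := Option.some.inj (h7.symm.trans k1)
        exact hne (h.eq_root hmin hA h2 (.inr (net.label_injective (hd ▸ k2))))
      subst hρρ
      refine ⟨by_contra fun hne => (hf z).2 hne ?_, by rw [h7]; exact Option.some_ne_none m, hc2⟩
      rw [hc1]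
      simp only [if_pos h3]
      exact handleBtd_parent_of_none hd hn
  refine ⟨hto v, ?_⟩
  rintro ⟨rfl, hne, hnone⟩
  obtain ⟨m, hm⟩ := Option.ne_none_iff_exists'.1 hne
  obtain ⟨u, hu⟩ := h.holder m hm
  obtain ⟨ρ', -, k1, k2, k3⟩ := h.out u m hu
  obtain ⟨k, x, y, hxy, he⟩ := (tokenCfg_wf v j).msg m hm
  have hmt : m.tok = net.label v := by rw [he]
  obtain ⟨z, hz, hd, -, hc⟩ := tokenCfg_succ_of_some hm k2
  have hmz := (hI z m).2 ⟨u, hz, hu⟩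
  have hflag : (settled (net.label z) (nbrLabels M net z) (b z) (I z) (C z)).2.2 = true := by
    rcases h.cases hρ hI hC z with ⟨h1, -⟩ | ⟨ρ, hA, h1, h2, h3⟩
    · have : m.tok ∈ toks (b z) (I z) (C z) :=
        List.mem_append_left _ (List.mem_append_right _ (List.mem_map_of_mem hmz))
      rw [h1] at this
      cases this
    · obtain rfl := h.eq_root hmin hA h2 (.inl ⟨m, hmz, hmt⟩)
      rcases h3 with ⟨h3, -⟩ | ⟨u', m₁, -, -, -, -, k7, -, k9⟩
      · exact absurd hmt (h3 m hmz)
      · obtain rfl : m = m₁ := Option.some.inj (hm.symm.trans k7)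
        rw [k9]
        exact decide_eq_true ⟨hd, hc ▸ hnone⟩
  obtain rfl := (hto z hflag).1
  exact hflag

/-- After an execution of `Smallest_Token` there is at most one holder of a token in each box. -/
theorem Contest.sparse (h : Contest M net A ρ₀ j b o) (hρ : ρ₀ ∈ A)
    (hI : ∀ v m, m ∈ I v ↔ ∃ u, (commGraph M net).Adj u v ∧ o u = some m)
    (hC : ∀ v τ, τ ∈ C v ↔ ∃ u, (commGraph M net).Adj u v ∧
      claimTok (net.label u) (I u) = some τ) :
    Sparse M net (senders fun v =>
      (settled (net.label v) (nbrLabels M net v) (b v) (I v) (C v)).2.1) 1 := by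
  classical
  have key : ∀ v, (settled (net.label v) (nbrLabels M net v) (b v) (I v) (C v)).2.1 ≠ none →
      ∃ u m, o u = some m ∧ m.dst = net.label v ∧ (∀ σ ∈ C v, m.tok ≤ σ) ∧
        claimTok (net.label v) (I v) = some m.tok := by
    intro v hv
    rcases h.cases hρ hI hC v with
      ⟨-, h2⟩ | ⟨ρ, hA, -, h2, ⟨-, h3, -⟩ | ⟨u, m, h3, h4, h5, h6, h7, h8, h9⟩⟩
    · rw [h2] at hv; exact absurd rfl hv
    · rw [h3] at hv; exact absurd rfl hv
    · rw [h9] at hv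
      have hd : m.dst = net.label v := by
        by_contra hne
        exact hv (handleBtd_snd_of_ne hne)
      refine ⟨u, m, h4, hd, fun σ hσ => h5 ▸ h2 σ (List.mem_append_right _ hσ), ?_⟩
      refine List.min?_eq_some_iff.2 ⟨List.mem_map_of_mem (List.mem_filter.2 ⟨h6, by simp [hd]⟩), ?_⟩
      intro σ hσ
      obtain ⟨m', hm', rfl⟩ := List.mem_map.1 hσ
      exact h5 ▸ h2 _ (List.mem_append_left _ (List.mem_append_right _
        (List.mem_map_of_mem (List.mem_filter.1 hm').1)))
  intro β
  refine Finset.card_le_one.2 fun v hv v' hv' => by_contra fun hne => ?_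
  obtain ⟨hv, hvβ⟩ := Finset.mem_filter.1 hv
  obtain ⟨hv', hvβ'⟩ := Finset.mem_filter.1 hv'
  obtain ⟨u, m, h1, h2, h3, h4⟩ := key v ((mem_senders (e := fun v =>
    (settled (net.label v) (nbrLabels M net v) (b v) (I v) (C v)).2.1)).1 hv)
  obtain ⟨u', m', h1', h2', h3', h4'⟩ := key v' ((mem_senders (e := fun v =>
    (settled (net.label v) (nbrLabels M net v) (b v) (I v) (C v)).2.1)).1 hv')
  -- Both nodes claim the tokens that they accept, and being in the same cell they hear each other's
  -- claims. So neither token is smaller; equal tokens come from the same message, which has only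
  -- one destination.
  have hadj : (commGraph M net).Adj v v' := adj_of_box_eq M net hne (hvβ.trans hvβ'.symm)
  have e1 := h3' _ ((hC v' _).2 ⟨v, hadj, h4⟩)
  have e2 := h3 _ ((hC v _).2 ⟨v', hadj.symm, h4'⟩)
  obtain ⟨rfl, -⟩ := h.unique h1 h1' (le_antisymm e2 e1)
  exact hne (net.label_injective (h2.symm.trans h2'))

/-- The destinations of the messages of a sparse set of nodes are sparse. -/
theorem sparse_claimants {δ : ℕ} (ho : Sparse M net (senders o) δ)
    (hI : ∀ v m, m ∈ I v ↔ ∃ u, (commGraph M net).Adj u v ∧ o u = some m) :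
    Sparse M net (senders fun v => claimTok (net.label v) (I v)) (nb.card * δ) := by
  classical
  intro β
  -- A claimant is the destination of a message that comes from one of the `nb.card` cells around
  -- it, and every holder sends to one destination.
  have hsub : ((senders fun v => claimTok (net.label v) (I v)).filter
      fun v => box M net v = β) ⊆
      nb.biUnion fun d => ((senders o).filter fun u => box M net u = β - d).biUnion fun u =>
        Finset.univ.filter fun v => ∃ m, o u = some m ∧ m.dst = net.label v := by
    intro v hv
    obtain ⟨hv, hvβ⟩ := Finset.mem_filter.1 hv
    obtain ⟨τ, hτ⟩ := Option.ne_none_iff_exists'.1 (mem_senders.1 hv)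
    obtain ⟨m, hm, -⟩ := List.mem_map.1 (List.min?_mem hτ)
    obtain ⟨hm, hd⟩ := List.mem_filter.1 hm
    obtain ⟨u, hu, hum⟩ := (hI v m).1 hm
    refine Finset.mem_biUnion.2 ⟨_, box_sub_mem_nb M net hu.symm, ?_⟩
    refine Finset.mem_biUnion.2 ⟨u, Finset.mem_filter.2
      ⟨mem_senders.2 (by rw [hum]; exact Option.some_ne_none m), ?_⟩,
      Finset.mem_filter.2 ⟨Finset.mem_univ _, m, hum, of_decide_eq_true hd⟩⟩
    rw [← hvβ, sub_sub_cancel]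
  refine (Finset.card_le_card hsub).trans ?_
  refine Finset.card_biUnion_le_card_mul _ _ _ fun d _ => ?_
  refine (Finset.card_biUnion_le_card_mul _ _ 1 fun u _ => ?_).trans ?_
  · refine Finset.card_le_one.2 fun v hv v' hv' => net.label_injective ?_
    obtain ⟨m, h1, h2⟩ := (Finset.mem_filter.1 hv).2
    obtain ⟨m', h1', h2'⟩ := (Finset.mem_filter.1 hv').2
    rw [← h2, ← h2', Option.some.inj (h1.symm.trans h1')]
  · rw [mul_one]
    exact ho _

/-! ## The beginning of the traversals -/

theorem tokenCfg_zero_root (ρ : V) :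
    (tokenCfg M net ρ 0).1 ρ = (advanceBtd (net.label ρ)
      ⟨net.label ρ, true, false, none, (nbrLabels M net ρ).erase (net.label ρ), [], []⟩).1 ∧
    (tokenCfg M net ρ 0).2 = (advanceBtd (net.label ρ)
      ⟨net.label ρ, true, false, none, (nbrLabels M net ρ).erase (net.label ρ), [], []⟩).2 := by
  classical
  have h := blank_erase (τ := net.label ρ) net.label_injective (nbrList_nodup M net) ∅ ρ ρ
  have h' : (blank net.label (nbrList M net) (net.label ρ) ∅ ρ).unmarked = nbrLabels M net ρ := by
    rw [← map_nbrList]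
    simp [blank]
  rw [h'] at h
  have e : tokenCfg M net ρ 0 = startCfg net.label (nbrList M net) (net.label ρ) ρ := by
    unfold tokenCfg
    rw [Function.iterate_zero, id]
  rw [e]
  unfold startCfg goOn
  rw [h]
  simp

theorem tokenCfg_zero_of_ne {ρ v : V} (hv : v ≠ ρ) :
    (tokenCfg M net ρ 0).1 v = freshBtd (nbrLabels M net v) (net.label ρ) := by
  classical
  have h := blank_erase (τ := net.label ρ) net.label_injective (nbrList_nodup M net) ∅ v ρ
  have h' : (blank net.label (nbrList M net) (net.label ρ) ∅ v).unmarked = nbrLabels M net v := by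
    rw [← map_nbrList]
    simp [blank]
  rw [h'] at h
  have e : tokenCfg M net ρ 0 = startCfg net.label (nbrList M net) (net.label ρ) ρ := by
    unfold tokenCfg
    rw [Function.iterate_zero, id]
  rw [e]
  unfold startCfg goOn freshBtd
  rw [h]
  simp [blank, hv]

theorem advanceBtd_src {id : ℕ} {b : Btd} {m : Pass} (h : (advanceBtd id b).2 = some m) :
    m.src = id := by
  obtain ⟨tok, vis, mk, par, un, q, c⟩ := b
  cases un <;> cases q <;> cases par <;> simp [advanceBtd] at h <;> rw [← h]

open Classical in
theorem Contest.zero (hρ : ρ₀ ∈ A) :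
    Contest M net A ρ₀ 0 (fun v => if v ∈ A then some ((tokenCfg M net v 0).1 v) else none)
      (fun v => if v ∈ A then (tokenCfg M net v 0).2 else none) where
  tok v x hx := by
    split_ifs at hx with hv
    obtain rfl := Option.some.inj hx
    exact ⟨v, hv, ((tokenCfg_wf v 0).btd v).tok⟩
  out v m hm := by
    split_ifs at hm with hv
    refine ⟨v, hv, ?_, ?_, hm⟩
    · obtain ⟨k, x, y, hxy, he⟩ := (tokenCfg_wf v 0).msg m hm
      rw [he]
    · rw [(tokenCfg_zero_root v).2] at hm
      exact advanceBtd_src hm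
  behind ρ hA _ v hx := by
    refine tokenCfg_zero_of_ne ?_
    rintro rfl
    have := hx _ (if_pos hA)
    rw [((tokenCfg_wf v 0).btd v).tok] at this
    exact lt_irrefl _ this
  same ρ hA _ v x hx hxt := by
    split_ifs at hx with hv
    obtain rfl := Option.some.inj hx
    rw [((tokenCfg_wf v 0).btd v).tok] at hxt
    rw [net.label_injective hxt]
  unvisited ρ hA hne _ := by
    rw [tokenCfg_zero_of_ne (Ne.symm hne)]
    rfl
  root := ⟨_, if_pos hρ, ((tokenCfg_wf ρ₀ 0).btd ρ₀).tok⟩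
  holder m hm := ⟨ρ₀, by simpa only [if_pos hρ] using hm⟩
  held v m hm := by
    split_ifs at hm with hv
    refine ⟨_, if_pos hv, ?_⟩
    obtain ⟨k, x, y, hxy, he⟩ := (tokenCfg_wf v 0).msg m hm
    rw [((tokenCfg_wf v 0).btd v).tok, he]

/-- A root with a neighbour has something to check, so no walk starts in the round in which the
tokens are issued. -/
theorem tokenCfg_zero_ne_none {ρ y : V} (h : (commGraph M net).Adj ρ y) :
    (tokenCfg M net ρ 0).2 ≠ none := by
  rw [(tokenCfg_zero_root ρ).2]
  have h1 : net.label y ∈ (nbrLabels M net ρ).erase (net.label ρ) := by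
    refine (List.mem_erase_of_ne fun e => h.ne (net.label_injective e).symm).2 ?_
    rw [← map_nbrList]
    exact List.mem_map_of_mem ((mem_nbrList M net).2 h)
  cases hl : (nbrLabels M net ρ).erase (net.label ρ) with
  | nil => rw [hl] at h1; cases h1
  | cons z l => simp [advanceBtd]

end Contest

end Sinr

namespace Sinr

open Trav

/-! ### Executions of `Smallest_Token` until the smallest traversal is complete -/

section Traversals

variable {V : Type*} [Fintype V] {N : ℕ} {M : Model} {net : Network V N} {R : Type*}
  [DecidableEq R] {F : Families} {hold : V → List R}
  {A : Finset V} {ρ₀ : V} {j : ℕ} {a : V → Bool} {b : V → Option Btd} {o : V → Option Pass}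

variable (M net F hold) in
/-- All messages sent before time `t` have fields at most `B`. -/
def Modest (B t : ℕ) : Prop :=
  ∀ t' < t, ∀ v (m : Msg Ctl R),
    transmitted (btdProtocol R F) (run M net F hold t') v = some m → m.ctl.Bounded B

theorem label_le (net : Network V N) (v : V) : net.label v ≤ N :=
  (Finset.mem_Icc.1 (net.label_mem v)).2

theorem Modest.extend {B t s : ℕ} (h : Modest M net F hold B t)
    (h' : ∀ q < s, ∀ v (m : Msg Ctl R),
      transmitted (btdProtocol R F) (run M net F hold (t + q)) v = some m → m.ctl.Bounded B) :
    Modest M net F hold B (t + s) := by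
  intro t' ht' v m hm
  rcases lt_or_ge t' t with hlt | hge
  · exact h t' hlt v m hm
  · exact h' (t' - t) (by omega) v m (by rwa [Nat.add_sub_cancel' hge])

theorem modest_elim {B : ℕ} (hB : N ≤ B) (hB' : F.sel.flatten.length ≤ B) :
    Modest M net F hold B F.sel.flatten.length := by
  classical
  intro t ht v m hm
  rw [(sim_elim ht.le).transmitted_eq, elimState_send ht] at hm
  split_ifs at hm
  · obtain rfl := Option.some.inj hm
    intro y hy
    have := label_le net v
    simp only [Ctl.fields, List.mem_cons, List.not_mem_nil, or_false] at hy
    omega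
  · cases hm

/-- An execution of `Smallest_Token`. -/
theorem At.contest_step (hl : 0 < F.ssf.length) {δ : ℕ} (hδ : 2 ≤ δ) (hδ' : nb.card * 2 ≤ δ)
    (hF : Spreads M net F.ssf δ) (hρ : ρ₀ ∈ A)
    (hmin : ∀ ρ ∈ A, net.label ρ₀ ≤ net.label ρ)
    (hfin : ∀ ρ j, (tokenCfg M net ρ j).2 = none → ∀ v,
      ((tokenCfg M net ρ j).1 v).visited = true ∧
        (v ≠ ρ → ((tokenCfg M net ρ j).1 v).parent ≠ none))
    (h : At M net F hold (F.sel.flatten.length + 2 * F.ssf.length * j) a b o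
      (fun _ => []) fun _ => [])
    (hc : Contest M net A ρ₀ j b o) (hs : Sparse M net (senders o) 2)
    (hj : (tokenCfg M net ρ₀ j).2 ≠ none) :
    ∃ b' o', Contest M net A ρ₀ (j + 1) b' o' ∧ Sparse M net (senders o') 2 ∧
      (Sim M net F hold (F.sel.flatten.length + 2 * F.ssf.length * (j + 1)) fun v =>
        ⟨net.label v, nbrLabels M net v, F.sel.flatten.length + 2 * F.ssf.length * (j + 1), a v,
          b' v, o' v, [], [], open Classical in
          if v = ρ₀ ∧ (tokenCfg M net ρ₀ (j + 1)).2 = none then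
            Tour.start (((b' v).map Btd.children).getD []) 1 else Tour.idle⟩) ∧
      ∀ B, 5 ≤ B → N ≤ B → F.sel.flatten.length + 2 * F.ssf.length * (j + 1) ≤ B →
        Modest M net F hold B (F.sel.flatten.length + 2 * F.ssf.length * j) →
        Modest M net F hold B (F.sel.flatten.length + 2 * F.ssf.length * (j + 1)) := by
  classical
  obtain ⟨h1, h2⟩ := h.superround hl rfl
  set I := collect M net F.ssf o F.ssf.length with hIdef
  set C := collect M net F.ssf (fun v => claimTok (net.label v) (I v)) F.ssf.length with hCdef
  have hI : ∀ v m, m ∈ I v ↔ ∃ u, (commGraph M net).Adj u v ∧ o u = some m := fun v m =>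
    (hF.mono hδ).mem_collect hs
  have hC : ∀ v τ, τ ∈ C v ↔ ∃ u, (commGraph M net).Adj u v ∧
      claimTok (net.label u) (I u) = some τ := fun v τ =>
    (hF.mono hδ').mem_collect (sparse_claimants hs hI)
  have e : F.sel.flatten.length + 2 * F.ssf.length * (j + 1) =
      F.sel.flatten.length + 2 * F.ssf.length * j + 2 * F.ssf.length := by ring
  refine ⟨_, _, hc.step hρ hmin hI hC _ fun v => rfl,
    fun β => (hc.sparse hρ hI hC β).trans one_le_two, ?_, ?_⟩
  · rw [e]
    convert h1 using 2 with v
    rw [settle_calm]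
    have hst := hc.started hρ hmin hfin hI hC v
    unfold State.bump
    simp only [State.mk.injEq, true_and]
    refine ⟨by omega, if_congr ?_ rfl rfl⟩
    rw [hst]
    exact ⟨fun h => ⟨h.1, hj, h.2⟩, fun h => ⟨h.1, h.2.2⟩⟩
  · intro B hB hN hT hm
    rw [e] at hT ⊢
    refine hm.extend (h2 B hB hT fun v m hvm => ?_)
    obtain ⟨ρ, -, -, -, h5⟩ := hc.out v m hvm
    obtain ⟨k, x, y, -, rfl⟩ := (tokenCfg_wf ρ j).msg m h5
    exact ⟨(label_le net _).trans hN, (label_le net _).trans hN, (label_le net _).trans hN⟩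

open Classical in
/-- The beginning of the traversals. -/
theorem at_zero (hnbr : ∀ v, ∃ u, (commGraph M net).Adj v u) :
    At M net F hold F.sel.flatten.length
      (fun v => decide (v ∈ participants M net F hold F.sel.flatten.length))
      (fun v => if v ∈ participants M net F hold F.sel.flatten.length then
        some ((tokenCfg M net v 0).1 v) else none)
      (fun v => if v ∈ participants M net F hold F.sel.flatten.length then
        (tokenCfg M net v 0).2 else none) (fun _ => []) fun _ => [] := by
  refine ⟨_, sim_elim le_rfl, fun v => ?_⟩
  obtain ⟨u, hu⟩ := hnbr v
  by_cases hv : v ∈ participants M net F hold F.sel.flatten.length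
  · have hne := tokenCfg_zero_ne_none hu
    rw [(tokenCfg_zero_root v).2] at hne
    have h1 : (elimState M net F hold F.sel.flatten.length v).issue F =
        (elimState M net F hold F.sel.flatten.length v).advance
          ⟨net.label v, true, false, none, (nbrLabels M net v).erase (net.label v), [], []⟩ :=
      if_pos ⟨rfl, decide_eq_true hv⟩
    unfold State.prepare
    rw [h1, State.advance_eq]
    have h2 : (elimState M net F hold F.sel.flatten.length v).id = net.label v := rfl
    simp only [h2, if_neg hne, calm, if_pos hv, (tokenCfg_zero_root v).1, (tokenCfg_zero_root v).2]
    have h3 : (decide (v ∈ participants M net F hold F.sel.flatten.length)) = true :=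
      decide_eq_true hv
    unfold elimState
    rw [h3]
    rfl
  · have h1 : (elimState M net F hold F.sel.flatten.length v).issue F =
        elimState M net F hold F.sel.flatten.length v :=
      if_neg fun h => hv (of_decide_eq_true h.2)
    unfold State.prepare
    rw [h1]
    simp only [calm, if_neg hv]
    have h3 : (decide (v ∈ participants M net F hold F.sel.flatten.length)) = false :=
      decide_eq_false hv
    unfold elimState
    rw [h3]
    rfl

/-- A complete traversal has visited all nodes. -/
theorem tokenCfg_complete (hG : (commGraph M net).Connected) (ρ : V) :
    ∃ (r : V → Btd) (f : Forest V) (k : ℕ), k ≤ 4 * Fintype.card V ∧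
      tokenCfg M net ρ k = (r, none) ∧
      r ρ = ⟨net.label ρ, true, false, none, [], [], f.roots.map net.label⟩ ∧
      Served net.label (net.label ρ) r ρ f ∧ Linked (commGraph M net) ρ f ∧
      (∀ x, x ∈ f.verts ↔ x ≠ ρ) ∧ f.verts.Nodup ∧
      (∀ β, innerCount (box M net) β (.cons ρ f .nil) ≤ 1 + nb.card) ∧
      ∀ v, (r v).visited = true ∧ (v ≠ ρ → (r v).parent ≠ none) := by
  classical
  obtain ⟨r, f, k, hk, h1, h2, h3, h4, h5, h6, h7⟩ := exists_traversal net.label_injective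
    (nbrList_nodup M net) (fun x y => mem_nbrList M net) hG (net.label ρ) ρ
  refine ⟨r, f, k, hk, h1, h2, h3, h4, h5, h6, fun β => ?_, fun v => ?_⟩
  -- The neighbours of the stations in cell `β` lie in the cells at offsets from `nb`; these serve
  -- as the cells `J` of the counting lemma.
  · refine (h7 (box M net) β (nb.image fun d => β - d) (fun x y hne he => ?_)
      fun x y hx hy => ?_).trans (Nat.add_le_add_left Finset.card_image_le _)
    · exact (mem_nbrList M net).2 (adj_of_box_eq M net hne he)
    · refine Finset.mem_image.2 ⟨_, box_sub_mem_nb M net ((mem_nbrList M net).1 hy), ?_⟩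
      rw [← hx, sub_sub_cancel]
  · have key : ∀ (g : Forest V) (p : V), Served net.label (net.label ρ) r p g → ∀ v ∈ g.verts,
        (r v).visited = true ∧ (r v).parent ≠ none := by
      intro g
      induction g with
      | nil => intro p _ v hv; cases hv
      | cons w s t ih1 ih2 =>
        rintro p ⟨k1, k2, k3⟩ v hv
        simp only [Forest.verts, List.mem_cons, List.mem_append] at hv
        rcases hv with rfl | hv | hv
        · rw [k1]; simp
        · exact ih1 _ k2 v hv
        · exact ih2 _ k3 v hv
    by_cases hv : v = ρ
    · subst hv
      rw [h2]
      simp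
    · have := key f ρ h3 v ((h5 v).2 hv)
      exact ⟨this.1, fun _ => this.2⟩

theorem tokenCfg_eq_of_none' {ρ : V} {j k : ℕ} (hj : (tokenCfg M net ρ j).2 = none)
    (hk : (tokenCfg M net ρ k).2 = none) : tokenCfg M net ρ j = tokenCfg M net ρ k := by
  rcases le_total j k with h | h
  · exact (tokenCfg_eq_of_none hj h).symm
  · exact tokenCfg_eq_of_none hk h

/-- The state of the execution when the traversal of the smallest token is complete. -/
theorem exists_complete (hl : 0 < F.ssf.length) {δ : ℕ} (hδ : 2 ≤ δ) (hδ' : nb.card * 2 ≤ δ)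
    (hF : Spreads M net F.ssf δ) (hG : (commGraph M net).Connected)
    (hnbr : ∀ v, ∃ u, (commGraph M net).Adj v u)
    (hne : (participants M net F hold F.sel.flatten.length).Nonempty)
    (hsp : Sparse M net (participants M net F hold F.sel.flatten.length) 2) :
    ∃ (ρ : V) (r : V → Btd) (f : Forest V) (J : ℕ) (a : V → Bool), 0 < J ∧
      J ≤ 4 * Fintype.card V ∧
      r ρ = ⟨net.label ρ, true, false, none, [], [], f.roots.map net.label⟩ ∧
      Served net.label (net.label ρ) r ρ f ∧ Linked (commGraph M net) ρ f ∧
      (∀ x, x ∈ f.verts ↔ x ≠ ρ) ∧ f.verts.Nodup ∧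
      (∀ β, innerCount (box M net) β (.cons ρ f .nil) ≤ 1 + nb.card) ∧
      (Sim M net F hold (F.sel.flatten.length + 2 * F.ssf.length * J) fun v =>
        ⟨net.label v, nbrLabels M net v, F.sel.flatten.length + 2 * F.ssf.length * J, a v,
          some (r v), none, [], [], open Classical in
          if v = ρ then Tour.start (r v).children 1 else Tour.idle⟩) ∧
      ∀ B, 5 ≤ B → N ≤ B → F.sel.flatten.length + 2 * F.ssf.length * J ≤ B →
        Modest M net F hold B (F.sel.flatten.length + 2 * F.ssf.length * J) := by
  classical
  set L := F.sel.flatten.length with hL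
  set A := participants M net F hold L with hA
  obtain ⟨ρ, hρ, hmin⟩ := Finset.exists_min_image A net.label hne
  have hfin : ∀ ρ j, (tokenCfg M net ρ j).2 = none → ∀ v,
      ((tokenCfg M net ρ j).1 v).visited = true ∧
        (v ≠ ρ → ((tokenCfg M net ρ j).1 v).parent ≠ none) := by
    intro ρ j hj v
    obtain ⟨r, f, k, -, h1, -, -, -, -, -, -, h2⟩ := tokenCfg_complete hG ρ
    have := tokenCfg_eq_of_none' hj (k := k) (by rw [h1])
    rw [this, h1]
    exact h2 v
  obtain ⟨r, f, k, hk, h1, h2, h3, h4, h5, h6, h7, h8⟩ := tokenCfg_complete hG ρ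
  have hex : ∃ J, (tokenCfg M net ρ J).2 = none := ⟨k, by rw [h1]⟩
  -- The walk starts at the first step at which nothing is left to send; before it all tours are
  -- idle.
  obtain ⟨J, hJ, hJmin⟩ : ∃ J, (tokenCfg M net ρ J).2 = none ∧
      ∀ j < J, (tokenCfg M net ρ j).2 ≠ none :=
    ⟨Nat.find hex, Nat.find_spec hex, fun j hj => Nat.find_min hex hj⟩
  have hJk : J ≤ k := by
    by_contra hlt
    exact hJmin k (not_le.1 hlt) (by rw [h1])
  have hJ0 : 0 < J := by
    rcases Nat.eq_zero_or_pos J with rfl | h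
    · obtain ⟨u, hu⟩ := hnbr ρ
      exact absurd hJ (tokenCfg_zero_ne_none hu)
    · exact h
  have hcfg : tokenCfg M net ρ J = (r, none) := by
    rw [← h1]
    exact tokenCfg_eq_of_none' hJ (by rw [h1])
  set a : V → Bool := fun v => decide (v ∈ A) with ha
  -- the situation before the last execution of `Smallest_Token`
  have key : ∀ j < J, ∃ b o, At M net F hold (L + 2 * F.ssf.length * j) a b o
      (fun _ => []) (fun _ => []) ∧ Contest M net A ρ j b o ∧ Sparse M net (senders o) 2 ∧
      ∀ B, 5 ≤ B → N ≤ B → L + 2 * F.ssf.length * j ≤ B →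
        Modest M net F hold B (L + 2 * F.ssf.length * j) := by
    intro j
    induction j with
    | zero =>
      intro _
      refine ⟨_, _, at_zero hnbr, Contest.zero hρ, ?_, fun B _ hN hB => modest_elim hN hB⟩
      intro β
      refine (Finset.card_le_card fun v hv => ?_).trans (hsp β)
      obtain ⟨hv, hvβ⟩ := Finset.mem_filter.1 hv
      refine Finset.mem_filter.2 ⟨?_, hvβ⟩
      by_contra hvA
      exact mem_senders.1 hv (if_neg hvA)
    | succ j ih =>
      intro hj
      obtain ⟨b, o, k1, k2, k3, k4⟩ := ih (by omega)
      obtain ⟨b', o', e1, e2, e3, e4⟩ := k1.contest_step hl hδ hδ' hF hρ hmin hfin k2 k3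
        (hJmin j (by omega))
      refine ⟨b', o', ?_, e1, e2, fun B hB hN hT => e4 B hB hN hT (k4 B hB hN (le_trans ?_ hT))⟩
      · refine Sim.at ?_ (t := L + 2 * F.ssf.length * (j + 1)) ?_
        · have : 0 < 2 * F.ssf.length * (j + 1) := by positivity
          omega
        · convert e3 using 2 with v
          simp only [if_neg (fun h : v = ρ ∧ _ => hJmin _ hj h.2)]
          rfl
      · exact Nat.add_le_add_left (Nat.mul_le_mul_left _ j.le_succ) _
  obtain ⟨j, rfl⟩ : ∃ j, J = j + 1 := ⟨J - 1, by omega⟩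
  obtain ⟨b, o, k1, k2, k3, k4⟩ := key j (by omega)
  obtain ⟨b', o', e1, e2, e3, e4⟩ := k1.contest_step hl hδ hδ' hF hρ hmin hfin k2 k3
    (hJmin j (by omega))
  -- The complete traversal has visited `v`, so `v` cannot be in the untouched state of the clause
  -- `behind`. As no id is smaller, its record is that of the smallest token.
  have hb : ∀ v, b' v = some (r v) := by
    intro v
    have hvis : ¬∀ x, b' v = some x → net.label ρ < x.tok := by
      intro h
      have h' := e1.behind ρ hρ (.inr rfl) v h
      rw [hcfg] at h'
      have h'' := (h8 v).1
      rw [show r v = _ from h'] at h''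
      cases h''
    push Not at hvis
    obtain ⟨x, hx, hle⟩ := hvis
    obtain ⟨ρ', hρ', ht⟩ := e1.tok v x hx
    have h' := e1.same ρ hρ (.inr rfl) v x hx (le_antisymm hle (ht ▸ hmin ρ' hρ'))
    rw [hcfg] at h'
    rw [hx, ← h']
  -- A remaining message would belong to the token of its sender's record, which is the smallest
  -- token; but that traversal has nothing left to send.
  have ho : ∀ v, o' v = none := by
    intro v
    cases hov : o' v with
    | none => rfl
    | some m =>
      obtain ⟨ρ', hρ', ht, -, hm⟩ := e1.out v m hov
      obtain ⟨x, hx, hxt⟩ := e1.held v m hov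
      have hr : ρ' = ρ := by
        obtain rfl := Option.some.inj ((hb v).symm.trans hx)
        refine net.label_injective ?_
        rw [← ht, ← hxt, show r v = (tokenCfg M net ρ (j + 1)).1 v by rw [hcfg],
          ((tokenCfg_wf ρ (j + 1)).btd v).tok]
      rw [hr, hcfg] at hm
      cases hm
  refine ⟨ρ, r, f, j + 1, a, hJ0, hJk.trans hk, h2, h3, h4, h5, h6, h7, ?_, ?_⟩
  · convert e3 using 2 with v
    simp only [hb, ho, hcfg, and_true]
    rfl
  · intro B hB hN hT
    refine e4 B hB hN hT (k4 B hB hN (le_trans ?_ hT))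
    exact Nat.add_le_add_left (Nat.mul_le_mul_left _ j.le_succ) _

end Traversals

end Sinr

namespace Sinr

open Trav

/-! ## The walks of `BTD_Traversals` -/

section Touring

variable {V : Type*} [Fintype V] [DecidableEq V] {N : ℕ} {M : Model} {net : Network V N}
  {R : Type*} [DecidableEq R] {F : Families} {hold : V → List R}

variable (M net) in
/-- The state of `v` during the walks of `BTD_Traversals`. -/
noncomputable def touring (a : V → Bool) (r : V → Btd) (t : ℕ) (θ : V → Tour) (v : V) :
    Trav.State :=
  ⟨net.label v, nbrLabels M net v, t, a v, some (r v), none, [], [], θ v⟩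

variable {a : V → Bool} {r : V → Btd} {t : ℕ} {θ θ' : V → Tour} {par : V → Option V}
  {ch : V → List V} {n : ℕ} {sync : Bool} {h : V}

/-- The executions of `Smallest_Token` formally go on during the walks; without messages they change
nothing. -/
theorem settle_touring (v : V) : (touring M net a r t θ v).settle = touring M net a r t θ v := by
  unfold State.settle
  simp [touring]

theorem close_touring (t' : ℕ) (v : V) :
    (touring M net a r t θ v).close F t' = touring M net a r t θ v := by
  unfold State.close
  rw [settle_touring, ite_self]

theorem prepare_touring (ht : F.sel.flatten.length < t) (v : V) :
    (touring M net a r t θ v).prepare F =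
      touring M net a r t (fun x => (θ x).turn (r x).parent (r x).children) v := by
  have h : (touring M net a r t θ v).issue F = touring M net a r t θ v :=
    if_neg fun h => ht.ne' h.1
  unfold State.prepare
  rw [h]
  rfl

theorem emit_touring (ht : F.sel.flatten.length < t) (v : V) :
    (touring M net a r t θ v).emit F = (θ v).send (net.label v) (r v).parent := by
  unfold State.emit
  change (match (θ v).send (net.label v) (r v).parent with
    | some c => some c
    | none => if t < F.sel.flatten.length then _ else _) = _
  cases (θ v).send (net.label v) (r v).parent with
  | some c => rfl
  | none =>
    simp only
    rw [if_neg (not_lt.2 ht.le)]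
    simp [touring]

variable (M net F hold a r) in
/-- At time `t` the prepared tours are given by `θ`. -/
def WalkAt (t : ℕ) (θ : V → Tour) : Prop :=
  ∃ θ₀, Sim M net F hold t (touring M net a r t θ₀) ∧
    ∀ x, (θ₀ x).turn (r x).parent (r x).children = θ x

theorem Move.send_eq {cnt : Bool}
    (hm : Move (commGraph M net) net.label par ch n cnt sync h θ θ') :
    ∃ z w, (commGraph M net).Adj h z ∧ (θ h).token = some w ∧ w.sync = sync ∧ w.num ≤ n ∧
      w.step < 2 * n ∧ θ' = moved net.label par ch cnt h z w θ ∧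
      ∀ v, (θ v).send (net.label v) ((par v).map net.label) =
        if v = h then some (Ctl.walk w.sync (net.label h) (net.label z) w.num w.step) else none := by
  obtain ⟨z, w, h1, h2, h3, h4, h5, h6, h7⟩ := hm.exists_move
  refine ⟨z, w, h1, h2, h3, h4, h5, h7, fun v => ?_⟩
  unfold Tour.send
  by_cases hv : v = h
  · subst hv
    rw [h2, h6, if_pos rfl]
    rfl
  · rw [hm.others v hv, if_neg hv]

/-- Only the holder of the walk token transmits, so exactly its neighbours hear it, and the
execution agrees with the abstract move. -/
theorem WalkAt.move (hw : WalkAt M net F hold a r t θ) (ht : F.sel.flatten.length < t)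
    (hpar : ∀ v, (r v).parent = (par v).map net.label)
    (hch : ∀ v, (r v).children = (ch v).map net.label)
    (hm : Move (commGraph M net) net.label par ch n true sync h θ θ') :
    ∃ θ₀, Sim M net F hold t (touring M net a r t θ₀) ∧
      (∀ v, (touring M net a r t θ₀ v).recv F (heard M net F (touring M net a r t θ₀) v) =
        touring M net a r (t + 1) θ' v) ∧
      ∀ v c, (touring M net a r t θ₀ v).send F = some c →
        ∀ B, 5 ≤ B → N ≤ B → 2 * n ≤ B → c.Bounded B := by
  obtain ⟨θ₀, hs, hθ⟩ := hw
  obtain ⟨z, w, hz, -, -, hwn, hws, rfl, hsend⟩ := hm.send_eq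
  have hp : ∀ v, (touring M net a r t θ₀ v).prepare F = touring M net a r t θ v := by
    intro v
    rw [prepare_touring ht]
    exact congrArg (fun θ => touring M net a r t θ v) (funext hθ)
  have hsend' : ∀ v, (touring M net a r t θ₀ v).send F =
      if v = h then some (Ctl.walk w.sync (net.label h) (net.label z) w.num w.step) else none := by
    intro v
    unfold State.send
    rw [hp, emit_touring ht, hpar, hsend]
  refine ⟨θ₀, hs, fun v => ?_, fun v c hc B h5 hN hn => ?_⟩
  · have hothers : ∀ v, v ≠ h → (touring M net a r t θ₀ v).send F = none := fun v hv => by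
      rw [hsend', if_neg hv]
    have hgo : (touring M net a r t θ v).goes = touring M net a r t
        (fun x => ((θ x).depart ((par x).map net.label)).tick) v := by
      unfold State.goes
      change (⟨_, _, _, _, _, _, _, _, ((θ v).depart (r v).parent).tick⟩ : Trav.State) = _
      rw [hpar]
      rfl
    have hc : (touring M net a r t θ₀ v).clock = t := rfl
    rw [recv_eq, hp, hgo, hc]
    unfold heard
    by_cases hv : (commGraph M net).Adj h v
    · rw [hear_single M net hothers hv, hsend', if_pos rfl]
      unfold State.listen State.absorb
      by_cases hvz : v = z
      · subst hvz
        simp only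
        rw [if_pos (show net.label v = (touring M net a r t _ v).id from rfl)]
        have e : ∀ T : Tour, ({ touring M net a r t
            (fun x => ((θ x).depart ((par x).map net.label)).tick) v with tour := T } :
            Trav.State) = touring M net a r t (fun _ => T) v := fun T => rfl
        rw [e, close_touring]
        unfold touring
        simp only [State.bump]
        rw [moved_self]
        change (⟨_, _, _, _, _, _, _, _, Tour.arrive (r v).parent (r v).children _ _ _ _ _ _⟩ :
          Trav.State) = _
        rw [hpar, hch]
      · simp only
        rw [if_neg (show ¬net.label z = (touring M net a r t _ v).id from
          fun e => hvz (net.label_injective e).symm), close_touring]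
        unfold touring
        simp only [State.bump]
        rw [moved_of_ne hvz]
    · rw [hear_single_eq_none M net hothers hv]
      have hvz : v ≠ z := fun e => hv (e ▸ hz)
      unfold State.listen
      simp only
      rw [close_touring]
      unfold touring
      simp only [State.bump]
      rw [moved_of_ne hvz]
  · rw [hsend'] at hc
    split_ifs at hc
    obtain rfl := Option.some.inj hc
    intro y hy
    have h1 := label_le net h
    have h2 := label_le net z
    have h3 : w.sync.toNat ≤ 1 := Bool.toNat_le _
    simp only [Ctl.fields, List.mem_cons, List.not_mem_nil, or_false] at hy
    omega

/-- The first conclusion is for the counting walk, during which no timer is set; the second one is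
for the synchronizing walk, at whose end all nodes enter `BTD_MB` in the same round. -/
theorem WalkAt.path {hs : List V}
    (hp : MovePath (commGraph M net) net.label par ch n true sync hs θ θ')
    (hpar : ∀ v, (r v).parent = (par v).map net.label)
    (hch : ∀ v, (r v).children = (ch v).map net.label) :
    ∀ t, F.sel.flatten.length < t → hs ≠ [] → WalkAt M net F hold a r t θ →
    ((∀ x, (θ' x).timer ≠ some 0) →
      Sim M net F hold (t + hs.length) (touring M net a r (t + hs.length) θ')) ∧
    ((∀ x, (θ' x).timer = some 0) → ∀ v, run M net F hold (t + hs.length) v =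
      some (.broadcasting (Mb.init (net.label v) ((par v).map net.label) ((ch v).map net.label)
        (θ' v).size (hold v)))) ∧
    ∀ B, 5 ≤ B → N ≤ B → 2 * n ≤ B → Modest M net F hold B t →
      Modest M net F hold B (t + hs.length) := by
  induction hp with
  | nil => intro t _ h; exact absurd rfl h
  | @cons h hs θ θ₁ θ₂ hm hp ih =>
    intro t ht _ hw
    obtain ⟨θ₀, h1, h2, h3⟩ := hw.move ht hpar hch hm
    have hmod : ∀ B, 5 ≤ B → N ≤ B → 2 * n ≤ B → Modest M net F hold B t →
        Modest M net F hold B (t + 1) := by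
      intro B h5 hN hn hB
      refine hB.extend fun q hq v m hqm => ?_
      obtain rfl : q = 0 := by omega
      rw [Nat.add_zero, h1.transmitted_eq] at hqm
      obtain ⟨c, hc, rfl⟩ := Option.map_eq_some_iff.1 hqm
      exact h3 v c hc B h5 hN hn
    have hstep : (∀ x, (θ₁ x).timer ≠ some 0) →
        Sim M net F hold (t + 1) (touring M net a r (t + 1) θ₁) := by
      intro htm
      have := h1.step (fun v m hb _ => by cases hb) (fun v => by rw [h2]; exact htm v)
      simpa only [h2] using this
    cases hp with
    | nil =>
      refine ⟨hstep, fun htm v => ?_, hmod⟩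
      have := h1.finish (fun v => by simp [touring]) (fun v => by rw [h2]; exact htm v) v
      simp only [h2] at this
      rw [List.length_singleton, this, ← hpar, ← hch]
      rfl
    | @cons h' hs' _ θ₃ _ hm' hp' =>
      have hw' : WalkAt M net F hold a r (t + 1) θ₁ :=
        ⟨θ₁, hstep hm'.timer, fun x => by rw [hpar, hch]; exact hm'.turn_eq x⟩
      have := ih (t + 1) (by omega) (List.cons_ne_nil _ _) hw'
      have e : t + (h :: h' :: hs').length = t + 1 + (h' :: hs').length := by
        simp only [List.length_cons]; omega
      rw [e]
      exact ⟨this.1, this.2.1, fun B h5 hN hn hB => this.2.2 B h5 hN hn (hmod B h5 hN hn hB)⟩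

end Touring

/-- `BTD_Traversals` computes a spanning tree with few internal nodes in each box. -/
theorem exists_tree {V : Type*} [Fintype V] {N : ℕ} {M : Model} {net : Network V N}
    {R : Type*} [DecidableEq R] {F : Families} {hold : V → List R}
    (hl : 0 < F.ssf.length) {δ : ℕ} (hδ : 2 ≤ δ) (hδ' : nb.card * 2 ≤ δ)
    (hF : Spreads M net F.ssf δ) (hG : (commGraph M net).Connected)
    (hn : 2 ≤ Fintype.card V)
    (hne : (participants M net F hold F.sel.flatten.length).Nonempty)
    (hsp : Sparse M net (participants M net F hold F.sel.flatten.length) 2) :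
    ∃ (par : V → Option V) (ch : V → List V) (ρ : V) (f : Forest V) (T : ℕ) (X : Finset V),
      IsTree (commGraph M net) par ch ρ f ∧
      Sparse M net X (1 + nb.card) ∧ (∀ v, ch v ≠ [] → v ∈ X) ∧
      T ≤ F.sel.flatten.length + 2 * F.ssf.length * (4 * Fintype.card V) + 4 * Fintype.card V ∧
      (∀ v, run M net F hold T v = some (.broadcasting (Mb.init (net.label v)
        ((par v).map net.label) ((ch v).map net.label) (Fintype.card V) (hold v)))) ∧
      ∀ B, 5 ≤ B → N ≤ B → F.sel.flatten.length + 2 * F.ssf.length * (4 * Fintype.card V) +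
        4 * Fintype.card V ≤ B → Modest M net F hold B T := by
  classical
  have hnt : Nontrivial V := Fintype.one_lt_card_iff_nontrivial.1 hn
  have hnbr : ∀ v, ∃ u, (commGraph M net).Adj v u := fun v =>
    hG.preconnected.exists_adj_of_nontrivial v
  obtain ⟨ρ, r, f, J, a, hJ0, hJ, h1, h2, h3, h4, h5, h6, h7, h8⟩ :=
    exists_complete hl hδ hδ' hF hG hnbr hne hsp
  set par := parOf net.label r with hpardef
  set ch := chOf net.label r with hchdef
  obtain ⟨k1, k2⟩ := h2.treeShape net.label_injective h3
  have hparρ : par ρ = none := by simp [hpardef, parOf, h1]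
  have hchρ : ch ρ = f.roots := by simp [hchdef, chOf, h1, filterMap_ofLabel net.label_injective]
  have ht : IsTree (commGraph M net) par ch ρ f := ⟨hparρ, hchρ, k1, h4, h5⟩
  have hpar : ∀ v, (r v).parent = (par v).map net.label := by
    intro v
    by_cases hv : v = ρ
    · subst hv; rw [hparρ, h1]; rfl
    · exact (k2 v ((h4 v).2 hv)).2.2.1.symm
  have hch : ∀ v, (r v).children = (ch v).map net.label := by
    intro v
    by_cases hv : v = ρ
    · subst hv; rw [hchρ, h1]
    · exact (k2 v ((h4 v).2 hv)).2.2.2.1.symm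
  set T₀ := F.sel.flatten.length + 2 * F.ssf.length * J with hT₀
  have hTlt : F.sel.flatten.length < T₀ := by
    have : 0 < 2 * F.ssf.length * J := by positivity
    omega
  set θ₀ : V → Tour := fun v => if v = ρ then Tour.start (r v).children 1 else Tour.idle with hθ₀
  have hs0 : Sim M net F hold T₀ (touring M net a r T₀ θ₀) := h7
  have hθρ : θ₀ ρ = Tour.start ((ch ρ).map net.label) 1 := by simp [hθ₀, hch]
  have hθx : ∀ x, x ≠ ρ → θ₀ x = Tour.idle := fun x hx => by simp [hθ₀, hx]
  obtain ⟨hs₁, θ₁, hs₂, θ₂, p₁, l₁, -, m₁, p₂, l₂, m₂⟩ := exists_walks net.label_injective ht rfl hn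
    true θ₀ (by rw [hθρ]; rfl) (by rw [hθρ]; rfl) (fun x hx => by rw [hθx x hx]; rfl) (fun x => by
      by_cases hx : x = ρ
      · rw [hx, hθρ]; rfl
      · rw [hθx x hx]; rfl)
  have hne₁ : hs₁ ≠ [] := by
    rintro rfl
    simp at l₁; omega
  have hne₂ : hs₂ ≠ [] := by
    rintro rfl
    simp at l₂; omega
  have w₁ : WalkAt M net F hold a r T₀ θ₀ := by
    refine ⟨θ₀, hs0, fun x => ?_⟩
    rw [hpar, hch]
    cases p₁ with
    | nil => exact absurd rfl hne₁
    | cons hm _ => exact hm.turn_eq x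
  obtain ⟨a₁, -, b₁⟩ := w₁.path p₁ hpar hch T₀ hTlt hne₁
  have s₁ := a₁ fun x => by rw [m₁ x]; exact (Option.some_ne_none 0).symm
  obtain ⟨-, a₂, b₂⟩ := WalkAt.path (F := F) (hold := hold) (a := a) p₂ hpar hch (T₀ + hs₁.length)
    (by omega) hne₂ ⟨θ₁, s₁, fun x => by rw [hpar, hch]⟩
  have hle : T₀ ≤ F.sel.flatten.length + 2 * F.ssf.length * (4 * Fintype.card V) :=
    Nat.add_le_add_left (Nat.mul_le_mul_left _ hJ) _
  refine ⟨par, ch, ρ, f, T₀ + hs₁.length + hs₂.length,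
    Finset.univ.filter fun v => v ∈ Forest.internals (.cons ρ f .nil), ht, fun β => ?_,
    fun v hv => ?_, by omega, fun v => ?_, fun B hB5 hN hB => ?_⟩
  · refine le_trans ?_ (h6 β)
    unfold innerCount
    refine le_trans (Finset.card_le_card fun v hv => ?_) (List.toFinset_card_le _)
    obtain ⟨hv, hvβ⟩ := Finset.mem_filter.1 hv
    rw [List.mem_toFinset, List.mem_filter]
    exact ⟨(Finset.mem_filter.1 hv).2, decide_eq_true hvβ⟩
  · refine Finset.mem_filter.2 ⟨Finset.mem_univ _, ?_⟩
    simp only [Forest.internals, List.mem_append]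
    by_cases hvρ : v = ρ
    · subst hvρ
      left
      rw [hchρ] at hv
      cases f with
      | nil => exact absurd rfl hv
      | cons => simp
    · exact .inr (.inl (k1.mem_internals ((h4 v).2 hvρ) hv))
  · rw [a₂ (fun x => (m₂ x).1) v, (m₂ v).2]
  · exact b₂ B hB5 hN (by omega) (b₁ B hB5 hN (by omega) (h8 B hB5 hN (by omega)))

end Sinr

namespace Sinr

/-! ## Spreading the rumours along a connected set of nodes -/

section Push

variable {R : Type*} [DecidableEq R]

/-- A new rumour is put on top of the stack; a pair consists of the stack and the list of all
rumours that ever were on the stack. -/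
def pushPair (p : List R × List R) (r : R) : List R × List R :=
  if r ∈ p.2 then p else (r :: p.1, r :: p.2)

/-- The last clause says that pushing does not affect the set of rumours that are known but not on
the stack, that is, those already taken from it. A rumour once taken never returns. -/
theorem foldl_pushPair (l : List R) : ∀ p : List R × List R, p.1.Nodup → p.2.Nodup →
    (∀ r ∈ p.1, r ∈ p.2) →
    (l.foldl pushPair p).1.Nodup ∧ (l.foldl pushPair p).2.Nodup ∧
    (∀ r ∈ (l.foldl pushPair p).1, r ∈ (l.foldl pushPair p).2) ∧
    (∀ r, r ∈ (l.foldl pushPair p).2 ↔ r ∈ p.2 ∨ r ∈ l) ∧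
    ∀ r, (r ∈ (l.foldl pushPair p).2 ∧ r ∉ (l.foldl pushPair p).1) ↔ (r ∈ p.2 ∧ r ∉ p.1) := by
  induction l with
  | nil => intro p h1 h2 h3; exact ⟨h1, h2, h3, by simp, by simp⟩
  | cons x l ih =>
    intro p h1 h2 h3
    rw [List.foldl_cons]
    by_cases hx : x ∈ p.2
    · have e : pushPair p x = p := if_pos hx
      rw [e]
      obtain ⟨a1, a2, a3, a4, a5⟩ := ih p h1 h2 h3
      refine ⟨a1, a2, a3, fun r => ?_, a5⟩
      rw [a4, List.mem_cons]
      constructor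
      · rintro (h | h)
        · exact .inl h
        · exact .inr (.inr h)
      · rintro (h | rfl | h)
        · exact .inl h
        · exact .inl hx
        · exact .inr h
    · have e : pushPair p x = (x :: p.1, x :: p.2) := if_neg hx
      rw [e]
      obtain ⟨a1, a2, a3, a4, a5⟩ := ih (x :: p.1, x :: p.2)
        (List.nodup_cons.2 ⟨fun h => hx (h3 x h), h1⟩) (List.nodup_cons.2 ⟨hx, h2⟩)
        (fun r hr => by
          rcases List.mem_cons.1 hr with rfl | hr
          · exact List.mem_cons_self
          · exact List.mem_cons_of_mem _ (h3 r hr))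
      refine ⟨a1, a2, a3, fun r => ?_, fun r => ?_⟩
      · rw [a4]
        simp only [List.mem_cons]
        tauto
      · rw [a5]
        simp only [List.mem_cons]
        constructor
        · rintro ⟨rfl | h, h'⟩
          · exact absurd (.inl rfl) h'
          · exact ⟨h, fun h'' => h' (.inr h'')⟩
        · rintro ⟨h, h'⟩
          refine ⟨.inr h, ?_⟩
          rintro (rfl | h'')
          · exact hx h
          · exact h' h''

end Push

section Flood

variable {V : Type*} {R : Type*} [DecidableEq R] (G : SimpleGraph V) (X : Set V)

/-- The stacks of the nodes and the lists of all rumours that ever were on them, at the beginnings of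
successive runs in which each node of `X` sends the top rumour of its stack to all its neighbours;
`L` are the rumours received. -/
structure Flood (st : ℕ → V → List R × List R) (L : ℕ → V → List R) : Prop where
  mem : ∀ j v r, r ∈ L j v ↔ ∃ u, G.Adj u v ∧ u ∈ X ∧ (st j u).1.head? = some r
  succ : ∀ j v, st (j + 1) v = (L j v).foldl pushPair ((st j v).1.tail, (st j v).2)
  zero : ∀ v, (st 0 v).1 = (st 0 v).2
  nodup : ∀ v, (st 0 v).1.Nodup

variable {G X} {st : ℕ → V → List R × List R} {L : ℕ → V → List R}

theorem Flood.wf (h : Flood G X st L) (j : ℕ) (v : V) :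
    (st j v).1.Nodup ∧ (st j v).2.Nodup ∧ ∀ r ∈ (st j v).1, r ∈ (st j v).2 := by
  induction j with
  | zero =>
    have h0 := h.nodup v
    refine ⟨h0, h.zero v ▸ h0, fun r hr => h.zero v ▸ hr⟩
  | succ j ih =>
    rw [h.succ]
    obtain ⟨a1, a2, a3, -⟩ := foldl_pushPair (L j v) ((st j v).1.tail, (st j v).2)
      (ih.1.sublist (List.tail_sublist _)) ih.2.1 fun r hr => ih.2.2 r (List.mem_of_mem_tail hr)
    exact ⟨a1, a2, a3⟩

theorem Flood.succ_spec (h : Flood G X st L) (j : ℕ) (v : V) :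
    (∀ r, r ∈ (st (j + 1) v).2 ↔ r ∈ (st j v).2 ∨ r ∈ L j v) ∧
    ∀ r, (r ∈ (st (j + 1) v).2 ∧ r ∉ (st (j + 1) v).1) ↔
      (r ∈ (st j v).2 ∧ r ∉ (st j v).1.tail) := by
  have ih := h.wf j v
  rw [h.succ]
  obtain ⟨-, -, -, a4, a5⟩ := foldl_pushPair (L j v) ((st j v).1.tail, (st j v).2)
    (ih.1.sublist (List.tail_sublist _)) ih.2.1 fun r hr => ih.2.2 r (List.mem_of_mem_tail hr)
  exact ⟨a4, a5⟩

/-- The rumours that have been taken from the stack. -/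
def sent (st : ℕ → V → List R × List R) (j : ℕ) (v : V) : Finset R :=
  (st j v).2.toFinset \ (st j v).1.toFinset

theorem mem_sent {j : ℕ} {v : V} {r : R} :
    r ∈ sent st j v ↔ r ∈ (st j v).2 ∧ r ∉ (st j v).1 := by
  simp [sent]

theorem Flood.sent_succ_of_nil (h : Flood G X st L) {j : ℕ} {v : V} (hv : (st j v).1 = []) :
    sent st (j + 1) v = sent st j v := by
  ext r
  rw [mem_sent, (h.succ_spec j v).2, mem_sent, hv, List.tail_nil]

theorem Flood.sent_succ_of_cons (h : Flood G X st L) {j : ℕ} {v : V} {x : R} {l : List R}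
    (hv : (st j v).1 = x :: l) :
    sent st (j + 1) v = insert x (sent st j v) ∧ x ∉ sent st j v := by
  obtain ⟨h1, h2, h3⟩ := h.wf j v
  constructor
  · ext r
    rw [mem_sent, (h.succ_spec j v).2, Finset.mem_insert, mem_sent, hv, List.tail_cons]
    rw [hv] at h1 h3
    constructor
    · rintro ⟨a, b⟩
      by_cases hr : r = x
      · exact .inl hr
      · exact .inr ⟨a, by simp [hr, b]⟩
    · rintro (rfl | ⟨a, b⟩)
      · exact ⟨h3 r List.mem_cons_self, (List.nodup_cons.1 h1).1⟩
      · exact ⟨a, fun hr => b (List.mem_cons_of_mem _ hr)⟩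
  · rw [mem_sent, hv]
    simp

theorem Flood.sent_mono (h : Flood G X st L) (j : ℕ) (v : V) :
    sent st j v ⊆ sent st (j + 1) v := by
  cases hv : (st j v).1 with
  | nil => rw [h.sent_succ_of_nil hv]
  | cons x l => rw [(h.sent_succ_of_cons hv).1]; exact Finset.subset_insert _ _

/-- What has been sent is known to the neighbours. -/
theorem Flood.heard (h : Flood G X st L) {u v : V} (huv : G.Adj u v) (hu : u ∈ X) (j : ℕ) {r : R}
    (hr : r ∈ sent st j u) : r ∈ (st j v).2 := by
  induction j with
  | zero =>
    rw [mem_sent, h.zero] at hr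
    exact absurd hr.1 hr.2
  | succ j ih =>
    rw [(h.succ_spec j v).1]
    cases hs : (st j u).1 with
    | nil => rw [h.sent_succ_of_nil hs] at hr; exact .inl (ih hr)
    | cons x l =>
      rw [(h.sent_succ_of_cons hs).1, Finset.mem_insert] at hr
      rcases hr with rfl | hr
      · exact .inr ((h.mem j v r).2 ⟨u, huv, hu, by rw [hs]; rfl⟩)
      · exact .inl (ih hr)

/-- A node whose stack contains `r` initially sends something new in each run until it sends `r`. -/
theorem Flood.sent_of_zero (h : Flood G X st L) {v : V} {r : R} (hr : r ∈ (st 0 v).2) (j : ℕ) :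
    r ∈ sent st j v ∨ j ≤ (sent st j v).card := by
  suffices hs : r ∈ sent st j v ∨ (r ∈ (st j v).1 ∧ j ≤ (sent st j v).card) from
    hs.imp_right And.right
  induction j with
  | zero => exact .inr ⟨h.zero v ▸ hr, Nat.zero_le _⟩
  | succ j ih =>
    rcases ih with ih | ⟨ih1, ih2⟩
    · exact .inl (h.sent_mono j v ih)
    · cases hs : (st j v).1 with
      | nil => rw [hs] at ih1; cases ih1
      | cons x l =>
        obtain ⟨e1, e2⟩ := h.sent_succ_of_cons hs
        by_cases hr' : r ∈ sent st (j + 1) v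
        · exact .inl hr'
        · refine .inr ⟨?_, ?_⟩
          · by_contra hc
            exact hr' (mem_sent.2 ⟨((h.succ_spec j v).1 r).2 (.inl ((h.wf j v).2.2 r ih1)), hc⟩)
          · rw [e1, Finset.card_insert_of_notMem e2]
            omega

/-- If a node sends `r` in time, up to a delay of `i` runs, its neighbours do so with a delay of
`i + 1` runs. -/
theorem Flood.sent_of_adj (h : Flood G X st L) {u v : V} (huv : G.Adj u v) (hu : u ∈ X) {r : R}
    {i : ℕ} (hi : ∀ j, r ∈ sent st j u ∨ j ≤ i + (sent st j u).card) (j : ℕ) :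
    r ∈ sent st j v ∨ j ≤ i + 1 + (sent st j v).card := by
  induction j with
  | zero => exact .inr (Nat.zero_le _)
  | succ j ih =>
    by_cases hr : r ∈ sent st (j + 1) v
    · exact .inl hr
    right
    have hr' : r ∉ sent st j v := fun hr' => hr (h.sent_mono j v hr')
    have ih' := ih.resolve_left hr'
    -- The core of the pipelining argument. If the stack of `v` is empty then `v` has sent
    -- everything it knows, in particular everything that `u` has sent, so it is at most one run
    -- behind `u`. Otherwise it sends something new, and its count keeps pace with the time. The
    -- order of the stack plays no role.
    cases hs : (st j v).1 with
    | nil =>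
      have hsub : sent st j u ⊆ sent st j v := fun x hx =>
        mem_sent.2 ⟨h.heard huv hu j hx, by rw [hs]; simp⟩
      have := (hi j).resolve_left fun hx => hr' (hsub hx)
      have := Finset.card_le_card hsub
      rw [h.sent_succ_of_nil hs]
      omega
    | cons x l =>
      obtain ⟨e1, e2⟩ := h.sent_succ_of_cons hs
      rw [e1, Finset.card_insert_of_notMem e2]
      omega

theorem Flood.sent_of_walk (h : Flood G X st L) {r : R} {u v : X} (p : (G.induce X).Walk u v) :
    ∀ {i : ℕ}, (∀ j, r ∈ sent st j u ∨ j ≤ i + (sent st j u).card) →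
    ∀ j, r ∈ sent st j v ∨ j ≤ i + p.length + (sent st j v).card := by
  induction p with
  | nil => intro i hi j; simpa using hi j
  | @cons u w v huw p ih =>
    intro i hi j
    have huw' : G.Adj u w := huw
    have := ih (h.sent_of_adj huw' u.2 hi) j
    rw [SimpleGraph.Walk.length_cons]
    rwa [Nat.add_assoc i 1, Nat.add_comm 1] at this

/-- After `n + k + 1` runs all nodes know all `k` rumours, if each node outside the connected set `X`
has a neighbour in `X` and each rumour is initially known in `X`. -/
theorem Flood.complete [Fintype V] (h : Flood G X st L) (hX : (G.induce X).Connected)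
    (hdom : ∀ v, v ∉ X → ∃ u ∈ X, G.Adj u v) {K : Finset R} (hK : ∀ v, ∀ r ∈ (st 0 v).2, r ∈ K)
    {r : R} (hr : ∃ u ∈ X, r ∈ (st 0 u).2) {j : ℕ} (hj : Fintype.card V + K.card < j) (v : V) :
    r ∈ (st j v).2 := by
  classical
  have hsub : ∀ j v, ∀ r ∈ (st j v).2, r ∈ K := by
    intro j
    induction j with
    | zero => exact hK
    | succ j ih =>
      intro v r hr
      rcases ((h.succ_spec j v).1 r).1 hr with hr | hr
      · exact ih v r hr
      · obtain ⟨u, -, -, hu⟩ := (h.mem j v r).1 hr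
        exact ih u r ((h.wf j u).2.2 r (List.mem_of_mem_head? hu))
  obtain ⟨u, hu, hur⟩ := hr
  -- A node of `X` that had not sent `r` after `j` runs would have sent at least `j` minus the
  -- length of a path from `u` many rumours. The path is shorter than the number of stations, so
  -- this would exceed the number of all rumours.
  have key : ∀ v ∈ X, r ∈ sent st j v := by
    intro v hv
    obtain ⟨p, hp⟩ := (hX.preconnected ⟨u, hu⟩ ⟨v, hv⟩).exists_isPath
    have h1 := h.sent_of_walk p (r := r) (i := 0)
      (fun j => by simpa using h.sent_of_zero hur j) j
    refine h1.resolve_right fun hle => ?_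
    have h2 : p.length < Fintype.card V := lt_of_lt_of_le hp.length_lt
      (Fintype.card_subtype_le _)
    have h3 : (sent st j v).card ≤ K.card := Finset.card_le_card fun x hx =>
      hsub j v x (mem_sent.1 hx).1
    simp only at hle
    omega
  by_cases hv : v ∈ X
  · exact (mem_sent.1 (key v hv)).1
  · obtain ⟨w, hw, hwv⟩ := hdom v hv
    exact h.heard hwv hw j (key w hw)

end Flood

/-- The internal nodes of a tree form a connected set. -/
theorem IsTree.internal_connected {V : Type*} [DecidableEq V] {G : SimpleGraph V}
    {par : V → Option V} {ch : V → List V} {ρ : V} {f : Forest V} (ht : IsTree G par ch ρ f)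
    (hρ : ch ρ ≠ []) : (G.induce {v | ch v ≠ []}).Connected := by
  have key : ∀ (g : Forest V) (p : V) (hp : ch p ≠ []), TreeShape G par ch p g →
      ∀ v ∈ g.verts, ∀ hv : ch v ≠ [],
      (G.induce {v | ch v ≠ []}).Reachable ⟨p, hp⟩ ⟨v, hv⟩ := by
    intro g
    induction g with
    | nil => intro p hp _ v hv; cases hv
    | cons w s t ih1 ih2 =>
      rintro p hp ⟨h1, h2, h3, h4, h5⟩ v hv hvc
      simp only [Forest.verts, List.mem_cons, List.mem_append] at hv
      have hadj : ∀ hw : ch w ≠ [], (G.induce {v | ch v ≠ []}).Reachable ⟨p, hp⟩ ⟨w, hw⟩ :=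
        fun hw => SimpleGraph.Adj.reachable (by exact h3)
      rcases hv with rfl | hv | hv
      · exact hadj hvc
      · have hw : ch w ≠ [] := by
          rw [h2]
          intro he
          rw [Forest.roots_eq_nil.1 he] at hv
          cases hv
        exact (hadj hw).trans (ih1 w hw h4 v hv hvc)
      · exact ih2 p hp h5 v hv hvc
  have hreach : ∀ v : {v | ch v ≠ []}, (G.induce {v | ch v ≠ []}).Reachable ⟨ρ, hρ⟩ v := by
    rintro ⟨v, hv⟩
    by_cases hvρ : v = ρ
    · subst hvρ; exact SimpleGraph.Reachable.refl _
    · exact key f ρ hρ ht.shape v ((ht.mem_verts v).2 hvρ) hv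
  exact { preconnected := fun u v => (hreach u).symm.trans (hreach v)
          nonempty := ⟨⟨ρ, hρ⟩⟩ }

end Sinr

namespace Sinr

open Mb

/-! ## The execution of `BTD_MB` -/

section Broadcasting

variable {V : Type*} [Fintype V] {N : ℕ} (M : Model) (net : Network V N)
  {R : Type*} [DecidableEq R] (F : Families) (hold : V → List R)

/-- At time `t`, all nodes execute `BTD_MB`, and their states are `s`. -/
def BAt (t : ℕ) (s : V → Mb.State R) : Prop :=
  ∀ v, run M net F hold t v = some (.broadcasting (s v))

/-- What `v` hears in `BTD_MB`. -/
noncomputable def heardB (s : V → Mb.State R) (v : V) : Option (Msg Ctl R) :=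
  hear M net (fun v => (s v).send F) v

variable {M net F hold} {t : ℕ} {s : V → Mb.State R}

theorem BAt.transmitted_eq (h : BAt M net F hold t s) :
    transmitted (btdProtocol R F) (run M net F hold t) = fun v => (s v).send F := by
  funext v
  unfold transmitted
  rw [h v]
  rfl

theorem BAt.received_eq (h : BAt M net F hold t s) (v : V) :
    received M net (btdProtocol R F) (run M net F hold t) v = heardB M net F s v := by
  rw [received_eq_hear, h.transmitted_eq]
  rfl

theorem BAt.step (h : BAt M net F hold t s) :
    BAt M net F hold (t + 1) fun v => (s v).recv F (heardB M net F s v) := by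
  intro v
  rw [run_succ, h.received_eq, h v]
  rfl

theorem absorb_seen {s : Mb.State R} {m : Msg Ctl R} {r : R} (h : r ∈ (s.absorb m).seen) :
    r ∈ s.seen ∨ m.rumor = some r := by
  have hp : ∀ r', r ∈ (s.push r').seen → r ∈ s.seen ∨ r = r' := by
    intro r' h
    unfold State.push at h
    split_ifs at h
    · exact .inl h
    · rcases List.mem_cons.1 h with h | h
      · exact .inr h
      · exact .inl h
  obtain ⟨c, x⟩ := m
  cases c with
  | elim a b => exact .inl h
  | pass a b => exact .inl h
  | claim a b => exact .inl h
  | walk b src dst num step =>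
    left
    simp only [State.absorb] at h
    split_ifs at h <;> exact h
  | hand dst =>
    cases x with
    | none => exact .inl h
    | some r' =>
      simp only [State.absorb] at h
      split_ifs at h
      · exact (hp r' h).imp_right fun e => by rw [e]
      · exact .inl h
  | spread =>
    cases x with
    | none => exact .inl h
    | some r' => exact (hp r' h).imp_right fun e => by rw [e]

/-- The walk after a round in which nothing is received. -/
def Mb.State.goes (s : Mb.State R) : Mb.State R :=
  match s.frozen with
  | some _ => { s with pour := s.pour.tail }
  | none => { s with tour := (s.tour.depart s.parent).tick }

/-- The message received in a round, if any, is recorded. -/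
def Mb.State.listen (s : Mb.State R) : Option (Msg Ctl R) → Mb.State R
  | some m => s.absorb m
  | none => s

/-- The counter of rounds advances. -/
def Mb.State.count (s : Mb.State R) : Mb.State R :=
  match s.round with
  | some q => { s with round := some (q + 1) }
  | none => if s.tour.timer = some 0 then { s with round := some 0 } else s

theorem Mb.State.recv_eq (s : Mb.State R) (m : Option (Msg Ctl R)) :
    s.recv F m = ((s.prepare F).goes.listen m).count := by
  cases m <;> rfl

theorem recv_seen {s : Mb.State R} {m : Option (Msg Ctl R)} {r : R}
    (h : r ∈ (s.recv F m).seen) : r ∈ s.seen ∨ ∃ m', m = some m' ∧ m'.rumor = some r := by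
  have h1 : (s.prepare F).seen = s.seen := by
    unfold State.prepare
    split
    · rfl
    · split_ifs <;> rfl
  have h2 : (s.prepare F).goes.seen = s.seen := by
    rw [← h1]
    unfold State.goes
    split <;> rfl
  have h3 : ∀ s' : Mb.State R, s'.count.seen = s'.seen := by
    intro s'
    unfold State.count
    split
    · rfl
    · split_ifs <;> rfl
  rw [State.recv_eq, h3] at h
  cases m with
  | none =>
    left
    rw [← h2]
    exact h
  | some m =>
    rcases absorb_seen h with h | h
    · left
      rw [← h2]
      exact h
    · exact .inr ⟨m, rfl, h⟩

variable (M net F hold) in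
/-- What is recorded as seen has been received. -/
def Sound (t : ℕ) (s : V → Mb.State R) : Prop :=
  ∀ v, ∀ r ∈ (s v).seen, Knows M net (btdProtocol R F) hold t v r

theorem Sound.step (h : BAt M net F hold t s) (hs : Sound M net F hold t s) :
    Sound M net F hold (t + 1) fun v => (s v).recv F (heardB M net F s v) := by
  intro v r hr
  rcases recv_seen hr with hr | ⟨m, hm, hmr⟩
  · rcases hs v r hr with h1 | ⟨t', ht', h2⟩
    · exact .inl h1
    · exact .inr ⟨t', by omega, h2⟩
  · exact .inr ⟨t, by omega, m, (h.received_eq v).trans hm, hmr⟩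

variable (M net F hold) in
/-- All nodes execute `BTD_MB` in the states `s`, and what is recorded as seen has been received. -/
structure Good (t : ℕ) (s : V → Mb.State R) : Prop where
  at_ : BAt M net F hold t s
  sound : Sound M net F hold t s

theorem Good.step (h : Good M net F hold t s) :
    Good M net F hold (t + 1) fun v => (s v).recv F (heardB M net F s v) :=
  ⟨h.at_.step, h.sound.step h.at_⟩

theorem Good.modest (h : Good M net F hold t s) {B : ℕ}
    (hs : ∀ v m, (s v).send F = some m → m.ctl.Bounded B) (hB : Modest M net F hold B t) :
    Modest M net F hold B (t + 1) := by
  refine hB.extend fun q hq v m hm => ?_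
  obtain rfl : q = 0 := by omega
  rw [Nat.add_zero, h.at_.transmitted_eq] at hm
  exact hs v m hm

/-! ### The walks -/

section Pouring

variable [DecidableEq V] (net) (par : V → Option V) (ch : V → List V)

/-- The state of `v` during the walks of `BTD_MB`. -/
noncomputable def pouring (θ : V → Tour) (pr st : V → List R) (v : V) : Mb.State R :=
  ⟨net.label v, (par v).map net.label, (ch v).map net.label, θ v, pr v, st v, st v, none, none⟩

variable {net par ch} {θ θ' : V → Tour} {pr st : V → List R} {n : ℕ} {sync : Bool} {h : V}

theorem prepare_pouring (v : V) : (pouring net par ch θ pr st v).prepare F =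
    pouring net par ch (fun x => (θ x).turn ((par x).map net.label) ((ch x).map net.label))
      pr st v := rfl

theorem frozen_pouring {v : V} (hv : (θ v).token = none ∨ ch v ≠ [] ∨ pr v = [] ∨
    ∃ w, (θ v).token = some w ∧ w.sync = true) :
    (pouring net par ch θ pr st v).frozen = none := by
  unfold State.frozen
  simp only [pouring]
  rcases hv with h | h | h | ⟨w, h, h'⟩
  · rw [h]
  · cases hc : ch v with
    | nil => exact absurd hc h
    | cons x l =>
      cases (θ v).token <;> simp
  · rw [h]
    cases (θ v).token <;> cases ch v <;> cases par v <;> simp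
  · rw [h]
    cases ch v <;> cases par v <;> cases pr v <;> simp [h']

variable (M net F hold par ch) in
/-- At time `t` the prepared tours of the walks of `BTD_MB` are given by `θ`. -/
def PourAt (t : ℕ) (θ : V → Tour) (pr st : V → List R) : Prop :=
  ∃ θ₀, Good M net F hold t (pouring net par ch θ₀ pr st) ∧
    ∀ x, (θ₀ x).turn ((par x).map net.label) ((ch x).map net.label) = θ x

/-- A leaf sends a rumour to its parent. -/
theorem PourAt.pour (hp : PourAt M net F hold par ch t θ pr st)
    (hm : Move (commGraph M net) net.label par ch n false false h θ θ') (hc : ch h = []) {p : V}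
    (hpar : par h = some p) (hadj : (commGraph M net).Adj h p) {r : R} {l : List R}
    (hr : pr h = r :: l) :
    PourAt M net F hold par ch (t + 1) θ (Function.update pr h l)
      (Function.update st p (if r ∈ st p then st p else r :: st p)) ∧
    ∀ B, 5 ≤ B → N ≤ B → Modest M net F hold B t → Modest M net F hold B (t + 1) := by
  obtain ⟨θ₀, hg, hθ⟩ := hp
  obtain ⟨z, w, hz, hw, hsync, -, -, -, hsend⟩ := hm.send_eq
  have hprep : ∀ v, (pouring net par ch θ₀ pr st v).prepare F = pouring net par ch θ pr st v := by
    intro v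
    rw [prepare_pouring]
    exact congrArg (fun θ => pouring net par ch θ pr st v) (funext hθ)
  have hfr : ∀ v, (pouring net par ch θ pr st v).frozen =
      if v = h then some ⟨.hand (net.label p), some r⟩ else none := by
    intro v
    by_cases hv : v = h
    · subst hv
      unfold State.frozen
      simp only [pouring, hw, hc, hpar, hr, if_true]
      simp [hsync]
    · rw [if_neg hv]
      exact frozen_pouring (.inl (hm.others v hv))
  have hsnd : ∀ v, (pouring net par ch θ₀ pr st v).send F =
      if v = h then some ⟨.hand (net.label p), some r⟩ else none := by
    intro v
    unfold State.send
    rw [hprep]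
    unfold State.emit
    change ((pouring net par ch θ pr st v).frozen).or (((θ v).send (net.label v)
      ((par v).map net.label)).map _) = _
    rw [hfr, hsend]
    by_cases hv : v = h <;> simp [hv]
  have hoth : ∀ v, v ≠ h → (pouring net par ch θ₀ pr st v).send F = none := fun v hv => by
    rw [hsnd, if_neg hv]
  have htm : ∀ x, (θ x).timer = none := hm.first rfl
  -- the states after the round
  have hrecv : ∀ v, (pouring net par ch θ₀ pr st v).recv F
      (heardB M net F (pouring net par ch θ₀ pr st) v) =
      pouring net par ch θ (Function.update pr h l)
        (Function.update st p (if r ∈ st p then st p else r :: st p)) v := by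
    intro v
    have hmid : (pouring net par ch θ pr st v).goes =
        pouring net par ch θ (Function.update pr h l) st v := by
      unfold State.goes
      rw [hfr]
      by_cases hv : v = h
      · subst hv
        rw [if_pos rfl]
        simp [pouring, hr]
      · rw [if_neg hv]
        have : ((θ v).depart ((par v).map net.label)).tick = θ v := by
          rw [Tour.depart_of_none (hm.others v hv)]
          have := htm v
          unfold Tour.tick
          rw [this]
          cases hθv : θ v
          rw [hθv] at this
          simp_all
        simp only [pouring, this, Function.update_of_ne hv]
    rw [State.recv_eq, hprep, hmid]
    have hlast : ∀ st' : V → List R, (pouring net par ch θ (Function.update pr h l) st' v).count =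
        pouring net par ch θ (Function.update pr h l) st' v := by
      intro st'
      refine if_neg ?_
      change (θ v).timer ≠ some 0
      rw [htm]
      exact (Option.some_ne_none 0).symm
    unfold heardB
    by_cases hv : (commGraph M net).Adj h v
    · rw [hear_single M net hoth hv, hsnd, if_pos rfl]
      have habs : (pouring net par ch θ (Function.update pr h l) st v).absorb
          ⟨.hand (net.label p), some r⟩ = pouring net par ch θ (Function.update pr h l)
            (Function.update st p (if r ∈ st p then st p else r :: st p)) v := by
        unfold State.absorb
        by_cases hvp : v = p
        · subst hvp
          simp only
          rw [if_pos (show net.label v = (pouring net par ch θ _ st v).id from rfl)]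
          unfold State.push
          change (if r ∈ st v then _ else _) = _
          by_cases hrs : r ∈ st v
          · rw [if_pos hrs]
            simp [pouring, hrs]
          · rw [if_neg hrs]
            simp [pouring, hrs]
        · simp only
          rw [if_neg (show ¬net.label p = (pouring net par ch θ _ st v).id from
            fun e => hvp (net.label_injective e).symm)]
          simp [pouring, Function.update_of_ne hvp]
      unfold State.listen
      simp only
      rw [habs]
      exact hlast _
    · rw [hear_single_eq_none M net hoth hv]
      have hvp : v ≠ p := fun e => hv (e ▸ hadj)
      unfold State.listen
      simp only
      rw [hlast]
      simp [pouring, Function.update_of_ne hvp]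
  constructor
  · have := hg.step
    simp only [hrecv] at this
    exact ⟨θ, this, hm.turn_eq⟩
  · intro B h5 hN hB
    refine hg.modest (fun v m hvm => ?_) hB
    rw [hsnd] at hvm
    split_ifs at hvm
    obtain rfl := Option.some.inj hvm
    intro y hy
    have := label_le net p
    simp only [Ctl.fields, List.mem_cons, List.not_mem_nil, or_false] at hy
    omega

/-- A move of a walk of `BTD_MB`. -/
theorem PourAt.move (hp : PourAt M net F hold par ch t θ pr st)
    (hm : Move (commGraph M net) net.label par ch n false sync h θ θ')
    (hc : sync = false → ch h = [] → pr h = []) :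
    (Good M net F hold (t + 1) fun v => if (θ' v).timer = some 0 then
      { pouring net par ch θ' pr st v with round := some 0 } else
        pouring net par ch θ' pr st v) ∧
    ∀ B, 5 ≤ B → N ≤ B → 2 * n ≤ B → Modest M net F hold B t → Modest M net F hold B (t + 1) := by
  obtain ⟨θ₀, hg, hθ⟩ := hp
  obtain ⟨z, w, hz, hw, hsync, hwn, hws, rfl, hsend⟩ := hm.send_eq
  have hprep : ∀ v, (pouring net par ch θ₀ pr st v).prepare F = pouring net par ch θ pr st v := by
    intro v
    rw [prepare_pouring]
    exact congrArg (fun θ => pouring net par ch θ pr st v) (funext hθ)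
  have hfr : ∀ v, (pouring net par ch θ pr st v).frozen = none := by
    intro v
    refine frozen_pouring ?_
    by_cases hv : v = h
    · subst hv
      cases hs : sync with
      | true => exact .inr (.inr (.inr ⟨w, hw, hsync.trans hs⟩))
      | false =>
        by_cases hcv : ch v = []
        · exact .inr (.inr (.inl (hc hs hcv)))
        · exact .inr (.inl hcv)
    · exact .inl (hm.others v hv)
  have hsnd : ∀ v, (pouring net par ch θ₀ pr st v).send F =
      if v = h then some ⟨Ctl.walk w.sync (net.label h) (net.label z) w.num w.step, none⟩
      else none := by
    intro v
    unfold State.send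
    rw [hprep]
    unfold State.emit
    change ((pouring net par ch θ pr st v).frozen).or (((θ v).send (net.label v)
      ((par v).map net.label)).map _) = _
    rw [hfr, hsend]
    by_cases hv : v = h <;> simp [hv]
  have hoth : ∀ v, v ≠ h → (pouring net par ch θ₀ pr st v).send F = none := fun v hv => by
    rw [hsnd, if_neg hv]
  set θ' := moved net.label par ch false h z w θ with hθ'
  have hrecv : ∀ v, (pouring net par ch θ₀ pr st v).recv F
      (heardB M net F (pouring net par ch θ₀ pr st) v) =
      if (θ' v).timer = some 0 then { pouring net par ch θ' pr st v with round := some 0 } else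
        pouring net par ch θ' pr st v := by
    intro v
    rw [State.recv_eq, hprep]
    have hgo : (pouring net par ch θ pr st v).goes = pouring net par ch
        (fun x => ((θ x).depart ((par x).map net.label)).tick) pr st v := by
      unfold State.goes
      rw [hfr]
      rfl
    have hmid : (pouring net par ch θ pr st v).goes.listen
        (heardB M net F (pouring net par ch θ₀ pr st) v) = pouring net par ch θ' pr st v := by
      rw [hgo]
      unfold heardB
      by_cases hv : (commGraph M net).Adj h v
      · rw [hear_single M net hoth hv, hsnd, if_pos rfl]
        unfold State.listen State.absorb
        simp only
        by_cases hvz : v = z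
        · subst hvz
          rw [if_pos (show net.label v = (pouring net par ch _ pr st v).id from rfl)]
          unfold pouring
          rw [hθ', moved_self]
        · rw [if_neg (show ¬net.label z = (pouring net par ch _ pr st v).id from
            fun e => hvz (net.label_injective e).symm)]
          unfold pouring
          rw [hθ', moved_of_ne hvz]
      · rw [hear_single_eq_none M net hoth hv]
        have hvz : v ≠ z := fun e => hv (e ▸ hz)
        unfold State.listen
        simp only
        unfold pouring
        rw [hθ', moved_of_ne hvz]
    rw [hmid]
    rfl
  constructor
  · have := hg.step
    simp only [hrecv] at this
    exact this
  · intro B h5 hN hn hB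
    refine hg.modest (fun v m hvm => ?_) hB
    rw [hsnd] at hvm
    split_ifs at hvm
    obtain rfl := Option.some.inj hvm
    intro y hy
    have h1 := label_le net h
    have h2 := label_le net z
    have h3 : w.sync.toNat ≤ 1 := Bool.toNat_le _
    simp only [Ctl.fields, List.mem_cons, List.not_mem_nil, or_false] at hy
    omega

end Pouring

end Broadcasting

end Sinr

namespace Sinr

open Mb

section Broadcasting

variable {V : Type*} [Fintype V] {N : ℕ} {M : Model} {net : Network V N}
  {R : Type*} [DecidableEq R] {F : Families} {hold : V → List R} {t : ℕ}

/-! ### The walks of `BTD_MB` as a whole -/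

section Pouring

variable [DecidableEq V] {par : V → Option V} {ch : V → List V} {θ θ' : V → Tour}
  {pr st : V → List R} {n : ℕ} {sync : Bool} {h : V}

variable (hold par ch) in
/-- The rumours during the first walk of `BTD_MB`: `pr` are those that leaves have still to send to
their parents, and `st` the stacks. -/
structure PourInv (pr st : V → List R) : Prop where
  nodup : ∀ v, (st v).Nodup
  sub : ∀ v, ∀ r ∈ hold v, r ∈ st v
  leaf : ∀ v p, ch v = [] → par v = some p → ∀ r ∈ hold v, r ∈ pr v ∨ r ∈ st p
  pr_src : ∀ v, ∀ r ∈ pr v, ∃ w, r ∈ hold w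
  st_src : ∀ v, ∀ r ∈ st v, ∃ w, r ∈ hold w

theorem PourInv.pour (hi : PourInv hold par ch pr st) {p : V} (hpar : par h = some p) {r : R}
    {l : List R} (hr : pr h = r :: l) :
    PourInv hold par ch (Function.update pr h l)
      (Function.update st p (if r ∈ st p then st p else r :: st p)) := by
  have hmono : ∀ v, ∀ x ∈ st v,
      x ∈ Function.update st p (if r ∈ st p then st p else r :: st p) v := by
    intro v x hx
    by_cases hv : v = p
    · subst hv
      rw [Function.update_self]
      split_ifs
      · exact hx
      · exact List.mem_cons_of_mem _ hx
    · rwa [Function.update_of_ne hv]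
  have hrp : r ∈ Function.update st p (if r ∈ st p then st p else r :: st p) p := by
    rw [Function.update_self]
    split_ifs with hrs
    · exact hrs
    · exact List.mem_cons_self
  refine ⟨fun v => ?_, fun v x hx => hmono v x (hi.sub v x hx), fun v q hc hq x hx => ?_,
    fun v x hx => ?_, fun v x hx => ?_⟩
  · by_cases hv : v = p
    · subst hv
      rw [Function.update_self]
      split_ifs with hrs
      · exact hi.nodup v
      · exact List.nodup_cons.2 ⟨hrs, hi.nodup v⟩
    · rw [Function.update_of_ne hv]
      exact hi.nodup v
  · rcases hi.leaf v q hc hq x hx with h1 | h1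
    · by_cases hv : v = h
      · subst hv
        rw [hr] at h1
        obtain rfl : q = p := Option.some.inj (hq.symm.trans hpar)
        rw [Function.update_self]
        rcases List.mem_cons.1 h1 with rfl | h1
        · exact .inr hrp
        · exact .inl h1
      · rw [Function.update_of_ne hv]
        exact .inl h1
    · exact .inr (hmono q x h1)
  · by_cases hv : v = h
    · subst hv
      rw [Function.update_self] at hx
      exact hi.pr_src v x (by rw [hr]; exact List.mem_cons_of_mem _ hx)
    · rw [Function.update_of_ne hv] at hx
      exact hi.pr_src v x hx
  · by_cases hv : v = p
    · subst hv
      rw [Function.update_self] at hx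
      split_ifs at hx
      · exact hi.st_src v x hx
      · rcases List.mem_cons.1 hx with rfl | hx
        · exact hi.pr_src h x (by rw [hr]; exact List.mem_cons_self)
        · exact hi.st_src v x hx
    · rw [Function.update_of_ne hv] at hx
      exact hi.st_src v x hx

/-- A leaf sends its rumours to its parent. -/
theorem PourAt.drain (hm : Move (commGraph M net) net.label par ch n false false h θ θ')
    (hc : ch h = []) {p : V} (hpar : par h = some p) (hadj : (commGraph M net).Adj h p) :
    ∀ (l : List R) (t : ℕ) (pr st : V → List R), pr h = l →
    PourAt M net F hold par ch t θ pr st → PourInv hold par ch pr st →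
    ∃ st', PourAt M net F hold par ch (t + l.length) θ (Function.update pr h []) st' ∧
      PourInv hold par ch (Function.update pr h []) st' ∧
      ∀ B, 5 ≤ B → N ≤ B → Modest M net F hold B t → Modest M net F hold B (t + l.length) := by
  intro l
  induction l with
  | nil =>
    intro t pr st hl hp hi
    have e : Function.update pr h [] = pr := by
      conv_lhs => rw [← hl]
      exact Function.update_eq_self h pr
    rw [e]
    exact ⟨st, hp, hi, fun B _ _ h => h⟩
  | cons r l ih =>
    intro t pr st hl hp hi
    obtain ⟨h1, h2⟩ := hp.pour hm hc hpar hadj hl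
    obtain ⟨st', a1, a2, a3⟩ := ih (t + 1) _ _ (Function.update_self _ _ _) h1 (hi.pour hpar hl)
    rw [Function.update_idem] at a1 a2
    have e : t + (r :: l).length = t + 1 + l.length := by rw [List.length_cons]; omega
    rw [e]
    exact ⟨st', a1, a2, fun B h5 hN hB => a3 B h5 hN (h2 B h5 hN hB)⟩

theorem sum_update_nil (pr : V → List R) (h : V) :
    ∑ v, (Function.update pr h [] v).length + (pr h).length = ∑ v, (pr v).length := by
  rw [← Finset.add_sum_erase _ _ (Finset.mem_univ h), ← Finset.add_sum_erase _ (fun v =>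
    (pr v).length) (Finset.mem_univ h), Function.update_self, List.length_nil, zero_add, add_comm]
  congr 1
  exact Finset.sum_congr rfl fun v hv => by
    rw [Function.update_of_ne (Finset.ne_of_mem_erase hv)]

/-- The sum of the time and of the rumours still to be poured grows by one only: a round in which
the walk is frozen removes one of them. Over the whole walk the leaves cause at most `k` extra
rounds. -/
theorem PourAt.drain_move (hp : PourAt M net F hold par ch t θ pr st)
    (hi : PourInv hold par ch pr st)
    (hm : Move (commGraph M net) net.label par ch n false false h θ θ')
    (hleaf : ∀ v, ch v = [] → ∃ p, par v = some p ∧ (commGraph M net).Adj v p)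
    (htm : ∀ x, (θ' x).timer ≠ some 0) :
    ∃ t' pr' st', Good M net F hold t' (pouring net par ch θ' pr' st') ∧
      PourInv hold par ch pr' st' ∧
      t' + ∑ v, (pr' v).length = t + 1 + ∑ v, (pr v).length ∧
      (ch h = [] → pr' h = []) ∧ (∀ v, pr v = [] → pr' v = []) ∧
      ∀ B, 5 ≤ B → N ≤ B → 2 * n ≤ B → Modest M net F hold B t → Modest M net F hold B t' := by
  have key : ∀ (t : ℕ) (pr st : V → List R), PourAt M net F hold par ch t θ pr st →
      (ch h = [] → pr h = []) → Good M net F hold (t + 1) (pouring net par ch θ' pr st) ∧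
      ∀ B, 5 ≤ B → N ≤ B → 2 * n ≤ B → Modest M net F hold B t →
        Modest M net F hold B (t + 1) := by
    intro t pr st hp hc
    obtain ⟨h1, h2⟩ := hp.move hm fun _ => hc
    simp only [if_neg (htm _)] at h1
    exact ⟨h1, h2⟩
  by_cases hc : ch h = []
  · obtain ⟨p, hpar, hadj⟩ := hleaf h hc
    obtain ⟨st', a1, a2, a3⟩ := PourAt.drain hm hc hpar hadj _ t pr st rfl hp hi
    obtain ⟨b1, b2⟩ := key _ _ _ a1 fun _ => Function.update_self _ _ _
    refine ⟨_, _, _, b1, a2, ?_, fun _ => Function.update_self _ _ _, fun v hv => ?_,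
      fun B h5 hN hn hB => b2 B h5 hN hn (a3 B h5 hN hB)⟩
    · have := sum_update_nil pr h
      omega
    · by_cases hvh : v = h
      · rw [hvh, Function.update_self]
      · rwa [Function.update_of_ne hvh]
  · obtain ⟨b1, b2⟩ := key t pr st hp fun h => absurd h hc
    exact ⟨_, _, _, b1, hi, rfl, fun h => absurd h hc, fun _ h => h, b2⟩

/-- The first walk of `BTD_MB`. -/
theorem PourAt.path {hs : List V}
    (hp : MovePath (commGraph M net) net.label par ch n false false hs θ θ')
    (hleaf : ∀ v, ch v = [] → ∃ p, par v = some p ∧ (commGraph M net).Adj v p)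
    (htm : ∀ x, (θ' x).timer ≠ some 0) :
    ∀ (t : ℕ) (pr st : V → List R), hs ≠ [] → PourAt M net F hold par ch t θ pr st →
    PourInv hold par ch pr st →
    ∃ t' pr' st', Good M net F hold t' (pouring net par ch θ' pr' st') ∧
      PourInv hold par ch pr' st' ∧
      t' + ∑ v, (pr' v).length = t + hs.length + ∑ v, (pr v).length ∧
      (∀ v ∈ hs, ch v = [] → pr' v = []) ∧ (∀ v, pr v = [] → pr' v = []) ∧
      ∀ B, 5 ≤ B → N ≤ B → 2 * n ≤ B → Modest M net F hold B t → Modest M net F hold B t' := by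
  induction hp with
  | nil => intro t pr st h; exact absurd rfl h
  | @cons h hs θ θ₁ θ₂ hm hp ih =>
    intro t pr st _ hw hi
    have htm₁ : ∀ x, (θ₁ x).timer ≠ some 0 := by
      cases hp with
      | nil => exact htm
      | cons hm' _ => exact hm'.timer
    obtain ⟨t₁, pr₁, st₁, a1, a2, a3, a4, a5, a6⟩ := hw.drain_move hi hm hleaf htm₁
    cases hp with
    | nil =>
      refine ⟨t₁, pr₁, st₁, a1, a2, a3, fun v hv => ?_, a5, a6⟩
      rw [List.mem_singleton.1 hv]
      exact a4
    | @cons h' hs' _ θ₃ _ hm' hp' =>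
      obtain ⟨t₂, pr₂, st₂, b1, b2, b3, b4, b5, b6⟩ := ih htm t₁ pr₁ st₁ (List.cons_ne_nil _ _)
        ⟨θ₁, a1, hm'.turn_eq⟩ a2
      refine ⟨t₂, pr₂, st₂, b1, b2, ?_, fun v hv hc => ?_, fun v hv => b5 v (a5 v hv),
        fun B h5 hN hn hB => b6 B h5 hN hn (a6 B h5 hN hn hB)⟩
      · rw [List.length_cons]
        omega
      · rcases List.mem_cons.1 hv with rfl | hv
        · exact b5 v (a4 hc)
        · exact b4 v hv hc

/-- The second walk of `BTD_MB`. -/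
theorem PourAt.sync_path {hs : List V}
    (hp : MovePath (commGraph M net) net.label par ch n false true hs θ θ')
    (htm : ∀ x, (θ' x).timer = some 0) :
    ∀ t : ℕ, hs ≠ [] → PourAt M net F hold par ch t θ pr st →
    (Good M net F hold (t + hs.length) fun v =>
      { pouring net par ch θ' pr st v with round := some 0 }) ∧
    ∀ B, 5 ≤ B → N ≤ B → 2 * n ≤ B → Modest M net F hold B t →
      Modest M net F hold B (t + hs.length) := by
  induction hp with
  | nil => intro t h; exact absurd rfl h
  | @cons h hs θ θ₁ θ₂ hm hp ih =>
    intro t _ hw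
    obtain ⟨a1, a2⟩ := hw.move hm fun h => by cases h
    cases hp with
    | nil =>
      simp only [if_pos (htm _)] at a1
      exact ⟨a1, a2⟩
    | @cons h' hs' _ θ₃ _ hm' hp' =>
      simp only [if_neg (hm'.timer _)] at a1
      obtain ⟨b1, b2⟩ := ih htm (t + 1) (List.cons_ne_nil _ _) ⟨θ₁, a1, hm'.turn_eq⟩
      have e : t + (h :: h' :: hs').length = t + 1 + (h' :: hs').length := by
        simp only [List.length_cons]; omega
      rw [e]
      exact ⟨b1, fun B h5 hN hn hB => b2 B h5 hN hn (a2 B h5 hN hn hB)⟩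

end Pouring

/-! ### The second stage -/

/-- The part of the state of `v` that matters in the second stage. -/
structure Spreading (net : Network V N) (ch : V → List V) (v : V) (q : ℕ) (cur : Option R)
    (p : List R × List R) (s : Mb.State R) : Prop where
  id : s.id = net.label v
  children : s.children = (ch v).map net.label
  stack : s.stack = p.1
  seen : s.seen = p.2
  round : s.round = some q
  cur : s.cur = cur

variable {ch : V → List V} {v : V} {q : ℕ} {cur : Option R} {p : List R × List R}
  {s : Mb.State R}

theorem Spreading.prepare_zero (h : Spreading net ch v q cur p s) (hq : q % F.ssf.length = 0) :
    Spreading net ch v q p.1.head? (p.1.tail, p.2) (s.prepare F) := by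
  unfold State.prepare
  rw [h.round]
  simp only [if_pos hq]
  exact ⟨h.id, h.children, by rw [h.stack], h.seen, rfl, by rw [h.stack]⟩

theorem Spreading.prepare_ne (h : Spreading net ch v q cur p s) (hq : q % F.ssf.length ≠ 0) :
    Spreading net ch v q cur p (s.prepare F) := by
  unfold State.prepare
  rw [h.round]
  simp only [if_neg hq]
  exact h

theorem Spreading.emit (h : Spreading net ch v q cur p s) : s.emit F =
    (if fires F.ssf (q % F.ssf.length) (net.label v) then
      (if ch v = [] then none else cur) else none).map fun r => ⟨Ctl.spread, some r⟩ := by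
  unfold State.emit
  rw [h.round, h.cur, h.children, h.id]
  cases ch v <;> cases cur <;> simp

theorem Spreading.recv (h : Spreading net ch v q cur p (s.prepare F)) (x : Option R) :
    Spreading net ch v (q + 1) cur (x.toList.foldl pushPair p)
      (s.recv F (x.map fun r => ⟨Ctl.spread, some r⟩)) := by
  rw [State.recv_eq]
  have h1 : Spreading net ch v q cur p (s.prepare F).goes := by
    unfold State.goes
    split <;> exact ⟨h.id, h.children, h.stack, h.seen, h.round, h.cur⟩
  have h2 : Spreading net ch v q cur (x.toList.foldl pushPair p)
      ((s.prepare F).goes.listen (x.map fun r => ⟨Ctl.spread, some r⟩)) := by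
    cases x with
    | none => exact h1
    | some r =>
      change Spreading net ch v q cur (pushPair p r) ((s.prepare F).goes.push r)
      unfold State.push pushPair
      rw [h1.seen]
      split_ifs
      · exact h1
      · exact ⟨h1.id, h1.children, by rw [h1.stack], rfl, h1.round, h1.cur⟩
  unfold State.count
  rw [h2.round]
  exact ⟨h2.id, h2.children, h2.stack, h2.seen, rfl, h2.cur⟩

variable (M net) in
/-- The stacks at the beginnings of successive runs of `S`. -/
noncomputable def flood (S : List (Finset ℕ)) (ch : V → List V) (p₀ : V → List R × List R) :
    ℕ → V → List R × List R
  | 0 => p₀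
  | j + 1 => fun v => (collect M net S (fun u => if ch u = [] then none else
      (flood S ch p₀ j u).1.head?) S.length v).foldl pushPair
        ((flood S ch p₀ j v).1.tail, (flood S ch p₀ j v).2)

/-- The internal nodes are sparse, so each run of the SSF brings the top rumour of every internal
node to all its neighbours, which is what the abstract process `Flood` requires. -/
theorem flood_spec {S : List (Finset ℕ)} {p₀ : V → List R × List R} {δ : ℕ}
    (hS : Spreads M net S δ) {X : Finset V} (hX : Sparse M net X δ) (hch : ∀ v, ch v ≠ [] → v ∈ X)
    (h0 : ∀ v, (p₀ v).1 = (p₀ v).2) (hnd : ∀ v, (p₀ v).1.Nodup) :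
    Flood (commGraph M net) {v | ch v ≠ []} (flood M net S ch p₀)
      (fun j => collect M net S (fun u => if ch u = [] then none else
        (flood M net S ch p₀ j u).1.head?) S.length) where
  mem j v r := by
    rw [hS.mem_collect]
    · refine exists_congr fun u => and_congr_right fun _ => ?_
      by_cases hu : ch u = [] <;> simp [hu]
    · intro β
      refine (Finset.card_le_card fun v hv => ?_).trans (hX β)
      obtain ⟨hv, hvβ⟩ := Finset.mem_filter.1 hv
      refine Finset.mem_filter.2 ⟨hch v fun hc => ?_, hvβ⟩
      exact mem_senders.1 hv (if_pos hc)
  succ _ _ := rfl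
  zero := h0
  nodup := hnd

/-- A run of the SSF in the second stage. -/
theorem Good.run {s : V → Mb.State R} (hg : Good M net F hold t s) (hl : 0 < F.ssf.length)
    {j : ℕ} {cur : V → Option R} {p : V → List R × List R}
    (hs : ∀ v, Spreading net ch v (F.ssf.length * j) (cur v) (p v) (s v)) {B : ℕ} (hB : 5 ≤ B)
    (hm : Modest M net F hold B t) :
    ∃ s', Good M net F hold (t + F.ssf.length) s' ∧
      (∀ v, Spreading net ch v (F.ssf.length * (j + 1)) ((p v).1.head?)
        ((collect M net F.ssf (fun u => if ch u = [] then none else (p u).1.head?)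
          F.ssf.length v).foldl pushPair ((p v).1.tail, (p v).2)) (s' v)) ∧
      Modest M net F hold B (t + F.ssf.length) := by
  set x : V → Option R := fun u => if ch u = [] then none else (p u).1.head? with hx
  set l := F.ssf.length with hldef
  let c : ℕ → V → List R × List R := fun i v =>
    (collect M net F.ssf x i v).foldl pushPair ((p v).1.tail, (p v).2)
  have hmod : ∀ i < l, (l * j + i) % l = i := fun i hi => by
    rw [Nat.mul_add_mod, Nat.mod_eq_of_lt hi]
  have step : ∀ i < l, ∀ s : V → Mb.State R, Good M net F hold (t + i) s →
      (∀ v, Spreading net ch v (l * j + i) ((p v).1.head?) (c i v) ((s v).prepare F)) →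
      Modest M net F hold B (t + i) →
      ∃ s', Good M net F hold (t + (i + 1)) s' ∧
        (∀ v, Spreading net ch v (l * j + (i + 1)) ((p v).1.head?) (c (i + 1) v) (s' v)) ∧
        Modest M net F hold B (t + (i + 1)) := by
    intro i hi s hg hs hm
    have hsend : ∀ v, (s v).send F = (if fires F.ssf i (net.label v) then x v else none).map
        fun r => ⟨Ctl.spread, some r⟩ := by
      intro v
      unfold State.send
      rw [(hs v).emit, hmod i hi]
    have hheard : ∀ v, heardB M net F s v = (hears M net F.ssf x i v).map
        fun r => ⟨Ctl.spread, some r⟩ := by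
      intro v
      unfold heardB
      have : (fun v => (s v).send F) = fun v =>
          (if fires F.ssf i (net.label v) then x v else none).map
            fun r => ⟨Ctl.spread, some r⟩ := funext hsend
      rw [this]
      exact hear_map M net _ _ v
    refine ⟨_, hg.step, fun v => ?_, hg.modest (fun v m hvm => ?_) hm⟩
    · have := (hs v).recv (hears M net F.ssf x i v)
      rw [hheard]
      have e : c (i + 1) v = (hears M net F.ssf x i v).toList.foldl pushPair (c i v) := by
        simp only [c]
        rw [collect_succ, List.foldl_append]
      rw [e]
      exact this
    · rw [hsend] at hvm
      obtain ⟨r, -, rfl⟩ := Option.map_eq_some_iff.1 hvm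
      intro y hy
      simp only [Ctl.fields, List.mem_cons, List.not_mem_nil, or_false] at hy
      omega
  have key : ∀ i < l, ∃ s : V → Mb.State R, Good M net F hold (t + i) s ∧
      (∀ v, Spreading net ch v (l * j + i) ((p v).1.head?) (c i v) ((s v).prepare F)) ∧
      Modest M net F hold B (t + i) := by
    intro i
    induction i with
    | zero =>
      intro _
      refine ⟨s, hg, fun v => ?_, hm⟩
      exact (hs v).prepare_zero (Nat.mul_mod_right _ _)
    | succ i ih =>
      intro hi
      obtain ⟨s₁, a1, a2, a3⟩ := ih (by omega)
      obtain ⟨s₂, b1, b2, b3⟩ := step i (by omega) s₁ a1 a2 a3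
      refine ⟨s₂, b1, fun v => (b2 v).prepare_ne ?_, b3⟩
      rw [← hldef, hmod _ hi]
      omega
  obtain ⟨s₁, a1, a2, a3⟩ := key (l - 1) (by omega)
  obtain ⟨s₂, b1, b2, b3⟩ := step (l - 1) (by omega) s₁ a1 a2 a3
  have e : l - 1 + 1 = l := by omega
  rw [e] at b1 b2 b3
  refine ⟨s₂, b1, fun v => ?_, b3⟩
  rw [Nat.mul_succ]
  exact b2 v

theorem Good.runs {s : V → Mb.State R} (hg : Good M net F hold t s) (hl : 0 < F.ssf.length)
    {p₀ : V → List R × List R} (hs : ∀ v, Spreading net ch v 0 none (p₀ v) (s v)) {B : ℕ}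
    (hB : 5 ≤ B) (hm : Modest M net F hold B t) (j : ℕ) :
    ∃ (s' : V → Mb.State R) (cur : V → Option R),
      Good M net F hold (t + F.ssf.length * j) s' ∧
      (∀ v, Spreading net ch v (F.ssf.length * j) (cur v) (flood M net F.ssf ch p₀ j v) (s' v)) ∧
      Modest M net F hold B (t + F.ssf.length * j) := by
  induction j with
  | zero => exact ⟨s, fun _ => none, hg, hs, hm⟩
  | succ j ih =>
    obtain ⟨s', cur, a1, a2, a3⟩ := ih
    obtain ⟨s₂, b1, b2, b3⟩ := a1.run hl a2 hB a3
    rw [Nat.mul_succ, ← Nat.add_assoc]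
    refine ⟨s₂, fun v => (flood M net F.ssf ch p₀ j v).1.head?, b1, fun v => ?_, b3⟩
    have := b2 v
    rw [Nat.mul_succ] at this
    exact this

end Broadcasting

/-- `BTD_MB` accomplishes multi-broadcast. -/
theorem broadcast_complete {V : Type*} [Fintype V] {N : ℕ} {M : Model} {net : Network V N}
    {R : Type*} [DecidableEq R] {F : Families} {hold : V → List R} {par : V → Option V}
    {ch : V → List V} {ρ : V} {f : Forest V} {T : ℕ} {X : Finset V} {δ : ℕ}
    (hl : 0 < F.ssf.length) (hF : Spreads M net F.ssf δ) (hn : 2 ≤ Fintype.card V)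
    [DecidableEq V] (ht : IsTree (commGraph M net) par ch ρ f)
    (hX : Sparse M net X δ) (hch : ∀ v, ch v ≠ [] → v ∈ X) (hnd : ∀ v, (hold v).Nodup)
    (hT : ∀ v, run M net F hold T v = some (.broadcasting (Mb.init (net.label v)
      ((par v).map net.label) ((ch v).map net.label) (Fintype.card V) (hold v))))
    {B : ℕ} (hB5 : 5 ≤ B) (hBN : N ≤ B) (hBn : 2 * Fintype.card V ≤ B)
    (hm : Modest M net F hold B T) :
    (∀ t, Modest M net F hold B t) ∧
    ∀ t, T + 4 * Fintype.card V + ∑ v, (hold v).length +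
      F.ssf.length * (Fintype.card V + ∑ v, (hold v).length + 1) ≤ t →
      ∀ v w, ∀ r ∈ hold v, Knows M net (btdProtocol R F) hold t w r := by
  set n := Fintype.card V with hndef
  set k := ∑ v, (hold v).length with hk
  have hlen := ht.length_verts
  have hchρ : ch ρ ≠ [] := by
    rw [ht.ch_root]
    intro he
    rw [Forest.roots_eq_nil.1 he] at hlen
    simp [Forest.verts] at hlen
    omega
  have hleaf : ∀ v, ch v = [] → ∃ p, par v = some p ∧ (commGraph M net).Adj v p ∧ ch p ≠ [] := by
    intro v hv
    have hvρ : v ≠ ρ := fun e => hchρ (e ▸ hv)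
    obtain ⟨q, h1, h2, h3⟩ := ht.par_ne_none hvρ
    refine ⟨q, h1, h2.symm, ?_⟩
    rcases h3 with rfl | h3
    · exact hchρ
    · exact h3
  set θ₀ : V → Tour := fun v => if (par v).map net.label = none then
    Tour.start ((ch v).map net.label) n else Tour.idle with hθ₀
  have hθρ : θ₀ ρ = Tour.start ((ch ρ).map net.label) n := by simp [hθ₀, ht.par_root]
  have hθx : ∀ x, x ≠ ρ → θ₀ x = Tour.idle := by
    intro x hx
    obtain ⟨q, h1, -⟩ := ht.par_ne_none hx
    simp [hθ₀, h1]
  obtain ⟨hs₁, θ₁, hs₂, θ₂, p₁, l₁, c₁, m₁, p₂, l₂, m₂⟩ := exists_walks net.label_injective ht rfl hn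
    false θ₀ (by rw [hθρ]; rfl) (by rw [hθρ]; rfl) (fun x hx => by rw [hθx x hx]; rfl) (fun x => by
      by_cases hx : x = ρ
      · rw [hx, hθρ]; rfl
      · rw [hθx x hx]; rfl)
  have hne₁ : hs₁ ≠ [] := by
    rintro rfl
    simp at l₁; omega
  have hne₂ : hs₂ ≠ [] := by
    rintro rfl
    simp at l₂; omega
  have hg₀ : Good M net F hold T (pouring net par ch θ₀ hold hold) := by
    refine ⟨fun v => hT v, fun v r hr => .inl hr⟩
  have w₁ : PourAt M net F hold par ch T θ₀ hold hold := by
    refine ⟨θ₀, hg₀, fun x => ?_⟩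
    cases p₁ with
    | nil => exact absurd rfl hne₁
    | cons hm _ => exact hm.turn_eq x
  have hi₀ : PourInv hold par ch hold hold :=
    ⟨hnd, fun _ _ h => h, fun _ _ _ _ _ h => .inl h, fun v r h => ⟨v, h⟩, fun v r h => ⟨v, h⟩⟩
  obtain ⟨t₁, pr, st, a1, a2, a3, a4, -, a6⟩ := PourAt.path p₁
    (fun v hv => by obtain ⟨p, h1, h2, -⟩ := hleaf v hv; exact ⟨p, h1, h2⟩)
    (fun x => by rw [m₁ x]; exact (Option.some_ne_none 0).symm) T hold hold hne₁ w₁ hi₀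
  obtain ⟨b1, b2⟩ := PourAt.sync_path (F := F) (hold := hold) p₂ (fun x => (m₂ x).1) t₁ hne₂
    ⟨θ₁, a1, fun _ => rfl⟩
  set t₂ := t₁ + hs₂.length with ht₂
  have hm₂ := b2 B hB5 hBN hBn (a6 B hB5 hBN hBn hm)
  set p₀ : V → List R × List R := fun v => (st v, st v) with hp₀
  have hs₀ : ∀ v, Spreading net ch v 0 none (p₀ v)
      ({ pouring net par ch θ₂ pr st v with round := some 0 } : Mb.State R) :=
    fun v => ⟨rfl, rfl, rfl, rfl, rfl, rfl⟩
  have hruns := fun j => b1.runs hl hs₀ hB5 hm₂ j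
  have hflood := flood_spec hF hX hch (p₀ := p₀) (fun _ => rfl) a2.nodup
  constructor
  -- Since the SSF is not empty, `t` runs last at least `t` rounds; hence the bound on the fields
  -- holds at all times.
  · intro t t' ht' v m hvm
    obtain ⟨s', cur, -, -, hm'⟩ := hruns t
    refine hm' t' (lt_of_lt_of_le ht' ?_) v m hvm
    exact (Nat.le_mul_of_pos_left t hl).trans (Nat.le_add_left _ _)
  · intro t hle v w r hr
    obtain ⟨s', cur, hg, hsp, -⟩ := hruns (n + k + 1)
    set K : Finset R := Finset.univ.biUnion fun v => (hold v).toFinset with hKdef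
    have hK : K.card ≤ k := by
      refine Finset.card_biUnion_le.trans (Finset.sum_le_sum fun v _ => List.toFinset_card_le _)
    have hcomp := hflood.complete (ht.internal_connected hchρ) (fun v hv => by
        obtain ⟨p, -, h1, h2⟩ := hleaf v (by simpa using hv)
        exact ⟨p, h2, h1.symm⟩) (K := K) (fun v x hx => by
        obtain ⟨u, hu⟩ := a2.st_src v x hx
        exact Finset.mem_biUnion.2 ⟨u, Finset.mem_univ _, List.mem_toFinset.2 hu⟩) (r := r) (by
        by_cases hc : ch v = []
        · obtain ⟨p, h1, -, h2⟩ := hleaf v hc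
          have hvρ : v ≠ ρ := fun e => hchρ (e ▸ hc)
          have := (a2.leaf v p hc h1 r hr).resolve_left (by
            rw [a4 v (c₁ v hvρ) hc]; exact List.not_mem_nil)
          exact ⟨p, h2, this⟩
        · exact ⟨v, hc, a2.sub v r hr⟩) (j := n + k + 1) (by omega) w
    have hseen : r ∈ (s' w).seen := by rw [(hsp w).seen]; exact hcomp
    rcases hg.sound w r hseen with h1 | ⟨t', ht', h2⟩
    · exact .inl h1
    · refine .inr ⟨t', lt_of_lt_of_le ht' (le_trans ?_ hle), h2⟩
      omega

end Sinr

namespace Sinr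

/-! ### Logarithmic bounds and lengths of encodings -/

section Numbers

theorem half_le_log {n : ℕ} (hn : 1 ≤ n) : 1 / 2 ≤ Real.log (n + 1) := by
  have h1 : (2 : ℝ) ≤ n + 1 := by
    have : (1 : ℝ) ≤ n := by exact_mod_cast hn
    linarith
  have h2 := Real.log_le_log (by norm_num) h1
  have h3 := Real.log_two_gt_d9
  linarith

theorem log_succ_le {n : ℕ} (hn : 2 ≤ n) : Real.log (n + 1) ≤ 2 * Real.log n := by
  have hn' : (2 : ℝ) ≤ n := by exact_mod_cast hn
  have h : Real.log (n ^ 2) = 2 * Real.log n := by rw [Real.log_pow]; norm_num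
  rw [← h]
  exact Real.log_le_log (by positivity) (by nlinarith)

/-- The binary length of a number that is polynomial in `n` is logarithmic. -/
theorem exists_log_bound (A : ℝ) (d : ℕ) : ∃ K : ℝ, 0 < K ∧ ∀ n x : ℕ, 1 ≤ n →
    (x : ℝ) ≤ A * (n + 1) ^ d → ((Nat.log 2 x + 1 : ℕ) : ℝ) ≤ K * Real.log (n + 1) := by
  set a := max A 1 with ha
  have ha1 : 1 ≤ a := le_max_right _ _
  have ha0 : 0 ≤ Real.log a := Real.log_nonneg ha1
  refine ⟨2 * (2 * Real.log a + d) + 2, by positivity, fun n x hn hx => ?_⟩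
  have hΛ := half_le_log hn
  have hx' : (x : ℝ) ≤ a * (n + 1) ^ d :=
    hx.trans (mul_le_mul_of_nonneg_right (le_max_left _ _) (by positivity))
  have h2 := Real.log_two_gt_d9
  have key : (Nat.log 2 x : ℝ) * Real.log 2 ≤ Real.log a + d * Real.log (n + 1) := by
    rcases Nat.eq_zero_or_pos x with rfl | hx0
    · simp only [Nat.log_zero_right, Nat.cast_zero, zero_mul]
      positivity
    · have h3 : (2 : ℝ) ^ Nat.log 2 x ≤ a * (n + 1) ^ d := by
        refine le_trans ?_ hx'
        exact_mod_cast Nat.pow_log_le_self 2 hx0.ne'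
      have h4 := Real.log_le_log (by positivity) h3
      rwa [Real.log_mul (by positivity) (by positivity), Real.log_pow, Real.log_pow] at h4
  have h5 : (0 : ℝ) ≤ Nat.log 2 x := Nat.cast_nonneg _
  have h6 : (0 : ℝ) ≤ d := Nat.cast_nonneg _
  push_cast
  nlinarith [mul_nonneg h6 (by linarith : 0 ≤ Real.log (n + 1)),
    mul_nonneg ha0 (by linarith : 0 ≤ Real.log (n + 1) - 1 / 2)]

theorem eval_le (p : Polynomial ℕ) (n : ℕ) : p.eval n ≤ p.eval 1 * (n + 1) ^ p.natDegree := by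
  rw [Polynomial.eval_eq_sum_range, Polynomial.eval_eq_sum_range, Finset.sum_mul]
  refine Finset.sum_le_sum fun i hi => ?_
  rw [one_pow, mul_one]
  refine Nat.mul_le_mul_left _ ((Nat.pow_le_pow_left (Nat.le_succ n) i).trans ?_)
  exact Nat.pow_le_pow_right (Nat.succ_pos n) (Nat.lt_succ_iff.1 (Finset.mem_range.1 hi))

theorem encodeNat_length (x : ℕ) : (encodeNat x).length = 2 * x.size + 1 := by
  simp [encodeNat, Nat.size_eq_bits_len, List.length_flatMap, Function.const_def, mul_comm]

/-- There are at most six fields, each with two bits per binary digit and a terminating bit. -/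
theorem encode_length_le {c : Ctl} {B : ℕ} (h : c.Bounded B) :
    c.encode.length ≤ 6 * (2 * (Nat.log 2 B + 1) + 1) := by
  have h1 : c.fields.length ≤ 6 := by cases c <;> simp [Ctl.fields]
  have h2 : ∀ y ∈ c.fields.map fun x => (encodeNat x).length, y ≤ 2 * (Nat.log 2 B + 1) + 1 := by
    intro y hy
    obtain ⟨x, hx, rfl⟩ := List.mem_map.1 hy
    rw [encodeNat_length]
    have : x.size ≤ Nat.log 2 B + 1 :=
      (Nat.size_le_size (h x hx)).trans (Nat.size_le.2 (Nat.lt_pow_succ_log_self one_lt_two B))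
    omega
  rw [Ctl.encode, List.length_flatMap]
  refine (List.sum_le_card_nsmul _ _ h2).trans ?_
  rw [List.length_map, smul_eq_mul]
  exact Nat.mul_le_mul_right _ h1

/-- For these indices `(2 / 3) ^ i * n` is at least `1`, so rounding up costs only a constant
factor. -/
theorem selSize_le {n i : ℕ} (hn : 1 ≤ n) (hi : i < ⌈Real.logb (3 / 2) n⌉₊) :
    (selSize n (i + 1) : ℝ) ≤ 3 * ((2 / 3 : ℝ) ^ (i + 1) * n) := by
  have hn' : (0 : ℝ) < n := by exact_mod_cast hn
  have h1 : (3 / 2 : ℝ) ^ i ≤ n := by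
    rw [← Real.rpow_natCast, ← Real.le_logb_iff_rpow_le (by norm_num) hn']
    exact (Nat.lt_ceil.1 hi).le
  have h2 : (2 / 3 : ℝ) ^ i * (3 / 2 : ℝ) ^ i = 1 := by
    rw [← mul_pow]; norm_num
  have h3 : 1 ≤ (2 / 3 : ℝ) ^ i * n := by
    rw [← h2]
    exact mul_le_mul_of_nonneg_left h1 (by positivity)
  have h4 := (Nat.ceil_lt_add_one (a := (2 / 3 : ℝ) ^ (i + 1) * n) (by positivity)).le
  unfold selSize
  rw [pow_succ] at h4 ⊢
  linarith

theorem sum_pow_le (m : ℕ) : ∑ i ∈ Finset.range m, (2 / 3 : ℝ) ^ (i + 1) ≤ 2 := by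
  have h : ∑ i ∈ Finset.range m, (2 / 3 : ℝ) ^ (i + 1) = 2 - 2 * (2 / 3 : ℝ) ^ m := by
    induction m with
    | zero => norm_num
    | succ m ih => rw [Finset.sum_range_succ, ih]; ring
  rw [h]
  have : (0 : ℝ) ≤ (2 / 3 : ℝ) ^ m := by positivity
  linarith

/-- The selectors together have length `O(n log n)`. -/
theorem Families.Valid.length_le {F : Families} {n N c : ℕ} {C : ℝ} (h : F.Valid n N c C)
    (hC : 0 ≤ C) : (F.sel.flatten.length : ℝ) ≤ 2 * C * n * Real.log (n + 1) := by
  have hΛ : 0 ≤ Real.log ((n : ℝ) + 1) := Real.log_nonneg (by linarith [n.cast_nonneg (α := ℝ)])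
  have h1 : (F.sel.flatten.length : ℝ) = ∑ i : Fin F.sel.length, (F.sel[i].length : ℝ) := by
    rw [List.length_flatten, ← Fin.sum_univ_fun_getElem]
    push_cast
    rfl
  rw [h1]
  calc _ ≤ ∑ i : Fin F.sel.length, (2 / 3 : ℝ) ^ ((i : ℕ) + 1) * (C * n * Real.log (n + 1)) :=
        Finset.sum_le_sum fun i _ => (h.sel_short i i.2).trans (le_of_eq (by ring))
    _ = (∑ i ∈ Finset.range F.sel.length, (2 / 3 : ℝ) ^ (i + 1)) * (C * n * Real.log (n + 1)) := by
        rw [Finset.sum_mul,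
          ← Fin.sum_univ_eq_sum_range fun i => (2 / 3 : ℝ) ^ (i + 1) * (C * n * Real.log (n + 1))]
    _ ≤ 2 * (C * n * Real.log (n + 1)) := mul_le_mul_of_nonneg_right (sum_pow_le _) (by positivity)
    _ = _ := by ring

theorem Families.Valid.mono {F : Families} {n N c : ℕ} {C C' : ℝ} (h : F.Valid n N c C)
    (hC : C ≤ C') : F.Valid n N c C' := by
  have hΛ : 0 ≤ Real.log ((n : ℝ) + 1) := Real.log_nonneg (by linarith [n.cast_nonneg (α := ℝ)])
  refine ⟨h.sel_length, h.sel_selector, fun i hi => (h.sel_short i hi).trans ?_, h.ssf_ssf,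
    h.ssf_short.trans ?_⟩ <;> gcongr

end Numbers

/-- Families obtained from suitable hash functions. -/
theorem exists_families (D c : ℕ) (hD : 0 < D) (hc : 0 < c) (p : Polynomial ℕ) :
    ∃ C : ℝ, 0 < C ∧ ∀ n N : ℕ, 1 ≤ n → N ≤ p.eval n → ∃ F : Families, F.Valid n N c C ∧
      0 < F.ssf.length ∧
      ∀ (i : ℕ) (h : i < F.sel.length), IsHashFamily N D n (i + 1) F.sel[i] := by
  obtain ⟨K, hK, hlog⟩ := exists_log_bound (p.eval 1 + 2 : ℕ) p.natDegree
  -- The factors are `3` from `selSize_le`, one `D` from the number of hash functions, the rest from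
  -- their range, and `K` from replacing the logarithm of `N` by that of `n + 1`.
  set C₁ : ℝ := (3 * (D * (D * 2 ^ (16 * (D + 1)))) : ℕ) * K with hC₁
  set C₂ : ℝ := (c * (c * 2 ^ (c + 1)) : ℕ) * K with hC₂
  have h1 : 0 ≤ C₁ := by positivity
  have h2 : 0 < C₂ := by positivity
  refine ⟨C₁ + C₂, by positivity, fun n N hn hN => ?_⟩
  have hΛ := half_le_log hn
  have hlg : ((Nat.log 2 (N + 2) + 1 : ℕ) : ℝ) ≤ K * Real.log (n + 1) := by
    refine hlog n (N + 2) hn ?_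
    have h3 : N + 2 ≤ (p.eval 1 + 2) * (n + 1) ^ p.natDegree := by
      have := eval_le p n
      have : 0 < (n + 1) ^ p.natDegree := by positivity
      nlinarith
    exact_mod_cast h3
  obtain ⟨S, hS, hSl⟩ := exists_ssf N c hc
  choose l hl hll using fun i => exists_isHashing N D (selSize n (i + 1)) hD (selSize_pos hn)
  refine ⟨⟨(List.range ⌈Real.logb (3 / 2) n⌉₊).map fun i =>
    hashSets N (D * selSize n (i + 1) * 2 ^ (16 * (D + 1))) (l i), S⟩,
    ⟨by simp, fun i hi => ?_, fun i hi => ?_, hS, ?_⟩, ?_, fun i hi => ?_⟩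
  · simp only [List.getElem_map, List.getElem_range]
    refine (hl i).isSelector hD ?_
    have h4 : ⌈(2 / 3 : ℝ) ^ (i + 1) * n / 2⌉₊ ≤ (selSize n (i + 1) + 1) / 2 := by
      refine Nat.ceil_le.2 ?_
      have h5 : (2 / 3 : ℝ) ^ (i + 1) * n ≤ selSize n (i + 1) := Nat.le_ceil _
      have h6 : selSize n (i + 1) ≤ 2 * ((selSize n (i + 1) + 1) / 2) := by omega
      have h7 : (selSize n (i + 1) : ℝ) ≤ 2 * ((selSize n (i + 1) + 1) / 2 : ℕ) := by
        exact_mod_cast h6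
      linarith
    have h5 : 0 < selSize n (i + 1) := selSize_pos hn
    omega
  · have hi' : i < ⌈Real.logb (3 / 2) n⌉₊ := by simpa using hi
    simp only [List.getElem_map, List.getElem_range, hashSets_length, hll]
    have h4 := selSize_le hn hi'
    set X := (2 / 3 : ℝ) ^ (i + 1) * n with hX
    have hX0 : 0 ≤ X := by positivity
    calc ((D * (Nat.log 2 (N + 2) + 1) * (D * selSize n (i + 1) * 2 ^ (16 * (D + 1))) : ℕ) : ℝ)
        = (D * (D * 2 ^ (16 * (D + 1))) : ℕ) * ((Nat.log 2 (N + 2) + 1 : ℕ) : ℝ) *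
          selSize n (i + 1) := by push_cast; ring
      _ ≤ (D * (D * 2 ^ (16 * (D + 1))) : ℕ) * (K * Real.log (n + 1)) * (3 * X) := by gcongr
      _ = C₁ * X * Real.log (n + 1) := by rw [hC₁]; push_cast; ring
      _ ≤ (C₁ + C₂) * X * Real.log (n + 1) := by gcongr; linarith
  · rw [hSl]
    calc ((c * (Nat.log 2 (N + 2) + 1) * (c * 2 ^ (c + 1)) : ℕ) : ℝ)
        = (c * (c * 2 ^ (c + 1)) : ℕ) * ((Nat.log 2 (N + 2) + 1 : ℕ) : ℝ) := by push_cast; ring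
      _ ≤ (c * (c * 2 ^ (c + 1)) : ℕ) * (K * Real.log (n + 1)) := by gcongr
      _ = C₂ * Real.log (n + 1) := by rw [hC₂]; ring
      _ ≤ (C₁ + C₂) * Real.log (n + 1) := by gcongr; linarith
  · change 0 < S.length
    rw [hSl]
    positivity
  · simp only [List.getElem_map, List.getElem_range]
    exact ⟨_, _, hl i, rfl⟩

end Sinr

namespace Sinr

/-! ### Executions without any transmission -/

section Quiet

variable {V : Type*} [Fintype V] {N : ℕ} {M : Model} {net : Network V N} {R : Type*}
  [DecidableEq R] {F : Families} {hold : V → List R}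

/-- The state of a station without neighbours. -/
def NodeState.Lonely : NodeState R → Prop
  | .traversing s _ => s.nbrs = [] ∧ s.out = none ∧ s.inbox = [] ∧ s.tour.pending = [] ∧
      ∀ b, s.btd = some b → b.parent = none ∧ b.unmarked = [] ∧ b.queue = [] ∧ b.children = []
  | .broadcasting s => s.parent = none ∧ s.children = [] ∧ s.tour.pending = []

theorem Tour.turn_pending {T : Tour} {parent : Option ℕ} (h : T.pending = []) :
    (T.turn parent []).pending = [] := by
  unfold Tour.turn
  split
  · split_ifs <;> rfl
  · exact h

theorem Tour.send_eq_none {T : Tour} (id : ℕ) (h : T.pending = []) : T.send id none = none := by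
  unfold Tour.send
  rw [h]
  cases T.token <;> rfl

theorem Tour.depart_eq_self {T : Tour} (h : T.pending = []) : T.depart none = T := by
  unfold Tour.depart
  rw [h]
  rfl

theorem NodeState.Lonely.parent_children {s : Trav.State} {own : List R}
    (h : (NodeState.traversing s own).Lonely) : s.parent = none ∧ s.children = [] := by
  obtain ⟨-, -, -, -, h5⟩ := h
  unfold Trav.State.parent Trav.State.children
  cases hb : s.btd with
  | none => exact ⟨rfl, rfl⟩
  | some b => exact ⟨(h5 b hb).1, (h5 b hb).2.2.2⟩

theorem NodeState.Lonely.prepare {s : Trav.State} {own : List R}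
    (h : (NodeState.traversing s own).Lonely) :
    (NodeState.traversing (s.prepare F) own).Lonely := by
  have h' : (NodeState.traversing (s.issue F) own).Lonely := by
    obtain ⟨h1, h2, h3, h4, h5⟩ := h
    unfold Trav.State.issue
    split_ifs
    · simp only [Trav.State.fresh, h1, List.erase_nil, Trav.State.advance]
      refine ⟨rfl, rfl, h3, rfl, fun b hb => ?_⟩
      obtain rfl := Option.some.inj hb
      exact ⟨rfl, rfl, rfl, rfl⟩
    · exact ⟨h1, h2, h3, h4, h5⟩
  have hc := h'.parent_children.2
  obtain ⟨h1, h2, h3, h4, h5⟩ := h'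
  refine ⟨h1, h2, h3, ?_, h5⟩
  change ((s.issue F).tour.turn (s.issue F).parent (s.issue F).children).pending = []
  rw [hc]
  exact Tour.turn_pending h4

theorem NodeState.Lonely.settle {s : Trav.State} {own : List R}
    (h : (NodeState.traversing s own).Lonely) : (NodeState.traversing s.settle own).Lonely := by
  obtain ⟨h1, h2, h3, h4, h5⟩ := h
  unfold Trav.State.settle
  split
  · exact ⟨h1, rfl, rfl, h4, h5⟩
  · rw [h3]
    refine ⟨h1, rfl, rfl, h4, fun b hb => ?_⟩
    have hf : ∀ τ, (s.fresh τ).parent = none ∧ (s.fresh τ).unmarked = [] ∧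
        (s.fresh τ).queue = [] ∧ (s.fresh τ).children = [] := fun τ =>
      ⟨rfl, by rw [Trav.State.fresh, h1, List.erase_nil], rfl, rfl⟩
    obtain rfl := Option.some.inj hb
    split
    · next b' hb' =>
      split_ifs
      · exact h5 b' hb'
      · exact hf _
    · exact hf _

theorem NodeState.Lonely.send_eq_none (hF : F.sel.flatten.length = 0) {s : NodeState R}
    (h : s.Lonely) : (btdProtocol R F).send s = none := by
  cases s with
  | traversing s own =>
    have hp := (h.prepare (F := F)).parent_children.1
    obtain ⟨h1, h2, h3, h4, h5⟩ := h.prepare (F := F)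
    have : s.send F = none := by
      unfold Trav.State.send Trav.State.emit
      rw [hp, Tour.send_eq_none _ h4, h2, h3, hF]
      simp
    change (s.send F).map _ = none
    rw [this]
    rfl
  | broadcasting s =>
    obtain ⟨h1, h2, h3⟩ := h
    change (s.prepare F).emit F = none
    unfold Mb.State.prepare
    cases hr : s.round with
    | none =>
      simp only [Mb.State.emit, Mb.State.frozen, h1, h2]
      rw [Tour.send_eq_none _ (Tour.turn_pending h3)]
      cases (s.tour.turn none []).token <;> rfl
    | some q =>
      simp only
      split_ifs <;> simp [Mb.State.emit, h2, hr]

theorem NodeState.Lonely.recv_none {s : NodeState R} (h : s.Lonely) :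
    ((btdProtocol R F).recv s none).Lonely := by
  cases s with
  | traversing s own =>
    have hs : (NodeState.traversing (s.recv F none) own).Lonely := by
      have h' : (NodeState.traversing ((s.prepare F).goes.close F s.clock) own).Lonely := by
        have hp := (h.prepare (F := F)).parent_children.1
        obtain ⟨h1, h2, h3, h4, h5⟩ := h.prepare (F := F)
        have hg : (NodeState.traversing (s.prepare F).goes own).Lonely := by
          refine ⟨h1, h2, h3, ?_, h5⟩
          change ((s.prepare F).tour.depart (s.prepare F).parent).pending = []
          rw [hp, Tour.depart_eq_self h4]
          exact h4
        unfold Trav.State.close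
        split_ifs
        · exact hg.settle
        · exact hg
      rw [recv_eq]
      obtain ⟨h1, h2, h3, h4, h5⟩ := h'
      exact ⟨h1, h2, h3, h4, h5⟩
    change (proceed (s.recv F none) own).Lonely
    unfold proceed
    split_ifs
    · refine ⟨hs.parent_children.1, hs.parent_children.2, ?_⟩
      change (if _ then _ else _ : Tour).pending = []
      split_ifs
      · exact hs.parent_children.2
      · rfl
    · exact hs
  | broadcasting s =>
    have hp : (NodeState.broadcasting (s.prepare F)).Lonely := by
      obtain ⟨h1, h2, h3⟩ := h
      unfold Mb.State.prepare
      split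
      · refine ⟨h1, h2, ?_⟩
        simp only [h2]
        exact Tour.turn_pending h3
      · split_ifs <;> exact ⟨h1, h2, h3⟩
    have hg : (NodeState.broadcasting (s.prepare F).goes).Lonely := by
      obtain ⟨h1, h2, h3⟩ := hp
      unfold Mb.State.goes
      split
      · exact ⟨h1, h2, h3⟩
      · refine ⟨h1, h2, ?_⟩
        simp only [h1]
        rw [Tour.depart_eq_self h3]
        exact h3
    change (NodeState.broadcasting (s.recv F none)).Lonely
    rw [Mb.State.recv_eq]
    obtain ⟨h1, h2, h3⟩ := hg
    unfold Mb.State.count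
    split
    · exact ⟨h1, h2, h3⟩
    · split_ifs <;> exact ⟨h1, h2, h3⟩

/-- A single station has nobody to check and completes all walks without a move, and it skips the
empty elimination. Without rumours nobody ever wakes up. In both cases, by induction on time,
nothing is received because nothing was sent. -/
theorem transmitted_eq_none (hV : Fintype.card V ≤ 1 ∧ F.sel.flatten.length = 0 ∨ ∀ v, hold v = [])
    (t : ℕ) (v : V) : transmitted (btdProtocol R F) (run M net F hold t) v = none := by
  have hnone : ∀ t, (∀ v, transmitted (btdProtocol R F) (run M net F hold t) v = none) →
      ∀ v, received M net (btdProtocol R F) (run M net F hold t) v = none := by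
    intro t ht v
    rw [received, dif_neg]
    rintro ⟨u, hu⟩
    have := hu.1
    simp [ht] at this
  rcases hV with ⟨hV, hF⟩ | hV
  · have key : ∀ t v s, run M net F hold t v = some s → s.Lonely := by
      intro t
      induction t with
      | zero =>
        intro v s hs
        cases hv : hold v with
        | nil => simp [run, states, hv] at hs
        | cons r l =>
          simp only [run, states, hv] at hs
          obtain rfl := Option.some.inj hs
          refine ⟨?_, rfl, rfl, rfl, fun b hb => by cases hb⟩
          have : (knowledge M net v).nbrs = ∅ := by
            classical
            refine Finset.image_eq_empty.2 (Finset.filter_eq_empty_iff.2 fun u _ hu => hu.ne ?_)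
            exact Fintype.card_le_one_iff.1 hV u v
          change ((knowledge M net v).nbrs.sort (· ≤ ·)) = []
          rw [this, Finset.sort_empty]
      | succ t ih =>
        intro v s hs
        have hr := hnone t (fun v => by
          unfold transmitted
          cases h : run M net F hold t v with
          | none => rfl
          | some s => exact (ih v s h).send_eq_none hF) v
        simp only [run, states] at hs hr
        rw [hr] at hs
        cases h : run M net F hold t v with
        | none => simp [run] at h; simp [h] at hs
        | some s' =>
          have h' := h
          simp only [run] at h'
          rw [h'] at hs
          obtain rfl := Option.some.inj hs
          exact (ih v s' h).recv_none
    unfold transmitted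
    cases h : run M net F hold t v with
    | none => rfl
    | some s => exact (key t v s h).send_eq_none hF
  · have key : ∀ t v, run M net F hold t v = none := by
      intro t
      induction t with
      | zero => intro v; simp only [run, states, hV v]; rfl
      | succ t ih =>
        intro v
        have hr := hnone t (fun v => by unfold transmitted; rw [ih]; rfl) v
        have h := ih v
        simp only [run] at h hr
        simp only [run, states, h, hr]
        rfl
    unfold transmitted
    rw [key]
    rfl

end Quiet

end Sinr

/-! ### Assembly of the bounds -/

namespace Sinr

/-- The execution in a network of at least two stations with at least one rumour. -/
theorem execution_bounds {V : Type*} [Fintype V] {N : ℕ} {M : Model} {net : Network V N}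
    {R : Type*} [DecidableEq R] {F : Families} {hold : V → List R}
    {near : Finset (Fin 2 → ℤ)} (hnear : IsNear M near (M.ε * M.noise / 16))
    (hlen : F.sel.length = ⌈Real.logb (3 / 2) (Fintype.card V)⌉₊)
    (hsel : ∀ (i : ℕ) (h : i < F.sel.length),
      IsHashFamily N (2 * near.card) (Fintype.card V) (i + 1) F.sel[i])
    (hl : 0 < F.ssf.length) (hF : Spreads M net F.ssf (2 * nb.card + 2))
    (hG : (commGraph M net).Connected) (hn : 2 ≤ Fintype.card V) (hne : ∃ v, hold v ≠ [])
    (hnd : ∀ v, (hold v).Nodup) {B : ℕ}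
    (hB : 5 + N + F.sel.flatten.length + 2 * F.ssf.length * (4 * Fintype.card V) +
      4 * Fintype.card V ≤ B) :
    (∀ t, Modest M net F hold B t) ∧
    ∀ t, F.sel.flatten.length + 2 * F.ssf.length * (4 * Fintype.card V) + 8 * Fintype.card V +
      ∑ v, (hold v).length + F.ssf.length * (Fintype.card V + ∑ v, (hold v).length + 1) ≤ t →
      ∀ v w, ∀ r ∈ hold v, Knows M net (btdProtocol R F) hold t w r := by
  classical
  have hsrc : (sources hold).Nonempty := by
    obtain ⟨v, hv⟩ := hne
    exact ⟨v, Finset.mem_filter.2 ⟨Finset.mem_univ v, hv⟩⟩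
  have hpart : participants M net F hold F.sel.flatten.length =
      elimRun M net (sources hold) F.sel.flatten := by
    rw [participants, List.take_length]
  -- The density `2 * nb.card + 2` covers all uses of the SSF: two token holders per cell, `2 *
  -- nb.card` destinations of their messages, and `1 + nb.card` internal nodes.
  obtain ⟨par, ch, ρ, f, T, X, ht, hX, hch, hT, hrun, hm⟩ := exists_tree hl
    (δ := 2 * nb.card + 2) (by omega) (by omega) hF hG hn
    (by rw [hpart]; exact elimRun_nonempty M net hsrc _)
    (by rw [hpart]; exact sparse_survivors M net hnear (by omega) hlen hsel _)
  obtain ⟨h1, h2⟩ := broadcast_complete hl hF hn ht (hX.mono M net (by omega)) hch hnd hrun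
    (B := B) (by omega) (by omega) (by omega) (hm B (by omega) (by omega) (by omega))
  exact ⟨h1, fun t ht => h2 t (le_trans (by omega) ht)⟩

end Sinr

open Sinr in
theorem mainTheorem1 (M : Model) (p : Polynomial ℕ) :
    ∃ c : ℕ, 0 < c ∧ ∃ C : ℝ, 0 < C ∧
      ∀ n N : ℕ, 1 ≤ n → n ≤ N → N ≤ p.eval n →
        ∃ F : Families, F.Valid n N c C ∧
          ∀ (V : Type*) [Fintype V] (R : Type*) [DecidableEq R]
            (net : Network V N) (hold : V → List R),
            Fintype.card V = n →
            (commGraph M net).Connected →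
            (∀ v, (hold v).Nodup) →
            (∀ v w, v ≠ w → (hold v).Disjoint (hold w)) →
            (∀ (t : ℕ) (v : V) (m : Msg Ctl R),
              transmitted (btdProtocol R F) (states M net (btdProtocol R F) hold t) v = some m →
                (((btdProtocol R F).encode m.ctl).length : ℝ) ≤ C * Real.log (n + 1)) ∧
            ∀ t : ℕ, C * ((n : ℝ) + (∑ v, (hold v).length : ℕ)) * Real.log n ≤ t →
              ∀ (v w : V) (r : R), r ∈ hold v → Knows M net (btdProtocol R F) hold t w r := by
  have hεn := mul_pos M.ε_pos M.noise_pos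
  -- Two notions of nearness are used: `near` for the elimination, whose density varies and whose
  -- noisy slots are only counted, and `near'` for the SSF with its fixed density.
  obtain ⟨near, hnear⟩ := exists_isNear M (η := M.ε * M.noise / 16) (by positivity)
  obtain ⟨near', hnear'⟩ := exists_isNear M
    (η := M.ε * M.noise / ((2 * nb.card + 2 : ℕ) + 1)) (by positivity)
  have hD : 0 < 2 * near.card :=
    Nat.mul_pos two_pos (Finset.card_pos.2 ⟨0, hnear.nb_subset zero_mem_nb⟩)
  set c := (2 * nb.card + 2) * near'.card + 1 with hc
  obtain ⟨C₀, hC₀, hfam⟩ := exists_families (2 * near.card) c hD (Nat.succ_pos _) p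
  -- This polynomial bounds the fields of all messages: `N` by `eval_le`, the clocks by `10 * C₀ * n
  -- ^ 2`, and `5 + 4 * n` by the summand `9`.
  obtain ⟨K, hK, hlog⟩ := exists_log_bound (p.eval 1 + 10 * C₀ + 9) (p.natDegree + 2)
  refine ⟨c, Nat.succ_pos _, 25 * C₀ + 12 * K + 44, by positivity, fun n N hn _ hN => ?_⟩
  obtain ⟨F, hF, hl, hsel⟩ := hfam n N hn hN
  refine ⟨F, hF.mono (by linarith), fun V _ R _ net hold hV hG hnd _ => ?_⟩
  -- For `n = 1` the allowed time `log n` vanishes, and without rumours no token is issued; both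
  -- cases need no communication at all.
  by_cases hsilent : Fintype.card V ≤ 1 ∨ ∀ v, hold v = []
  · have hflat : Fintype.card V ≤ 1 → F.sel.flatten.length = 0 := by
      intro h1
      obtain rfl : n = 1 := by omega
      have : F.sel = [] := List.length_eq_zero_iff.1 (by rw [hF.sel_length]; simp)
      rw [this]
      rfl
    constructor
    · intro t v m hm
      have := transmitted_eq_none (M := M) (net := net) (F := F) (hold := hold)
        (hsilent.imp_left fun h => ⟨h, hflat h⟩) t v
      exact absurd (this.symm.trans hm) (by simp)
    · intro t _ v w r hr
      rcases hsilent with h | h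
      · rw [Fintype.card_le_one_iff.1 h v w] at hr
        exact .inl hr
      · rw [h v] at hr
        exact absurd hr List.not_mem_nil
  push Not at hsilent
  obtain ⟨hn2, hne⟩ := hsilent
  have hspread : Spreads M net F.ssf (2 * nb.card + 2) :=
    hF.ssf_ssf.spreads hnear' (Nat.le_succ _)
  obtain ⟨h1, h2⟩ := execution_bounds hnear (by rw [hV]; exact hF.sel_length)
    (by rw [hV]; exact hsel) hl hspread hG hn2 hne hnd le_rfl
  rw [hV] at h1 h2 hn2
  have hΛ := half_le_log hn
  have hL := hF.length_le hC₀.le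
  have hs := hF.ssf_short
  set Λ := Real.log ((n : ℝ) + 1) with hΛdef
  have hn1 : (1 : ℝ) ≤ n := by exact_mod_cast hn
  constructor
  · intro t v m hm
    refine le_trans (Nat.cast_le.2 (encode_length_le (h1 (t + 1) t (Nat.lt_succ_self t) v m hm))) ?_
    have hp : (N : ℝ) ≤ p.eval 1 * (n + 1) ^ p.natDegree := by
      exact_mod_cast hN.trans (eval_le p n)
    have hΛn : Λ ≤ n := by
      have := Real.log_le_sub_one_of_pos (show (0 : ℝ) < n + 1 by linarith)
      linarith
    have hpow : (1 : ℝ) ≤ (n + 1) ^ p.natDegree := one_le_pow₀ (by linarith)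
    have hB := hlog n (5 + N + F.sel.flatten.length + 2 * F.ssf.length * (4 * n) + 4 * n) hn (by
      push_cast
      have e1 : 2 * (F.ssf.length : ℝ) * (4 * n) ≤ 8 * C₀ * (n * Λ) := by nlinarith
      have e2 : (n : ℝ) * Λ ≤ n * n := by gcongr
      have e3 : ((n : ℝ) + 1) ^ 2 ≤ (n + 1) ^ (p.natDegree + 2) := by
        rw [pow_add]
        exact le_mul_of_one_le_left (by positivity) hpow
      have e4 : ((n : ℝ) + 1) ^ p.natDegree ≤ (n + 1) ^ (p.natDegree + 2) :=
        pow_le_pow_right₀ (by linarith) (by omega)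
      have e5 : (N : ℝ) ≤ p.eval 1 * (n + 1) ^ (p.natDegree + 2) :=
        hp.trans (mul_le_mul_of_nonneg_left e4 (Nat.cast_nonneg _))
      have e6 : 10 * C₀ * (n * Λ) ≤ 10 * C₀ * (n + 1) ^ (p.natDegree + 2) := by
        gcongr
        nlinarith
      nlinarith)
    rw [← hΛdef] at hB
    push_cast at hB ⊢
    nlinarith
  · intro t ht
    refine h2 t ?_
    set k := ∑ v, (hold v).length with hk
    have hlg := log_succ_le hn2
    rw [← hΛdef] at hlg
    have hk0 : (0 : ℝ) ≤ k := Nat.cast_nonneg _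
    have e1 : (F.ssf.length : ℝ) * (8 * n + (n + k + 1)) ≤ C₀ * Λ * (10 * n + k) :=
      mul_le_mul hs (by linarith) (by positivity) (by positivity)
    -- In terms of `Λ` the total time is at most `(12 * C₀ + 16) * (n + k) * Λ`: the selectors
    -- contribute `2 * C₀`, the runs of the SSF at most `10 * C₀`, and the single rounds `16`,
    -- because `Λ` is at least `1 / 2`. Passing to `log n` doubles this; the rest of the constant is
    -- needed for the message length.
    have e2 : ((n : ℝ) + k) * Λ ≤ (n + k) * (2 * Real.log n) := by gcongr
    have e3 : (12 * C₀ + 16) * (((n : ℝ) + k) * Λ) ≤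
        (12 * C₀ + 16) * ((n + k) * (2 * Real.log n)) := by gcongr
    have e4 : 0 ≤ (C₀ + 12 * K + 12) * (((n : ℝ) + k) * Real.log n) := by
      have : 0 ≤ Real.log n := Real.log_nonneg hn1
      positivity
    have e5 : (1 / 2) * ((n : ℝ) + k) ≤ Λ * (n + k) := by gcongr
    have e6 : 0 ≤ C₀ * Λ * k := by positivity
    rw [← Nat.cast_le (α := ℝ)]
    refine le_trans ?_ ht
    push_cast
    nlinarith
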